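/- **Setting.** All algorithms are probabilistic polynomial time (PPT), and the statement holds both for uniform adversaries and for adversaries with polynomial-size advice. A *program* is a probabilistic interactive program with an explicit (unary) time bound, so that its size bounds its running time; in each run of a game it starts afresh. For a game $G(\mathsf{sk},\cdot)$ with trivial winning probability $\eta$, a program $C$ is *$\gamma$-good* for $\mathsf{sk}$ if it wins $G(\mathsf{sk},\cdot)$ with probability at least $\eta+\gamma$. A *secure watermarkable implementation* of a primitive with game $G$ has, besides the algorithms of the primitive, PPT algorithms $\mathsf{WMSetup}(1^\lambda)\to(\mathsf{sk},\mathsf{mk},\mathsf{xk})$, $\mathsf{Mark}(\mathsf{mk},\mathsf{sk},\tau)\to\mathsf{sk}_\tau$ for $\tau$ in a mark space, and $\mathsf{Extract}(\mathsf{xk},1^a,C)$, which outputs a tuple of marks (the empty tuple is $\bot$), such that: 1. *Correctness and functionality preservation.* The primitive is correct for unmarked keys up to negligible error. For all marks $\tau$ and all inputs, up to a negligible error that is uniform in $\tau$ and in the input: (PRF) $\mathsf{Eval}(\mathsf{sk}_\tau,x)=\mathsf{Eval}(\mathsf{sk},x)$; (MAC, SKE) a tag, resp. ciphertext, produced with $\mathsf{sk}_\tau$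 verifies, resp. decrypts to the message, under both $\mathsf{sk}_\tau$ and $\mathsf{sk}$. 2. *Security.* Every PPT adversary wins $G$ with probability at most $\eta+\mathrm{negl}(\lambda)$. 3. *Strong unremovability.* For every polynomially bounded $a=a(\lambda)\ge 1$ and every PPT adversary $\mathcal A$ with oracle $\mathsf{Mark}(\mathsf{mk},\mathsf{sk},\cdot)$, with only negligible probability $\mathcal A$ outputs a program $C$ that is $1/a$-good for $\mathsf{sk}$ while $\mathsf{Extract}(\mathsf{xk},1^a,C)$ contains none of the queried marks. *Collusion resistant*: arbitrarily many marking queries; *single-key*: one query. 4. *Extraction key simulation and syntax.* A stateful PPT simulator given only $\mathsf{xk}$ produces exactly the view of every player in $G(\mathsf{sk},\cdot)$; and $\mathsf{Extract}$ uses $C$ as a black box: its output distribution depends on $C$ only through its length and its input-output behaviour. 5. *Correctness of extraction.* There are a public deterministic polynomial-time algorithm $T$ and a constant $a_0$ such that for all polynomially bounded $a\ge a_0$ and all efficiently generated marks $\tau$, the tuple $\mathsf{Extract}(\mathsf{xk},1^a,T(\mathsf{sk}_\tau))$ contains $\tau$ except with negligible probability. It is *meaningful* if for every PPT algorithm $D$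 that is given the unmarked key $\mathsf{sk}$ and every polynomially bounded $a\geq 1$, $\mathsf{Extract}(\mathsf{xk},1^a,D(\mathsf{sk}))=\bot$ except with negligible probability. Extraction is *private*: $\mathsf{xk}$ is not given to adversaries. The games are as follows. *Weak PRF* on $\{0,1\}^{\ell}$, $\ell=\ell(\lambda)\ge1$, $\eta=\frac12$: distinguish $(x,\mathsf{Eval}(\mathsf{sk},x))$ from $(x,y)$ for random $x,y$, with adaptive evaluation queries before and after the challenge, after it on inputs other than $x$. *MAC*, $\eta=0$: given oracles for $\mathsf{Sign}(\mathsf{sk},\cdot)$ and the deterministic $\mathsf{Verify}(\mathsf{sk},\cdot,\cdot)$, output a valid message–tag pair that the signing oracle has not output. *CCA2* for secret-key encryption (SKE) of messages in $\{0,1\}^\ell$, $\ell\geq 1$, $\eta=\frac12$: given an encryption oracle and a decryption oracle that refuses the challenge ciphertext, tell which of two chosen messages is encrypted. **Theorem.** Let $F$ be a collusion-resistant (resp. single-key) secure watermarkable implementation of a weak PRF on $\{0,1\}^\ell$ and $M$ a collusion-resistant (resp. single-key) secure watermarkable implementation of a MAC, with the same mark space, such that $\{0,1\}^{2\ell}$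 is contained in the message space of $M$. Then there are deterministic polynomial-time transformations of programs $R_1(1^\lambda,\mathsf{xk}_M,C)$ and $R_2(1^\lambda,\mathsf{xk}_F,C)$ for which the following encrypt-then-MAC scheme is a collusion-resistant (resp. single-key) secure watermarkable implementation of CCA2-secure SKE on $\{0,1\}^\ell$, with private extraction: * all keys are pairs of a key of $F$ and a key of $M$, generated independently; * $\mathsf{Mark}$ marks both components with $\tau$; * $\mathsf{Enc}(m)=((r,c),\sigma)$ with $r\gets\{0,1\}^\ell$, $c=F.\mathsf{Eval}(\mathsf{sk}_F,r)\oplus m$, $\sigma\gets M.\mathsf{Sign}(\mathsf{sk}_M,r\|c)$; * $\mathsf{Dec}((r,c),\sigma)$ outputs $F.\mathsf{Eval}(\mathsf{sk}_F,r)\oplus c$ if $\sigma$ is a valid tag on $r\|c$, and $\bot$ otherwise; * $\mathsf{Extract}(\mathsf{xk},1^a,C)$ outputs all marks found by $F.\mathsf{Extract}(\mathsf{xk}_F,1^{8a},R_1(1^\lambda,\mathsf{xk}_M,C))$ and by $M.\mathsf{Extract}(\mathsf{xk}_M,1^{8a},R_2(1^\lambda,\mathsf{xk}_F,C))$. Moreover,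 $R_1,R_2$ are reductions: for all keys that $\mathsf{WMSetup}$ can output and all $a\ge 1$, if a program $C$ is $1/a$-good in the CCA2 game, then $R_1(1^\lambda,\mathsf{xk}_M,C)$ is $1/(8a)$-good in the weak PRF game of $F$ or $R_2(1^\lambda,\mathsf{xk}_F,C)$ is $1/(8a)$-good in the MAC game of $M$. Finally, if $F$ and $M$ are meaningful, so is the scheme. -/

import Mathlib

/-!
# Watermarkable weak PRFs, MACs and CCA2-secure secret-key encryption

All strings handled by algorithms are binary trees (`Data`); bit strings, unary numbers, pairs and
lists are encoded into them.  Running time is counted in an explicit probabilistic oracle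
programming language (`Prog`), in which programs are themselves data.
-/

/-! ## Data -/

/-- Binary trees. -/
inductive Data : Type where
  | nil : Data
  | cons : Data → Data → Data
  deriving DecidableEq

namespace Data

/-- The size of a tree: its number of `cons` nodes. -/
def size : Data → ℕ
  | nil => 0
  | cons a b => a.size + b.size + 1

/-- First component (the components of `nil` are `nil`). -/
def fst : Data → Data
  | nil => nil
  | cons a _ => a

/-- Second component. -/
def snd : Data → Data
  | nil => nil
  | cons _ b => b

theorem size_snd_le (d : Data) : d.snd.size ≤ d.size := by
  cases d with
  | nil => simp [snd, size]
  | cons a b => simp only [snd, size]; omega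

/-- One bit. -/
def bit : Bool → Data
  | false => nil
  | true => cons nil nil

/-- Parsing of an encoded bit string. -/
def toBits : Data → Option (List Bool)
  | nil => some []
  | cons nil d => d.toBits.map (false :: ·)
  | cons (cons nil nil) d => d.toBits.map (true :: ·)
  | cons (cons _ _) _ => none

/-- The length of the right spine: reading a unary number. -/
def toNat : Data → ℕ
  | nil => 0
  | cons _ d => d.toNat + 1

/-- The unary representation of a natural number. -/
def unary : ℕ → Data
  | 0 => nil
  | n + 1 => cons nil (unary n)

theorem toNat_unary (n : ℕ) : (unary n).toNat = n := by
  induction n with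
  | zero => rfl
  | succ n ih => simp [unary, toNat, ih]

end Data

/-- Types whose elements are represented as trees. -/
class Enc (α : Type) where
  enc : α → Data

open Enc

instance : Enc Data := ⟨fun d => d⟩
instance : Enc ℕ := ⟨Data.unary⟩
instance : Enc Bool := ⟨Data.bit⟩
instance {α β : Type} [Enc α] [Enc β] : Enc (α × β) := ⟨fun x => .cons (enc x.1) (enc x.2)⟩
instance {α : Type} [Enc α] : Enc (List α) :=
  ⟨fun l => l.foldr (fun a d => .cons (enc a) d) .nil⟩
instance {α : Type} [Enc α] : Enc (Option α) :=
  ⟨fun o => o.elim .nil (fun a => .cons .nil (enc a))⟩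

theorem Data.toBits_enc (l : List Bool) : (enc l).toBits = some l := by
  induction l with
  | nil => rfl
  | cons b l ih =>
    have h : (enc (b :: l) : Data) = .cons (Data.bit b) (enc l) := rfl
    rw [h]
    cases b <;> simp [Data.bit, Data.toBits, ih]

/-! ## Interactive probabilistic computations -/

/-- A computation that returns a value, tosses a fair coin, or sends a message to its environment
and continues with the reply. -/
inductive OComp (α : Type) : Type where
  | pure : α → OComp α
  | coin : (Bool → OComp α) → OComp α
  | query : Data → (Data → OComp α) → OComp α

namespace OComp

/-- Sequential composition. -/
def bind {α β : Type} : OComp α → (α → OComp β) → OComp β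
  | .pure a, f => f a
  | .coin k, f => .coin fun b => (k b).bind f
  | .query q k, f => .query q fun a => (k a).bind f

/-- A fair coin. -/
noncomputable def fairCoin : PMF Bool := PMF.uniformOfFintype Bool

/-- Running a computation against a stateful randomized environment. -/
noncomputable def run {α σ : Type} (step : σ → Data → PMF (Data × σ)) :
    OComp α → σ → PMF (α × σ)
  | .pure a, s => PMF.pure (a, s)
  | .coin k, s => fairCoin.bind fun b => run step (k b) s
  | .query q k, s => (step s q).bind fun r => run step (k r.1) r.2

/-- The computation samples from `μ` and does not interact with its environment. -/
def Samples {α : Type} (c : OComp α) (μ : PMF α) : Prop :=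
  ∀ (σ : Type) (step : σ → Data → PMF (Data × σ)) (s : σ),
    c.run step s = μ.map fun a => (a, s)

/-- Equality of input-output behaviour: indistinguishable in every environment. -/
def Equiv {α : Type} (c c' : OComp α) : Prop :=
  ∀ (σ : Type) (step : σ → Data → PMF (Data × σ)) (s : σ), c.run step s = c'.run step s

/-- The output distribution when every query is answered by `nil`. -/
noncomputable def dist {α : Type} (c : OComp α) : PMF α :=
  (c.run (fun (s : Unit) _ => PMF.pure (Data.nil, s)) ()).map Prod.fst

end OComp

/-! ## Programs and their running time -/

/-- Programs.  A program maps an input tree to an output tree. -/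
inductive Prog : Type where
  | id : Prog
  | fst : Prog
  | snd : Prog
  /-- whether the two components of the input are equal -/
  | eq : Prog
  /-- a fair coin -/
  | coin : Prog
  /-- send the input to the environment and return the reply -/
  | query : Prog
  /-- run a program given as data, answering its queries by another program given as data -/
  | handle : Prog
  | const : Data → Prog
  | pair : Prog → Prog → Prog
  /-- first the left, then the right program -/
  | comp : Prog → Prog → Prog
  /-- branch on the first component of the input (`nil` is false), continue on the second -/
  | cond : Prog → Prog → Prog
  /-- repeat while the first component is not `nil`, then return the second -/
  | loop : Prog → Prog

namespace Prog

/-- Programs as data. -/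
def encode : Prog → Data
  | id => .cons (.unary 0) (.cons .nil .nil)
  | fst => .cons (.unary 1) (.cons .nil .nil)
  | snd => .cons (.unary 2) (.cons .nil .nil)
  | eq => .cons (.unary 3) (.cons .nil .nil)
  | coin => .cons (.unary 4) (.cons .nil .nil)
  | query => .cons (.unary 5) (.cons .nil .nil)
  | handle => .cons (.unary 6) (.cons .nil .nil)
  | const d => .cons (.unary 7) (.cons d .nil)
  | pair p q => .cons (.unary 8) (.cons p.encode q.encode)
  | comp p q => .cons (.unary 9) (.cons p.encode q.encode)
  | cond p q => .cons (.unary 10) (.cons p.encode q.encode)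
  | loop p => .cons (.unary 11) (.cons p.encode .nil)

/-- Data as programs (data that represent no program are read as `id`). -/
def decode : Data → Prog
  | .cons t (.cons a b) =>
    match t.toNat with
    | 1 => fst
    | 2 => snd
    | 3 => eq
    | 4 => coin
    | 5 => query
    | 6 => handle
    | 7 => const a
    | 8 => pair (decode a) (decode b)
    | 9 => comp (decode a) (decode b)
    | 10 => cond (decode a) (decode b)
    | 11 => loop (decode a)
    | _ => id
  | _ => id

theorem decode_encode (p : Prog) : decode p.encode = p := by
  induction p <;> simp_all [encode, decode, Data.toNat_unary]

/-- Result of a run with bounded fuel: `none` if the fuel is exhausted, otherwise the output and the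
fuel that is left. -/
abbrev Res : Type := Option (Data × ℕ)

/-- Return `y`, at the cost of its size. -/
def ret (fuel : ℕ) (y : Data) : OComp Res :=
  .pure (if y.size ≤ fuel then some (y, fuel - y.size) else none)

/-- Continue with the output and the remaining fuel. -/
def andThen (c : OComp Res) (f : Data → ℕ → OComp Res) : OComp Res :=
  c.bind fun o => match o with
    | none => .pure none
    | some (y, r) => f y r

/-- Run `c`, answering each query `q` in state `s` by the computation `h fuel (cons q s)`, which
returns the reply and the next state and pays with `fuel`.  The result is the output of `c` (`nil`
if `c` ran out of its own fuel) together with the last state. -/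
def answerBy (h : ℕ → Data → OComp Res) : OComp Res → ℕ → Data → OComp Res
  | .pure none, fuel, s => ret fuel (.cons .nil s)
  | .pure (some (y, _)), fuel, s => ret fuel (.cons y s)
  | .coin k, fuel, s => .coin fun b => answerBy h (k b) fuel s
  | .query q k, fuel, s =>
    andThen (h fuel (.cons q s)) fun as r => answerBy h (k as.fst) r as.snd

/-- Execution with bounded fuel.  Each instruction costs one unit of fuel plus the size of the data
that it creates or receives from outside.  `handle` expects `(C, (arg, (H, s)))`, where
`C = (code, clock)`; it runs `code` on `arg` with fuel the size of `clock`, answering its queries by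
the program `H` starting from the state `s`, and is charged the size of `C` and the cost of `H`. -/
def eval (fuel : ℕ) (p : Prog) (x : Data) : OComp Res :=
  match fuel with
  | 0 => .pure none
  | n + 1 =>
    match p with
    | id => ret n x
    | fst => ret n x.fst
    | snd => ret n x.snd
    | eq => ret n (.bit (decide (x.fst = x.snd)))
    | coin => .coin fun b => ret n (.bit b)
    | query => if x.size ≤ n then .query x fun a => ret (n - x.size) a else .pure none
    | handle =>
      if hC : x.fst.size ≤ n then
        answerBy (fun r y => eval (min r n) (decode x.snd.snd.fst) y)
          (eval x.fst.snd.size (decode x.fst.fst) x.snd.fst)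
          (n - x.fst.size) x.snd.snd.snd
      else .pure none
    | const d => ret n d
    | pair p q =>
      andThen (eval n p x) fun y r => andThen (eval (min r n) q x) fun z r' =>
        .pure (some (.cons y z, r'))
    | comp p q => andThen (eval n p x) fun y r => eval (min r n) q y
    | cond p q => if x.fst = .nil then eval n q x.snd else eval n p x.snd
    | loop p =>
      if x.fst = .nil then ret n x.snd
      else andThen (eval n p x) fun y r => eval (min r n) (loop p) y
termination_by fuel
decreasing_by
  all_goals first
    | omega
    | exact Nat.lt_succ_of_le ((Data.size_snd_le _).trans hC)

/-- Execution with a time limit; a run that exceeds it outputs `nil`. -/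
def clocked (time : ℕ) (p : Prog) (x : Data) : OComp Data :=
  (eval time p x).bind fun o => .pure (o.elim .nil Prod.fst)

end Prog

/-- The behaviour of a tree `C = (code, clock)` as an interactive program: `code` is run (without
input) for a time bounded by the size of `clock`. -/
def Data.program (C : Data) : OComp Data :=
  Prog.clocked C.snd.size (Prog.decode C.fst) .nil

/-- `f` is a probabilistic polynomial-time algorithm. -/
def PPT {α β : Type} [Enc α] [Enc β] (f : α → PMF β) : Prop :=
  ∃ (p : Prog) (k : ℕ), ∀ a : α,
    ((p.eval (((enc a).size + 2) ^ k) (enc a)).bind fun o => .pure (o.map Prod.fst)).Samples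
      ((f a).map fun b => some (enc b))

/-- `f` is a deterministic polynomial-time algorithm. -/
def PolyTime {α β : Type} [Enc α] [Enc β] (f : α → β) : Prop :=
  PPT fun a => PMF.pure (f a)

/-- Whether adversaries are uniform or receive polynomial-size advice. -/
inductive AdvModel : Type where
  | uniform
  | nonuniform

/-- A probabilistic polynomial-time oracle adversary. -/
structure Adversary (𝔐 : AdvModel) where
  prog : Prog
  /-- the running time is at most `(n + 2) ^ exponent` -/
  exponent : ℕ
  advice : ℕ → Data
  advice_size : ∀ n, (advice n).size ≤ (n + 2) ^ exponent
  advice_uniform : 𝔐 = .uniform → ∀ n, advice n = .nil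

/-- The adversary at security parameter `n`, with input `1ⁿ` and the advice. -/
def Adversary.comp {𝔐 : AdvModel} (A : Adversary 𝔐) (n : ℕ) : OComp Data :=
  A.prog.clocked ((n + 2) ^ A.exponent) (enc (n, A.advice n))

/-- Functions bounded by a polynomial. -/
def PolyBounded (p : ℕ → ℕ) : Prop := ∃ k, ∀ n, p n ≤ (n + 2) ^ k

/-- Negligible functions. -/
def Negligible (ν : ℕ → ℝ) : Prop :=
  Asymptotics.SuperpolynomialDecay Filter.atTop (fun n : ℕ => (n : ℝ)) ν

/-- The probability of an event. -/
noncomputable def Pr {α : Type} (μ : PMF α) (E : α → Prop) : ℝ :=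
  (μ.toOuterMeasure {a | E a}).toReal

/-- A uniformly random bit string of length `l`. -/
noncomputable def randomBits : ℕ → PMF (List Bool)
  | 0 => PMF.pure []
  | l + 1 => OComp.fairCoin.bind fun b => (randomBits l).map fun r => b :: r

/-- Bitwise exclusive or. -/
def xorBits (x y : List Bool) : List Bool := List.zipWith xor x y

/-! ## Games -/

/-- A game against an interactive program: the challenger's state, its replies, and the winning
condition on the final state and the program's output. -/
structure Game where
  St : Type
  init : PMF St
  step : St → Data → PMF (Data × St)
  win : St → Data → Prop

/-- The probability that `c` wins. -/
noncomputable def Game.winProb (G : Game) (c : OComp Data) : ℝ :=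
  Pr (G.init.bind fun s => c.run G.step s) fun ys => G.win ys.2 ys.1

/-- The output of `c` in the game.  As `c` ranges over all computations, this covers the complete
view of a player. -/
noncomputable def Game.view (G : Game) (c : OComp Data) : PMF Data :=
  (G.init.bind fun s => c.run G.step s).map Prod.fst

/-- `c` is `γ`-good in a game whose trivial winning probability is `η`. -/
def Game.Good (G : Game) (η γ : ℝ) (c : OComp Data) : Prop := η + γ ≤ G.winProb c

/-! ## Watermarkable implementations of a primitive -/

/-- Secret key, marking key and extraction key. -/
structure Keys where
  ofParts ::
  sk : Data
  mk : Data
  xk : Data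

instance : Enc Keys := ⟨fun K => enc (K.sk, K.mk, K.xk)⟩

/-- The watermarking algorithms.  The first argument is always the security parameter.  `extract`
takes the extraction key, an accuracy parameter `a` in unary (pirate programs with advantage at
least `1/a` are to be traced) and a program; it outputs the tuple of the marks that were found (the
empty tuple if there are none). -/
structure WMScheme where
  Marks : ℕ → Set Data
  setup : ℕ → PMF Keys
  mark : ℕ → (mk sk τ : Data) → PMF Data
  extract : ℕ → (xk : Data) → (a : ℕ) → (C : Data) → PMF (List Data)

/-- How many marking queries the adversary may make: one, or arbitrarily many. -/
inductive Collusion : Type where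
  | singleKey
  | collusionResistant

/-- Whether a further marking query is allowed after `m` queries. -/
def Collusion.Allows : Collusion → ℕ → Prop
  | .singleKey, m => m = 0
  | .collusionResistant, _ => True

namespace WMScheme

variable (W : WMScheme)

open Classical in
/-- The marking oracle; its state is the list of the marks queried so far. -/
noncomputable def markStep (q : Collusion) (n : ℕ) (K : Keys) (Q : List Data) (τ : Data) :
    PMF (Data × List Data) :=
  if τ ∈ W.Marks n ∧ q.Allows Q.length then
    (W.mark n K.mk K.sk τ).map fun s => (.cons .nil s, τ :: Q)
  else PMF.pure (.nil, Q)

/-- The outcome of the unremovability experiment: the keys, the program output by the adversary, the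
queried marks and the extracted marks. -/
noncomputable def markGame (q : Collusion) {𝔐 : AdvModel} (A : Adversary 𝔐) (a : ℕ) (n : ℕ) :
    PMF (Keys × Data × List Data × List Data) :=
  (W.setup n).bind fun K =>
    ((A.comp n).run (W.markStep q n K) []).bind fun CQ =>
      (W.extract n K.xk a CQ.1).map fun L => (K, CQ.1, CQ.2, L)

/-- Strong unremovability with respect to the game `G` (depending on security parameter and secret
key) with trivial winning probability `η`: for every inverse polynomial `1/a`, no adversary with
access to the marking oracle outputs, with more than negligible probability, a `1/a`-good program
from which no queried mark is extracted. -/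
def Unremovable (G : ℕ → Data → Game) (η : ℝ) (𝔐 : AdvModel) (q : Collusion) : Prop :=
  ∀ a : ℕ → ℕ, PolyBounded a → (∀ n, 1 ≤ a n) → ∀ A : Adversary 𝔐, Negligible fun n =>
    Pr (W.markGame q A (a n) n) fun o =>
      (∀ τ ∈ o.2.2.2, τ ∉ o.2.2.1) ∧ (G n o.1.sk).Good η (1 / (a n : ℝ)) o.2.1.program

/-- Security of the underlying primitive. -/
def SecureFor (G : ℕ → Data → Game) (η : ℝ) (𝔐 : AdvModel) : Prop :=
  ∀ A : Adversary 𝔐, ∃ ν, Negligible ν ∧ ∀ n,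
    ∑' K, (W.setup n K).toReal * (G n K.sk).winProb (A.comp n) ≤ η + ν n

/-- States that a simulator can reach, starting from `nil`, with queries of given total size. -/
inductive Reaches (step : Data → Data → PMF (Data × Data)) : ℕ → Data → Prop
  | start : Reaches step 0 .nil
  | next {m : ℕ} {s q a s' : Data} : Reaches step m s → (a, s') ∈ (step s q).support →
      Reaches step (m + q.size + 1) s'

/-- The extraction key can perfectly simulate the game: there is a stateful probabilistic
polynomial-time simulator, given only the extraction key, whose replies produce exactly the view of
the game. -/
def KeySimulates (G : ℕ → Data → Game) : Prop :=
  ∃ (sim : ℕ → (xk s q : Data) → PMF (Data × Data)) (k : ℕ),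
    PPT (fun i : ℕ × Data × Data × Data => sim i.1 i.2.1 i.2.2.1 i.2.2.2) ∧
    ∀ n, ∀ K ∈ (W.setup n).support,
      (∀ m s, Reaches (sim n K.xk) m s → s.size ≤ (n + m + 2) ^ k) ∧
      ∀ c : OComp Data, (c.run (sim n K.xk) .nil).map Prod.fst = (G n K.sk).view c

/-- Extraction uses its input program as a black box: it depends only on the input-output behaviour
(and the length) of the program. -/
def BlackBox : Prop :=
  ∀ n, ∀ K ∈ (W.setup n).support, ∀ (a : ℕ) (C C' : Data),
    C.size = C'.size → C.program.Equiv C'.program → W.extract n K.xk a C = W.extract n K.xk a C'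

/-- Correctness of extraction: a public polynomial-time algorithm `T` turns a marked key into a
program from which the mark is extracted, for all efficiently generated marks. -/
def ExtractionCorrect (𝔐 : AdvModel) : Prop :=
  ∃ (T : ℕ → Data → Data) (a₀ : ℕ), PolyTime (fun i : ℕ × Data => T i.1 i.2) ∧
    ∀ a : ℕ → ℕ, PolyBounded a → (∀ n, a₀ ≤ a n) → ∀ A : Adversary 𝔐, Negligible fun n =>
      Pr ((A.comp n).dist.bind fun τ => (W.setup n).bind fun K =>
          (W.mark n K.mk K.sk τ).bind fun s =>
            (W.extract n K.xk (a n) (T n s)).map fun L => (τ, L))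
        fun o => o.1 ∈ W.Marks n ∧ o.1 ∉ o.2

/-- Meaningfulness: from a program produced with the unmarked secret key only, no mark is
extracted. -/
def Meaningful (𝔐 : AdvModel) : Prop :=
  ∀ a : ℕ → ℕ, PolyBounded a → (∀ n, 1 ≤ a n) → ∀ A : Adversary 𝔐, Negligible fun n =>
    Pr ((W.setup n).bind fun K =>
        (A.prog.clocked ((n + 2) ^ A.exponent) (enc (n, A.advice n, K.sk))).dist.bind fun C =>
          W.extract n K.xk (a n) C)
      fun L => L ≠ []

/-- The properties of a watermarkable implementation that do not depend on the syntax of the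
primitive, which is given through its game. -/
structure IsWatermarkable (G : ℕ → Data → Game) (η : ℝ) (𝔐 : AdvModel) (q : Collusion) :
    Prop where
  setup_ppt : PPT W.setup
  mark_ppt : PPT fun i : ℕ × Data × Data × Data => W.mark i.1 i.2.1 i.2.2.1 i.2.2.2
  extract_ppt : PPT fun i : ℕ × Data × ℕ × Data => W.extract i.1 i.2.1 i.2.2.1 i.2.2.2
  secure : W.SecureFor G η 𝔐
  unremovable : W.Unremovable G η 𝔐 q
  key_simulates : W.KeySimulates G
  black_box : W.BlackBox
  extraction_correct : W.ExtractionCorrect 𝔐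

/-- `K` generated by `setup` together with a key marked with `τ`. -/
noncomputable def markedKeys (n : ℕ) (τ : Data) : PMF (Keys × Data) :=
  (W.setup n).bind fun K => (W.mark n K.mk K.sk τ).map fun s => (K, s)

end WMScheme

/-! ## Weak pseudorandom functions -/

/-- A watermarkable pseudorandom function from `{0,1}^len` to `{0,1}^len`. -/
structure WPRF extends WMScheme where
  len : ℕ → ℕ
  eval : ℕ → (sk : Data) → List Bool → List Bool
  length_eval : ∀ n sk x, x.length = len n → (eval n sk x).length = len n

namespace WPRF

variable (F : WPRF)

/-- The weak pseudorandomness game with adaptive evaluation queries.  State: the hidden bit and the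
challenge input, if it has been issued.  Query `(0, x)` asks for the value at `x`, which must not be
the challenge input; `(1, _)` asks for the challenge, a random input with its value (hidden bit 0)
or with a random string (hidden bit 1).  The player has to output the hidden bit. -/
noncomputable def game (n : ℕ) (sk : Data) : Game where
  St := Bool × Option (List Bool)
  init := OComp.fairCoin.map fun b => (b, none)
  step := fun s q => match q with
    | .cons .nil d => PMF.pure (match d.toBits with
      | some x => if x.length = F.len n ∧ s.2 ≠ some x then enc (F.eval n sk x) else .nil
      | none => .nil, s)
    | .cons (.cons _ _) _ => match s.2 with
      | none => (randomBits (F.len n)).bind fun x =>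
          (bif s.1 then randomBits (F.len n) else PMF.pure (F.eval n sk x)).map fun y =>
            (enc (x, y), (s.1, some x))
      | some _ => PMF.pure (.nil, s)
    | .nil => PMF.pure (.nil, s)
  win := fun s out => out = .bit s.1

/-- `F` is a secure watermarkable implementation of a weak PRF. -/
structure IsSecure (𝔐 : AdvModel) (q : Collusion) : Prop where
  watermarkable : F.IsWatermarkable F.game (1 / 2) 𝔐 q
  len_pos : ∀ n, 1 ≤ F.len n
  len_polyTime : PolyTime F.len
  eval_polyTime : PolyTime fun i : ℕ × Data × List Bool => F.eval i.1 i.2.1 i.2.2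
  functionality_preserving : ∃ ν, Negligible ν ∧ ∀ n, ∀ τ ∈ F.Marks n, ∀ x : List Bool,
    x.length = F.len n →
      1 - ν n ≤ Pr (F.markedKeys n τ) fun o => F.eval n o.2 x = F.eval n o.1.sk x

end WPRF

/-! ## Message authentication codes -/

/-- A watermarkable message authentication code with message space `Msgs`. -/
structure WMAC extends WMScheme where
  Msgs : ℕ → Set (List Bool)
  sign : ℕ → (sk : Data) → List Bool → PMF Data
  verify : ℕ → (sk : Data) → List Bool → (σ : Data) → Bool

namespace WMAC

variable (M : WMAC)

open Classical in
/-- The chosen-message attack game.  State: the list of the message-tag pairs output by the signing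
oracle.  Query `(0, m)` asks for a tag on `m`, `(1, (m, σ))` asks whether `σ` is a valid tag on `m`.
The player has to output a valid message-tag pair that the signing oracle has not output. -/
noncomputable def game (n : ℕ) (sk : Data) : Game where
  St := List (List Bool × Data)
  init := PMF.pure []
  step := fun s q => match q with
    | .cons .nil d => match d.toBits with
      | some m => if m ∈ M.Msgs n then (M.sign n sk m).map fun σ => (enc (some σ), (m, σ) :: s)
          else PMF.pure (.nil, s)
      | none => PMF.pure (.nil, s)
    | .cons (.cons _ _) (.cons d σ) => PMF.pure (match d.toBits with
      | some m => .bit (M.verify n sk m σ)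
      | none => .nil, s)
    | _ => PMF.pure (.nil, s)
  win := fun s out => ∃ m ∈ M.Msgs n, ∃ σ, out = enc (m, σ) ∧ M.verify n sk m σ = true ∧ (m, σ) ∉ s

/-- `M` is a secure watermarkable implementation of a MAC. -/
structure IsSecure (𝔐 : AdvModel) (q : Collusion) : Prop where
  watermarkable : M.IsWatermarkable M.game 0 𝔐 q
  sign_ppt : PPT fun i : ℕ × Data × List Bool => M.sign i.1 i.2.1 i.2.2
  verify_polyTime : PolyTime fun i : ℕ × Data × List Bool × Data =>
    M.verify i.1 i.2.1 i.2.2.1 i.2.2.2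
  correct : ∃ ν, Negligible ν ∧ ∀ n, ∀ m ∈ M.Msgs n,
    1 - ν n ≤ Pr ((M.setup n).bind fun K => (M.sign n K.sk m).map fun σ => (K, σ))
      fun o => M.verify n o.1.sk m o.2 = true
  functionality_preserving : ∃ ν, Negligible ν ∧ ∀ n, ∀ τ ∈ M.Marks n, ∀ m ∈ M.Msgs n,
    1 - ν n ≤ Pr ((M.markedKeys n τ).bind fun o => (M.sign n o.2 m).map fun σ => (o, σ))
      fun o => M.verify n o.1.2 m o.2 = true ∧ M.verify n o.1.1.sk m o.2 = true

end WMAC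

/-! ## Secret-key encryption -/

/-- A watermarkable secret-key encryption scheme with message space `{0,1}^len`. -/
structure WSKE extends WMScheme where
  len : ℕ → ℕ
  encrypt : ℕ → (sk : Data) → List Bool → PMF Data
  decrypt : ℕ → (sk ct : Data) → Option (List Bool)

namespace WSKE

variable (S : WSKE)

/-- The CCA2 game.  State: the hidden bit and the challenge ciphertext, if it has been issued.
Query `(0, m)` asks for an encryption of `m`, `(1, ct)` for the decryption of `ct`, which must not
be the challenge ciphertext, and `(2, (m₀, m₁))` for the challenge.  The player has to output the
hidden bit. -/
noncomputable def game (n : ℕ) (sk : Data) : Game where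
  St := Bool × Option Data
  init := OComp.fairCoin.map fun b => (b, none)
  step := fun s q => match q with
    | .cons .nil d => match d.toBits with
      | some m => if m.length = S.len n then (S.encrypt n sk m).map fun ct => (enc (some ct), s)
          else PMF.pure (.nil, s)
      | none => PMF.pure (.nil, s)
    | .cons (.cons .nil .nil) ct =>
        PMF.pure (if s.2 = some ct then .nil else enc (S.decrypt n sk ct), s)
    | .cons (.cons .nil (.cons .nil .nil)) (.cons d₀ d₁) =>
      match s.2, d₀.toBits, d₁.toBits with
      | none, some m₀, some m₁ =>
        if m₀.length = S.len n ∧ m₁.length = S.len n then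
          (S.encrypt n sk (bif s.1 then m₁ else m₀)).map fun ct =>
            (enc (some ct), (s.1, some ct))
        else PMF.pure (.nil, s)
      | _, _, _ => PMF.pure (.nil, s)
    | _ => PMF.pure (.nil, s)
  win := fun s out => out = .bit s.1

/-- `S` is a secure watermarkable implementation of CCA2-secure secret-key encryption. -/
structure IsSecure (𝔐 : AdvModel) (q : Collusion) : Prop where
  watermarkable : S.IsWatermarkable S.game (1 / 2) 𝔐 q
  len_pos : ∀ n, 1 ≤ S.len n
  len_polyTime : PolyTime S.len
  encrypt_ppt : PPT fun i : ℕ × Data × List Bool => S.encrypt i.1 i.2.1 i.2.2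
  decrypt_polyTime : PolyTime fun i : ℕ × Data × Data => S.decrypt i.1 i.2.1 i.2.2
  correct : ∃ ν, Negligible ν ∧ ∀ n, ∀ m : List Bool, m.length = S.len n →
    1 - ν n ≤ Pr ((S.setup n).bind fun K => (S.encrypt n K.sk m).map fun ct => (K, ct))
      fun o => S.decrypt n o.1.sk o.2 = some m
  functionality_preserving : ∃ ν, Negligible ν ∧ ∀ n, ∀ τ ∈ S.Marks n, ∀ m : List Bool,
    m.length = S.len n →
      1 - ν n ≤ Pr ((S.markedKeys n τ).bind fun o => (S.encrypt n o.2 m).map fun ct => (o, ct))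
        fun o => S.decrypt n o.1.2 o.2 = some m ∧ S.decrypt n o.1.1.sk o.2 = some m

end WSKE

/-! ## Encrypt-then-MAC -/

/-- The watermarkable encrypt-then-MAC scheme.  Keys are pairs, marking marks both components, a
ciphertext is `((r, F(r) ⊕ m), σ)` with a tag `σ` on `(r, F(r) ⊕ m)`.  Extraction turns the input
program `C` by `R₁` (which is given the MAC extraction key) into a program against the PRF and by
`R₂` (which is given the PRF extraction key) into a program against the MAC, and runs both component
extractors. -/
noncomputable def encryptThenMAC (F : WPRF) (M : WMAC) (R₁ R₂ : ℕ → (xk C : Data) → Data) :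
    WSKE where
  Marks := F.Marks
  setup := fun n => (F.setup n).bind fun K => (M.setup n).map fun L =>
    ⟨.cons K.sk L.sk, .cons K.mk L.mk, .cons K.xk L.xk⟩
  mark := fun n mk sk τ => (F.mark n mk.fst sk.fst τ).bind fun s =>
    (M.mark n mk.snd sk.snd τ).map fun t => .cons s t
  extract := fun n xk a C => (F.extract n xk.fst (8 * a) (R₁ n xk.snd C)).bind fun l₁ =>
    (M.extract n xk.snd (8 * a) (R₂ n xk.fst C)).map fun l₂ => l₁ ++ l₂
  len := F.len
  encrypt := fun n sk m => (randomBits (F.len n)).bind fun r =>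
    let c := xorBits (F.eval n sk.fst r) m
    (M.sign n sk.snd (r ++ c)).map fun σ => enc ((r, c), σ)
  decrypt := fun n sk ct => match ct with
    | .cons (.cons dr dc) σ => match dr.toBits, dc.toBits with
      | some r, some c =>
        if r.length = F.len n ∧ c.length = F.len n ∧ M.verify n sk.snd (r ++ c) σ = true then
          some (xorBits (F.eval n sk.fst r) c)
        else none
      | _, _ => none
    | _ => none

/-- `R₁` and `R₂` turn, for all keys that the setup can output, every `1/a`-good program in the CCA2
game into a `1/(8a)`-good program in the weak pseudorandomness game or in the forgery game. -/
def AreReductions (F : WPRF) (M : WMAC) (R₁ R₂ : ℕ → (xk C : Data) → Data) : Prop :=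
  ∀ n, ∀ K ∈ (F.setup n).support, ∀ L ∈ (M.setup n).support, ∀ (C : Data) (a : ℕ), 1 ≤ a →
    ((encryptThenMAC F M R₁ R₂).game n (.cons K.sk L.sk)).Good (1 / 2) (1 / (a : ℝ)) C.program →
    (F.game n K.sk).Good (1 / 2) (1 / (8 * a : ℝ)) (R₁ n L.xk C).program ∨
      (M.game n L.sk).Good 0 (1 / (8 * a : ℝ)) (R₂ n K.xk C).program

/-!
# The watermarkable encrypt-then-MAC scheme

The two reductions are the parts of the usual proof that encrypt-then-MAC is CCA2-secure, turned into
transformations of programs that need only an extraction key.  A player of the CCA2 game is connected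
to a weak pseudorandom function and a MAC by a *layer* (`coreStep`), which encrypts with nonces and
values from a nonce stage and asks the MAC oracles for tags.  In the real mode the layer over the true
function and MAC is the CCA2 game (`run_coreStep_real`).  In the ideal mode it refuses all valid
ciphertexts that it has not produced itself, records the first one as a forgery, and then stops
answering.  Both modes agree until there is a forgery (`coreStep_real_eq_ideal`).

* `R₂` runs the player against the layer in the ideal mode over the MAC oracles, with the pseudorandom
  function game simulated by means of its extraction key, and outputs the recorded forgery
  (`forgeRun`, `exists_forge_reduction`).
* `R₁` runs the player against the layer in the ideal mode, with the MAC game simulated by means of its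
  extraction key.  Since the layer in this mode knows the plaintexts of all ciphertexts that it decrypts,
  it needs values of the function for encryption only.  So `R₁` may ask for values at random points
  before the player is run, one for each possible query, and use the challenge of its own game for the
  challenge ciphertext; no value is asked for after the challenge, where its input would be refused.  It guesses that the challenge was a true value if the player found the bit
  without a forgery (`guessRun`, `exists_guess_reduction`).  For a random challenge the player's bit is
  hidden by a one-time pad (`run_challenge_pad`).

This gives `winCCA - 1/2 ≤ 2 (winF - 1/2) + winM` for each pair of keys and each program
(`winProb_encryptThenMAC_le`, `Reductions.advantage`).  If a program is `1/a`-good, the right-hand side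
is at least `1/a`, so that one of the transformed programs is `1/(8a)`-good.  Both transformations run
the given program by the instruction `handle`, as a black box that is charged for its length, and
their result depends only on its length and its behaviour (`wrap_equiv`).

Since the reductions work for each pair of keys, the properties of the scheme follow from those of the
components.  An adversary against one component generates the keys of the other one, runs the adversary
against the scheme and transforms its program (`exists_adversary` and its applications); so a `1/a`-good
program without a queried mark contradicts unremovability of one component, and similarly for security
and meaningfulness.  The layer over both simulators simulates the CCA2 game
(`encryptThenMAC_keySimulates`).  Correctness of extraction follows from unremovability: a key `sk_τ`
of the scheme yields a player that asks for a challenge and decrypts it by the pseudorandom function of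
`sk_τ`.  By functionality preservation and Markov's inequality this player wins with probability at
least `3/4` except for few keys, and it is the output of an adversary whose only marking query is `τ`
(`encryptThenMAC_extractionCorrect`).

Randomized computations are described by `Prog.Runs`, which states the joint distribution of the output
and the final state of the environment together with a bound of the fuel that is used.  Polynomial-time
functions are closed under composition, pairing, branching and bounded loops; this is left to
`fun_prop`.
-/

/-! ### Probabilities and expectations -/

namespace PMF

theorem bind_congr_support {α β : Type} {p : PMF α} {f g : α → PMF β}
    (h : ∀ a ∈ p.support, f a = g a) : p.bind f = p.bind g := by
  ext b
  rw [bind_apply, bind_apply]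
  refine tsum_congr fun a => ?_
  by_cases ha : a ∈ p.support
  · rw [h a ha]
  · rw [(p.apply_eq_zero_iff a).2 ha, zero_mul, zero_mul]

theorem map_congr_support {α β : Type} {p : PMF α} {f g : α → β}
    (h : ∀ a ∈ p.support, f a = g a) : p.map f = p.map g :=
  bind_congr_support fun a ha => by simp [h a ha]

theorem map_eq_bind {α β : Type} (p : PMF α) (f : α → β) : p.map f = p.bind fun a => pure (f a) :=
  rfl

end PMF

/-- The expectation of a real function. -/
noncomputable def ex {α : Type} (μ : PMF α) (f : α → ℝ) : ℝ := ∑' a, (μ a).toReal * f a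

section Ex

variable {α β : Type} (μ : PMF α)

theorem summable_toReal : Summable fun a => (μ a).toReal :=
  ENNReal.summable_toReal (by rw [μ.tsum_coe]; exact ENNReal.one_ne_top)

theorem tsum_toReal : ∑' a, (μ a).toReal = 1 := by
  rw [← ENNReal.tsum_toReal_eq fun a => μ.apply_ne_top a, μ.tsum_coe, ENNReal.toReal_one]

theorem summable_ex {f : α → ℝ} {b : ℝ} (hf : ∀ a, |f a| ≤ b) :
    Summable fun a => (μ a).toReal * f a :=
  .of_norm_bounded (g := fun a => (μ a).toReal * b) ((summable_toReal μ).mul_right b) fun a => by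
    rw [Real.norm_eq_abs, abs_mul, abs_of_nonneg ENNReal.toReal_nonneg]
    exact mul_le_mul_of_nonneg_left (hf a) ENNReal.toReal_nonneg

theorem ex_mono {f g : α → ℝ} {b : ℝ} (hf : ∀ a, |f a| ≤ b) {b' : ℝ} (hg : ∀ a, |g a| ≤ b')
    (h : ∀ a ∈ μ.support, f a ≤ g a) : ex μ f ≤ ex μ g := by
  refine Summable.tsum_le_tsum (fun a => ?_) (summable_ex μ hf) (summable_ex μ hg)
  by_cases ha : a ∈ μ.support
  · exact mul_le_mul_of_nonneg_left (h a ha) ENNReal.toReal_nonneg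
  · rw [(μ.apply_eq_zero_iff a).2 ha]; simp

theorem ex_congr {f g : α → ℝ} (h : ∀ a ∈ μ.support, f a = g a) : ex μ f = ex μ g := by
  refine tsum_congr fun a => ?_
  by_cases ha : a ∈ μ.support
  · rw [h a ha]
  · rw [(μ.apply_eq_zero_iff a).2 ha]; simp

theorem ex_const (c : ℝ) : ex μ (fun _ => c) = c := by
  rw [ex, tsum_mul_right, tsum_toReal, one_mul]

theorem ex_add {f g : α → ℝ} {b : ℝ} (hf : ∀ a, |f a| ≤ b) {b' : ℝ} (hg : ∀ a, |g a| ≤ b') :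
    ex μ (fun a => f a + g a) = ex μ f + ex μ g := by
  simp only [ex, mul_add]
  exact (summable_ex μ hf).tsum_add (summable_ex μ hg)

theorem ex_mul (c : ℝ) (f : α → ℝ) : ex μ (fun a => c * f a) = c * ex μ f := by
  rw [ex, ex, ← tsum_mul_left]
  exact tsum_congr fun a => by ring

theorem ex_bind (g : α → PMF β) {f : β → ℝ} {b : ℝ} (hf : ∀ y, |f y| ≤ b) :
    ex (μ.bind g) f = ex μ fun a => ex (g a) f := by
  simp only [ex, PMF.bind_apply]
  have h1 : ∀ y, (∑' a, μ a * g a y).toReal = ∑' a, (μ a).toReal * (g a y).toReal := fun y => by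
    rw [ENNReal.tsum_toReal_eq fun a => ENNReal.mul_ne_top (μ.apply_ne_top a) ((g a).apply_ne_top y)]
    simp [ENNReal.toReal_mul]
  have hs : Summable fun x : α × β => (μ x.1).toReal * (g x.1 x.2).toReal := by
    have h0 : 0 ≤ fun x : α × β => (μ x.1).toReal * (g x.1 x.2).toReal := fun x =>
      mul_nonneg ENNReal.toReal_nonneg ENNReal.toReal_nonneg
    rw [summable_prod_of_nonneg h0]
    have h2 : ∀ a, Summable fun y => (μ a).toReal * (g a y).toReal := fun a =>
      (summable_toReal (g a)).mul_left (μ a).toReal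
    refine ⟨h2, ?_⟩
    simp only [tsum_mul_left, tsum_toReal, mul_one]
    exact summable_toReal μ
  have hs' : Summable fun x : α × β => (μ x.1).toReal * (g x.1 x.2).toReal * f x.2 :=
    .of_norm_bounded (g := fun x : α × β => (μ x.1).toReal * (g x.1 x.2).toReal * b)
      (hs.mul_right b) fun x => by
      rw [Real.norm_eq_abs, abs_mul,
        abs_of_nonneg (mul_nonneg ENNReal.toReal_nonneg ENNReal.toReal_nonneg)]
      exact mul_le_mul_of_nonneg_left (hf x.2) (mul_nonneg ENNReal.toReal_nonneg ENNReal.toReal_nonneg)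
  calc ∑' y, (∑' a, μ a * g a y).toReal * f y
      = ∑' y, ∑' a, (μ a).toReal * (g a y).toReal * f y :=
        tsum_congr fun y => by rw [h1, tsum_mul_right]
    _ = ∑' a, ∑' y, (μ a).toReal * (g a y).toReal * f y := Summable.tsum_comm hs'
    _ = _ := tsum_congr fun a => by rw [← tsum_mul_left]; exact tsum_congr fun y => by ring

theorem ex_pure (a : α) (f : α → ℝ) : ex (PMF.pure a) f = f a := by
  classical
  rw [ex, tsum_eq_single a]
  · simp
  · intro b hb; simp [PMF.pure_apply, hb]

open Classical in
theorem Pr_eq_ex (E : α → Prop) : Pr μ E = ex μ fun a => if E a then 1 else 0 := by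
  rw [Pr, PMF.toOuterMeasure_apply, ENNReal.tsum_toReal_eq, ex]
  · refine tsum_congr fun a => ?_
    by_cases h : E a <;> simp [Set.indicator, h]
  · intro a
    by_cases h : E a <;> simp [Set.indicator, h, μ.apply_ne_top]

open Classical in
theorem abs_ite_le_one (p : Prop) : |(if p then 1 else 0 : ℝ)| ≤ 1 := by split_ifs <;> simp

variable {μ}

theorem Pr_nonneg (E : α → Prop) : 0 ≤ Pr μ E := ENNReal.toReal_nonneg

theorem Pr_mono {E E' : α → Prop} (h : ∀ a ∈ μ.support, E a → E' a) : Pr μ E ≤ Pr μ E' := by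
  classical
  rw [Pr_eq_ex, Pr_eq_ex]
  refine ex_mono μ (fun a => abs_ite_le_one _) (fun a => abs_ite_le_one _) fun a ha => ?_
  have := h a ha
  split_ifs <;> first | tauto | norm_num

theorem Pr_congr {E E' : α → Prop} (h : ∀ a ∈ μ.support, E a ↔ E' a) : Pr μ E = Pr μ E' :=
  le_antisymm (Pr_mono fun a ha => (h a ha).1) (Pr_mono fun a ha => (h a ha).2)

theorem Pr_true : Pr μ (fun _ => True) = 1 := by
  classical
  rw [Pr_eq_ex]; simp [ex_const]

theorem Pr_le_one (E : α → Prop) : Pr μ E ≤ 1 := (Pr_mono fun _ _ _ => trivial).trans Pr_true.le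

theorem abs_Pr_le (E : α → Prop) : |Pr μ E| ≤ 1 := by
  rw [abs_of_nonneg (Pr_nonneg E)]; exact Pr_le_one E

theorem Pr_eq_one {E : α → Prop} (h : ∀ a ∈ μ.support, E a) : Pr μ E = 1 :=
  (Pr_congr fun a ha => iff_of_true (h a ha) trivial).trans Pr_true

theorem Pr_eq_zero {E : α → Prop} (h : ∀ a ∈ μ.support, ¬ E a) : Pr μ E = 0 := by
  classical
  rw [Pr_eq_ex, ex_congr μ (g := fun _ => 0) fun a ha => by simp [h a ha], ex_const]

theorem Pr_or_le (E E' : α → Prop) : Pr μ (fun a => E a ∨ E' a) ≤ Pr μ E + Pr μ E' := by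
  classical
  simp only [Pr_eq_ex]
  rw [← ex_add μ (fun a => abs_ite_le_one _) (fun a => abs_ite_le_one _)]
  refine ex_mono μ (b' := 2) (fun a => abs_ite_le_one _) (fun a => ?_) fun a ha => ?_
  · split_ifs <;> norm_num
  · by_cases h : E a <;> by_cases h' : E' a <;> simp [h, h']

theorem Pr_not (E : α → Prop) : Pr μ (fun a => ¬ E a) = 1 - Pr μ E := by
  classical
  have : Pr μ (fun a => ¬ E a) + Pr μ E = 1 := by
    simp only [Pr_eq_ex]
    rw [← ex_add μ (fun a => abs_ite_le_one _) (fun a => abs_ite_le_one _)]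
    rw [ex_congr μ (g := fun _ => 1) fun a ha => by by_cases h : E a <;> simp [h], ex_const]
  linarith

theorem Pr_pure (a : α) (E : α → Prop) [Decidable (E a)] :
    Pr (PMF.pure a) E = if E a then 1 else 0 := by
  rw [Pr_eq_ex, ex_pure]; split_ifs <;> rfl

theorem Pr_bind (g : α → PMF β) (E : β → Prop) : Pr (μ.bind g) E = ex μ fun a => Pr (g a) E := by
  classical
  simp only [Pr_eq_ex]
  exact ex_bind μ g fun _ => abs_ite_le_one _

theorem Pr_map (f : α → β) (E : β → Prop) : Pr (μ.map f) E = Pr μ fun a => E (f a) := by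
  classical
  rw [PMF.map_eq_bind, Pr_bind, Pr_eq_ex]
  exact ex_congr μ fun a _ => by rw [Pr_pure]

theorem Pr_bind_le {g : α → PMF β} {E : β → Prop} {c : ℝ} (h : ∀ a ∈ μ.support, Pr (g a) E ≤ c) :
    Pr (μ.bind g) E ≤ c := by
  rw [Pr_bind, ← ex_const μ c]
  exact ex_mono μ (fun _ => abs_Pr_le _) (fun _ => le_rfl) h

theorem le_Pr_bind {g : α → PMF β} {E : β → Prop} {c : ℝ} (h : ∀ a ∈ μ.support, c ≤ Pr (g a) E) :
    c ≤ Pr (μ.bind g) E := by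
  rw [Pr_bind, ← ex_const μ c]
  exact ex_mono μ (fun _ => le_rfl) (fun _ => abs_Pr_le _) h

theorem Pr_bind_mono {γ : Type} {g : α → PMF β} {g' : α → PMF γ} {E : β → Prop} {E' : γ → Prop}
    (h : ∀ a ∈ μ.support, Pr (g a) E ≤ Pr (g' a) E') : Pr (μ.bind g) E ≤ Pr (μ.bind g') E' := by
  rw [Pr_bind, Pr_bind]
  exact ex_mono μ (fun _ => abs_Pr_le _) (fun _ => abs_Pr_le _) h

theorem ex_fairCoin (f : Bool → ℝ) : ex OComp.fairCoin f = (f false + f true) / 2 := by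
  have h : ∀ b, (OComp.fairCoin b).toReal = 1 / 2 := fun b => by
    simp [OComp.fairCoin, PMF.uniformOfFintype_apply]
  rw [ex, tsum_bool, h, h]; ring

theorem Pr_coin (f : Bool → PMF α) (E : α → Prop) :
    Pr (OComp.fairCoin.bind f) E = (Pr (f false) E + Pr (f true) E) / 2 := by
  rw [Pr_bind, ex_fairCoin]

theorem PMF.ext_Pr {μ ν : PMF α} (h : ∀ a, Pr μ (fun x => x = a) = Pr ν (fun x => x = a)) :
    μ = ν := by
  ext a
  have := h a
  simp only [Pr] at this
  rw [show {x | x = a} = {a} from rfl, PMF.toOuterMeasure_apply_singleton,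
    PMF.toOuterMeasure_apply_singleton] at this
  exact (ENNReal.toReal_eq_toReal_iff' (μ.apply_ne_top a) (ν.apply_ne_top a)).1 this

end Ex

/-! ### Interactive computations -/

namespace OComp

variable {α β γ σ τ : Type}

theorem bind_assoc (c : OComp α) (f : α → OComp β) (g : β → OComp γ) :
    (c.bind f).bind g = c.bind fun a => (f a).bind g := by
  induction c with
  | pure a => rfl
  | coin k ih => exact congrArg OComp.coin (funext ih)
  | query q k ih => exact congrArg (OComp.query q) (funext ih)

theorem run_bind (step : σ → Data → PMF (Data × σ)) (c : OComp α) (f : α → OComp β) (s : σ) :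
    (c.bind f).run step s = (c.run step s).bind fun o => (f o.1).run step o.2 := by
  induction c generalizing s with
  | pure a => simp [bind, run]
  | coin k ih => simp [bind, run, ih]
  | query q k ih => simp [bind, run, ih]

theorem run_bind_pure (step : σ → Data → PMF (Data × σ)) (c : OComp α) (f : α → β) (s : σ) :
    (c.bind fun a => .pure (f a)).run step s = (c.run step s).map fun o => (f o.1, o.2) := by
  rw [run_bind]; rfl

theorem Equiv.bind {c c' : OComp α} (h : c.Equiv c') {f g : α → OComp β}
    (hf : ∀ a, (f a).Equiv (g a)) : (c.bind f).Equiv (c'.bind g) := fun σ step s => by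
  rw [run_bind, run_bind, h]
  exact congrArg _ (funext fun o => hf o.1 σ step o.2)

theorem Equiv.refl (c : OComp α) : c.Equiv c := fun _ _ _ => rfl

theorem Samples.run_bind {c : OComp α} {μ : PMF α} (h : c.Samples μ)
    (step : σ → Data → PMF (Data × σ)) (f : α → OComp β) (s : σ) :
    (c.bind f).run step s = μ.bind fun a => (f a).run step s := by
  rw [OComp.run_bind, h]; simp [PMF.bind_map, Function.comp_def]

/-- Run `c`, answering its queries by the stateful interactive computation `h`. -/
def handleWith (h : τ → Data → OComp (Data × τ)) : OComp α → τ → OComp (α × τ)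
  | .pure a, t => .pure (a, t)
  | .coin k, t => .coin fun b => handleWith h (k b) t
  | .query q k, t => (h t q).bind fun r => handleWith h (k r.1) r.2

/-- The environment formed by an interactive handler together with the environment it queries. -/
noncomputable def handlerStep (h : τ → Data → OComp (Data × τ)) (step : σ → Data → PMF (Data × σ))
    (s : τ × σ) (q : Data) : PMF (Data × τ × σ) :=
  ((h s.1 q).run step s.2).map fun o => (o.1.1, o.1.2, o.2)

theorem run_handleWith (h : τ → Data → OComp (Data × τ)) (step : σ → Data → PMF (Data × σ))
    (c : OComp α) (t : τ) (s : σ) :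
    ((handleWith h c t).run step s).map (fun o => (o.1.1, o.1.2, o.2)) =
      c.run (handlerStep h step) (t, s) := by
  induction c generalizing t s with
  | pure a => simp [handleWith, run, PMF.pure_map]
  | coin k ih => simp only [handleWith, run, PMF.map_bind, ih]
  | query q k ih =>
    simp only [handleWith, run, run_bind, PMF.map_bind, ih, handlerStep, PMF.bind_map]
    rfl

theorem run_invariant {step : σ → Data → PMF (Data × σ)} {I : σ → Prop}
    (hI : ∀ s q, I s → ∀ o ∈ (step s q).support, I o.2) (c : OComp α) {s : σ} (hs : I s) :
    ∀ o ∈ (c.run step s).support, I o.2 := by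
  induction c generalizing s with
  | pure a => intro o ho; simp [run] at ho; subst ho; exact hs
  | coin k ih =>
    intro o ho
    simp only [run, PMF.mem_support_bind_iff] at ho
    obtain ⟨b, -, ho⟩ := ho
    exact ih b hs o ho
  | query q k ih =>
    intro o ho
    simp only [run, PMF.mem_support_bind_iff] at ho
    obtain ⟨r, hr, ho⟩ := ho
    exact ih r.1 (hI s q hs r hr) o ho

/-- If one environment is a function of another one, as long as an invariant holds, then so are the
runs. -/
theorem run_project {step : σ → Data → PMF (Data × σ)} {step' : τ → Data → PMF (Data × τ)}
    {I : σ → Prop} (f : σ → τ)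
    (hI : ∀ s q, I s → ∀ o ∈ (step s q).support, I o.2)
    (hf : ∀ s q, I s → (step s q).map (fun o => (o.1, f o.2)) = step' (f s) q)
    (c : OComp α) {s : σ} (hs : I s) :
    (c.run step s).map (fun o => (o.1, f o.2)) = c.run step' (f s) := by
  induction c generalizing s with
  | pure a => simp [run, PMF.pure_map]
  | coin k ih => simp only [run, PMF.map_bind, ih _ hs]
  | query q k ih =>
    simp only [run, PMF.map_bind]
    rw [← hf s q hs, PMF.bind_map]
    exact PMF.bind_congr_support fun o ho => ih o.1 (hI s q hs o ho)

theorem run_congr {step step' : σ → Data → PMF (Data × σ)} {I : σ → Prop}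
    (hI : ∀ s q, I s → ∀ o ∈ (step s q).support, I o.2)
    (hf : ∀ s q, I s → step s q = step' s q)
    (c : OComp α) {s : σ} (hs : I s) : c.run step s = c.run step' s := by
  have := run_project (step' := step') (fun s => s) hI (fun s q h => by
    rw [← hf s q h]; exact PMF.map_id _) c hs
  rw [← this]; exact (PMF.map_id _).symm

/-- Two environments that agree until a persistent flag is raised: an event without the flag is at
most as likely in the one as the event is in the other. -/
theorem Pr_run_until_flag {step step' : σ → Data → PMF (Data × σ)} {I flag : σ → Prop}
    (hflag : ∀ s q, flag s → ∀ o ∈ (step s q).support, flag o.2)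
    (hI : ∀ s q, I s → ∀ o ∈ (step s q).support, I o.2)
    (hstep : ∀ s q, I s → ¬ flag s →
      step s q = step' s q ∨ ∀ o ∈ (step s q).support, flag o.2)
    (c : OComp α) {s : σ} (hs : I s) (E : α × σ → Prop) :
    Pr (c.run step s) (fun o => E o ∧ ¬ flag o.2) ≤ Pr (c.run step' s) E := by
  induction c generalizing s with
  | pure a => exact Pr_mono fun o _ h => h.1
  | coin k ih => exact Pr_bind_mono fun b _ => ih b hs
  | query q k ih =>
    simp only [run]
    have hz : (∀ o ∈ (step s q).support, flag o.2) →
        Pr ((step s q).bind fun r => run step (k r.1) r.2) (fun o => E o ∧ ¬ flag o.2) ≤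
        Pr ((step' s q).bind fun r => run step' (k r.1) r.2) E := fun hall => by
      rw [Pr_eq_zero]
      · exact Pr_nonneg _
      · intro o ho
        obtain ⟨r, hr, ho⟩ := (PMF.mem_support_bind_iff _ _ _).1 ho
        exact fun h => h.2 (run_invariant hflag (k r.1) (hall r hr) o ho)
    by_cases hfl : flag s
    · exact hz (hflag s q hfl)
    · rcases hstep s q hs hfl with h | h
      · rw [← h]
        exact Pr_bind_mono fun r hr => ih r.1 (hI s q hs r hr)
      · exact hz h

end OComp

/-- If the output of every player with outputs in `Data` is distributed alike in two environments,
then so is the output of every player. -/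
theorem OComp.view_ext {α σ τ : Type} {step : σ → Data → PMF (Data × σ)}
    {step' : τ → Data → PMF (Data × τ)} {s₀ : PMF σ} {t₀ : PMF τ}
    (h : ∀ c : OComp Data, (s₀.bind fun s => c.run step s).map Prod.fst =
      (t₀.bind fun t => c.run step' t).map Prod.fst) (c : OComp α) :
    (s₀.bind fun s => c.run step s).map Prod.fst = (t₀.bind fun t => c.run step' t).map Prod.fst := by
  classical
  refine PMF.ext_Pr fun a => ?_
  have hb := h (c.bind fun x => .pure (Data.bit (decide (x = a))))
  have key : ∀ {σ : Type} (step : σ → Data → PMF (Data × σ)) (s₀ : PMF σ),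
      Pr ((s₀.bind fun s => c.run step s).map Prod.fst) (fun x => x = a) =
      Pr ((s₀.bind fun s => (c.bind fun x => .pure (Data.bit (decide (x = a)))).run step s).map
        Prod.fst) (fun x => x = Data.bit true) := by
    intro σ step s₀
    simp only [run_bind_pure, Pr_map, Pr_bind]
    refine ex_congr _ fun s _ => Pr_congr fun o _ => ?_
    by_cases ho : o.1 = a <;> simp [ho, Data.bit]
  rw [key, key, hb]

/-! ### Execution with sufficient fuel -/

namespace Prog

/-- `c'` behaves like `c`, with `d` more units of fuel left, unless `c` runs out of fuel. -/
inductive Ext (d : ℕ) : OComp Res → OComp Res → Prop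
  | none (c : OComp Res) : Ext d (.pure none) c
  | some (y : Data) (r : ℕ) : Ext d (.pure (some (y, r))) (.pure (some (y, r + d)))
  | coin {k k' : Bool → OComp Res} : (∀ b, Ext d (k b) (k' b)) → Ext d (.coin k) (.coin k')
  | query (q : Data) {k k' : Data → OComp Res} :
      (∀ a, Ext d (k a) (k' a)) → Ext d (.query q k) (.query q k')

theorem Ext.ret (d n : ℕ) (y : Data) : Ext d (ret n y) (ret (n + d) y) := by
  unfold Prog.ret
  by_cases h : y.size ≤ n
  · rw [if_pos h, if_pos (by omega), show n + d - y.size = n - y.size + d by omega]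
    exact .some _ _
  · rw [if_neg h]; exact .none _

theorem Ext.andThen {d : ℕ} {c c' : OComp Res} (h : Ext d c c') {f f' : Data → ℕ → OComp Res}
    (hf : ∀ y r, Ext d (f y r) (f' y (r + d))) : Ext d (andThen c f) (andThen c' f') := by
  unfold Prog.andThen
  induction h with
  | none c => exact .none _
  | some y r => exact hf y r
  | coin _ ih => exact .coin ih
  | query q _ ih => exact .query q ih

theorem Ext.answerBy {d : ℕ} {h h' : ℕ → Data → OComp Res}
    (hh : ∀ r y, Ext d (h r y) (h' (r + d) y)) (c : OComp Res) (n : ℕ) (s : Data) :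
    Ext d (answerBy h c n s) (answerBy h' c (n + d) s) := by
  induction c generalizing n s with
  | pure o =>
    rcases o with _ | ⟨y, r⟩ <;> exact Ext.ret _ _ _
  | coin k ih => exact .coin fun b => ih b n s
  | query q k ih => exact (hh n _).andThen fun y r => ih _ _ _

/-- More fuel does not change a run that does not run out of fuel. -/
theorem ext_eval (d : ℕ) : ∀ (n : ℕ) (p : Prog) (x : Data), Ext d (eval n p x) (eval (n + d) p x) := by
  intro n
  induction n using Nat.strong_induction_on with
  | _ n IH =>
    intro p x
    cases n with
    | zero => rw [eval]; exact .none _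
    | succ n =>
      have hn : n + 1 + d = (n + d) + 1 := by omega
      rw [hn]
      have ih : ∀ p x, Ext d (eval n p x) (eval (n + d) p x) := IH n (by omega)
      have ihm : ∀ r p x, Ext d (eval (min r n) p x) (eval (min (r + d) (n + d)) p x) :=
        fun r p x => by
          rw [Nat.add_min_add_right]
          exact IH _ (by omega) p x
      cases p with
      | id => rw [eval, eval]; exact .ret _ _ _
      | fst => rw [eval, eval]; exact .ret _ _ _
      | snd => rw [eval, eval]; exact .ret _ _ _
      | eq => rw [eval, eval]; exact .ret _ _ _
      | coin => rw [eval, eval]; exact .coin fun b => .ret _ _ _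
      | query =>
        rw [eval, eval]
        by_cases h : x.size ≤ n
        · rw [if_pos h, if_pos (by omega)]
          refine .query _ fun a => ?_
          rw [show n + d - x.size = n - x.size + d by omega]
          exact .ret _ _ _
        · rw [if_neg h]; exact .none _
      | handle =>
        rw [eval, eval]
        by_cases h : x.fst.size ≤ n
        · rw [dif_pos h, dif_pos (by omega), show n + d - x.fst.size = n - x.fst.size + d by omega]
          exact .answerBy (fun r y => ihm r _ y) _ _ _
        · rw [dif_neg h]; exact .none _
      | const c => rw [eval, eval]; exact .ret _ _ _
      | pair p q =>
        rw [eval, eval]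
        exact (ih p x).andThen fun y r => (ihm r q x).andThen fun z r' => .some _ _
      | comp p q =>
        rw [eval, eval]
        exact (ih p x).andThen fun y r => ihm r q y
      | cond p q =>
        rw [eval, eval]
        split_ifs
        · exact ih _ _
        · exact ih _ _
      | loop p =>
        rw [eval, eval]
        split_ifs
        · exact .ret _ _ _
        · exact (ih p x).andThen fun y r => ihm r _ y

/-- The total size of the queries on every path, and of the output with the fuel that is left, is
bounded by `n`. -/
def Within : ℕ → OComp Res → Prop
  | n, .pure o => ∀ y r, o = some (y, r) → y.size + r ≤ n
  | n, .coin k => ∀ b, Within n (k b)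
  | n, .query q k => q.size + 1 ≤ n ∧ ∀ a, Within (n - (q.size + 1)) (k a)

theorem Within.mono {c : OComp Res} {n m : ℕ} (h : Within n c) (hnm : n ≤ m) : Within m c := by
  induction c generalizing n m with
  | pure o => exact fun y r ho => (h y r ho).trans hnm
  | coin k ih => exact fun b => ih b (h b) hnm
  | query q k ih => exact ⟨h.1.trans hnm, fun a => ih a (h.2 a) (by omega)⟩

theorem Within.ret (n : ℕ) (y : Data) : Within n (ret n y) := by
  unfold Prog.ret
  split_ifs with h
  · intro y' r h'; cases h'; omega
  · intro y' r h'; cases h'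

theorem Within.andThen {c : OComp Res} {n : ℕ} (h : Within n c) {f : Data → ℕ → OComp Res} (t : ℕ)
    (hf : ∀ m y r, m ≤ n → y.size + r ≤ m → Within (m + t) (f y r)) :
    Within (n + t) (andThen c f) := by
  unfold Prog.andThen
  induction c generalizing n with
  | pure o =>
    rcases o with _ | ⟨y, r⟩
    · intro y r h; cases h
    · exact hf n y r le_rfl (h y r rfl)
  | coin k ih => exact fun b => ih b (h b) hf
  | query q k ih =>
    refine ⟨h.1.trans (by omega), fun a => ?_⟩
    have := ih a (h.2 a) fun m y r hm => hf m y r (by omega)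
    have hq := h.1
    rwa [show n + t - (q.size + 1) = n - (q.size + 1) + t by omega]

theorem Within.answerBy {h : ℕ → Data → OComp Res} (hh : ∀ r y, Within r (h r y)) (c : OComp Res)
    (n : ℕ) (s : Data) : Within n (answerBy h c n s) := by
  induction c generalizing n s with
  | pure o => rcases o with _ | ⟨y, r⟩ <;> exact Within.ret _ _
  | coin k ih => exact fun b => ih b n s
  | query q k ih => exact (hh n _).andThen 0 fun m y r _ hr => (ih _ _ _).mono (by omega)

theorem within_eval : ∀ (n : ℕ) (p : Prog) (x : Data), Within n (eval n p x) := by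
  intro n
  induction n using Nat.strong_induction_on with
  | _ n IH =>
    intro p x
    cases n with
    | zero => rw [eval]; intro y r h; cases h
    | succ n =>
      have ih : ∀ p x, Within n (eval n p x) := IH n (by omega)
      have ihm : ∀ r p x, Within r (eval (min r n) p x) :=
        fun r p x => (IH _ (by omega) p x).mono (min_le_left _ _)
      have hr : ∀ y, Within (n + 1) (Prog.ret n y) := fun y => (Within.ret n y).mono (by omega)
      cases p with
      | id => rw [eval]; exact hr _
      | fst => rw [eval]; exact hr _
      | snd => rw [eval]; exact hr _
      | eq => rw [eval]; exact hr _
      | coin => rw [eval]; exact fun b => hr _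
      | query =>
        rw [eval]
        split_ifs with h
        · exact ⟨by omega, fun a => (Within.ret _ _).mono (by omega)⟩
        · intro y r h; cases h
      | handle =>
        rw [eval]
        split_ifs with h
        · exact (Within.answerBy (fun r y => ihm r _ y) _ _ _).mono (by omega)
        · intro y r h; cases h
      | const c => rw [eval]; exact hr _
      | pair p q =>
        rw [eval]
        refine (ih p x).andThen 1 fun m y r _ hr => ?_
        refine ((ihm r q x).andThen (y.size + 1) fun m' z r' _ hr' => ?_).mono (by omega)
        intro y' r'' h
        cases h
        simp only [Data.size]; omega
      | comp p q =>
        rw [eval]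
        exact (ih p x).andThen 1 fun m y r _ hr => (ihm r q y).mono (by omega)
      | cond p q =>
        rw [eval]
        split_ifs
        · exact (ih _ _).mono (by omega)
        · exact (ih _ _).mono (by omega)
      | loop p =>
        rw [eval]
        split_ifs
        · exact hr _
        · exact (ih p x).andThen 1 fun m y r _ hr => (ihm r _ y).mono (by omega)

variable {σ : Type} {step : σ → Data → PMF (Data × σ)}

theorem Within.run {c : OComp Res} {n : ℕ} (h : Within n c) (e : σ) :
    ∀ o ∈ (c.run step e).support, ∀ y r, o.1 = some (y, r) → y.size + r ≤ n := by
  induction c generalizing n e with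
  | pure o => intro o' ho; simp [OComp.run] at ho; subst ho; exact h
  | coin k ih =>
    intro o ho
    simp only [OComp.run, PMF.mem_support_bind_iff] at ho
    obtain ⟨b, -, ho⟩ := ho
    exact ih b (h b) e o ho
  | query q k ih =>
    intro o ho
    simp only [OComp.run, PMF.mem_support_bind_iff] at ho
    obtain ⟨a, -, ho⟩ := ho
    intro y r hy
    have := ih _ (h.2 _) _ o ho y r hy
    omega

/-- With at least `B` units of fuel, the family `c` of computations (indexed by the available fuel)
started in the environment `step` with state `e` ends with output and environment state distributed
as `μ`, and uses at most `B` units of fuel. -/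
def Runs (step : σ → Data → PMF (Data × σ)) (c : ℕ → OComp Res) (e : σ) (B : ℕ)
    (μ : PMF (Data × σ)) : Prop :=
  ∀ fuel, B ≤ fuel →
    ((c fuel).run step e).map (fun o => (o.1.map Prod.fst, o.2)) = μ.map (fun o => (some o.1, o.2)) ∧
    ∀ o ∈ ((c fuel).run step e).support, ∀ y r, o.1 = some (y, r) → fuel ≤ r + B ∧ r ≤ fuel

/-- The family of computations of a program on a fixed input. -/
abbrev on (p : Prog) (x : Data) : ℕ → OComp Res := fun f => eval f p x

theorem Runs.mono {c : ℕ → OComp Res} {e : σ} {B B' : ℕ} {μ : PMF (Data × σ)}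
    (h : Runs step c e B μ) (hB : B ≤ B') : Runs step c e B' μ := fun f hf =>
  ⟨(h f (hB.trans hf)).1, fun o ho y r hy => by
    have := (h f (hB.trans hf)).2 o ho y r hy
    omega⟩

theorem Runs.congr {c : ℕ → OComp Res} {e : σ} {B : ℕ} {μ ν : PMF (Data × σ)}
    (h : Runs step c e B μ) (hμ : μ = ν) : Runs step c e B ν := hμ ▸ h

theorem Runs.exists_some {c : ℕ → OComp Res} {e : σ} {B : ℕ} {μ : PMF (Data × σ)}
    (h : Runs step c e B μ) {f : ℕ} (hf : B ≤ f) {o : Res × σ}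
    (ho : o ∈ ((c f).run step e).support) :
    ∃ y r, o.1 = some (y, r) ∧ (y, o.2) ∈ μ.support ∧ f ≤ r + B ∧ r ≤ f := by
  have h1 : (o.1.map Prod.fst, o.2) ∈ (μ.map fun o => (some o.1, o.2)).support := by
    rw [← (h f hf).1, PMF.mem_support_map_iff]
    exact ⟨o, ho, rfl⟩
  rw [PMF.mem_support_map_iff] at h1
  obtain ⟨z, hz, hzo⟩ := h1
  obtain ⟨o1, o2⟩ := o
  rcases o1 with _ | ⟨y, r⟩
  · simp at hzo
  · simp only [Option.map_some, Prod.mk.injEq, Option.some.injEq] at hzo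
    refine ⟨y, r, rfl, ?_, (h f hf).2 _ ho y r rfl⟩
    rw [← hzo.1, ← hzo.2]; exact hz

/-- A support element of the outcome is realised by a run. -/
theorem Runs.exists_run {c : ℕ → OComp Res} {e : σ} {B : ℕ} {μ : PMF (Data × σ)}
    (h : Runs step c e B μ) {o : Data × σ} (ho : o ∈ μ.support) :
    ∃ r, (some (o.1, r), o.2) ∈ ((c B).run step e).support := by
  have h1 : (some o.1, o.2) ∈ (((c B).run step e).map fun o => (o.1.map Prod.fst, o.2)).support := by
    rw [(h B le_rfl).1, PMF.mem_support_map_iff]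
    exact ⟨o, ho, rfl⟩
  rw [PMF.mem_support_map_iff] at h1
  obtain ⟨z, hz, hzo⟩ := h1
  obtain ⟨z1, z2⟩ := z
  rcases z1 with _ | ⟨y, r⟩
  · simp at hzo
  · simp only [Option.map_some, Prod.mk.injEq, Option.some.injEq] at hzo
    refine ⟨r, ?_⟩
    rw [← hzo.1, ← hzo.2]; exact hz

/-- Outputs are no larger than the cost. -/
theorem Runs.size_le {p : Prog} {x : Data} {e : σ} {B : ℕ} {μ : PMF (Data × σ)}
    (h : Runs step (on p x) e B μ) {o : Data × σ} (ho : o ∈ μ.support) : o.1.size ≤ B := by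
  obtain ⟨r, hr⟩ := h.exists_run ho
  have := (within_eval B p x).run e _ hr _ _ rfl
  omega

theorem run_andThen (c : OComp Res) (d : Data → ℕ → OComp Res) (e : σ) :
    (andThen c d).run step e = (c.run step e).bind fun o =>
      match o.1 with
      | none => PMF.pure (none, o.2)
      | some (y, r) => (d y r).run step o.2 := by
  rw [andThen, OComp.run_bind]
  congr 1
  funext o
  rcases o with ⟨_ | ⟨y, r⟩, e'⟩ <;> simp [OComp.run]

theorem Runs.andThen {c : ℕ → OComp Res} {e : σ} {B B' : ℕ} {μ : PMF (Data × σ)}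
    (h : Runs step c e B μ) {d : Data → ℕ → OComp Res} {D : ℕ → Data → ℕ → OComp Res}
    (hD : ∀ f y r, r ≤ f → D f y r = d y r) {κ : Data × σ → PMF (Data × σ)}
    (hd : ∀ o ∈ μ.support, Runs step (d o.1) o.2 B' (κ o)) :
    Runs step (fun f => Prog.andThen (c f) (D f)) e (B + B') (μ.bind κ) := by
  intro f hf
  have hB : B ≤ f := by omega
  constructor
  · calc (((Prog.andThen (c f) (D f)).run step e).map fun o => (o.1.map Prod.fst, o.2))
        = ((c f).run step e).bind fun o =>
          (match o.1.map Prod.fst with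
            | none => PMF.pure (none, o.2)
            | some y => (κ (y, o.2)).map fun o => (some o.1, o.2)) := by
          rw [run_andThen, PMF.map_bind]
          refine PMF.bind_congr_support fun o ho => ?_
          obtain ⟨y, r, hy, hmem, hr⟩ := h.exists_some hB ho
          obtain ⟨o1, o2⟩ := o
          simp only at hy hmem
          subst hy
          simp only [Option.map_some]
          rw [hD f y r hr.2]
          exact (hd _ hmem r (by omega)).1
      _ = (((c f).run step e).map fun o => (o.1.map Prod.fst, o.2)).bind fun o =>
          (match o.1 with
            | none => PMF.pure (none, o.2)
            | some y => (κ (y, o.2)).map fun o => (some o.1, o.2)) := by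
          rw [PMF.bind_map]; rfl
      _ = _ := by
          rw [(h f hB).1, PMF.bind_map, PMF.map_bind]; rfl
  · intro o ho y r hy
    rw [run_andThen, PMF.mem_support_bind_iff] at ho
    obtain ⟨o', ho', ho⟩ := ho
    obtain ⟨y', r', hy', hmem, hr⟩ := h.exists_some hB ho'
    obtain ⟨o1, o2⟩ := o'
    simp only at hy' hmem
    subst hy'
    simp only at ho
    rw [hD f y' r' hr.2] at ho
    have := (hd _ hmem r' (by omega)).2 o ho y r hy
    omega

theorem Runs.succ {c c' : ℕ → OComp Res} {e : σ} {B : ℕ} {μ : PMF (Data × σ)}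
    (h : Runs step c e B μ) (hc : ∀ n, c' (n + 1) = c n) : Runs step c' e (B + 1) μ := by
  intro f hf
  obtain ⟨n, rfl⟩ : ∃ n, f = n + 1 := ⟨f - 1, by omega⟩
  rw [hc]
  refine ⟨(h n (by omega)).1, fun o ho y r hy => ?_⟩
  have := (h n (by omega)).2 o ho y r hy
  omega

theorem Runs.ret (e : σ) (y : Data) : Runs step (fun f => ret f y) e y.size (PMF.pure (y, e)) := by
  intro f hf
  simp only [Prog.ret, if_pos hf, OComp.run, PMF.pure_map, true_and, Option.map_some]
  intro o ho y' r h
  simp at ho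
  subst ho
  cases h
  omega

section Rules

variable (e : σ) (x : Data)

theorem runs_id : Runs step (on id x) e (x.size + 1) (PMF.pure (x, e)) :=
  (Runs.ret e x).succ fun n => by rw [on, eval]

theorem runs_fst : Runs step (on fst x) e (x.fst.size + 1) (PMF.pure (x.fst, e)) :=
  (Runs.ret e _).succ fun n => by rw [on, eval]

theorem runs_snd : Runs step (on snd x) e (x.snd.size + 1) (PMF.pure (x.snd, e)) :=
  (Runs.ret e _).succ fun n => by rw [on, eval]

theorem runs_eq : Runs step (on eq x) e 2 (PMF.pure (.bit (decide (x.fst = x.snd)), e)) :=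
  ((Runs.ret e _).succ fun n => by rw [on, eval]).mono (by
    cases decide (x.fst = x.snd) <;> simp [Data.bit, Data.size])

theorem runs_const (d : Data) : Runs step (on (const d) x) e (d.size + 1) (PMF.pure (d, e)) :=
  (Runs.ret e d).succ fun n => by rw [on, eval]

theorem runs_coin : Runs step (on coin x) e 2 (OComp.fairCoin.map fun b => (.bit b, e)) := by
  have key : Runs step (fun f => OComp.coin fun b => Prog.ret f (.bit b)) e 1
      (OComp.fairCoin.map fun b => (.bit b, e)) := by
    intro f hf
    have hb : ∀ b, (Data.bit b).size ≤ f := fun b => by cases b <;> simp [Data.bit, Data.size, hf]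
    have hr := fun b : Bool => Runs.ret (step := step) e (.bit b) f (hb b)
    constructor
    · simp only [OComp.run, PMF.map_bind, PMF.map_comp]
      exact congrArg _ (funext fun b => by rw [(hr b).1, PMF.pure_map]; rfl)
    · intro o ho y r hy
      simp only [OComp.run, PMF.mem_support_bind_iff] at ho
      obtain ⟨b, -, ho⟩ := ho
      have := (hr b).2 o ho y r hy
      have h1 : (Data.bit b).size ≤ 1 := by cases b <;> simp [Data.bit, Data.size]
      omega
  exact key.succ fun n => by rw [on, eval]

theorem runs_query {b : ℕ} (hb : ∀ o ∈ (step e x).support, o.1.size ≤ b) :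
    Runs step (on query x) e (x.size + b + 1) (step e x) := by
  have key : Runs step (fun f => if x.size ≤ f then .query x fun a => Prog.ret (f - x.size) a
      else .pure none) e (x.size + b) (step e x) := by
    intro f hf
    beta_reduce
    rw [if_pos (by omega)]
    have hr : ∀ o ∈ (step e x).support, _ := fun o ho =>
      Runs.ret (step := step) o.2 o.1 (f - x.size) (by have := hb o ho; omega)
    constructor
    · simp only [OComp.run, PMF.map_bind]
      rw [PMF.map_eq_bind]
      exact PMF.bind_congr_support fun o ho => by rw [(hr o ho).1, PMF.pure_map]
    · intro o ho y r hy
      simp only [OComp.run, PMF.mem_support_bind_iff] at ho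
      obtain ⟨a, ha, ho⟩ := ho
      have := (hr a ha).2 o ho y r hy
      have := hb a ha
      omega
  exact key.succ fun n => by rw [on, eval]

variable {e x}

theorem runs_comp {p q : Prog} {B B' : ℕ} {μ : PMF (Data × σ)} {κ : Data × σ → PMF (Data × σ)}
    (hp : Runs step (on p x) e B μ) (hq : ∀ o ∈ μ.support, Runs step (on q o.1) o.2 B' (κ o)) :
    Runs step (on (comp p q) x) e (B + B' + 1) (μ.bind κ) :=
  (hp.andThen (D := fun n y r => eval (min r n) q y) (d := fun y => on q y)
    (fun f y r hr => by simp only [min_eq_left hr]) hq).succ fun n => by rw [on, eval]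

theorem runs_pair {p q : Prog} {B B' : ℕ} {μ : PMF (Data × σ)} {κ : Data × σ → PMF (Data × σ)}
    (hp : Runs step (on p x) e B μ) (hq : ∀ o ∈ μ.support, Runs step (on q x) o.2 B' (κ o)) :
    Runs step (on (pair p q) x) e (B + B' + 1)
      (μ.bind fun o => (κ o).map fun o' => (.cons o.1 o'.1, o'.2)) := by
  have h1 : ∀ (e : σ) (d : Data), Runs step (fun r => .pure (some (d, r))) e 0 (PMF.pure (d, e)) := by
    intro e d f _
    simp only [OComp.run, PMF.pure_map, Option.map_some, true_and]
    intro o ho y r h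
    simp at ho
    subst ho
    cases h
    omega
  have inner : ∀ o ∈ μ.support, Runs step
      (fun r => Prog.andThen (eval r q x) fun z r' => .pure (some (.cons o.1 z, r'))) o.2 B'
      ((κ o).map fun o' => (Data.cons o.1 o'.1, o'.2)) := fun o ho =>
    (hq o ho).andThen (κ := fun o' => PMF.pure (Data.cons o.1 o'.1, o'.2)) (B' := 0)
      (D := fun _ z r' => .pure (some (.cons o.1 z, r')))
      (d := fun z r' => .pure (some (.cons o.1 z, r'))) (fun _ _ _ _ => rfl)
      fun o' _ => h1 o'.2 (.cons o.1 o'.1)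
  have key := hp.andThen (κ := fun o => (κ o).map fun o' => (Data.cons o.1 o'.1, o'.2))
    (D := fun n y r => Prog.andThen (eval (min r n) q x)
      fun z r' => .pure (some (.cons y z, r')))
    (d := fun y r => Prog.andThen (eval r q x) fun z r' => .pure (some (.cons y z, r')))
    (B' := B') (fun f y r hr => by simp only [min_eq_left hr]) inner
  exact key.succ (c' := on (pair p q) x) fun n => by rw [on, eval]

theorem runs_cond_true {p q : Prog} {B : ℕ} {μ : PMF (Data × σ)} (hx : x.fst ≠ .nil)
    (hp : Runs step (on p x.snd) e B μ) : Runs step (on (cond p q) x) e (B + 1) μ :=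
  hp.succ fun n => by rw [on, eval, if_neg hx]

theorem runs_cond_false {p q : Prog} {B : ℕ} {μ : PMF (Data × σ)} (hx : x.fst = .nil)
    (hq : Runs step (on q x.snd) e B μ) : Runs step (on (cond p q) x) e (B + 1) μ :=
  hq.succ fun n => by rw [on, eval, if_pos hx]

theorem runs_loop_stop {p : Prog} (hx : x.fst = .nil) :
    Runs step (on (loop p) x) e (x.snd.size + 1) (PMF.pure (x.snd, e)) :=
  (Runs.ret e x.snd).succ fun n => by rw [on, eval, if_pos hx]

theorem runs_loop_step {p : Prog} {B B' : ℕ} {μ : PMF (Data × σ)} {κ : Data × σ → PMF (Data × σ)}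
    (hx : x.fst ≠ .nil) (hp : Runs step (on p x) e B μ)
    (hq : ∀ o ∈ μ.support, Runs step (on (loop p) o.1) o.2 B' (κ o)) :
    Runs step (on (loop p) x) e (B + B' + 1) (μ.bind κ) :=
  (hp.andThen (D := fun n y r => eval (min r n) (loop p) y) (d := fun y => on (loop p) y)
    (fun f y r hr => by simp only [min_eq_left hr]) hq).succ fun n => by rw [on, eval, if_neg hx]

end Rules

theorem Runs.unique {c : ℕ → OComp Res} {e : σ} {B B' : ℕ} {μ ν : PMF (Data × σ)}
    (h : Runs step c e B μ) (h' : Runs step c e B' ν) : μ = ν := by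
  have h1 := (h (max B B') (le_max_left _ _)).1.symm.trans (h' (max B B') (le_max_right _ _)).1
  have h2 := congrArg (PMF.map fun o : Option Data × σ => (o.1.elim Data.nil fun y => y, o.2)) h1
  rw [PMF.map_comp, PMF.map_comp] at h2
  exact (PMF.map_id μ).symm.trans (h2.trans (PMF.map_id ν))

/-- A continuation specified on the support of an indexed outcome is a function of the outcome. -/
theorem Runs.exists_index {ι : Type} {ν : PMF ι} {φ : ι → Data × σ}
    {d : Data → ℕ → OComp Res} {B : ℕ} {κ : ι → PMF (Data × σ)}
    (hd : ∀ i ∈ ν.support, Runs step (d (φ i).1) (φ i).2 B (κ i)) :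
    ∃ κ' : Data × σ → PMF (Data × σ), (∀ i ∈ ν.support, κ' (φ i) = κ i) ∧
      ∀ o ∈ (ν.map φ).support, Runs step (d o.1) o.2 B (κ' o) := by
  classical
  have key : ∀ o ∈ (ν.map φ).support, ∃ i ∈ ν.support, φ i = o := fun o ho =>
    (PMF.mem_support_map_iff _ _ _).1 ho
  let κ' : Data × σ → PMF (Data × σ) := fun o =>
    if h : o ∈ (ν.map φ).support then κ (key o h).choose else PMF.pure o
  have hκ : ∀ o ∈ (ν.map φ).support, Runs step (d o.1) o.2 B (κ' o) := fun o ho => by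
    have h1 := (key o ho).choose_spec
    have h2 := hd _ h1.1
    simp only [κ', dif_pos ho]
    rwa [h1.2] at h2
  refine ⟨κ', fun i hi => ?_, hκ⟩
  exact (hκ (φ i) ((PMF.mem_support_map_iff _ _ _).2 ⟨i, hi, rfl⟩)).unique (hd i hi)

section Indexed

variable {e : σ} {x : Data} {ι : Type} {ν : PMF ι} {φ : ι → Data × σ} {p q : Prog} {B B' : ℕ}
  {κ : ι → PMF (Data × σ)}

theorem runs_comp_index (hp : Runs step (on p x) e B (ν.map φ))
    (hq : ∀ i ∈ ν.support, Runs step (on q (φ i).1) (φ i).2 B' (κ i)) :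
    Runs step (on (comp p q) x) e (B + B' + 1) (ν.bind κ) := by
  obtain ⟨κ', h1, h2⟩ := Runs.exists_index (d := fun y => on q y) hq
  refine (runs_comp hp h2).congr ?_
  rw [PMF.bind_map]
  exact PMF.bind_congr_support h1

theorem runs_loop_step_index (hx : x.fst ≠ .nil) (hp : Runs step (on p x) e B (ν.map φ))
    (hq : ∀ i ∈ ν.support, Runs step (on (loop p) (φ i).1) (φ i).2 B' (κ i)) :
    Runs step (on (loop p) x) e (B + B' + 1) (ν.bind κ) := by
  obtain ⟨κ', h1, h2⟩ := Runs.exists_index (d := fun y => on (loop p) y) hq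
  refine (runs_loop_step hx hp h2).congr ?_
  rw [PMF.bind_map]
  exact PMF.bind_congr_support h1

theorem runs_comp_pure {y : Data} {e' : σ} {μ : PMF (Data × σ)}
    (hp : Runs step (on p x) e B (PMF.pure (y, e'))) (hq : Runs step (on q y) e' B' μ) :
    Runs step (on (comp p q) x) e (B + B' + 1) μ :=
  (runs_comp hp (κ := fun _ => μ) fun o ho => by
    obtain rfl := (PMF.mem_support_pure_iff _ _).1 ho
    exact hq).congr (PMF.pure_bind _ _)

theorem runs_pair_pure {y : Data} {e' : σ} {μ : PMF (Data × σ)}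
    (hp : Runs step (on p x) e B (PMF.pure (y, e'))) (hq : Runs step (on q x) e' B' μ) :
    Runs step (on (pair p q) x) e (B + B' + 1) (μ.map fun o' => (.cons y o'.1, o'.2)) :=
  (runs_pair hp (κ := fun _ => μ) fun o ho => by
    obtain rfl := (PMF.mem_support_pure_iff _ _).1 ho
    exact hq).congr (PMF.pure_bind _ _)

end Indexed

/-- The output of a computation with bounded fuel. -/
def outOf (o : Res) : Data := o.elim .nil Prod.fst

theorem Runs.clocked {p : Prog} {x : Data} {e : σ} {B T : ℕ} {μ : PMF (Data × σ)}
    (h : Runs step (on p x) e B μ) (hT : B ≤ T) : (clocked T p x).run step e = μ := by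
  rw [Prog.clocked, OComp.run_bind_pure]
  have h1 := congrArg (PMF.map fun o : Option Data × σ => (o.1.elim Data.nil fun y => y, o.2))
    (h T hT).1
  rw [PMF.map_comp, PMF.map_comp] at h1
  have h2 : μ.map ((fun o : Option Data × σ => (o.1.elim Data.nil fun y => y, o.2)) ∘
      fun o => (some o.1, o.2)) = μ := PMF.map_id μ
  rw [h2] at h1
  rw [← h1]
  congr 1
  funext o
  rcases o with ⟨_ | ⟨y, r⟩, e'⟩ <;> rfl

/-- Cost and outcome of answering the queries of a computation `c` with total query size at most `m`
by a handler whose cost per query is at most `B`.  The states of the handler and of its environment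
are described by `t` in a type `τ`, represented through `ψ`, and `I` is an invariant relating them to
the remaining query budget. -/
theorem runs_answerBy {τ : Type} {h : ℕ → Data → OComp Res} {ψ : τ → Data × σ}
    {I : ℕ → τ → Prop} {B S : ℕ} {κ : τ → Data → PMF (Data × τ)}
    (hh : ∀ m t q, q.size + 1 ≤ m → I m t →
      Runs step (fun f => h f (.cons q (ψ t).1)) (ψ t).2 B
        ((κ t q).map fun o => (.cons o.1 (ψ o.2).1, (ψ o.2).2)) ∧
      ∀ o ∈ (κ t q).support, I (m - (q.size + 1)) o.2)
    (hS : ∀ m t, I m t → (ψ t).1.size ≤ S) (c : OComp Res) {T m : ℕ} (hc : Within m c) (hm : m ≤ T)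
    {t : τ} (hI : I m t) :
    Runs step (fun f => answerBy h c f (ψ t).1) (ψ t).2 (m * B + T + S + 1)
      (((c.bind fun o => .pure (outOf o)).run κ t).map
        fun o => (.cons o.1 (ψ o.2).1, (ψ o.2).2)) := by
  induction c generalizing m t with
  | pure o =>
    have hs := hS _ _ hI
    rcases o with _ | ⟨y, r⟩
    · simp only [answerBy, OComp.bind, OComp.run, PMF.pure_map, outOf, Option.elim]
      refine (Runs.ret _ _).mono ?_
      simp only [Data.size]; omega
    · simp only [answerBy, OComp.bind, OComp.run, PMF.pure_map, outOf, Option.elim]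
      refine (Runs.ret _ _).mono ?_
      have := hc y r rfl
      simp only [Data.size]; omega
  | coin k ih =>
    intro f hf
    have hk := fun b => ih b (hc b) hm hI f hf
    simp only [answerBy, OComp.bind, OComp.run, PMF.map_bind]
    refine ⟨congrArg _ (funext fun b => (by rw [(hk b).1, PMF.map_comp])), fun o ho => ?_⟩
    · obtain ⟨b, -, ho⟩ := (PMF.mem_support_bind_iff _ _ _).1 ho
      exact (hk b).2 o ho
  | query q k ih =>
    obtain ⟨h1, h2⟩ := hh m t q hc.1 hI
    have hq := hc.1
    have hb : B + ((m - (q.size + 1)) * B + T + S + 1) ≤ m * B + T + S + 1 := by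
      obtain ⟨j, rfl⟩ : ∃ j, m = j + (q.size + 1) := ⟨m - (q.size + 1), by omega⟩
      rw [Nat.add_sub_cancel]
      nlinarith [Nat.zero_le (q.size * B)]
    have h3 : ∀ o ∈ (κ t q).support, Runs step
        (fun r => answerBy h (k (Data.cons o.1 (ψ o.2).1).fst) r (Data.cons o.1 (ψ o.2).1).snd)
        (ψ o.2).2 ((m - (q.size + 1)) * B + T + S + 1)
        ((((k o.1).bind fun o => .pure (outOf o)).run κ o.2).map
          fun o => (.cons o.1 (ψ o.2).1, (ψ o.2).2)) := fun o ho =>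
      ih o.1 (hc.2 _) (by omega) (h2 o ho)
    obtain ⟨κ', h4, h5⟩ := Runs.exists_index
      (φ := fun o : Data × τ => (Data.cons o.1 (ψ o.2).1, (ψ o.2).2))
      (d := fun as r => answerBy h (k as.fst) r as.snd) h3
    refine ((h1.andThen (D := fun _ as r => answerBy h (k as.fst) r as.snd)
      (d := fun as r => answerBy h (k as.fst) r as.snd) (fun _ _ _ _ => rfl) h5).mono hb).congr ?_
    simp only [OComp.bind, OComp.run, PMF.map_bind, PMF.bind_map]
    exact PMF.bind_congr_support h4

theorem andThen_congr {c : OComp Res} {n : ℕ} (hc : Within n c) {f g : Data → ℕ → OComp Res}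
    (hfg : ∀ y r, r ≤ n → f y r = g y r) : Prog.andThen c f = Prog.andThen c g := by
  unfold Prog.andThen
  induction c generalizing n with
  | pure o =>
    rcases o with _ | ⟨y, r⟩
    · rfl
    · exact hfg y r (by have := hc y r rfl; omega)
  | coin k ih => exact congrArg OComp.coin (funext fun b => ih b (hc b) hfg)
  | query q k ih =>
    exact congrArg (OComp.query q) (funext fun a => ih a (hc.2 a) fun y r hr => hfg y r (by omega))

theorem answerBy_congr {h h' : ℕ → Data → OComp Res} {n : ℕ} (hw : ∀ r y, Within r (h' r y))
    (hh : ∀ r y, r ≤ n → h r y = h' r y) (c : OComp Res) (s : Data) :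
    answerBy h c n s = answerBy h' c n s := by
  induction c generalizing n s with
  | pure o => rcases o with _ | ⟨y, r⟩ <;> rfl
  | coin k ih => exact congrArg OComp.coin (funext fun b => ih b hh s)
  | query q k ih =>
    simp only [answerBy]
    rw [hh n _ le_rfl]
    exact andThen_congr (hw n _) fun y r hr => ih _ (fun r' y hr' => hh r' y (by omega)) _

/-- Running the program `C = (code, clock)` on `arg` against a handler program. -/
theorem runs_handle {τ : Type} {H : Prog} {ψ : τ → Data × σ} {I : ℕ → τ → Prop} {B S : ℕ}
    {κ : τ → Data → PMF (Data × τ)} {C arg : Data}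
    (hh : ∀ m t q, q.size + 1 ≤ m → I m t →
      Runs step (on H (.cons q (ψ t).1)) (ψ t).2 B
        ((κ t q).map fun o => (.cons o.1 (ψ o.2).1, (ψ o.2).2)) ∧
      ∀ o ∈ (κ t q).support, I (m - (q.size + 1)) o.2)
    (hS : ∀ m t, I m t → (ψ t).1.size ≤ S) {t : τ} (hI : I C.snd.size t) :
    Runs step (on handle (.cons C (.cons arg (.cons H.encode (ψ t).1)))) (ψ t).2
      (C.size + (C.snd.size * B + C.snd.size + S + 1) + 1)
      (((clocked C.snd.size (decode C.fst) arg).run κ t).map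
        fun o => (.cons o.1 (ψ o.2).1, (ψ o.2).2)) := by
  have key := (runs_answerBy (h := fun r y => eval r H y) hh hS
    (eval C.snd.size (decode C.fst) arg) (within_eval _ _ _) le_rfl hI)
  intro f hf
  obtain ⟨n, rfl⟩ : ∃ n, f = n + 1 := ⟨f - 1, by omega⟩
  have he : on handle (.cons C (.cons arg (.cons H.encode (ψ t).1))) (n + 1) =
      answerBy (fun r y => eval r H y) (eval C.snd.size (decode C.fst) arg) (n - C.size) (ψ t).1 := by
    have hx : (Data.cons C (.cons arg (.cons H.encode (ψ t).1))).fst.size ≤ n := by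
      change C.size ≤ n; omega
    rw [on, eval, dif_pos hx]
    change answerBy (fun r y => eval (min r n) (decode H.encode) y) _ _ _ = _
    rw [decode_encode]
    exact answerBy_congr (fun r y => within_eval r H y)
      (fun r y hr => by rw [min_eq_left (by omega)]) _ _
  rw [he]
  obtain ⟨h1, h2⟩ := key (n - C.size) (by omega)
  refine ⟨h1, fun o ho y r hy => ?_⟩
  have := h2 o ho y r hy
  omega

end Prog

/-! ### Polynomial bounds -/

attribute [fun_prop] PolyBounded

namespace PolyBounded

@[fun_prop] theorem id' : PolyBounded fun n => n := ⟨1, fun n => by simp⟩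

@[fun_prop] theorem const (c : ℕ) : PolyBounded fun _ => c :=
  ⟨c, fun n => (Nat.lt_two_pow_self).le.trans (Nat.pow_le_pow_left (by omega) c)⟩

@[fun_prop] theorem mul {f g : ℕ → ℕ} (hf : PolyBounded f) (hg : PolyBounded g) :
    PolyBounded fun n => f n * g n := by
  obtain ⟨k, hk⟩ := hf
  obtain ⟨l, hl⟩ := hg
  exact ⟨k + l, fun n => by rw [pow_add]; exact Nat.mul_le_mul (hk n) (hl n)⟩

@[fun_prop] theorem add {f g : ℕ → ℕ} (hf : PolyBounded f) (hg : PolyBounded g) :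
    PolyBounded fun n => f n + g n := by
  obtain ⟨k, hk⟩ := hf
  obtain ⟨l, hl⟩ := hg
  refine ⟨k + l + 1, fun n => ?_⟩
  have h1 : (n + 2) ^ k ≤ (n + 2) ^ (k + l) := Nat.pow_le_pow_right (by omega) (by omega)
  have h2 : (n + 2) ^ l ≤ (n + 2) ^ (k + l) := Nat.pow_le_pow_right (by omega) (by omega)
  have := hk n
  have := hl n
  rw [pow_succ]
  nlinarith

@[fun_prop] theorem pow {f : ℕ → ℕ} (hf : PolyBounded f) (j : ℕ) :
    PolyBounded fun n => f n ^ j := by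
  obtain ⟨k, hk⟩ := hf
  exact ⟨k * j, fun n => by rw [pow_mul]; exact Nat.pow_le_pow_left (hk n) j⟩

end PolyBounded

/-! ### Sizes -/

/-- The size of the representation. -/
def sz {α : Type} [Enc α] (a : α) : ℕ := (enc a).size

section Size

variable {α β : Type} [Enc α] [Enc β]

@[simp] theorem enc_data (d : Data) : (enc d : Data) = d := rfl
@[simp] theorem enc_pair (a : α) (b : β) : (enc (a, b) : Data) = .cons (enc a) (enc b) := rfl
@[simp] theorem enc_nil : (enc ([] : List α) : Data) = .nil := rfl
@[simp] theorem enc_cons (a : α) (l : List α) : (enc (a :: l) : Data) = .cons (enc a) (enc l) := rfl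
@[simp] theorem enc_none : (enc (none : Option α) : Data) = .nil := rfl
@[simp] theorem enc_some (a : α) : (enc (some a) : Data) = .cons .nil (enc a) := rfl
@[simp] theorem enc_nat (n : ℕ) : (enc n : Data) = .unary n := rfl
@[simp] theorem enc_bool (b : Bool) : (enc b : Data) = .bit b := rfl

@[simp] theorem Data.fst_cons (a b : Data) : (Data.cons a b).fst = a := rfl
@[simp] theorem Data.snd_cons (a b : Data) : (Data.cons a b).snd = b := rfl
@[simp] theorem Data.fst_nil : Data.nil.fst = .nil := rfl
@[simp] theorem Data.snd_nil : Data.nil.snd = .nil := rfl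

@[simp] theorem Data.size_nil : Data.nil.size = 0 := rfl
@[simp] theorem Data.size_cons (a b : Data) : (Data.cons a b).size = a.size + b.size + 1 := rfl

theorem Data.size_fst_le (d : Data) : d.fst.size ≤ d.size := by
  cases d <;> simp; omega

@[simp] theorem Data.size_unary (n : ℕ) : (Data.unary n).size = n := by
  induction n with
  | zero => rfl
  | succ n ih => simp [Data.unary, ih]

theorem Data.size_bit_le (b : Bool) : (Data.bit b).size ≤ 1 := by cases b <;> simp [Data.bit]

@[simp] theorem sz_data (d : Data) : sz d = d.size := rfl
@[simp] theorem sz_pair (a : α) (b : β) : sz (a, b) = sz a + sz b + 1 := rfl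
@[simp] theorem sz_cons (a : α) (l : List α) : sz (a :: l) = sz a + sz l + 1 := rfl
@[simp] theorem sz_nat (n : ℕ) : sz n = n := Data.size_unary n

theorem sz_bool_le (b : Bool) : sz b ≤ 1 := Data.size_bit_le b

theorem size_enc (a : α) : (enc a : Data).size = sz a := rfl

end Size

/-! ### Polynomial-time algorithms -/

namespace Prog

theorem Ext.run {σ : Type} {step : σ → Data → PMF (Data × σ)} {d : ℕ} {c c' : OComp Res}
    (h : Ext d c c') (e : σ) (hc : ∀ o ∈ (c.run step e).support, o.1 ≠ Option.none) :
    c'.run step e = (c.run step e).map fun o => (o.1.map fun z => (z.1, z.2 + d), o.2) := by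
  induction h generalizing e with
  | none c => exact absurd rfl (hc (Option.none, e) (by simp [OComp.run]))
  | some y r => simp [OComp.run, PMF.pure_map]
  | @coin k k' _ ih =>
    simp only [OComp.run, PMF.map_bind]
    exact PMF.bind_congr_support fun b hb => ih b e fun o ho =>
      hc o ((PMF.mem_support_bind_iff _ _ _).2 ⟨b, hb, ho⟩)
  | @query q k k' _ ih =>
    simp only [OComp.run, PMF.map_bind]
    exact PMF.bind_congr_support fun r hr => ih r.1 r.2 fun o ho =>
      hc o ((PMF.mem_support_bind_iff _ _ _).2 ⟨r, hr, ho⟩)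

/-- The program `p` computes the randomized function `f` in time at most `b`, in every environment
and without interacting with it. -/
def Computes {α β : Type} [Enc α] [Enc β] (p : Prog) (f : α → PMF β) (b : ℕ → ℕ) : Prop :=
  ∀ (a : α) (σ : Type) (step : σ → Data → PMF (Data × σ)) (e : σ),
    Runs step (on p (enc a)) e (b (sz a)) ((f a).map fun y => (enc y, e))

end Prog

section Closure

open Prog

variable {α β γ δ : Type} [Enc α] [Enc β] [Enc γ] [Enc δ]

theorem ppt_iff {f : α → PMF β} : PPT f ↔ ∃ p k, Computes p f fun n => (n + 2) ^ k := by
  refine exists_congr fun p => exists_congr fun k => ?_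
  constructor
  · intro h a σ step e
    have h0 := h a σ step e
    rw [OComp.run_bind_pure, PMF.map_comp] at h0
    have hsome : ∀ o ∈ ((p.eval ((sz a + 2) ^ k) (enc a)).run step e).support, o.1 ≠ none := by
      intro o ho ho'
      have h1 : (o.1.map Prod.fst, o.2) ∈ (((p.eval ((sz a + 2) ^ k) (enc a)).run step e).map
          fun o => (o.1.map Prod.fst, o.2)).support :=
        (PMF.mem_support_map_iff _ _ _).2 ⟨o, ho, rfl⟩
      rw [show sz a = (enc a).size from rfl, h0] at h1
      obtain ⟨b, -, hb⟩ := (PMF.mem_support_map_iff _ _ _).1 h1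
      rw [ho'] at hb
      simp at hb
    intro fuel hf
    obtain ⟨d, rfl⟩ : ∃ d, fuel = (sz a + 2) ^ k + d := ⟨fuel - (sz a + 2) ^ k, by simp at hf; omega⟩
    have hr := (ext_eval d ((sz a + 2) ^ k) p (enc a)).run e hsome
    constructor
    · simp only [on, hr, PMF.map_comp]
      rw [show ((f a).map ((fun o : Data × σ => (some o.1, o.2)) ∘ fun y => (enc y, e))) = _
        from h0.symm]
      congr 1
      funext o
      rcases o with ⟨_ | ⟨y, r⟩, e'⟩ <;> rfl
    · intro o ho y r hy
      simp only [on, hr] at ho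
      obtain ⟨o', ho', rfl⟩ := (PMF.mem_support_map_iff _ _ _).1 ho
      obtain ⟨o1, o2⟩ := o'
      rcases o1 with _ | ⟨y', r'⟩
      · simp at hy
      · simp only [Option.map_some, Option.some.injEq, Prod.mk.injEq] at hy
        have := (within_eval _ p (enc a)).run e _ ho' _ _ rfl
        simp only
        omega
  · intro h a σ step e
    rw [OComp.run_bind_pure, PMF.map_comp]
    exact ((h a σ step e) _ le_rfl).1.trans (PMF.map_comp _ _ _)

theorem PPT.computes {f : α → PMF β} (h : PPT f) : ∃ p k, Computes p f fun n => (n + 2) ^ k :=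
  ppt_iff.1 h

theorem Prog.Computes.ppt {p : Prog} {f : α → PMF β} {b : ℕ → ℕ} (h : Computes p f b)
    (hb : PolyBounded b) : PPT f := by
  obtain ⟨k, hk⟩ := hb
  exact ppt_iff.2 ⟨p, k, fun a σ step e => (h a σ step e).mono (hk _)⟩

/-- A family of distributions, each of which the program samples in time `b`. -/
theorem PPT.of_runs {f : α → PMF β} (p : Prog) {b : ℕ → ℕ} (hb : PolyBounded b)
    (h : ∀ (a : α) (σ : Type) (step : σ → Data → PMF (Data × σ)) (e : σ),
      Runs step (on p (enc a)) e (b (sz a)) ((f a).map fun y => (enc y, e))) : PPT f :=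
  Computes.ppt h hb

/-- Outputs of polynomial-time algorithms have polynomial size. -/
theorem PPT.size_le {f : α → PMF β} (h : PPT f) :
    ∃ k, ∀ a, ∀ b ∈ (f a).support, sz b ≤ (sz a + 2) ^ k := by
  obtain ⟨p, k, hp⟩ := h.computes
  refine ⟨k, fun a b hb => ?_⟩
  exact (hp a Unit (fun s _ => PMF.pure (.nil, s)) ()).size_le (o := (enc b, ()))
    ((PMF.mem_support_map_iff _ _ _).2 ⟨b, hb, rfl⟩)

theorem PolyTime.size_le {f : α → β} (h : PolyTime f) : ∃ k, ∀ a, sz (f a) ≤ (sz a + 2) ^ k := by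
  obtain ⟨k, hk⟩ := PPT.size_le h
  exact ⟨k, fun a => hk a _ (by simp)⟩

theorem PolyTime.runs {f : α → β} (h : PolyTime f) : ∃ (p : Prog) (k : ℕ), ∀ (a : α) (σ : Type)
    (step : σ → Data → PMF (Data × σ)) (e : σ),
    Runs step (on p (enc a)) e ((sz a + 2) ^ k) (PMF.pure (enc (f a), e)) := by
  obtain ⟨p, k, hp⟩ := PPT.computes h
  exact ⟨p, k, fun a σ step e => by simpa [PMF.pure_map] using hp a σ step e⟩

theorem PolyTime.of_runs {f : α → β} (p : Prog) {b : ℕ → ℕ} (hb : PolyBounded b)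
    (h : ∀ (a : α) (σ : Type) (step : σ → Data → PMF (Data × σ)) (e : σ),
      Runs step (on p (enc a)) e (b (sz a)) (PMF.pure (enc (f a), e))) : PolyTime f :=
  PPT.of_runs p hb fun a σ step e => by simpa [PMF.pure_map] using h a σ step e

/-- Only the representation of the output matters. -/
theorem PPT.of_map_enc {f : α → PMF β} {g : α → PMF γ} (h : PPT f)
    (hg : ∀ a, (g a).map enc = (f a).map enc) : PPT g := by
  obtain ⟨p, k, hp⟩ := h
  refine ⟨p, k, fun a => ?_⟩
  have := congrArg (PMF.map some) (hg a)
  rw [PMF.map_comp, PMF.map_comp] at this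
  exact (show (g a).map (fun b => some (enc b)) = (f a).map fun b => some (enc b) from this) ▸ hp a

theorem PolyTime.of_enc_eq {f : α → β} {g : α → γ} (h : PolyTime f)
    (hg : ∀ a, (enc (g a) : Data) = enc (f a)) : PolyTime g :=
  PPT.of_map_enc h fun a => by simp [PMF.pure_map, hg]

theorem PPT.bind {f : α → PMF β} {g : α → β → PMF γ} (hf : PPT f)
    (hg : PPT fun i : α × β => g i.1 i.2) : PPT fun a => (f a).bind (g a) := by
  obtain ⟨p, k, hp⟩ := hf.computes
  obtain ⟨q, l, hq⟩ := hg.computes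
  obtain ⟨k', hk'⟩ := hf.size_le
  refine .of_runs (.comp (.pair .id p) q)
    (b := fun n => (n + 1 + (n + 2) ^ k + 1) + (n + (n + 2) ^ k' + 1 + 2) ^ l + 1)
    (by fun_prop) fun a σ step e => ?_
  have h1 : Runs step (on (.pair .id p) (enc a)) e (sz a + 1 + (sz a + 2) ^ k + 1)
      ((f a).map fun y => (enc (a, y), e)) :=
    (runs_pair_pure (runs_id e (enc a)) (hp a σ step e)).congr (PMF.map_comp _ _ _)
  refine (runs_comp_index h1 (κ := fun b => (g a b).map fun y => (enc y, e))
    fun b hb => (hq (a, b) σ step e).mono ?_).congr (PMF.map_bind _ _ _).symm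
  have := hk' a b hb
  simp only [sz_pair]
  gcongr

theorem PPT.comp {f : α → PMF β} {g : β → PMF γ} (hf : PPT f) (hg : PPT g) :
    PPT fun a => (f a).bind g := by
  obtain ⟨p, k, hp⟩ := hf.computes
  obtain ⟨q, l, hq⟩ := hg.computes
  obtain ⟨k', hk'⟩ := hf.size_le
  refine .of_runs (.comp p q) (b := fun n => (n + 2) ^ k + ((n + 2) ^ k' + 2) ^ l + 1)
    (by fun_prop) fun a σ step e => ?_
  refine (runs_comp_index (hp a σ step e) (κ := fun b => (g b).map fun y => (enc y, e))
    fun b hb => (hq b σ step e).mono ?_).congr (PMF.map_bind _ _ _).symm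
  have := hk' a b hb
  dsimp only
  gcongr

theorem PolyTime.ppt {f : α → β} (h : PolyTime f) : PPT fun a => PMF.pure (f a) := h

theorem PPT.precomp {f : α → β} {g : β → PMF γ} (hg : PPT g) (hf : PolyTime f) :
    PPT fun a => g (f a) := by
  simpa using PPT.comp hf.ppt hg

theorem PPT.map {f : α → PMF β} {g : α → β → γ} (hf : PPT f)
    (hg : PolyTime fun i : α × β => g i.1 i.2) : PPT fun a => (f a).map (g a) :=
  PPT.bind hf (g := fun a b => PMF.pure (g a b)) hg

attribute [fun_prop] PolyTime

@[fun_prop] theorem PolyTime.id' : PolyTime fun a : α => a :=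
  .of_runs .id (b := fun n => n + 1) (by fun_prop) fun a _ _ e => runs_id e (enc a)

@[fun_prop] theorem PolyTime.const (b : β) : PolyTime fun _ : α => b :=
  .of_runs (.const (enc b)) (b := fun _ => sz b + 1) (by fun_prop)
    fun a _ _ e => runs_const e (enc a) _

@[fun_prop] theorem PolyTime.comp {f : β → γ} {g : α → β} (hf : PolyTime f) (hg : PolyTime g) :
    PolyTime fun a => f (g a) :=
  PPT.precomp (g := fun b => PMF.pure (f b)) hf hg

@[fun_prop] theorem PolyTime.prodMk {f : α → β} {g : α → γ} (hf : PolyTime f) (hg : PolyTime g) :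
    PolyTime fun a => (f a, g a) := by
  obtain ⟨p, k, hp⟩ := hf.runs
  obtain ⟨q, l, hq⟩ := hg.runs
  refine .of_runs (.pair p q) (b := fun n => (n + 2) ^ k + (n + 2) ^ l + 1) (by fun_prop)
    fun a σ step e => ?_
  exact (runs_pair_pure (hp a σ step e) (hq a σ step e)).congr (PMF.pure_map _ _)

@[fun_prop] theorem PolyTime.dataFst : PolyTime Data.fst :=
  .of_runs .fst (b := fun n => n + 1) (by fun_prop) fun a _ _ e =>
    (runs_fst e a).mono (Nat.succ_le_succ (Data.size_fst_le a))

@[fun_prop] theorem PolyTime.dataSnd : PolyTime Data.snd :=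
  .of_runs .snd (b := fun n => n + 1) (by fun_prop) fun a _ _ e =>
    (runs_snd e a).mono (Nat.succ_le_succ (Data.size_snd_le a))

@[fun_prop] theorem PolyTime.fst : PolyTime (Prod.fst : α × β → α) :=
  .of_runs .fst (b := fun n => n + 1) (by fun_prop) fun a _ _ e =>
    (runs_fst e (enc a)).mono (Nat.succ_le_succ (Data.size_fst_le _))

@[fun_prop] theorem PolyTime.snd : PolyTime (Prod.snd : α × β → β) :=
  .of_runs .snd (b := fun n => n + 1) (by fun_prop) fun a _ _ e =>
    (runs_snd e (enc a)).mono (Nat.succ_le_succ (Data.size_snd_le _))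

@[fun_prop] theorem PolyTime.enc' : PolyTime (enc : α → Data) :=
  PolyTime.of_enc_eq (f := fun a : α => a) (by fun_prop) fun _ => rfl

@[fun_prop] theorem PolyTime.dataCons {f g : α → Data} (hf : PolyTime f) (hg : PolyTime g) :
    PolyTime fun a => Data.cons (f a) (g a) :=
  PolyTime.of_enc_eq (hf.prodMk hg) fun _ => rfl

@[fun_prop] theorem PolyTime.listCons {f : α → β} {g : α → List β} (hf : PolyTime f)
    (hg : PolyTime g) : PolyTime fun a => f a :: g a :=
  PolyTime.of_enc_eq (hf.prodMk hg) fun _ => rfl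

@[fun_prop] theorem PolyTime.some {f : α → β} (hf : PolyTime f) : PolyTime fun a => some (f a) :=
  PolyTime.of_enc_eq ((PolyTime.const Data.nil).prodMk hf) fun _ => rfl

@[fun_prop] theorem PolyTime.natSucc {f : α → ℕ} (hf : PolyTime f) : PolyTime fun a => f a + 1 :=
  PolyTime.of_enc_eq ((PolyTime.const Data.nil).prodMk hf) fun _ => rfl

@[fun_prop] theorem PolyTime.decideEq {f g : α → Data} (hf : PolyTime f) (hg : PolyTime g) :
    PolyTime fun a => decide (f a = g a) := by
  have h : PolyTime fun i : Data × Data => decide (i.1 = i.2) :=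
    .of_runs .eq (b := fun _ => 2) (by fun_prop) fun a _ _ e => runs_eq e (enc a)
  exact h.comp (hf.prodMk hg)

/-- Branching on a polynomial-time condition. -/
theorem PPT.cond {c : α → Bool} {f g : α → PMF β} (hc : PolyTime c) (hf : PPT f) (hg : PPT g) :
    PPT fun a => bif c a then f a else g a := by
  obtain ⟨r, j, hr⟩ := (hc.prodMk PolyTime.id').runs
  obtain ⟨p, k, hp⟩ := hf.computes
  obtain ⟨q, l, hq⟩ := hg.computes
  refine .of_runs (.comp r (.cond p q))
    (b := fun n => (n + 2) ^ j + ((n + 2) ^ k + (n + 2) ^ l + 1) + 1) (by fun_prop)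
    fun a σ step e => ?_
  refine runs_comp_pure (hr a σ step e) ?_
  cases h : c a
  · refine (runs_cond_false ?_ (hq a σ step e)).mono (by dsimp only; omega)
    rfl
  · refine (runs_cond_true ?_ (hp a σ step e)).mono (by dsimp only; omega)
    simp [Data.bit]

@[fun_prop] theorem PolyTime.cond {c : α → Bool} {f g : α → β} (hc : PolyTime c) (hf : PolyTime f)
    (hg : PolyTime g) : PolyTime fun a => bif c a then f a else g a := by
  refine (PPT.cond hc hf.ppt hg.ppt).of_map_enc fun a => ?_
  beta_reduce
  cases c a <;> rfl

@[fun_prop] theorem PolyTime.and {c d : α → Bool} (hc : PolyTime c) (hd : PolyTime d) :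
    PolyTime fun a => c a && d a := by
  have : (fun a => c a && d a) = fun a => bif c a then d a else false := by
    funext a; cases c a <;> rfl
  rw [this]; fun_prop

@[fun_prop] theorem PolyTime.or {c d : α → Bool} (hc : PolyTime c) (hd : PolyTime d) :
    PolyTime fun a => c a || d a := by
  have : (fun a => c a || d a) = fun a => bif c a then true else d a := by
    funext a; cases c a <;> rfl
  rw [this]; fun_prop

@[fun_prop] theorem PolyTime.not {c : α → Bool} (hc : PolyTime c) : PolyTime fun a => !c a := by
  have : (fun a => !c a) = fun a => bif c a then false else true := by
    funext a; cases c a <;> rfl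
  rw [this]; fun_prop

theorem ppt_fairCoin : PPT fun _ : α => OComp.fairCoin :=
  .of_runs .coin (b := fun _ => 2) (by fun_prop) fun a _ _ e => runs_coin e (enc a)

/-! ### Bounded loops -/

/-- Folding a randomized function over a list. -/
noncomputable def foldPMF {α β : Type} (g : β → α → PMF β) : List α → β → PMF β
  | [], b => PMF.pure b
  | a :: l, b => (g b a).bind (foldPMF g l)

/-- The program that folds `p` over the list that is the first component of its input. -/
def Prog.fold (p : Prog) : Prog :=
  .loop (.pair (.comp .fst .snd) (.comp (.pair (.comp .fst .fst) .snd) p))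

/-- Folding a program over a list, where `ψ` represents states of the fold as states of the program
and of its environment, and `I` is an invariant of the rest of the list and the state. -/
theorem runs_fold {σ τ : Type} {step : σ → Data → PMF (Data × σ)} {p : Prog} {B S : ℕ}
    {g : τ → α → PMF τ} {ψ : τ → Data × σ} {I : List α → τ → Prop}
    (hS : ∀ l t, I l t → sz l + (ψ t).1.size ≤ S)
    (hp : ∀ a l t, I (a :: l) t →
      Runs step (on p (.cons (enc a) (ψ t).1)) (ψ t).2 B ((g t a).map ψ) ∧
      ∀ o ∈ (g t a).support, I l o)
    (l : List α) (t : τ) (hI : I l t) :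
    Runs step (on p.fold (.cons (enc l) (ψ t).1)) (ψ t).2 (sz l * (B + 4 * S + 20) + S + 1)
      ((foldPMF g l t).map ψ) := by
  induction l generalizing t with
  | nil =>
    have := hS _ _ hI
    simp only [foldPMF, PMF.pure_map]
    refine (runs_loop_stop (x := .cons .nil (ψ t).1) rfl).mono ?_
    simp at this ⊢; omega
  | cons a l ih =>
    have hSz := hS _ _ hI
    simp only [sz_cons] at hSz
    obtain ⟨h1, h2⟩ := hp a l t hI
    have e1 := runs_comp_pure
      (runs_fst (step := step) (ψ t).2 (.cons (.cons (enc a) (enc l)) (ψ t).1))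
      (runs_snd (step := step) (ψ t).2 (.cons (enc a) (enc l)))
    have e2 := runs_comp_pure
      (runs_fst (step := step) (ψ t).2 (.cons (.cons (enc a) (enc l)) (ψ t).1))
      (runs_fst (step := step) (ψ t).2 (.cons (enc a) (enc l)))
    have e3 := runs_pair_pure e2
      (runs_snd (step := step) (ψ t).2 (.cons (.cons (enc a) (enc l)) (ψ t).1))
    rw [PMF.pure_map] at e3
    have e4 := runs_pair_pure e1 (runs_comp_pure e3 h1)
    rw [PMF.map_comp] at e4
    have e5 := runs_loop_step_index (x := .cons (.cons (enc a) (enc l)) (ψ t).1) (by simp) e4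
      (fun o ho => ih o (h2 o ho))
    refine (e5.mono ?_).congr (PMF.map_bind _ _ _).symm
    simp only [Data.size_cons, Data.fst_cons, Data.snd_cons, sz_cons, size_enc]
    nlinarith

/-- Folding a polynomial-time algorithm over a list takes polynomial time if the size of the state
grows by a bounded amount in each step. -/
theorem PPT.foldPMF {g : δ → β → α → PMF β} {l : δ → List α} {b₀ : δ → β} {k : ℕ}
    (hg : PPT fun i : δ × β × α => g i.1 i.2.1 i.2.2)
    (hk : ∀ x b a, ∀ b' ∈ (g x b a).support, sz b' ≤ sz b + (sz x + sz a + 2) ^ k)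
    (hl : PolyTime l) (hb : PolyTime b₀) :
    PPT fun x => _root_.foldPMF (g x) (l x) (b₀ x) := by
  have hg' : PPT fun i : α × δ × β => (g i.2.1 i.2.2 i.1).map fun b => (i.2.1, b) :=
    PPT.map (f := fun i : α × δ × β => g i.2.1 i.2.2 i.1) (g := fun i b => (i.2.1, b))
      (hg.precomp (f := fun i : α × δ × β => (i.2.1, i.2.2, i.1)) (by fun_prop)) (by fun_prop)
  obtain ⟨p, j, hp⟩ := hg'.computes
  have key : PPT fun i : List α × δ × β =>
      (_root_.foldPMF (g i.2.1) i.1 i.2.2).map fun b => (i.2.1, b) := by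
    refine .of_runs p.fold (b := fun n => n * (((n + n + (n + n * (n + n + 2) ^ k) + 2) + 2) ^ j +
      4 * (n + n + (n + n * (n + n + 2) ^ k) + 1) + 20) +
      (n + n + (n + n * (n + n + 2) ^ k) + 1) + 1)
      (by fun_prop) fun ⟨l, x, b⟩ σ step e => ?_
    set N := sz (l, x, b) with hN
    have hN' : N = sz l + (sz x + sz b + 1) + 1 := rfl
    set G := (N + N + 2) ^ k
    have h0 := runs_fold (p := p) (step := step) (g := g x) (ψ := fun b => (enc (x, b), e))
      (I := fun l' b' => sz l' ≤ sz l ∧ sz b' + sz l' * G ≤ sz b + sz l * G)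
      (S := N + N + (N + N * G) + 1) (B := (N + N + (N + N * G) + 2 + 2) ^ j) ?_ ?_ l b
      ⟨le_rfl, le_rfl⟩
    · refine (h0.mono ?_).congr ?_
      · have : sz l ≤ N := by omega
        gcongr
      · rw [PMF.map_comp]; rfl
    · rintro l' b' ⟨h1, h2⟩
      have : sz l * G ≤ N * G := Nat.mul_le_mul_right _ (by omega)
      simp only [size_enc, sz_pair]
      nlinarith [Nat.zero_le (sz l' * G)]
    · rintro a l' b' ⟨h1, h2⟩
      have h3 : sz l * G ≤ N * G := Nat.mul_le_mul_right _ (by omega)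
      simp only [sz_cons] at h1 h2
      have h4 : (sz a + sz l' + 1) * G = sz a * G + sz l' * G + G := by ring
      constructor
      · refine ((hp (a, x, b') σ step e).mono ?_).congr (PMF.map_comp _ _ _)
        dsimp only
        refine Nat.pow_le_pow_left ?_ j
        simp only [sz_pair]
        nlinarith [Nat.zero_le (sz l' * G), Nat.zero_le (sz a * G)]
      · intro b'' hb''
        have h5 := hk x b' a b'' hb''
        have h6 : (sz x + sz a + 2) ^ k ≤ G := Nat.pow_le_pow_left (by omega) k
        refine ⟨by omega, ?_⟩
        nlinarith [Nat.zero_le (sz a * G)]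
  have := PPT.map (f := fun x : δ => (_root_.foldPMF (g x) (l x) (b₀ x)).map fun b => (x, b))
    (g := fun _ i => i.2) (key.precomp (f := fun x => (l x, x, b₀ x)) (by fun_prop)) (by fun_prop)
  have hid : ∀ q : PMF β, q.map (fun b => b) = q := PMF.map_id
  simpa [PMF.map_comp, Function.comp_def, hid] using this

theorem foldPMF_pure {α β : Type} (g : β → α → β) (l : List α) (b : β) :
    foldPMF (fun b a => PMF.pure (g b a)) l b = PMF.pure (l.foldl g b) := by
  induction l generalizing b with
  | nil => rfl
  | cons a l ih => simp [foldPMF, ih]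

theorem PolyTime.foldl {g : δ → β → α → β} {l : δ → List α} {b₀ : δ → β} (k : ℕ)
    (hg : PolyTime fun i : δ × β × α => g i.1 i.2.1 i.2.2)
    (hk : ∀ x b a, sz (g x b a) ≤ sz b + (sz x + sz a + 2) ^ k)
    (hl : PolyTime l) (hb : PolyTime b₀) : PolyTime fun x => (l x).foldl (g x) (b₀ x) := by
  have := PPT.foldPMF (g := fun x b a => PMF.pure (g x b a)) (k := k) hg
    (fun x b a b' hb' => by
      obtain rfl := (PMF.mem_support_pure_iff _ _).1 hb'
      exact hk x b a) hl hb
  simp only [foldPMF_pure] at this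
  exact this

/-! ### Programs that ask one question -/

/-- A program that computes a question and a state, asks the environment and continues with the
answer and the state. -/
theorem exists_ask_prog {f : α → PMF (Data × β)} {g : Data × β → PMF γ} (hf : PPT f) (hg : PPT g) :
    ∃ (p : Prog) (k : ℕ), ∀ (a : α) (σ : Type) (step : σ → Data → PMF (Data × σ)) (e : σ) (b : ℕ),
      (∀ i ∈ (f a).support, ∀ o ∈ (step e i.1).support, o.1.size ≤ b) →
      Runs step (on p (enc a)) e ((sz a + b + 2) ^ k)
        ((f a).bind fun i => (step e i.1).bind fun o => (g (o.1, i.2)).map fun c => (enc c, o.2)) := by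
  obtain ⟨p, k, hp⟩ := hf.computes
  obtain ⟨q, l, hq⟩ := hg.computes
  obtain ⟨j, hj⟩ := hf.size_le
  have hpoly : PolyBounded fun n => (n + 2) ^ k + (((n + 2) ^ j + ((n + 2) ^ j + n + 1) + 1 +
    ((n + 2) ^ j + 1) + 1) + (n + (n + 2) ^ j + 1 + 2) ^ l + 1) + 1 := by fun_prop
  obtain ⟨m, hm⟩ := hpoly
  refine ⟨.comp p (.comp (.pair (.comp .fst .query) .snd) q), m, fun a σ step e b hb => ?_⟩
  refine (Runs.mono ?_ (hm (sz a + b)))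
  have hmain := runs_comp_index (hp a σ step e)
    (q := .comp (.pair (.comp .fst .query) .snd) q)
    (B' := (((sz a + b + 2) ^ j + ((sz a + b + 2) ^ j + (sz a + b) + 1) + 1 +
    ((sz a + b + 2) ^ j + 1) + 1) + (sz a + b + (sz a + b + 2) ^ j + 1 + 2) ^ l + 1))
    (κ := fun i => (step e i.1).bind fun o => (g (o.1, i.2)).map fun c => (enc c, o.2)) ?_
  · refine hmain.mono ?_
    have : (sz a + 2) ^ k ≤ (sz a + b + 2) ^ k := Nat.pow_le_pow_left (by omega) k
    dsimp only
    omega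
  · intro i hi
    have h1 : sz i ≤ (sz a + b + 2) ^ j :=
      (hj a i hi).trans (Nat.pow_le_pow_left (by omega) j)
    obtain ⟨d, x⟩ := i
    simp only [sz_pair, sz_data] at h1
    have e1 := runs_comp_pure (runs_fst (step := step) e (enc (d, x)))
      (runs_query e d (hb _ hi))
    have e2 := runs_pair e1 (q := .snd) (B' := (sz a + b + 2) ^ j + 1)
      (κ := fun o => PMF.pure (enc x, o.2)) fun o _ =>
        (runs_snd (step := step) o.2 (enc (d, x))).mono (by
          simp only [enc_pair, Data.snd_cons, size_enc]; omega)
    simp only [PMF.pure_map] at e2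
    have e3 := runs_comp_index (φ := fun o : Data × σ => (Data.cons o.1 (enc x), o.2)) e2
      (q := q) (B' := (sz a + b + (sz a + b + 2) ^ j + 1 + 2) ^ l)
      (κ := fun o => (g (o.1, x)).map fun c => (enc c, o.2)) fun o ho => by
        refine (hq (o.1, x) σ step o.2).mono (Nat.pow_le_pow_left ?_ l)
        have := hb _ hi o ho
        simp only [sz_pair, sz_data]
        omega
    refine e3.mono ?_
    simp only [enc_pair, Data.fst_cons, enc_data]
    omega

end Closure

/-! ### Some polynomial-time functions -/

section Lists

variable {α β γ : Type} [Enc α] [Enc β] [Enc γ]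

/-- The list of the left subtrees along the right spine. -/
def Data.spine : Data → List Data
  | .nil => []
  | .cons a d => a :: d.spine

@[simp] theorem enc_spine (d : Data) : (enc d.spine : Data) = d := by
  induction d with
  | nil => rfl
  | cons a d _ ih => simp [Data.spine, ih]

@[fun_prop] theorem PolyTime.spine : PolyTime Data.spine :=
  PolyTime.of_enc_eq PolyTime.id' fun d => enc_spine d

@[fun_prop] theorem PolyTime.replicateFalse : PolyTime fun n => List.replicate n false :=
  PolyTime.of_enc_eq PolyTime.id' fun n => by
    induction n with
    | zero => rfl
    | succ n ih => rw [List.replicate_succ, enc_cons, ih]; rfl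

theorem PolyTime.replicateNil : PolyTime fun n => List.replicate n Data.nil :=
  PolyTime.of_enc_eq PolyTime.id' fun n => by
    induction n with
    | zero => rfl
    | succ n ih => rw [List.replicate_succ, enc_cons, ih]; rfl

@[fun_prop] theorem PolyTime.length : PolyTime (List.length : List α → ℕ) := by
  have h := PolyTime.foldl (g := fun (_ : List α) k (_ : α) => k + 1) (l := fun l => l)
    (b₀ := fun _ => 0) 1 (by fun_prop) (fun x b a => by simp) (by fun_prop) (by fun_prop)
  have e : (List.length : List α → ℕ) = fun l => l.foldl (fun k _ => k + 1) 0 := by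
    funext l
    have : ∀ (l : List α) k, l.foldl (fun k _ => k + 1) k = k + l.length := fun l => by
      induction l with
      | nil => simp
      | cons a l ih => intro k; rw [List.foldl_cons, ih, List.length_cons]; omega
    rw [this, Nat.zero_add]
  rw [e]; exact h

@[fun_prop] theorem PolyTime.reverse : PolyTime (List.reverse : List α → List α) := by
  have h := PolyTime.foldl (g := fun (_ : List α) l (a : α) => a :: l) (l := fun l => l)
    (b₀ := fun _ => []) 1 (by fun_prop) (fun x b a => by simp; omega) (by fun_prop) (by fun_prop)
  have e : (List.reverse : List α → List α) = fun l => l.foldl (fun l a => a :: l) [] := by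
    funext l; simp
  rw [e]; exact h

@[fun_prop] theorem PolyTime.append {f g : γ → List α} (hf : PolyTime f) (hg : PolyTime g) :
    PolyTime fun x => f x ++ g x := by
  have h := PolyTime.foldl (g := fun (_ : γ) l (a : α) => a :: l) (l := fun x => (f x).reverse)
    (b₀ := g) 1 (by fun_prop) (fun x b a => by simp; omega) (by fun_prop) hg
  have e : (fun x => f x ++ g x) = fun x => (f x).reverse.foldl (fun l a => a :: l) (g x) := by
    funext x; simp
  rw [e]; exact h

@[fun_prop] theorem PolyTime.natAdd {f g : γ → ℕ} (hf : PolyTime f) (hg : PolyTime g) :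
    PolyTime fun x => f x + g x := by
  have h := PolyTime.foldl (g := fun (_ : γ) k (_ : Data) => k + 1)
    (l := fun x => List.replicate (f x) Data.nil)
    (b₀ := g) 1 (by fun_prop) (fun x b a => by simp)
    (PolyTime.replicateNil.comp hf) hg
  refine PolyTime.of_enc_eq h fun x => congrArg enc ?_
  generalize g x = b
  induction f x generalizing b with
  | zero => simp
  | succ n ih => rw [List.replicate_succ, List.foldl_cons, ← ih]; omega

@[fun_prop] theorem PolyTime.natMul {f g : γ → ℕ} (hf : PolyTime f) (hg : PolyTime g) :
    PolyTime fun x => f x * g x := by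
  have hg' : PolyTime fun i : ((γ × ℕ) × ℕ × Data) => i.2.1 + i.1.2 := by fun_prop
  have h := PolyTime.foldl (g := fun (y : γ × ℕ) k (_ : Data) => k + y.2)
    (l := fun y => List.replicate (f y.1) Data.nil)
    (b₀ := fun _ => 0) 1 hg' (fun x b a => by obtain ⟨x1, x2⟩ := x; simp; omega)
    (PolyTime.replicateNil.comp (by fun_prop)) (by fun_prop)
  have h' := h.comp (g := fun x => (x, g x)) (by fun_prop)
  refine PolyTime.of_enc_eq h' fun x => congrArg enc ?_
  have : ∀ n k : ℕ, (List.replicate n Data.nil).foldl (fun k _ => k + g x) k = k + n * g x :=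
    fun n => by
      induction n with
      | zero => simp
      | succ n ih => intro k; rw [List.replicate_succ, List.foldl_cons, ih]; ring
  rw [this, Nat.zero_add]

@[fun_prop] theorem PolyTime.natPow {f : γ → ℕ} (hf : PolyTime f) (k : ℕ) :
    PolyTime fun x => f x ^ k := by
  induction k with
  | zero => simpa using PolyTime.const 1
  | succ k ih => simp only [pow_succ]; fun_prop

theorem Data.unary_injective : Function.Injective Data.unary := fun a b h => by
  rw [← Data.toNat_unary a, h, Data.toNat_unary]

@[fun_prop] theorem PolyTime.decideNatEq {f g : γ → ℕ} (hf : PolyTime f) (hg : PolyTime g) :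
    PolyTime fun x => decide (f x = g x) := by
  have : (fun x => decide (f x = g x)) = fun x => decide ((enc (f x) : Data) = enc (g x)) := by
    funext x
    simp [Data.unary_injective.eq_iff]
  rw [this]; fun_prop

end Lists

section SizeComputation

/-- The number of steps needed to empty a stack of trees. -/
def Data.weight : Data → ℕ
  | .nil => 0
  | .cons a s => 2 * a.size + 1 + s.weight

theorem Data.weight_le (s : Data) : s.weight ≤ 2 * s.size := by
  induction s with
  | nil => simp [weight]
  | cons a s _ ih => simp [weight]; omega

/-- One step of counting the nodes of the trees on a stack. -/
def countStep (i : Data × ℕ) : Data × ℕ :=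
  bif decide (i.1.fst = .nil) then (i.1.snd, i.2)
  else (.cons i.1.fst.fst (.cons i.1.fst.snd i.1.snd), i.2 + 1)

theorem PolyTime.countStep : PolyTime _root_.countStep := by
  unfold _root_.countStep; fun_prop

/-- The number of nodes of the trees on a stack. -/
def Data.stackSize : Data → ℕ
  | .nil => 0
  | .cons a s => a.size + s.stackSize

@[fun_prop] theorem PolyTime.size : PolyTime Data.size := by
  obtain ⟨p, k, hp⟩ := PolyTime.countStep.runs
  have key : ∀ (S : ℕ) (σ : Type) (step : σ → Data → PMF (Data × σ)) (e : σ) (m : ℕ) (s : Data)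
      (c : ℕ), s.weight ≤ m → s.size + c + m + 1 ≤ S →
      Prog.Runs step (Prog.on (.loop p) (enc (s, c))) e (m * ((S + 2) ^ k + 1) + S + 1)
        (PMF.pure (enc (c + s.stackSize), e)) := by
    intro S σ step e m
    induction m with
    | zero =>
      intro s c hs hS
      cases s with
      | nil =>
        refine (Prog.runs_loop_stop (x := enc ((.nil : Data), c)) rfl).mono ?_
        simp; omega
      | cons a s => simp [Data.weight] at hs
    | succ m ih =>
      intro s c hs hS
      cases s with
      | nil =>
        refine (Prog.runs_loop_stop (x := enc ((.nil : Data), c)) rfl).mono ?_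
        simp; omega
      | cons a s =>
        have h1 : ∀ s' c', _root_.countStep (.cons a s, c) = (s', c') →
            s'.weight ≤ m ∧ s'.size + c' + m + 1 ≤ S ∧
              c' + s'.stackSize = c + (Data.cons a s).stackSize := by
          intro s' c' h
          cases a with
          | nil =>
            simp [_root_.countStep] at h
            obtain ⟨rfl, rfl⟩ := h
            simp [Data.weight, Data.stackSize] at hs hS ⊢
            omega
          | cons a b =>
            simp [_root_.countStep] at h
            obtain ⟨rfl, rfl⟩ := h
            simp [Data.weight, Data.stackSize] at hs hS ⊢
            omega
        obtain ⟨⟨s', c'⟩, hsc⟩ : ∃ i, _root_.countStep (.cons a s, c) = i := ⟨_, rfl⟩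
        obtain ⟨hw, hz, he⟩ := h1 s' c' hsc
        have h2 := hp (.cons a s, c) σ step e
        rw [hsc] at h2
        have h3 := Prog.runs_loop_step (x := enc (Data.cons a s, c)) (by simp) h2
          (κ := fun _ => PMF.pure (enc (c + (Data.cons a s).stackSize), e)) fun o ho => by
            obtain rfl := (PMF.mem_support_pure_iff _ _).1 ho
            rw [← he]
            exact ih s' c' hw hz
        rw [PMF.pure_bind] at h3
        refine h3.mono ?_
        have : (sz (Data.cons a s, c) + 2) ^ k ≤ (S + 2) ^ k :=
          Nat.pow_le_pow_left (by simp only [sz_pair, sz_data, sz_nat]; omega) k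
        rw [Nat.add_mul]
        omega
  have h : PolyTime fun i : Data × ℕ => i.2 + i.1.stackSize :=
    .of_runs (.loop p) (b := fun n => (2 * n) * ((n + 2 * n + 1 + 2) ^ k + 1) + (n + 2 * n + 1) + 1)
      (by fun_prop) fun ⟨s, c⟩ σ step e => (key _ σ step e (2 * sz (s, c)) s c (by
        have := s.weight_le
        simp only [sz_pair, sz_data]; omega) (by simp only [sz_pair, sz_data, sz_nat]; omega))
  have h' := h.comp (g := fun d => (Data.cons d .nil, 0)) (by fun_prop)
  simpa [Data.stackSize] using h'

end SizeComputation

/-! ### Bit strings -/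

/-- Whether a tree represents a bit string. -/
def Data.isBits (d : Data) : Bool :=
  d.spine.foldl (fun b a => b && (decide (a = .nil) || decide (a = .cons .nil .nil))) true

@[fun_prop] theorem PolyTime.isBits : PolyTime Data.isBits :=
  PolyTime.foldl (g := fun (_ : Data) b (a : Data) =>
      b && (decide (a = .nil) || decide (a = .cons .nil .nil))) (l := Data.spine)
    (b₀ := fun _ => true) 1 (by fun_prop) (fun x b a => by
      have := sz_bool_le (b && (decide (a = .nil) || decide (a = .cons .nil .nil)))
      rw [pow_one]; omega) (by fun_prop) (by fun_prop)

theorem Data.isBits_iff (d : Data) : d.isBits = true ↔ d.toBits.isSome = true := by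
  have key : ∀ (d : Data) (b : Bool), d.spine.foldl (fun b a => b &&
      (decide (a = .nil) || decide (a = .cons .nil .nil))) b = (b && d.toBits.isSome) := by
    intro d
    induction d with
    | nil => intro b; simp [spine, toBits]
    | cons a d _ ih =>
      intro b
      rw [spine, List.foldl_cons, ih]
      rcases a with _ | ⟨_ | ⟨a1, a2⟩, _ | ⟨a3, a4⟩⟩ <;> simp [toBits]
  rw [isBits, key]; simp

theorem Data.toBits_eq_some {d : Data} {l : List Bool} : d.toBits = some l ↔ d = enc l := by
  constructor
  · intro h
    induction d generalizing l with
    | nil => simp [toBits] at h; subst h; rfl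
    | cons a d _ ih =>
      rcases a with _ | ⟨_ | ⟨a1, a2⟩, _ | ⟨a3, a4⟩⟩ <;> simp [toBits] at h
      · obtain ⟨l', h', rfl⟩ := h; rw [ih h']; rfl
      · obtain ⟨l', h', rfl⟩ := h; rw [ih h']; rfl
  · rintro rfl; exact toBits_enc l

/-- The bit string represented by a tree; other trees are read as the empty string. -/
def Data.bits (d : Data) : List Bool := d.toBits.getD []

@[simp] theorem Data.bits_enc (l : List Bool) : (enc l : Data).bits = l := by
  simp [bits, toBits_enc]

theorem Data.enc_bits (d : Data) : (enc d.bits : Data) = bif d.isBits then d else .nil := by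
  by_cases h : d.isBits = true
  · obtain ⟨l, hl⟩ := Option.isSome_iff_exists.1 (d.isBits_iff.1 h)
    rw [h, toBits_eq_some.1 hl, bits_enc]; rfl
  · have : d.toBits = none := by
      rw [isBits_iff] at h
      simpa using h
    simp only [Bool.not_eq_true] at h
    simp [bits, h, this]

@[simp] theorem Data.isBits_enc (l : List Bool) : (enc l : Data).isBits = true := by
  rw [isBits_iff, toBits_enc]; rfl

@[fun_prop] theorem PolyTime.bits : PolyTime Data.bits :=
  PolyTime.of_enc_eq (f := fun d => bif d.isBits then d else .nil) (by fun_prop) Data.enc_bits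

@[fun_prop] theorem PolyTime.boolXor {γ : Type} [Enc γ] {f g : γ → Bool} (hf : PolyTime f)
    (hg : PolyTime g) : PolyTime fun x => xor (f x) (g x) := by
  have : (fun x => xor (f x) (g x)) = fun x => bif f x then !g x else g x := by
    funext x; cases f x <;> simp
  rw [this]; fun_prop

@[fun_prop] theorem PolyTime.xorBits {γ : Type} [Enc γ] {f g : γ → List Bool} (hf : PolyTime f)
    (hg : PolyTime g) : PolyTime fun x => _root_.xorBits (f x) (g x) := by
  have hb : PolyTime fun b : Bool => b := by fun_prop
  -- the state of the fold is the reversed output with the rest of the second string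
  let s : List Bool × Data → Bool → List Bool × Data := fun i a =>
    bif decide (i.2 = .nil) then i else (xor a (!decide (i.2.fst = .nil)) :: i.1, i.2.snd)
  have h := PolyTime.foldl (g := fun (_ : γ) i a => s i a) (l := f)
    (b₀ := fun x => (([] : List Bool), enc (g x))) 1 (by simp only [s]; fun_prop)
    (fun x b a => by
      simp only [s]
      cases decide (b.2 = .nil)
      · have := sz_bool_le (xor a (!decide (b.2.fst = .nil)))
        have := Data.size_snd_le b.2
        obtain ⟨b1, b2⟩ := b
        simp only [cond_false, sz_pair, sz_cons, sz_data, pow_one] at *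
        omega
      · simp)
    hf (by fun_prop)
  refine PolyTime.of_enc_eq (f := fun x => ((f x).foldl s ([], enc (g x))).1.reverse)
    (by fun_prop) fun x => congrArg enc ?_
  have key : ∀ (l m : List Bool) (acc : List Bool),
      (l.foldl s (acc, enc m)).1 = (List.zipWith xor l m).reverse ++ acc := by
    intro l
    induction l with
    | nil => intro m acc; simp
    | cons a l ih =>
      intro m acc
      cases m with
      | nil =>
        have h0 : s (acc, enc ([] : List Bool)) a = (acc, enc ([] : List Bool)) := by simp [s]
        rw [List.foldl_cons, h0, ih]; simp
      | cons b m =>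
        have h0 : s (acc, enc (b :: m)) a = (xor a b :: acc, enc m) := by
          cases b <;> simp [s, Data.bit]
        rw [List.foldl_cons, h0, ih]; simp
  rw [key]; simp [_root_.xorBits]

theorem foldPMF_concat {α β : Type} (g : β → α → PMF β) (l : List α) (a : α) (b : β) :
    foldPMF g (l ++ [a]) b = (foldPMF g l b).bind fun b => g b a := by
  induction l generalizing b with
  | nil => simp [foldPMF]
  | cons c l ih =>
    simp only [List.cons_append, foldPMF, PMF.bind_bind]
    exact congrArg _ (funext ih)

theorem PPT.randomBits : PPT fun n : ℕ => _root_.randomBits n := by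
  have hstep : PPT fun i : ℕ × List Bool × Data => OComp.fairCoin.map fun b => b :: i.2.1 :=
    PPT.map (f := fun _ => OComp.fairCoin) (g := fun (i : ℕ × List Bool × Data) b => b :: i.2.1)
      ppt_fairCoin (by fun_prop)
  have h := PPT.foldPMF (g := fun (_ : ℕ) (l : List Bool) (_ : Data) =>
    OComp.fairCoin.map fun b => b :: l) (l := fun n => List.replicate n Data.nil)
    (b₀ := fun _ => []) (k := 1) hstep (fun x l a l' hl' => by
      obtain ⟨b, -, rfl⟩ := (PMF.mem_support_map_iff _ _ _).1 hl'
      have := sz_bool_le b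
      simp only [sz_cons, pow_one]; omega) PolyTime.replicateNil (by fun_prop)
  refine h.of_map_enc fun n => congrArg _ ?_
  induction n with
  | zero => rfl
  | succ n ih =>
    rw [List.replicate_succ', foldPMF_concat, ← ih, _root_.randomBits]
    simp only [PMF.map_eq_bind]
    rw [PMF.bind_comm]

/-! ### Association lists -/

/-- The value of a key in an association list represented by a tree, as an optional value. -/
def Data.lookup (key tab : Data) : Data :=
  tab.spine.foldl (fun r e => bif decide (e.fst = key) then .cons .nil e.snd else r) .nil

/-- Whether a key occurs in an association list represented by a tree. -/
def Data.hasKey (key tab : Data) : Bool := decide (key.lookup tab ≠ .nil)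

@[fun_prop] theorem PolyTime.lookup {γ : Type} [Enc γ] {f g : γ → Data} (hf : PolyTime f)
    (hg : PolyTime g) : PolyTime fun x => (f x).lookup (g x) := by
  have h := PolyTime.foldl (g := fun (i : Data × Data) (r e : Data) =>
      bif decide (e.fst = i.1) then .cons .nil e.snd else r) (l := fun i => i.2.spine)
    (b₀ := fun _ => Data.nil) 1 (by fun_prop) (fun x b a => by
      cases decide (a.fst = x.1)
      · simp
      · have := Data.size_snd_le a
        simp; omega) (by fun_prop) (by fun_prop)
  exact h.comp (g := fun x => (f x, g x)) (by fun_prop)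

@[fun_prop] theorem PolyTime.hasKey {γ : Type} [Enc γ] {f g : γ → Data} (hf : PolyTime f)
    (hg : PolyTime g) : PolyTime fun x => (f x).hasKey (g x) := by
  have : (fun x => (f x).hasKey (g x)) = fun x => !decide ((f x).lookup (g x) = .nil) := by
    funext x; simp [Data.hasKey]
  rw [this]; fun_prop

/-! ### The encrypt-then-MAC layer between a CCA2 player and its oracles -/

/-- Exclusive or of represented bit strings. -/
def xorD (v d : Data) : Data := enc (xorBits v.bits d.bits)

/-- Concatenation of represented bit strings. -/
def appD (d e : Data) : Data := enc (d.bits ++ e.bits)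

/-- Whether a tree represents a bit string of length `l`. -/
def okMsg (l : ℕ) (d : Data) : Bool := d.isBits && decide (d.bits.length = l)

/-- The parameters of the layer: in the mode `ideal`, decryption queries for valid ciphertexts that
were not produced by encryption queries are not answered, and nothing is answered after them; `bit`
is the hidden bit and `len` the message length. -/
structure CoreParams where
  ideal : Bool
  bit : Bool
  len : ℕ

instance : Enc CoreParams := ⟨fun k => enc (k.ideal, k.bit, k.len)⟩

@[fun_prop] theorem PolyTime.coreIdeal : PolyTime CoreParams.ideal :=
  (PolyTime.fst (α := Bool) (β := Bool × ℕ)).comp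
    (PolyTime.of_enc_eq (f := fun k : CoreParams => k) (g := fun k => (k.ideal, k.bit, k.len))
      (by fun_prop) fun _ => rfl)

@[fun_prop] theorem PolyTime.coreBit : PolyTime CoreParams.bit :=
  PolyTime.comp (f := fun i : Bool × Bool × ℕ => i.2.1) (by fun_prop)
    (PolyTime.of_enc_eq (f := fun k : CoreParams => k) (g := fun k => (k.ideal, k.bit, k.len))
      (by fun_prop) fun _ => rfl)

@[fun_prop] theorem PolyTime.coreLen : PolyTime CoreParams.len :=
  PolyTime.comp (f := fun i : Bool × Bool × ℕ => i.2.2) (by fun_prop)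
    (PolyTime.of_enc_eq (f := fun k : CoreParams => k) (g := fun k => (k.ideal, k.bit, k.len))
      (by fun_prop) fun _ => rfl)

@[fun_prop] theorem PolyTime.coreMk {γ : Type} [Enc γ] {f g : γ → Bool} {h : γ → ℕ}
    (hf : PolyTime f) (hg : PolyTime g) (hh : PolyTime h) :
    PolyTime fun x => CoreParams.mk (f x) (g x) (h x) :=
  PolyTime.of_enc_eq (f := fun x => (f x, g x, h x)) (by fun_prop) fun _ => rfl

namespace CoreParams

variable (k : CoreParams)

/-! The state of the layer is a tree `w = (ch, (tab, bad))` with the challenge ciphertext `ch` (if it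
has been issued), the association list `tab` of the other ciphertexts produced so far with their
messages, and the first forgery `bad`, a pair of a message and a tag (if there is one). -/

/-- Whether no more queries are answered. -/
def frozen (w : Data) : Bool := k.ideal && !decide (w.snd.snd = .nil)

/-- Whether `q` is tagged as a challenge query. -/
def isChal (q : Data) : Bool := decide (q.fst = .cons .nil (.cons .nil .nil))

/-- Whether `q` is tagged as a decryption query. -/
def isDec (q : Data) : Bool := decide (q.fst = .cons .nil .nil)

/-- The message that the query `q` asks to encrypt (as an optional value). -/
def toEncrypt (w q : Data) : Data :=
  bif k.frozen w then .nil
  else bif decide (q.fst = .nil) && okMsg k.len q.snd then .cons .nil q.snd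
  else bif isChal q && decide (w.fst = .nil) && okMsg k.len q.snd.fst && okMsg k.len q.snd.snd then
    .cons .nil (bif k.bit then q.snd.snd else q.snd.fst)
  else .nil

/-- Whether the query `q` asks to decrypt a ciphertext of the right format other than the
challenge. -/
def toDecrypt (w q : Data) : Bool :=
  !k.frozen w && isDec q && !decide (w.fst = .cons .nil q.snd) && okMsg k.len q.snd.fst.fst &&
    okMsg k.len q.snd.fst.snd

/-- The message whose tag is to be computed or verified for a decryption query. -/
def decMsg (q : Data) : Data := appD q.snd.fst.fst q.snd.fst.snd

/-- The query to the MAC oracles, where `r` is a nonce and `v` the value of the pseudorandom function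
at the nonce. -/
def pre (w q r v : Data) : Data :=
  bif !decide (k.toEncrypt w q = .nil) then .cons .nil (appD r (xorD v (k.toEncrypt w q).snd))
  else bif k.toDecrypt w q then .cons (.bit true) (.cons (decMsg q) q.snd.snd)
  else .nil

/-- The ciphertext, given the answer `a` of the signing oracle. -/
def ctxt (w q r v a : Data) : Data := .cons (.cons r (xorD v (k.toEncrypt w q).snd)) a.snd

/-- The reply to the player, given the answer `a` of the MAC oracle. -/
def reply (w q r v a : Data) : Data :=
  bif !decide (k.toEncrypt w q = .nil) then .cons .nil (k.ctxt w q r v a)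
  else bif k.toDecrypt w q && !decide (a = .nil) then
    bif q.snd.hasKey w.snd.fst then q.snd.lookup w.snd.fst
    else bif k.ideal then .nil else .cons .nil (xorD v q.snd.fst.snd)
  else .nil

/-- The next state, given the answer `a` of the MAC oracle. -/
def next (w q r v a : Data) : Data :=
  bif !decide (k.toEncrypt w q = .nil) then
    bif isChal q then .cons (.cons .nil (k.ctxt w q r v a)) w.snd
    else .cons w.fst (.cons (.cons (.cons (k.ctxt w q r v a) (k.toEncrypt w q).snd) w.snd.fst)
      w.snd.snd)
  else bif k.toDecrypt w q && !decide (a = .nil) then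
    bif q.snd.hasKey w.snd.fst then w
    else .cons w.fst (.cons w.snd.fst
      (bif decide (w.snd.snd = .nil) then .cons (decMsg q) q.snd.snd else w.snd.snd))
  else w

variable {γ : Type} [Enc γ] {κ : γ → CoreParams} {w q r v a : γ → Data}

@[fun_prop] theorem polyTime_frozen (hk : PolyTime κ) (hw : PolyTime w) :
    PolyTime fun x => (κ x).frozen (w x) := by unfold frozen; fun_prop

@[fun_prop] theorem polyTime_okMsg {l : γ → ℕ} (hl : PolyTime l) (hw : PolyTime w) :
    PolyTime fun x => okMsg (l x) (w x) := by unfold okMsg; fun_prop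

@[fun_prop] theorem polyTime_xorD (hw : PolyTime w) (hq : PolyTime q) :
    PolyTime fun x => xorD (w x) (q x) := by unfold xorD; fun_prop

@[fun_prop] theorem polyTime_appD (hw : PolyTime w) (hq : PolyTime q) :
    PolyTime fun x => appD (w x) (q x) := by unfold appD; fun_prop

@[fun_prop] theorem polyTime_isChal : PolyTime isChal := by unfold isChal; fun_prop

@[fun_prop] theorem polyTime_isDec : PolyTime isDec := by unfold isDec; fun_prop

@[fun_prop] theorem polyTime_decMsg : PolyTime decMsg := by unfold decMsg; fun_prop

@[fun_prop] theorem polyTime_toEncrypt (hk : PolyTime κ) (hw : PolyTime w) (hq : PolyTime q) :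
    PolyTime fun x => (κ x).toEncrypt (w x) (q x) := by unfold toEncrypt; fun_prop

@[fun_prop] theorem polyTime_toDecrypt (hk : PolyTime κ) (hw : PolyTime w) (hq : PolyTime q) :
    PolyTime fun x => (κ x).toDecrypt (w x) (q x) := by unfold toDecrypt; fun_prop

@[fun_prop] theorem polyTime_pre (hk : PolyTime κ) (hw : PolyTime w) (hq : PolyTime q)
    (hr : PolyTime r) (hv : PolyTime v) :
    PolyTime fun x => (κ x).pre (w x) (q x) (r x) (v x) := by unfold pre; fun_prop

@[fun_prop] theorem polyTime_ctxt (hk : PolyTime κ) (hw : PolyTime w) (hq : PolyTime q)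
    (hr : PolyTime r) (hv : PolyTime v) (ha : PolyTime a) :
    PolyTime fun x => (κ x).ctxt (w x) (q x) (r x) (v x) (a x) := by unfold ctxt; fun_prop

@[fun_prop] theorem polyTime_reply (hk : PolyTime κ) (hw : PolyTime w) (hq : PolyTime q)
    (hr : PolyTime r) (hv : PolyTime v) (ha : PolyTime a) :
    PolyTime fun x => (κ x).reply (w x) (q x) (r x) (v x) (a x) := by unfold reply; fun_prop

@[fun_prop] theorem polyTime_next (hk : PolyTime κ) (hw : PolyTime w) (hq : PolyTime q)
    (hr : PolyTime r) (hv : PolyTime v) (ha : PolyTime a) :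
    PolyTime fun x => (κ x).next (w x) (q x) (r x) (v x) (a x) := by unfold next; fun_prop

end CoreParams

theorem size_enc_bits_le (l : List Bool) : (enc l : Data).size ≤ 2 * l.length := by
  induction l with
  | nil => simp
  | cons b l ih =>
    have := Data.size_bit_le b
    simp; omega

theorem length_bits_le (d : Data) : d.bits.length ≤ d.size := by
  have h : ∀ l : List Bool, l.length ≤ (enc l : Data).size := fun l => by
    induction l with
    | nil => simp
    | cons b l ih => simp; omega
  refine (h d.bits).trans ?_
  rw [Data.enc_bits]
  cases d.isBits <;> simp

theorem size_xorD_le (v d : Data) : (xorD v d).size ≤ 2 * d.size := by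
  refine (size_enc_bits_le _).trans ?_
  have : (xorBits v.bits d.bits).length ≤ d.bits.length := by simp [xorBits]
  have := length_bits_le d
  omega

theorem size_appD_le (d e : Data) : (appD d e).size ≤ 2 * (d.size + e.size) := by
  refine (size_enc_bits_le _).trans ?_
  have := length_bits_le d
  have := length_bits_le e
  rw [List.length_append]; omega

namespace CoreParams

variable (k : CoreParams) (w q r v a : Data)

theorem size_toEncrypt_le : (k.toEncrypt w q).size ≤ q.size + 1 := by
  have h1 := q.size_snd_le
  have h2 := q.snd.size_snd_le
  have h3 := q.snd.size_fst_le
  unfold toEncrypt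
  cases k.frozen w <;> cases decide (q.fst = .nil) && okMsg k.len q.snd <;>
    cases isChal q && decide (w.fst = .nil) && okMsg k.len q.snd.fst && okMsg k.len q.snd.snd <;>
    cases k.bit <;> simp <;> omega

theorem size_decMsg_le : (decMsg q).size + q.snd.snd.size ≤ 5 * q.size := by
  have h0 := size_appD_le q.snd.fst.fst q.snd.fst.snd
  have h1 := q.size_snd_le
  have h2 := q.snd.size_snd_le
  have h3 := q.snd.size_fst_le
  have h4 := q.snd.fst.size_fst_le
  have h5 := q.snd.fst.size_snd_le
  unfold decMsg
  omega

theorem size_pre_le : (k.pre w q r v).size ≤ 5 * q.size + 2 * r.size + 10 := by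
  have h1 := k.size_toEncrypt_le w q
  have h2 := (k.toEncrypt w q).size_snd_le
  have h3 := size_xorD_le v (k.toEncrypt w q).snd
  have h4 := size_appD_le r (xorD v (k.toEncrypt w q).snd)
  have h5 := size_decMsg_le q
  unfold pre
  cases decide (k.toEncrypt w q = .nil) <;> cases k.toDecrypt w q <;> simp [Data.bit] <;> omega

theorem size_ctxt_le : (k.ctxt w q r v a).size ≤ 2 * q.size + r.size + a.size + 4 := by
  have h1 := k.size_toEncrypt_le w q
  have h2 := (k.toEncrypt w q).size_snd_le
  have h3 := size_xorD_le v (k.toEncrypt w q).snd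
  have h4 := a.size_snd_le
  simp only [ctxt, Data.size_cons]
  omega

theorem size_next_le :
    (k.next w q r v a).size ≤ w.size + (10 * q.size + r.size + a.size + 20) := by
  have h1 := k.size_toEncrypt_le w q
  have h2 := (k.toEncrypt w q).size_snd_le
  have h3 := k.size_ctxt_le w q r v a
  have h5 := size_decMsg_le q
  have hw : w.fst.size + w.snd.size ≤ w.size := by cases w <;> simp
  have hw' : w.snd.fst.size + w.snd.snd.size + 1 ≤ w.snd.size + 1 := by
    cases w.snd <;> simp
  unfold next
  cases decide (k.toEncrypt w q = .nil) <;> cases k.toDecrypt w q && !decide (a = .nil) <;>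
    cases isChal q <;> cases q.snd.hasKey w.snd.fst <;> cases decide (w.snd.snd = .nil) <;>
    simp <;> omega

end CoreParams

/-! ### Random bit strings -/

theorem length_of_mem_randomBits {l : ℕ} {r : List Bool} (h : r ∈ (randomBits l).support) :
    r.length = l := by
  induction l generalizing r with
  | zero => simp [randomBits] at h; simp [h]
  | succ l ih =>
    simp only [randomBits, PMF.mem_support_bind_iff, PMF.mem_support_map_iff] at h
    obtain ⟨b, -, r', hr', rfl⟩ := h
    simp [ih hr']

theorem fairCoin_map_xor (b : Bool) : OComp.fairCoin.map (fun a => xor a b) = OComp.fairCoin := by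
  ext c
  rw [PMF.map_apply, tsum_bool]
  cases b <;> cases c <;> simp [OComp.fairCoin, PMF.uniformOfFintype_apply]

/-- A one-time pad is uniformly distributed. -/
theorem randomBits_map_xorBits (m : List Bool) :
    (randomBits m.length).map (fun y => xorBits y m) = randomBits m.length := by
  induction m with
  | nil => simp [randomBits, PMF.pure_map, xorBits]
  | cons b m ih =>
    simp only [List.length_cons, randomBits, PMF.map_bind, PMF.map_comp]
    conv_rhs => rw [← fairCoin_map_xor b, PMF.bind_map]
    congr 1
    funext a
    simp only [Function.comp]
    conv_rhs => rw [← ih, PMF.map_comp]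
    rfl

theorem xorBits_xorBits_cancel {x m : List Bool} (h : x.length = m.length) :
    xorBits x (xorBits x m) = m := by
  induction x generalizing m with
  | nil => cases m <;> simp_all [xorBits]
  | cons a x ih =>
    cases m with
    | nil => simp at h
    | cons b m =>
      have := ih (m := m) (by simpa using h)
      simp only [xorBits] at this
      simp [xorBits, this]

theorem length_xorBits {x m : List Bool} (h : x.length = m.length) :
    (xorBits x m).length = m.length := by
  simp [xorBits, h]

/-! ### Distributions sampled by interactive computations -/

/-- A distribution that can be sampled by finitely many coin tosses. -/
def Sampleable {α : Type} (μ : PMF α) : Prop := ∃ c : OComp α, c.Samples μ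

namespace Sampleable

variable {α β : Type}

theorem pure (a : α) : Sampleable (PMF.pure a) :=
  ⟨.pure a, fun σ step s => by simp [OComp.run, PMF.pure_map]⟩

theorem bind {μ : PMF α} {f : α → PMF β} (h : Sampleable μ) (hf : ∀ a, Sampleable (f a)) :
    Sampleable (μ.bind f) := by
  obtain ⟨c, hc⟩ := h
  choose d hd using hf
  refine ⟨c.bind d, fun σ step s => ?_⟩
  rw [hc.run_bind, PMF.map_bind]
  exact congrArg _ (funext fun a => hd a σ step s)

theorem map {μ : PMF α} (h : Sampleable μ) (f : α → β) : Sampleable (μ.map f) :=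
  h.bind fun a => pure (f a)

theorem coin : Sampleable OComp.fairCoin :=
  ⟨.coin .pure, fun σ step s => by simp [OComp.run]; rfl⟩

theorem randomBits (l : ℕ) : Sampleable (_root_.randomBits l) := by
  induction l with
  | zero => exact pure _
  | succ l ih => exact coin.bind fun b => ih.map _

end Sampleable

theorem PPT.sampleable {α β : Type} [Enc α] [Enc β] {f : α → PMF β} (h : PPT f) (a : α) :
    Sampleable ((f a).map enc) := by
  obtain ⟨p, k, hp⟩ := h
  have h1 : Sampleable ((f a).map fun b => some (enc b)) := ⟨_, hp a⟩
  have := h1.map fun o => o.getD .nil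
  rwa [PMF.map_comp] at this

/-! ### The layer as an environment -/

section Core

variable {σN σM : Type}

/-- The environment of a player formed by the encrypt-then-MAC layer, a nonce stage `N`, which yields
a nonce with the value of the pseudorandom function, and the environment `stepM` with the MAC
oracles. -/
noncomputable def coreStep (k : CoreParams) (N : σN → Data → PMF ((Data × Data) × σN))
    (stepM : σM → Data → PMF (Data × σM)) (s : (Data × σN) × σM) (q : Data) :
    PMF (Data × (Data × σN) × σM) :=
  (N s.1.2 q).bind fun o => (stepM s.2 (k.pre s.1.1 q o.1.1 o.1.2)).map fun a =>
    (k.reply s.1.1 q o.1.1 o.1.2 a.1, (k.next s.1.1 q o.1.1 o.1.2 a.1, o.2), a.2)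

/-- The nonce for a query: that of the ciphertext for a decryption query, otherwise a random one. -/
noncomputable def nonceDist (l : ℕ) (q : Data) : PMF Data :=
  bif CoreParams.isDec q then PMF.pure q.snd.fst.fst else (randomBits l).map enc

/-- The nonce stage that asks for the value of the pseudorandom function. -/
noncomputable def nonceVia {σF : Type} (l : ℕ) (stepF : σF → Data → PMF (Data × σF)) (s : σF)
    (q : Data) : PMF ((Data × Data) × σF) :=
  (nonceDist l q).bind fun r => (stepF s (.cons .nil r)).map fun o => ((r, o.1), o.2)

/-- The nonce stage that knows the pseudorandom function `fv`. -/
noncomputable def nonceTrue (l : ℕ) (fv : Data → Data) (_ : Unit) (q : Data) :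
    PMF ((Data × Data) × Unit) :=
  (nonceDist l q).map fun r => ((r, fv r), ())

theorem sampleable_nonceDist (l : ℕ) (q : Data) : Sampleable (nonceDist l q) := by
  unfold nonceDist
  cases CoreParams.isDec q
  · exact (Sampleable.randomBits l).map _
  · exact Sampleable.pure _

/-- A perfect simulator of the MAC oracles can be replaced by the MAC oracles. -/
theorem map_run_coreStep_simM {α : Type} (k : CoreParams)
    {N : σN → Data → PMF ((Data × Data) × σN)} (hN : ∀ s q, Sampleable (N s q)) {G : Game}
    {sim : Data → Data → PMF (Data × Data)}
    (h : ∀ c : OComp Data, (c.run sim .nil).map Prod.fst = G.view c) (c : OComp α) (w : Data)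
    (sN : σN) :
    (c.run (coreStep k N sim) ((w, sN), .nil)).map (fun o => (o.1, o.2.1)) =
      (G.init.bind fun t => c.run (coreStep k N G.step) ((w, sN), t)).map fun o => (o.1, o.2.1) := by
  choose oc hoc using hN
  let hd : Data × σN → Data → OComp (Data × Data × σN) := fun s q =>
    (oc s.2 q).bind fun o => .query (k.pre s.1 q o.1.1 o.1.2) fun a =>
      .pure (k.reply s.1 q o.1.1 o.1.2 a, k.next s.1 q o.1.1 o.1.2 a, o.2)
  have hstep : ∀ {τ : Type} (step : τ → Data → PMF (Data × τ)),
      OComp.handlerStep hd step = coreStep k N step := by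
    intro τ step
    funext s q
    simp only [OComp.handlerStep, hd, coreStep]
    rw [(hoc s.1.2 q).run_bind, PMF.map_bind]
    congr 1
    funext o
    simp only [OComp.run, PMF.map_bind, PMF.pure_map]
    rfl
  have h1 := OComp.view_ext (s₀ := PMF.pure Data.nil) (t₀ := G.init) (step := sim)
    (step' := G.step) (fun c => by rw [PMF.pure_bind]; exact h c) (OComp.handleWith hd c (w, sN))
  rw [PMF.pure_bind] at h1
  have h2 := fun {τ : Type} (step : τ → Data → PMF (Data × τ)) (t : τ) =>
    congrArg (PMF.map fun o => (o.1, o.2.1)) (OComp.run_handleWith hd step c (w, sN) t)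
  simp only [PMF.map_comp, hstep] at h2
  rw [← h2 sim, PMF.map_bind]
  simp only [← h2 G.step]
  rw [PMF.map_bind] at h1
  exact h1

/-- A perfect simulator of the pseudorandom function game can be replaced by the game. -/
theorem map_run_coreStep_simF {α : Type} (k : CoreParams) (l : ℕ)
    {stepM : σM → Data → PMF (Data × σM)} (hM : ∀ s q, Sampleable (stepM s q)) {G : Game}
    {sim : Data → Data → PMF (Data × Data)}
    (h : ∀ c : OComp Data, (c.run sim .nil).map Prod.fst = G.view c) (c : OComp α) (w : Data)
    (sM : σM) :
    (c.run (coreStep k (nonceVia l sim) stepM) ((w, .nil), sM)).map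
        (fun o => (o.1, o.2.1.1, o.2.2)) =
      (G.init.bind fun t => c.run (coreStep k (nonceVia l G.step) stepM) ((w, t), sM)).map
        fun o => (o.1, o.2.1.1, o.2.2) := by
  choose oc hoc using hM
  choose on hon using sampleable_nonceDist l
  let hd : Data × σM → Data → OComp (Data × Data × σM) := fun s q =>
    (on q).bind fun r => .query (.cons .nil r) fun v => (oc s.2 (k.pre s.1 q r v)).bind fun a =>
      .pure (k.reply s.1 q r v a.1, k.next s.1 q r v a.1, a.2)
  have hstep : ∀ {τ : Type} (step : τ → Data → PMF (Data × τ)) (s : (Data × σM) × τ) (q : Data),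
      OComp.handlerStep hd step s q =
        (coreStep k (nonceVia l step) stepM ((s.1.1, s.2), s.1.2) q).map
          fun o => (o.1, (o.2.1.1, o.2.2), o.2.1.2) := by
    intro τ step s q
    simp only [OComp.handlerStep, hd, coreStep, nonceVia]
    rw [(hon q).run_bind]
    simp only [PMF.map_bind, PMF.bind_bind]
    congr 1
    funext r
    simp only [OComp.run, PMF.map_bind, PMF.bind_map, PMF.map_comp]
    congr 1
    funext v
    rw [(hoc s.1.2 _).run_bind]
    simp only [OComp.run, PMF.map_bind, PMF.pure_map]
    rfl
  have h1 := OComp.view_ext (s₀ := PMF.pure Data.nil) (t₀ := G.init) (step := sim)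
    (step' := G.step) (fun c => by rw [PMF.pure_bind]; exact h c) (OComp.handleWith hd c (w, sM))
  rw [PMF.pure_bind] at h1
  have h2 : ∀ {τ : Type} (step : τ → Data → PMF (Data × τ)) (t : τ),
      ((OComp.handleWith hd c (w, sM)).run step t).map Prod.fst =
      (c.run (coreStep k (nonceVia l step) stepM) ((w, t), sM)).map
        fun o => (o.1, o.2.1.1, o.2.2) := by
    intro τ step t
    have e1 := OComp.run_handleWith hd step c (w, sM) t
    have e2 : (c.run (coreStep k (nonceVia l step) stepM) ((w, t), sM)).map
        (fun o => (o.1, (o.2.1.1, o.2.2), o.2.1.2)) =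
        c.run (OComp.handlerStep hd step) ((w, sM), t) :=
      OComp.run_project (step := coreStep k (nonceVia l step) stepM)
        (step' := OComp.handlerStep hd step) (I := fun _ => True)
        (fun s => ((s.1.1, s.2), s.1.2)) (fun _ _ _ _ _ => trivial)
        (fun s q _ => (hstep step ((s.1.1, s.2), s.1.2) q).symm) c (s := ((w, t), sM)) trivial
    rw [← e2] at e1
    have e3 := congrArg (PMF.map fun o => (o.1, o.2.1)) e1
    rw [PMF.map_comp, PMF.map_comp] at e3
    exact e3
  rw [← h2 sim, PMF.map_bind]
  simp only [← h2 G.step]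
  rw [PMF.map_bind] at h1
  exact h1

end Core

/-! ### The layer over the true games -/

theorem PMF.map_eq_pure {α β : Type} {p : PMF α} {f : α → β} {b : β} (h : ∀ a, f a = b) :
    p.map f = PMF.pure b := by
  rw [funext h]
  exact PMF.map_const p b

theorem okMsg_iff {l : ℕ} {d : Data} :
    okMsg l d = true ↔ ∃ x : List Bool, d = enc x ∧ x.length = l := by
  rw [okMsg, Bool.and_eq_true, decide_eq_true_eq]
  constructor
  · rintro ⟨h1, h2⟩
    refine ⟨d.bits, ?_, h2⟩
    rw [Data.enc_bits, h1]; rfl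
  · rintro ⟨x, rfl, h⟩
    simp [h]

theorem okMsg_nil {l : ℕ} (hl : 1 ≤ l) : okMsg l .nil = false := by
  rw [Bool.eq_false_iff, ne_eq, okMsg_iff]
  rintro ⟨x, hx, h⟩
  cases x with
  | nil => simp at h; omega
  | cons b x => simp at hx

theorem Data.lookup_cons (key e tab : Data) : key.lookup (.cons e tab) =
    if key.lookup tab = .nil then (if e.fst = key then .cons .nil e.snd else .nil)
    else key.lookup tab := by
  have gen : ∀ (l : List Data) (r : Data),
      l.foldl (fun r e => bif decide (e.fst = key) then Data.cons Data.nil e.snd else r) r =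
      if l.foldl (fun r e => bif decide (e.fst = key) then Data.cons Data.nil e.snd else r)
        Data.nil = .nil then r
      else l.foldl (fun r e => bif decide (e.fst = key) then Data.cons Data.nil e.snd else r)
        Data.nil := by
    intro l
    induction l using List.reverseRecOn with
    | nil => intro r; simp
    | append_singleton l e ih =>
      intro r
      simp only [List.foldl_append, List.foldl_cons, List.foldl_nil]
      rw [ih r]
      by_cases h : e.fst = key <;> simp [h]
  rw [lookup, spine, List.foldl_cons, gen]
  by_cases h : e.fst = key <;> simp [h, lookup]

@[simp] theorem Data.lookup_nil (key : Data) : key.lookup .nil = .nil := rfl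

theorem Data.hasKey_iff {key tab : Data} : key.hasKey tab = true ↔ key.lookup tab ≠ .nil := by
  simp [hasKey]

@[simp] theorem xorD_enc (x y : List Bool) : xorD (enc x) (enc y) = enc (xorBits x y) := by
  simp [xorD]

@[simp] theorem appD_enc (x y : List Bool) : appD (enc x) (enc y) = enc (x ++ y) := by
  simp [appD]

/-- The represented value of the pseudorandom function; it is `nil` outside the domain. -/
def WPRF.value (F : WPRF) (n : ℕ) (sk d : Data) : Data :=
  bif okMsg (F.len n) d then enc (F.eval n sk d.bits) else .nil

theorem WPRF.value_enc (F : WPRF) (n : ℕ) (sk : Data) {x : List Bool} (hx : x.length = F.len n) :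
    F.value n sk (enc x) = enc (F.eval n sk x) := by
  have : okMsg (F.len n) (enc x) = true := okMsg_iff.2 ⟨x, rfl, hx⟩
  simp [value, this]

/-- The oracles of the weak pseudorandomness game. -/
noncomputable def WPRF.oracle (F : WPRF) (n : ℕ) (sk : Data) :
    Bool × Option (List Bool) → Data → PMF (Data × (Bool × Option (List Bool))) :=
  (F.game n sk).step

theorem WPRF.oracle_eval (F : WPRF) (n : ℕ) (sk d : Data) (b : Bool) :
    F.oracle n sk (b, none) (.cons .nil d) = PMF.pure (F.value n sk d, (b, none)) := by
  change PMF.pure _ = _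
  congr 2
  by_cases h : okMsg (F.len n) d = true
  · obtain ⟨x, rfl, hx⟩ := okMsg_iff.1 h
    rw [F.value_enc n sk hx]
    simp [Data.toBits_enc, hx]
  · have hv : F.value n sk d = .nil := by
      rw [Bool.not_eq_true] at h
      simp [value, h]
    rw [hv]
    cases hd : d.toBits with
    | none => rfl
    | some x =>
      obtain rfl := Data.toBits_eq_some.1 hd
      have : x.length ≠ F.len n := fun hx => h (okMsg_iff.2 ⟨x, rfl, hx⟩)
      simp [this]

/-- A perfect simulator of the pseudorandom function game makes the layer see the true function. -/
theorem map_run_coreStep_value {α σM : Type} (F : WPRF) (n : ℕ) (sk : Data) (k : CoreParams)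
    (l : ℕ) {stepM : σM → Data → PMF (Data × σM)} (hM : ∀ s q, Sampleable (stepM s q))
    {sim : Data → Data → PMF (Data × Data)}
    (h : ∀ c : OComp Data, (c.run sim .nil).map Prod.fst = (F.game n sk).view c) (c : OComp α)
    (w : Data) (sM : σM) :
    (c.run (coreStep k (nonceVia l sim) stepM) ((w, .nil), sM)).map
        (fun o => (o.1, o.2.1.1, o.2.2)) =
      (c.run (coreStep k (nonceTrue l (F.value n sk)) stepM) ((w, ()), sM)).map
        fun o => (o.1, o.2.1.1, o.2.2) := by
  rw [map_run_coreStep_simF k l hM h]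
  have key : ∀ b : Bool,
      (c.run (coreStep k (nonceVia l (F.oracle n sk)) stepM) ((w, (b, none)), sM)).map
        (fun o => (o.1, o.2.1.1, o.2.2)) =
      (c.run (coreStep k (nonceTrue l (F.value n sk)) stepM) ((w, ()), sM)).map
        fun o => (o.1, o.2.1.1, o.2.2) := by
    intro b
    have hN : ∀ q, nonceVia l (F.oracle n sk) (b, none) q =
        (nonceDist l q).map fun r => ((r, F.value n sk r), (b, none)) := by
      intro q
      simp only [nonceVia, F.oracle_eval, PMF.pure_map]
      rfl
    have := OComp.run_project (step := coreStep k (nonceVia l (F.oracle n sk)) stepM)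
      (step' := coreStep k (nonceTrue l (F.value n sk)) stepM)
      (I := fun s => s.1.2 = (b, none)) (fun s => ((s.1.1, ()), s.2)) ?_ ?_ c
      (s := ((w, (b, none)), sM)) rfl
    · simp only at this
      rw [← this, PMF.map_comp]
      rfl
    · rintro ⟨⟨w, s⟩, t⟩ q hs o ho
      obtain rfl : s = (b, none) := hs
      simp only [coreStep, hN, PMF.bind_map, Function.comp_def, PMF.mem_support_bind_iff,
        PMF.mem_support_map_iff] at ho
      obtain ⟨r, -, a, -, rfl⟩ := ho
      rfl
    · rintro ⟨⟨w, s⟩, t⟩ q hs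
      obtain rfl : s = (b, none) := hs
      simp only [coreStep, hN, nonceTrue, PMF.bind_map, PMF.map_bind, Function.comp_def,
        PMF.map_comp]
  change PMF.map (fun o : α × (Data × Bool × Option (List Bool)) × σM => (o.1, o.2.1.1, o.2.2))
    (PMF.bind (OComp.fairCoin.map fun b => ((b, none) : Bool × Option (List Bool)))
    fun t => c.run (coreStep k (nonceVia l (F.oracle n sk)) stepM) ((w, t), sM)) = _
  rw [PMF.bind_map, PMF.map_bind]
  simp only [Function.comp, key, PMF.bind_const]

section Normal

variable {σN : Type} (k : CoreParams) {w q : Data}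

theorem CoreParams.toEncrypt_cases (w q : Data) : k.toEncrypt w q = .nil ∨
    ∃ x : List Bool, x.length = k.len ∧ k.toEncrypt w q = .cons .nil (enc x) ∧ isDec q = false ∧
      k.frozen w = false ∧ (isChal q = true → w.fst = .nil) := by
  unfold toEncrypt
  cases hf : k.frozen w
  · cases h1 : decide (q.fst = .nil) && okMsg k.len q.snd
    · cases h2 : isChal q && decide (w.fst = .nil) && okMsg k.len q.snd.fst &&
        okMsg k.len q.snd.snd
      · left; rfl
      · right
        simp only [Bool.and_eq_true, decide_eq_true_eq] at h2
        obtain ⟨⟨⟨h3, h4⟩, h5⟩, h6⟩ := h2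
        obtain ⟨x, hx, hxl⟩ := okMsg_iff.1 h5
        obtain ⟨y, hy, hyl⟩ := okMsg_iff.1 h6
        have hd : isDec q = false := by
          simp only [isChal, decide_eq_true_eq] at h3
          simp [isDec, h3]
        cases k.bit
        · exact ⟨x, hxl, by simp [hx], hd, rfl, fun _ => h4⟩
        · exact ⟨y, hyl, by simp [hy], hd, rfl, fun _ => h4⟩
    · right
      simp only [Bool.and_eq_true, decide_eq_true_eq] at h1
      obtain ⟨x, hx, hxl⟩ := okMsg_iff.1 h1.2
      refine ⟨x, hxl, by simp [hx], by simp [isDec, h1.1], rfl, ?_⟩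
      simp [isChal, h1.1]
  · left; rfl

theorem CoreParams.toDecrypt_cases (hl : 1 ≤ k.len) (h : k.toDecrypt w q = true) :
    ∃ (r c : List Bool) (σ : Data), r.length = k.len ∧ c.length = k.len ∧
      q = .cons (.cons .nil .nil) (.cons (.cons (enc r) (enc c)) σ) ∧
      w.fst ≠ .cons .nil q.snd ∧ k.frozen w = false := by
  simp only [toDecrypt, Bool.and_eq_true, Bool.not_eq_true', decide_eq_false_iff_not, isDec,
    decide_eq_true_eq] at h
  obtain ⟨⟨⟨⟨h1, h2⟩, h3⟩, h4⟩, h5⟩ := h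
  obtain ⟨r, hr, hrl⟩ := okMsg_iff.1 h4
  obtain ⟨c, hc, hcl⟩ := okMsg_iff.1 h5
  refine ⟨r, c, q.snd.snd, hrl, hcl, ?_, h3, h1⟩
  have hne : ∀ x : List Bool, x.length = k.len → (enc x : Data) ≠ .nil := by
    intro x hx h
    cases x with
    | nil => simp at hx; omega
    | cons b x => simp at h
  cases q with
  | nil => simp at h2
  | cons t d =>
    cases d with
    | nil => exact absurd hr.symm (hne r hrl)
    | cons e σ =>
      cases e with
      | nil => exact absurd hr.symm (hne r hrl)
      | cons dr dc =>
        simp only [Data.fst_cons, Data.snd_cons] at h2 hr hc ⊢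
        rw [h2, hr, hc]

theorem CoreParams.toEncrypt_of_isDec (h : isDec q = true) : k.toEncrypt w q = .nil := by
  rcases k.toEncrypt_cases w q with h' | ⟨x, -, -, h', -⟩
  · exact h'
  · rw [h] at h'; cases h'

theorem CoreParams.toEncrypt_of_toDecrypt (h : k.toDecrypt w q = true) :
    k.toEncrypt w q = .nil := by
  refine k.toEncrypt_of_isDec ?_
  simp only [toDecrypt, Bool.and_eq_true] at h
  exact h.1.1.1.2

variable (M : WMAC) (n : ℕ) (skM : Data) (N : σN → Data → PMF ((Data × Data) × σN)) (sN : σN)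
  (s : List (List Bool × Data))

/-- The oracles of the MAC game. -/
noncomputable def WMAC.oracle :
    List (List Bool × Data) → Data → PMF (Data × List (List Bool × Data)) :=
  (M.game n skM).step

theorem WMAC.oracle_nil : M.oracle n skM s .nil = PMF.pure (.nil, s) := rfl

theorem WMAC.oracle_sign {m : List Bool} (hm : m ∈ M.Msgs n) :
    M.oracle n skM s (.cons .nil (enc m)) =
      (M.sign n skM m).map fun σ => (.cons .nil σ, (m, σ) :: s) := by
  simp only [WMAC.oracle, WMAC.game, Data.toBits_enc, if_pos hm]
  rfl

theorem WMAC.oracle_verify (m : List Bool) (σ : Data) :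
    M.oracle n skM s (.cons (.bit true) (.cons (enc m) σ)) =
      PMF.pure (.bit (M.verify n skM m σ), s) := by
  simp only [WMAC.oracle, WMAC.game, Data.bit, Data.toBits_enc]

theorem coreStep_of_idle {σM : Type} {stepM : σM → Data → PMF (Data × σM)} {sM : σM}
    (h1 : k.toEncrypt w q = .nil) (h2 : k.toDecrypt w q = false) :
    coreStep k N stepM ((w, sN), sM) q =
      (N sN q).bind fun o => (stepM sM .nil).map fun a => (.nil, (w, o.2), a.2) := by
  simp [coreStep, CoreParams.pre, CoreParams.reply, CoreParams.next, h1, h2]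

theorem coreStep_of_idle_game (h1 : k.toEncrypt w q = .nil) (h2 : k.toDecrypt w q = false) :
    coreStep k N (M.oracle n skM) ((w, sN), s) q =
      (N sN q).map fun o => (.nil, (w, o.2), s) := by
  rw [coreStep_of_idle k N sN h1 h2, WMAC.oracle_nil]
  simp only [PMF.pure_map]
  rfl

theorem coreStep_of_toDecrypt {r c : List Bool} {σ : Data}
    (h : k.toDecrypt w (.cons (.cons .nil .nil) (.cons (.cons (enc r) (enc c)) σ)) = true) :
    coreStep k N (M.oracle n skM) ((w, sN), s)
        (.cons (.cons .nil .nil) (.cons (.cons (enc r) (enc c)) σ)) =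
      (N sN (.cons (.cons .nil .nil) (.cons (.cons (enc r) (enc c)) σ))).map fun o =>
        (k.reply w (.cons (.cons .nil .nil) (.cons (.cons (enc r) (enc c)) σ)) o.1.1 o.1.2
          (.bit (M.verify n skM (r ++ c) σ)),
        (k.next w (.cons (.cons .nil .nil) (.cons (.cons (enc r) (enc c)) σ)) o.1.1 o.1.2
          (.bit (M.verify n skM (r ++ c) σ)), o.2), s) := by
  have hp : ∀ r' v', k.pre w (.cons (.cons .nil .nil) (.cons (.cons (enc r) (enc c)) σ)) r' v' =
      .cons (.bit true) (.cons (enc (r ++ c)) σ) := by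
    intro r' v'
    simp [CoreParams.pre, h, k.toEncrypt_of_toDecrypt h, CoreParams.decMsg]
  simp only [coreStep, hp, WMAC.oracle_verify, PMF.pure_map]
  rfl

theorem coreStep_of_toEncrypt (hMsgs : ∀ m : List Bool, m.length = 2 * k.len → m ∈ M.Msgs n)
    {f : List Bool → List Bool} {fv : Data → Data}
    (hf : ∀ r, r.length = k.len → fv (enc r) = enc (f r))
    (hf' : ∀ r, r.length = k.len → (f r).length = k.len)
    {x : List Bool} (hx : x.length = k.len) (h : k.toEncrypt w q = .cons .nil (enc x))
    (hd : CoreParams.isDec q = false) (u : Unit) :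
    coreStep k (nonceTrue k.len fv) (M.oracle n skM) ((w, u), s) q =
      (randomBits k.len).bind fun r => (M.sign n skM (r ++ xorBits (f r) x)).map fun σ =>
        (.cons .nil (enc ((r, xorBits (f r) x), σ)),
          (k.next w q (enc r) (enc (f r)) (.cons .nil σ), ()),
          (r ++ xorBits (f r) x, σ) :: s) := by
  simp only [coreStep, nonceTrue, nonceDist, hd, cond_false, PMF.bind_map, PMF.map_comp]
  refine PMF.bind_congr_support fun r hr => ?_
  have hr' := length_of_mem_randomBits hr
  have hp : k.pre w q (enc r) (enc (f r)) = .cons .nil (enc (r ++ xorBits (f r) x)) := by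
    simp [CoreParams.pre, h]
  simp only [Function.comp, hf r hr', hp]
  rw [WMAC.oracle_sign, PMF.map_comp]
  · congr 1
    funext σ
    simp [CoreParams.reply, CoreParams.ctxt, h]
  · refine hMsgs _ ?_
    rw [List.length_append, length_xorBits ((hf' r hr').trans hx.symm), hr', hx]; omega

end Normal

/-! ### The layer in the real mode is the CCA2 game -/

/-- All messages of an association list are the decryptions of their keys. -/
def TableSound (fv : Data → Data) (tab : Data) : Prop :=
  ∀ ct : Data, ct.lookup tab = .nil ∨ ct.lookup tab = .cons .nil (xorD (fv ct.fst.fst) ct.fst.snd)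

theorem TableSound.cons {fv : Data → Data} {tab ct m : Data} (h : TableSound fv tab)
    (hm : m = xorD (fv ct.fst.fst) ct.fst.snd) : TableSound fv (.cons (.cons ct m) tab) := by
  intro ct'
  rw [Data.lookup_cons]
  split_ifs with h1 h2
  · right; simp only [Data.fst_cons] at h2; subst h2; rw [← hm]; rfl
  · left; rfl
  · exact h ct'

/-- The initial state of the layer. -/
def coreInit : Data := .cons .nil (.cons .nil .nil)

/-- The challenge ciphertext recorded in a state of the layer. -/
def challengeOf (w : Data) : Option Data := if w.fst = .nil then none else some w.fst.snd

/-- The oracles of the CCA2 game. -/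
noncomputable def WSKE.oracle (S : WSKE) (n : ℕ) (sk : Data) :
    Bool × Option Data → Data → PMF (Data × (Bool × Option Data)) :=
  (S.game n sk).step

section Real

variable (F : WPRF) (M : WMAC) (n : ℕ) (skF skM : Data) (R₁ R₂ : ℕ → (xk C : Data) → Data)

theorem encryptThenMAC_decrypt {r c : List Bool} (hr : r.length = F.len n) (hc : c.length = F.len n)
    (σ : Data) : (encryptThenMAC F M R₁ R₂).decrypt n (.cons skF skM)
      (.cons (.cons (enc r) (enc c)) σ) =
      if M.verify n skM (r ++ c) σ = true then some (xorBits (F.eval n skF r) c) else none := by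
  simp only [encryptThenMAC, Data.toBits_enc, hr, hc, true_and]
  rfl

theorem encryptThenMAC_decrypt_eq_none {d : Data}
    (h : (okMsg (F.len n) d.fst.fst && okMsg (F.len n) d.fst.snd) = false) :
    (encryptThenMAC F M R₁ R₂).decrypt n (.cons skF skM) d = none := by
  rcases d with _ | ⟨_ | ⟨dr, dc⟩, σ⟩
  · rfl
  · rfl
  simp only [encryptThenMAC]
  split
  · rename_i r c hr hc
    obtain rfl := Data.toBits_eq_some.1 hr
    obtain rfl := Data.toBits_eq_some.1 hc
    refine if_neg fun h' => ?_
    have h1 : okMsg (F.len n) (enc r) = true := okMsg_iff.2 ⟨r, rfl, h'.1⟩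
    have h2 : okMsg (F.len n) (enc c) = true := okMsg_iff.2 ⟨c, rfl, h'.2.1⟩
    simp [h1, h2] at h
  · rfl

theorem run_coreStep_real {α : Type} (hlen : 1 ≤ F.len n)
    (hMsgs : ∀ m : List Bool, m.length = 2 * F.len n → m ∈ M.Msgs n) (b : Bool) (c : OComp α) :
    (c.run (coreStep ⟨false, b, F.len n⟩ (nonceTrue (F.len n) (F.value n skF))
      (M.oracle n skM)) ((coreInit, ()), [])).map (fun o => (o.1, (b, challengeOf o.2.1.1))) =
    c.run ((encryptThenMAC F M R₁ R₂).oracle n (.cons skF skM)) (b, none) := by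
  set k : CoreParams := ⟨false, b, F.len n⟩ with hk
  have hfro : ∀ w, k.frozen w = false := fun w => rfl
  have hideal : k.ideal = false := rfl
  have hbit : k.bit = b := rfl
  have hlen' : k.len = F.len n := rfl
  let I : (Data × Unit) × List (List Bool × Data) → Prop := fun s =>
    (s.1.1.fst = .nil ∨ ∃ ct, s.1.1.fst = .cons .nil ct) ∧ TableSound (F.value n skF) s.1.1.snd.fst
  let S := encryptThenMAC F M R₁ R₂
  have hfl : ∀ r : List Bool, r.length = k.len → (F.eval n skF r).length = k.len :=
    fun r hr => F.length_eval n skF r hr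
  have hval : ∀ r : List Bool, r.length = k.len → F.value n skF (enc r) = enc (F.eval n skF r) :=
    fun r hr => F.value_enc n skF hr
  have hI : ∀ s q, I s → ∀ o ∈ (coreStep k (nonceTrue k.len (F.value n skF)) (M.oracle n skM) s
      q).support, I o.2 := by
    rintro ⟨⟨w, u⟩, s⟩ q ⟨h1, h2⟩ o ho
    rcases k.toEncrypt_cases w q with he | ⟨x, hx, he, hd, -, hch⟩
    · cases hdec : k.toDecrypt w q
      · rw [coreStep_of_idle_game k M n skM _ _ _ he hdec] at ho
        obtain ⟨o', -, rfl⟩ := (PMF.mem_support_map_iff _ _ _).1 ho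
        exact ⟨h1, h2⟩
      · obtain ⟨r, c, σ, hr, hc, rfl, hne, -⟩ := k.toDecrypt_cases hlen hdec
        rw [coreStep_of_toDecrypt k M n skM _ _ _ hdec] at ho
        obtain ⟨o', -, rfl⟩ := (PMF.mem_support_map_iff _ _ _).1 ho
        simp only [I, CoreParams.next, he, hdec]
        generalize (Data.bit (M.verify n skM (r ++ c) σ)) = a
        by_cases ha : a = .nil
        · simpa [ha] using ⟨h1, h2⟩
        · cases Data.hasKey _ w.snd.fst <;> simpa [ha] using ⟨h1, h2⟩
    · rw [coreStep_of_toEncrypt k M n skM s hMsgs hval hfl hx he hd] at ho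
      simp only [PMF.mem_support_bind_iff, PMF.mem_support_map_iff] at ho
      obtain ⟨r, hr, σ, -, rfl⟩ := ho
      have hr' := length_of_mem_randomBits hr
      simp only [I, CoreParams.next, he, CoreParams.ctxt]
      cases hq : CoreParams.isChal q
      · refine ⟨by simpa using h1, ?_⟩
        simp only [decide_false, Bool.not_false, cond_true, cond_false, Data.fst_cons,
          Data.snd_cons, reduceCtorEq]
        refine h2.cons ?_
        simp only [Data.fst_cons, Data.snd_cons]
        rw [hval r hr', xorD_enc, xorD_enc, xorBits_xorBits_cancel ((hfl r hr').trans hx.symm)]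
      · simpa using h2
  have hproj : ∀ s q, I s → (coreStep k (nonceTrue k.len (F.value n skF)) (M.oracle n skM) s
      q).map (fun o => (o.1, (b, challengeOf o.2.1.1))) =
      S.oracle n (.cons skF skM) (b, challengeOf s.1.1) q := by
    rintro ⟨⟨w, u⟩, s⟩ q ⟨h1, h2⟩
    -- the outcome when the query is refused
    have idle : k.toEncrypt w q = .nil → k.toDecrypt w q = false →
        (coreStep k (nonceTrue k.len (F.value n skF)) (M.oracle n skM) ((w, u), s)
          q).map (fun o => (o.1, (b, challengeOf o.2.1.1))) =
        PMF.pure (.nil, (b, challengeOf w)) := by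
      intro he hdec
      rw [coreStep_of_idle_game k M n skM _ _ _ he hdec, PMF.map_comp]
      exact PMF.map_eq_pure fun _ => rfl
    -- the outcome when a message is encrypted
    have encr : ∀ x : List Bool, x.length = k.len → k.toEncrypt w q = .cons .nil (enc x) →
        CoreParams.isDec q = false →
        (coreStep k (nonceTrue k.len (F.value n skF)) (M.oracle n skM) ((w, u), s)
          q).map (fun o => (o.1, (b, challengeOf o.2.1.1))) =
        (S.encrypt n (.cons skF skM) x).map fun ct => (enc (some ct),
          (b, if CoreParams.isChal q = true then some ct else challengeOf w)) := by
      intro x hx he hd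
      rw [coreStep_of_toEncrypt k M n skM s hMsgs hval hfl hx he hd]
      simp only [S, encryptThenMAC, PMF.map_bind, PMF.map_comp]
      congr 1
      funext r
      congr 1
      funext σ
      simp only [Function.comp, CoreParams.next, he, CoreParams.ctxt]
      cases hq : CoreParams.isChal q <;> simp [challengeOf]
    rcases q with _ | ⟨_ | ⟨t1, t2⟩, d⟩
    · rw [idle (by simp [CoreParams.toEncrypt, CoreParams.isChal, okMsg_nil hlen, hlen'])
        (by simp [CoreParams.toDecrypt, CoreParams.isDec])]
      rfl
    · have hdec : k.toDecrypt w (.cons .nil d) = false := by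
        simp [CoreParams.toDecrypt, CoreParams.isDec]
      by_cases hd : okMsg k.len d = true
      · obtain ⟨x, rfl, hx⟩ := okMsg_iff.1 hd
        rw [encr x hx (by simp [CoreParams.toEncrypt, hfro, hd]) (by simp [CoreParams.isDec])]
        have hx' : x.length = S.len n := hx
        simp [WSKE.oracle, WSKE.game, Data.toBits_enc, hx', CoreParams.isChal]
      · rw [idle (by simp [CoreParams.toEncrypt, CoreParams.isChal, hd]) hdec]
        cases hb : d.toBits with
        | none => simp [WSKE.oracle, WSKE.game, hb]
        | some x =>
          obtain rfl := Data.toBits_eq_some.1 hb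
          have hx' : x.length ≠ S.len n := fun hx => hd (okMsg_iff.2 ⟨x, rfl, hx⟩)
          simp [WSKE.oracle, WSKE.game, hb, hx']
    · by_cases ht : t1 = .nil
      swap
      · rw [idle (by cases t1 <;> simp_all [CoreParams.toEncrypt, CoreParams.isChal])
          (by cases t1 <;> simp_all [CoreParams.toDecrypt, CoreParams.isDec])]
        cases t1 with
        | nil => exact absurd rfl ht
        | cons _ _ => rfl
      subst ht
      by_cases ht : t2 = .nil
      · subst ht
        have hoD : S.oracle n (.cons skF skM) (b, challengeOf w) (.cons (.cons .nil .nil) d) =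
            PMF.pure (if challengeOf w = some d then .nil else
              enc (S.decrypt n (.cons skF skM) d), (b, challengeOf w)) := rfl
        rw [hoD]
        have he : k.toEncrypt w (.cons (.cons .nil .nil) d) = .nil :=
          k.toEncrypt_of_isDec (by simp [CoreParams.isDec])
        cases hdec : k.toDecrypt w (.cons (.cons .nil .nil) d)
        · rw [idle he hdec]
          congr 2
          split_ifs with hch
          · rfl
          · rw [encryptThenMAC_decrypt_eq_none]
            · rfl
            · have hne : w.fst ≠ .cons .nil d := fun h => hch (by simp [challengeOf, h])
              simpa [CoreParams.toDecrypt, hfro, CoreParams.isDec, hne] using hdec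
        · obtain ⟨r, c, σ, hr, hc, hd, hne, -⟩ := k.toDecrypt_cases hlen hdec
          obtain rfl := (Data.cons.inj hd).2
          rw [coreStep_of_toDecrypt k M n skM _ _ _ hdec,
            encryptThenMAC_decrypt F M n skF skM R₁ R₂ hr hc]
          have hch : challengeOf w ≠ some (.cons (.cons (enc r) (enc c)) σ) := by
            unfold challengeOf
            rcases h1 with h1 | ⟨ct, h1⟩
            · simp [h1]
            · rw [h1] at hne
              simpa [h1] using hne
          rw [if_neg hch]
          simp only [nonceTrue, nonceDist, CoreParams.isDec, Data.fst_cons, decide_true, cond_true,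
            PMF.pure_map, Data.snd_cons]
          cases hv : M.verify n skM (r ++ c) σ
          · simp [CoreParams.reply, CoreParams.next, he, hdec, Data.bit]
          · rw [hval r hr]
            have hw : challengeOf (k.next w (.cons (.cons .nil .nil)
                (.cons (.cons (enc r) (enc c)) σ)) (enc r) (enc (F.eval n skF r)) (.bit true)) =
                challengeOf w := by
              simp only [CoreParams.next, he, hdec, Data.bit]
              cases Data.hasKey _ w.snd.fst <;> simp [challengeOf]
            rw [hw]
            have htab := h2 (.cons (.cons (enc r) (enc c)) σ)
            simp only [Data.fst_cons, Data.snd_cons, hval r hr, xorD_enc] at htab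
            cases hk' : Data.hasKey (.cons (.cons (enc r) (enc c)) σ) w.snd.fst
            · simp [CoreParams.reply, he, hdec, Data.bit, hk', hideal]
            · rcases htab with htab | htab
              · rw [Data.hasKey_iff] at hk'
                exact absurd htab hk'
              · simp [CoreParams.reply, he, hdec, Data.bit, hk', htab]
      by_cases ht' : t2 = .cons .nil .nil
      · subst ht'
        have hdec : k.toDecrypt w (.cons (.cons .nil (.cons .nil .nil)) d) = false := by
          simp [CoreParams.toDecrypt, CoreParams.isDec]
        rcases d with _ | ⟨d0, d1⟩
        · rw [idle (by simp [CoreParams.toEncrypt, CoreParams.isChal, okMsg_nil hlen, hlen']) hdec]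
          rfl
        by_cases hd : w.fst = .nil ∧ okMsg k.len d0 = true ∧ okMsg k.len d1 = true
        · obtain ⟨hw, hd0, hd1⟩ := hd
          obtain ⟨x0, rfl, hx0⟩ := okMsg_iff.1 hd0
          obtain ⟨x1, rfl, hx1⟩ := okMsg_iff.1 hd1
          rw [encr (bif b then x1 else x0) (by cases b; exacts [hx0, hx1]) (by
            cases b <;> simp [CoreParams.toEncrypt, hfro, CoreParams.isChal, hw, hd0, hd1, hbit])
            (by simp [CoreParams.isDec])]
          have hx0' : x0.length = S.len n := hx0
          have hx1' : x1.length = S.len n := hx1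
          have hw' : challengeOf w = none := if_pos hw
          simp [WSKE.oracle, WSKE.game, Data.toBits_enc, hx0', hx1', CoreParams.isChal, hw']
        · rw [idle ?_ hdec]
          · symm
            simp only [WSKE.oracle, WSKE.game]
            split
            · rename_i x0 x1 e1 e2 e3
              obtain rfl := Data.toBits_eq_some.1 e2
              obtain rfl := Data.toBits_eq_some.1 e3
              rw [if_neg]
              rintro ⟨g1, g2⟩
              refine hd ⟨?_, okMsg_iff.2 ⟨x0, rfl, g1⟩, okMsg_iff.2 ⟨x1, rfl, g2⟩⟩
              simpa [challengeOf] using e1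
            · rfl
          · rw [not_and, not_and] at hd
            by_cases hw : w.fst = .nil
            · cases hd0 : okMsg k.len d0
              · simp [CoreParams.toEncrypt, hd0]
              · have := hd hw hd0
                simp [CoreParams.toEncrypt, this]
            · simp [CoreParams.toEncrypt, hw]
      · rw [idle (by simp [CoreParams.toEncrypt, CoreParams.isChal, ht'])
          (by simp [CoreParams.toDecrypt, CoreParams.isDec, ht])]
        rcases t2 with _ | ⟨_ | _, _ | _⟩
        · exact absurd rfl ht
        · exact absurd rfl ht'
        all_goals rfl
  exact OComp.run_project (fun s => (b, challengeOf s.1.1)) hI hproj c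
    (s := ((coreInit, ()), [])) ⟨Or.inl rfl, fun ct => Or.inl rfl⟩

end Real

/-! ### Forgeries, and the layer in the ideal mode -/

section Ideal

variable {F : WPRF} {M : WMAC} {n : ℕ} (skM : Data) (k : CoreParams) {fv : Data → Data}
  {f : List Bool → List Bool}

/-- Every recorded tag belongs to a recorded ciphertext, and a recorded forgery is one. -/
def ForgerySound (M : WMAC) (n : ℕ) (skM : Data) (l : ℕ) (w : Data) (s : List (List Bool × Data)) :
    Prop :=
  (∀ p ∈ s, ∃ r c : List Bool, r.length = l ∧ p.1 = r ++ c ∧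
    (w.fst = .cons .nil (enc ((r, c), p.2)) ∨
      Data.lookup (enc ((r, c), p.2)) w.snd.fst ≠ .nil)) ∧
  (w.snd.snd = .nil ∨ ∃ m ∈ M.Msgs n, ∃ σ : Data, w.snd.snd = enc (m, σ) ∧
    M.verify n skM m σ = true ∧ (m, σ) ∉ s)

theorem Data.lookup_cons_ne_nil {key e tab : Data} (h : key.lookup tab ≠ .nil ∨ e.fst = key) :
    key.lookup (.cons e tab) ≠ .nil := by
  rw [Data.lookup_cons]
  split_ifs with h1 h2
  · simp
  · rcases h with h | h
    · exact absurd h1 h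
    · exact absurd h h2
  · exact h1

variable {skM k}

theorem ForgerySound.step (hl : 1 ≤ k.len)
    (hMsgs : ∀ m : List Bool, m.length = 2 * k.len → m ∈ M.Msgs n)
    (hf : ∀ r, r.length = k.len → fv (enc r) = enc (f r))
    (hf' : ∀ r, r.length = k.len → (f r).length = k.len) (hk : k.ideal = true)
    {s : (Data × Unit) × List (List Bool × Data)} (h : ForgerySound M n skM k.len s.1.1 s.2)
    {q : Data} {o : Data × (Data × Unit) × List (List Bool × Data)}
    (ho : o ∈ (coreStep k (nonceTrue k.len fv) (M.oracle n skM) s q).support) :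
    ForgerySound M n skM k.len o.2.1.1 o.2.2 := by
  obtain ⟨⟨w, u⟩, s⟩ := s
  obtain ⟨h1, h2⟩ := h
  rcases k.toEncrypt_cases w q with he | ⟨x, hx, he, hd, hfr, hch⟩
  · cases hdec : k.toDecrypt w q
    · rw [coreStep_of_idle_game k M n skM _ _ _ he hdec] at ho
      obtain ⟨o', -, rfl⟩ := (PMF.mem_support_map_iff _ _ _).1 ho
      exact ⟨h1, h2⟩
    · obtain ⟨r, c, σ, hr, hc, rfl, hne, hfr⟩ := k.toDecrypt_cases hl hdec
      rw [coreStep_of_toDecrypt k M n skM _ _ _ hdec] at ho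
      obtain ⟨o', -, rfl⟩ := (PMF.mem_support_map_iff _ _ _).1 ho
      have hbad : w.snd.snd = .nil := by simpa [CoreParams.frozen, hk] using hfr
      cases hv : M.verify n skM (r ++ c) σ
      · simpa [CoreParams.next, he, hdec, Data.bit] using ⟨h1, h2⟩
      · cases hkey : Data.hasKey (.cons (.cons (enc r) (enc c)) σ) w.snd.fst
        · simp only [CoreParams.next, he, hdec, Data.bit, Data.snd_cons, hkey, hbad]
          refine ⟨by simpa using h1, Or.inr ⟨r ++ c, hMsgs _ (by simp [hr, hc]; omega), σ, ?_, hv, ?_⟩⟩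
          · simp [CoreParams.decMsg]
          · intro hmem
            obtain ⟨r', c', hr', hrc, hor⟩ := h1 _ hmem
            obtain ⟨rfl, rfl⟩ := List.append_inj hrc (hr.trans hr'.symm)
            rcases hor with hor | hor
            · exact hne (by simpa using hor)
            · have hk0 : Data.hasKey (.cons (.cons (enc r) (enc c)) σ) w.snd.fst = true :=
                Data.hasKey_iff.2 hor
              rw [hkey] at hk0; cases hk0
        · simpa [CoreParams.next, he, hdec, Data.bit, hkey] using ⟨h1, h2⟩
  · rw [coreStep_of_toEncrypt k M n skM s hMsgs hf hf' hx he hd] at ho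
    simp only [PMF.mem_support_bind_iff, PMF.mem_support_map_iff] at ho
    obtain ⟨r, hr, σ, -, rfl⟩ := ho
    have hr' := length_of_mem_randomBits hr
    have hbad : w.snd.snd = .nil := by simpa [CoreParams.frozen, hk] using hfr
    have hct : k.ctxt w q (enc r) (enc (f r)) (.cons .nil σ) =
        enc ((r, xorBits (f r) x), σ) := by simp [CoreParams.ctxt, he]
    simp only [CoreParams.next, he, hct]
    cases hq : CoreParams.isChal q
    · refine ⟨?_, Or.inl (by simpa using hbad)⟩
      intro p hp
      simp only [decide_false, Bool.not_false, cond_true, cond_false, Data.fst_cons,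
        Data.snd_cons, reduceCtorEq]
      rcases List.mem_cons.1 hp with rfl | hp
      · exact ⟨r, _, hr', rfl, Or.inr (Data.lookup_cons_ne_nil (Or.inr rfl))⟩
      · obtain ⟨r1, c1, hl1, hp1, hor⟩ := h1 p hp
        exact ⟨r1, c1, hl1, hp1, hor.imp_right fun h => Data.lookup_cons_ne_nil (Or.inl h)⟩
    · refine ⟨?_, Or.inl (by simpa using hbad)⟩
      intro p hp
      simp only [decide_false, Bool.not_false, cond_true, Data.fst_cons,
        Data.snd_cons, reduceCtorEq]
      rcases List.mem_cons.1 hp with rfl | hp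
      · exact ⟨r, _, hr', rfl, Or.inl rfl⟩
      · obtain ⟨r1, c1, hl1, hp1, hor⟩ := h1 p hp
        refine ⟨r1, c1, hl1, hp1, Or.inr ?_⟩
        rcases hor with hor | hor
        · rw [hch hq] at hor; cases hor
        · exact hor

/-- Whether a forgery has been recorded. -/
def HasForgery (w : Data) : Prop := w.snd.snd ≠ .nil

theorem HasForgery.next {w : Data} (h : HasForgery w) (q r v a : Data) :
    HasForgery (k.next w q r v a) := by
  unfold CoreParams.next HasForgery at *
  cases decide (k.toEncrypt w q = .nil) <;> cases k.toDecrypt w q && !decide (a = .nil) <;>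
    cases CoreParams.isChal q <;> cases q.snd.hasKey w.snd.fst <;> simp [h]

theorem HasForgery.coreStep {σN σM : Type} {N : σN → Data → PMF ((Data × Data) × σN)}
    {stepM : σM → Data → PMF (Data × σM)} {s : (Data × σN) × σM} (h : HasForgery s.1.1) {q : Data}
    {o : Data × (Data × σN) × σM} (ho : o ∈ (coreStep k N stepM s q).support) :
    HasForgery o.2.1.1 := by
  simp only [_root_.coreStep, PMF.mem_support_bind_iff, PMF.mem_support_map_iff] at ho
  obtain ⟨a, -, b, -, rfl⟩ := ho
  exact h.next q _ _ _

/-- The real and the ideal mode agree until a forgery is recorded. -/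
theorem coreStep_real_eq_ideal (hl : 1 ≤ k.len)
    (hMsgs : ∀ m : List Bool, m.length = 2 * k.len → m ∈ M.Msgs n)
    (hf : ∀ r, r.length = k.len → fv (enc r) = enc (f r))
    (hf' : ∀ r, r.length = k.len → (f r).length = k.len)
    {s : (Data × Unit) × List (List Bool × Data)} (hs : ¬ HasForgery s.1.1) (q : Data)
    (i j : Bool) :
    coreStep { k with ideal := i } (nonceTrue k.len fv) (M.oracle n skM) s q =
      coreStep { k with ideal := j } (nonceTrue k.len fv) (M.oracle n skM) s q ∨
    ∀ o ∈ (coreStep { k with ideal := i } (nonceTrue k.len fv) (M.oracle n skM) s q).support,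
      HasForgery o.2.1.1 := by
  obtain ⟨⟨w, u⟩, s⟩ := s
  have hbad : w.snd.snd = .nil := not_not.1 hs
  have hfr : ∀ i : Bool, CoreParams.frozen { k with ideal := i } w = false := by
    intro i; simp [CoreParams.frozen, hbad]
  have hte : CoreParams.toEncrypt { k with ideal := j } w q =
      CoreParams.toEncrypt { k with ideal := i } w q := by
    simp [CoreParams.toEncrypt, hfr]
  have htd : CoreParams.toDecrypt { k with ideal := j } w q =
      CoreParams.toDecrypt { k with ideal := i } w q := by
    simp [CoreParams.toDecrypt, hfr]
  rcases CoreParams.toEncrypt_cases { k with ideal := i } w q with he | ⟨x, hx, he, hd, -, hch⟩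
  · have he' := hte.trans he
    cases hdec : CoreParams.toDecrypt { k with ideal := i } w q
    · left
      rw [coreStep_of_idle_game _ M n skM _ _ _ he hdec,
        coreStep_of_idle_game _ M n skM _ _ _ he' (htd.trans hdec)]
    · have hdec' := htd.trans hdec
      obtain ⟨r, c, σ, hr, hc, rfl, hne, -⟩ := CoreParams.toDecrypt_cases { k with ideal := i } hl hdec
      rw [coreStep_of_toDecrypt _ M n skM _ _ _ hdec, coreStep_of_toDecrypt _ M n skM _ _ _ hdec']
      cases hv : M.verify n skM (r ++ c) σ
      · left
        simp [CoreParams.reply, CoreParams.next, he, he', hdec, hdec', Data.bit]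
      · cases hkey : Data.hasKey (.cons (.cons (enc r) (enc c)) σ) w.snd.fst
        · right
          intro o ho
          obtain ⟨o', -, rfl⟩ := (PMF.mem_support_map_iff _ _ _).1 ho
          simp [CoreParams.next, he, hdec, Data.bit, hkey, HasForgery, hbad]
        · left
          simp [CoreParams.reply, CoreParams.next, he, he', hdec, hdec', Data.bit, hkey]
  · left
    have he' := hte.trans he
    rw [coreStep_of_toEncrypt { k with ideal := i } M n skM s hMsgs hf hf' hx he hd,
      coreStep_of_toEncrypt { k with ideal := j } M n skM s hMsgs hf hf' hx he' hd]
    simp [CoreParams.next, CoreParams.ctxt, he, he']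

end Ideal

/-! ### Lazy sampling -/

namespace OComp

variable {α σ ζ : Type}

/-- The number of queries on every path is at most `t`. -/
def QueryBound : ℕ → OComp α → Prop
  | _, .pure _ => True
  | t, .coin k => ∀ b, QueryBound t (k b)
  | t, .query _ k => 1 ≤ t ∧ ∀ a, QueryBound (t - 1) (k a)

theorem QueryBound.mono {c : OComp α} {t u : ℕ} (h : QueryBound t c) (htu : t ≤ u) :
    QueryBound u c := by
  induction c generalizing t u with
  | pure a => trivial
  | coin k ih => exact fun b => ih b (h b) htu
  | query q k ih => exact ⟨h.1.trans htu, fun a => ih a (h.2 a) (by omega)⟩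

/-- A hidden value that the environment uses in one step only, which raises the flag `used`, may be
sampled in this step. -/
theorem run_sample_late (μ : PMF ζ) (step : ζ → σ → Data → PMF (Data × σ)) {used : σ → Prop}
    (h1 : ∀ s q, (∀ z z', step z s q = step z' s q) ∨ ∀ z, ∀ o ∈ (step z s q).support, used o.2)
    (h2 : ∀ s q, used s → (∀ z z', step z s q = step z' s q) ∧
      ∀ z, ∀ o ∈ (step z s q).support, used o.2)
    (c : OComp α) (s : σ) :
    (μ.bind fun z => c.run (step z) s) = c.run (fun s q => μ.bind fun z => step z s q) s := by
  have hconst : ∀ s q, (∀ z z', step z s q = step z' s q) → ∀ z,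
      (μ.bind fun z => step z s q) = step z s q := fun s q h z => by
    rw [funext fun z' => h z' z, PMF.bind_const]
  have hused : ∀ (c : OComp α) (s : σ), used s → ∀ z,
      c.run (step z) s = c.run (fun s q => μ.bind fun z => step z s q) s := fun c s hs z =>
    run_congr (I := used) (fun s q hs => (h2 s q hs).2 z)
      (fun s q hs => (hconst s q (h2 s q hs).1 z).symm) c hs
  induction c generalizing s with
  | pure a => simp [run]
  | coin k ih =>
    simp only [run]
    rw [PMF.bind_comm]
    exact congrArg _ (funext fun b => ih b s)
  | query q k ih =>
    simp only [run]
    rcases h1 s q with h | h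
    · obtain ⟨z₀, -⟩ := μ.support_nonempty
      rw [hconst s q h z₀, ← funext fun r : Data × σ => ih r.1 r.2, PMF.bind_comm]
      exact congrArg _ (funext fun z => by rw [h z z₀])
    · rw [PMF.bind_bind]
      exact congrArg _ (funext fun z => PMF.bind_congr_support fun r hr =>
        hused (k r.1) r.2 (h z r hr) z)

end OComp

theorem Prog.Within.queryBound {c : OComp Prog.Res} {n : ℕ} (h : Prog.Within n c) :
    OComp.QueryBound n c := by
  induction c generalizing n with
  | pure a => trivial
  | coin k ih => exact fun b => ih b (h b)
  | query q k ih => exact ⟨by have := h.1; omega, fun a => (ih a (h.2 a)).mono (by omega)⟩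

theorem OComp.QueryBound.bind_pure {α β : Type} {c : OComp α} {t : ℕ} (h : c.QueryBound t)
    (f : α → β) : (c.bind fun a => .pure (f a)).QueryBound t := by
  induction c generalizing t with
  | pure a => trivial
  | coin k ih => exact fun b => ih b (h b)
  | query q k ih => exact ⟨h.1, fun a => ih a (h.2 a)⟩

theorem Data.queryBound_program (C : Data) : C.program.QueryBound C.snd.size :=
  (Prog.within_eval _ _ _).queryBound.bind_pure _

section Nonces

variable {σM : Type}

/-- The nonce stage that takes nonces with values from a list sampled beforehand, one for each query,
and a separate one for challenge queries. -/
noncomputable def nonceQueue (x y P q : Data) : PMF ((Data × Data) × Data) :=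
  PMF.pure (bif CoreParams.isChal q then (x, y) else (P.fst.fst, P.fst.snd), P.snd)

/-- The nonce stage that samples nonces with values, except for challenge queries. -/
noncomputable def nonceFresh (l : ℕ) (fv : Data → Data) (x y : Data) (_ : Unit) (q : Data) :
    PMF ((Data × Data) × Unit) :=
  bif CoreParams.isChal q then PMF.pure ((x, y), ()) else
    (randomBits l).map fun r => ((enc r, fv (enc r)), ())

/-- A list of `t` nonces with their values. -/
noncomputable def queueDist (l : ℕ) (fv : Data → Data) : ℕ → PMF Data
  | 0 => PMF.pure .nil
  | t + 1 => (queueDist l fv t).bind fun P => (randomBits l).map fun r =>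
      .cons (.cons (enc r) (fv (enc r))) P

theorem run_nonceQueue {α : Type} (k : CoreParams) (l : ℕ) (fv : Data → Data) (x y : Data)
    (stepM : σM → Data → PMF (Data × σM)) (c : OComp α) {t : ℕ} (hc : c.QueryBound t) (w : Data)
    (sM : σM) :
    ((queueDist l fv t).bind fun P =>
      (c.run (coreStep k (nonceQueue x y) stepM) ((w, P), sM)).map
        fun o => (o.1, o.2.1.1, o.2.2)) =
    (c.run (coreStep k (nonceFresh l fv x y) stepM) ((w, ()), sM)).map
      fun o => (o.1, o.2.1.1, o.2.2) := by
  induction c generalizing t w sM with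
  | pure a => simp [OComp.run, PMF.pure_map]
  | coin k ih =>
    simp only [OComp.run, PMF.map_bind]
    rw [PMF.bind_comm]
    exact congrArg _ (funext fun b => ih b (hc b) w sM)
  | query q c ih =>
    obtain ⟨t, rfl⟩ : ∃ j, t = j + 1 := ⟨t - 1, by have := hc.1; omega⟩
    have ih' := fun (a : Data) (w : Data) (sM : σM) => ih a (hc.2 a) w sM
    simp only [Nat.add_sub_cancel] at ih'
    simp only [OComp.run, PMF.map_bind, coreStep, nonceQueue, nonceFresh, PMF.pure_bind,
      PMF.bind_map, queueDist, PMF.bind_bind, Function.comp_def, Data.fst_cons, Data.snd_cons]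
    have key : ∀ r v : Data, ((queueDist l fv t).bind fun P => (stepM sM (k.pre w q r v)).bind
        fun a => ((c (k.reply w q r v a.1)).run (coreStep k (nonceQueue x y) stepM)
          ((k.next w q r v a.1, P), a.2)).map fun o => (o.1, o.2.1.1, o.2.2)) =
        (stepM sM (k.pre w q r v)).bind fun a => ((c (k.reply w q r v a.1)).run
          (coreStep k (nonceFresh l fv x y) stepM) ((k.next w q r v a.1, ()), a.2)).map
            fun o => (o.1, o.2.1.1, o.2.2) := by
      intro r v
      rw [PMF.bind_comm]
      exact congrArg _ (funext fun a => ih' _ _ _)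
    cases hq : CoreParams.isChal q
    · simp only [cond_false, PMF.bind_map, Function.comp_def]
      rw [PMF.bind_comm]
      exact congrArg _ (funext fun r => key _ _)
    · simp only [cond_true, PMF.pure_bind, PMF.bind_const]
      exact key _ _

section Independence

variable {k : CoreParams} {w q : Data}

/-- In the ideal mode only queries that encrypt a message use the nonce. -/
theorem CoreParams.ideal_independent (hk : k.ideal = true) (h : k.toEncrypt w q = .nil)
    (r v r' v' a : Data) : k.pre w q r v = k.pre w q r' v' ∧
      k.reply w q r v a = k.reply w q r' v' a ∧ k.next w q r v a = k.next w q r' v' a := by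
  simp [pre, reply, next, h, hk]

theorem CoreParams.toEncrypt_of_challenged (hw : w.fst ≠ .nil) (hq : isChal q = true) :
    k.toEncrypt w q = .nil := by
  rcases k.toEncrypt_cases w q with h | ⟨x, -, -, -, -, h⟩
  · exact h
  · exact absurd (h hq) hw

theorem CoreParams.next_fst_ne_nil (h : w.fst ≠ .nil ∨ isChal q = true ∧ k.toEncrypt w q ≠ .nil)
    (r v a : Data) : (k.next w q r v a).fst ≠ .nil := by
  unfold next
  cases he : decide (k.toEncrypt w q = .nil) <;> cases k.toDecrypt w q && !decide (a = .nil) <;>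
    cases hq : isChal q <;> cases q.snd.hasKey w.snd.fst <;> simp_all

theorem coreStep_congr_ideal {σN : Type} (hk : k.ideal = true) (h : k.toEncrypt w q = .nil)
    {N N' : σN → Data → PMF ((Data × Data) × σN)} {sN : σN}
    (hN : (N sN q).map Prod.snd = (N' sN q).map Prod.snd)
    (stepM : σM → Data → PMF (Data × σM)) (sM : σM) :
    coreStep k N stepM ((w, sN), sM) q = coreStep k N' stepM ((w, sN), sM) q := by
  have e : ∀ N : σN → Data → PMF ((Data × Data) × σN), coreStep k N stepM ((w, sN), sM) q =
      ((N sN q).map Prod.snd).bind fun s => (stepM sM (k.pre w q .nil .nil)).map fun a =>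
        (k.reply w q .nil .nil a.1, (k.next w q .nil .nil a.1, s), a.2) := by
    intro N
    rw [PMF.bind_map]
    simp only [coreStep, Function.comp_def]
    congr 1
    funext o
    rw [(k.ideal_independent hk h o.1.1 o.1.2 .nil .nil .nil).1]
    congr 1
    funext a
    obtain ⟨-, h2, h3⟩ := k.ideal_independent hk h o.1.1 o.1.2 .nil .nil a.1
    rw [h2, h3]
  rw [e, e, hN]

end Independence

/-- In the ideal mode the nonce of the challenge may be sampled beforehand. -/
theorem run_nonceFresh {α : Type} {k : CoreParams} (hk : k.ideal = true) (l : ℕ)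
    (fv : Data → Data) (stepM : σM → Data → PMF (Data × σM)) (c : OComp α)
    (s : (Data × Unit) × σM) :
    ((randomBits l).bind fun x =>
      c.run (coreStep k (nonceFresh l fv (enc x) (fv (enc x))) stepM) s) =
      c.run (coreStep k (nonceTrue l fv) stepM) s := by
  have hN : ∀ (x y : Data) u q, ((nonceFresh l fv x y) u q).map Prod.snd = PMF.pure () :=
    fun x y u q => PMF.map_eq_pure fun _ => rfl
  have hsame : ∀ (w q : Data) (u : Unit) (sM : σM) (x x' : List Bool),
      k.toEncrypt w q = .nil ∨ CoreParams.isChal q = false →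
      coreStep k (nonceFresh l fv (enc x) (fv (enc x))) stepM ((w, u), sM) q =
      coreStep k (nonceFresh l fv (enc x') (fv (enc x'))) stepM ((w, u), sM) q := by
    intro w q u sM x x' h
    rcases h with h | h
    · exact coreStep_congr_ideal hk h (by rw [hN, hN]) _ _
    · simp [coreStep, nonceFresh, h]
  rw [OComp.run_sample_late (randomBits l)
    (fun x => coreStep k (nonceFresh l fv (enc x) (fv (enc x))) stepM)
    (used := fun s => s.1.1.fst ≠ .nil)]
  · refine OComp.run_congr (I := fun _ => True) (fun _ _ _ _ _ => trivial) ?_ c trivial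
    rintro ⟨⟨w, u⟩, sM⟩ q -
    by_cases h : k.toEncrypt w q = .nil
    · rw [funext fun x => hsame w q u sM x [] (Or.inl h), PMF.bind_const]
      refine coreStep_congr_ideal hk h ?_ _ _
      rw [hN]
      exact (PMF.map_eq_pure fun _ => rfl).symm
    · have hd : CoreParams.isDec q = false := by
        cases hd : CoreParams.isDec q
        · rfl
        · exact absurd (k.toEncrypt_of_isDec hd) h
      cases hq : CoreParams.isChal q
      · rw [funext fun x => hsame w q u sM x [] (Or.inr hq), PMF.bind_const]
        simp [coreStep, nonceFresh, nonceTrue, nonceDist, hq, hd, PMF.map_comp, Function.comp_def]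
      · simp [coreStep, nonceFresh, nonceTrue, nonceDist, hq, hd, PMF.bind_map, Function.comp_def]
  · rintro ⟨⟨w, u⟩, sM⟩ q
    by_cases h : k.toEncrypt w q = .nil ∨ CoreParams.isChal q = false
    · exact Or.inl fun z z' => hsame w q u sM z z' h
    · right
      intro z o ho
      rw [not_or, Bool.not_eq_false] at h
      simp only [coreStep, PMF.mem_support_bind_iff, PMF.mem_support_map_iff] at ho
      obtain ⟨a, -, b, -, rfl⟩ := ho
      exact k.next_fst_ne_nil (Or.inr h.symm) _ _ _
  · rintro ⟨⟨w, u⟩, sM⟩ q hw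
    refine ⟨fun z z' => hsame w q u sM z z' ?_, fun z o ho => ?_⟩
    · cases hq : CoreParams.isChal q
      · exact Or.inr rfl
      · exact Or.inl (k.toEncrypt_of_challenged hw hq)
    · simp only [coreStep, PMF.mem_support_bind_iff, PMF.mem_support_map_iff] at ho
      obtain ⟨a, -, b, -, rfl⟩ := ho
      exact k.next_fst_ne_nil (Or.inl hw) _ _ _

theorem CoreParams.toEncrypt_bit (l : ℕ) (w q : Data) (b : Bool) (h : isChal q = false ∨
    toEncrypt ⟨true, false, l⟩ w q = .nil) :
    toEncrypt ⟨true, b, l⟩ w q = toEncrypt ⟨true, false, l⟩ w q := by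
  have hf : frozen ⟨true, b, l⟩ w = frozen ⟨true, false, l⟩ w := rfl
  rcases h with h | h
  · simp [toEncrypt, hf, h]
  · rw [h]
    unfold toEncrypt at h ⊢
    rw [hf]
    revert h
    cases frozen ⟨true, false, l⟩ w
    · cases h1 : decide (q.fst = .nil) && okMsg l q.snd
      · cases h2 : isChal q && decide (w.fst = .nil) && okMsg l q.snd.fst && okMsg l q.snd.snd <;>
          simp
      · simp
    · simp

/-- With a random string in place of the value at the nonce of the challenge, the hidden bit is
independent of the run: it enters only through a one-time pad. -/
theorem run_challenge_pad {α : Type} (l : ℕ) (x : Data) (stepM : σM → Data → PMF (Data × σM))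
    (c : OComp α) (s : (Data × Data) × σM) (b : Bool) :
    ((randomBits l).bind fun y =>
      c.run (coreStep ⟨true, b, l⟩ (nonceQueue x (enc y)) stepM) s) =
    (randomBits l).bind fun y =>
      c.run (coreStep ⟨true, false, l⟩ (nonceQueue x (enc y)) stepM) s := by
  have hN : ∀ (y P q : Data), (nonceQueue x y P q).map Prod.snd = PMF.pure P.snd :=
    fun y u q => by rw [nonceQueue, PMF.pure_map]
  have hsame : ∀ (b : Bool) (w q P : Data) (sM : σM) (y y' : List Bool),
      CoreParams.toEncrypt ⟨true, b, l⟩ w q = .nil ∨ CoreParams.isChal q = false →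
      coreStep ⟨true, b, l⟩ (nonceQueue x (enc y)) stepM ((w, P), sM) q =
      coreStep ⟨true, b, l⟩ (nonceQueue x (enc y')) stepM ((w, P), sM) q := by
    intro b w q P sM y y' h
    rcases h with h | h
    · exact coreStep_congr_ideal rfl h (by rw [hN, hN]) _ _
    · simp [coreStep, nonceQueue, h]
  have hlate : ∀ b : Bool, ((randomBits l).bind fun y =>
      c.run (coreStep ⟨true, b, l⟩ (nonceQueue x (enc y)) stepM) s) =
      c.run (fun s q => (randomBits l).bind fun y =>
        coreStep ⟨true, b, l⟩ (nonceQueue x (enc y)) stepM s q) s := by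
    intro b
    refine OComp.run_sample_late (randomBits l)
      (fun y => coreStep ⟨true, b, l⟩ (nonceQueue x (enc y)) stepM)
      (used := fun s => s.1.1.fst ≠ .nil) ?_ ?_ c s
    · rintro ⟨⟨w, P⟩, sM⟩ q
      by_cases h : CoreParams.toEncrypt ⟨true, b, l⟩ w q = .nil ∨ CoreParams.isChal q = false
      · exact Or.inl fun z z' => hsame b w q P sM z z' h
      · right
        intro z o ho
        rw [not_or, Bool.not_eq_false] at h
        simp only [coreStep, PMF.mem_support_bind_iff, PMF.mem_support_map_iff] at ho
        obtain ⟨a, -, b, -, rfl⟩ := ho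
        exact CoreParams.next_fst_ne_nil (Or.inr h.symm) _ _ _
    · rintro ⟨⟨w, P⟩, sM⟩ q hw
      refine ⟨fun z z' => hsame b w q P sM z z' ?_, fun z o ho => ?_⟩
      · cases hq : CoreParams.isChal q
        · exact Or.inr rfl
        · exact Or.inl (CoreParams.toEncrypt_of_challenged hw hq)
      · simp only [coreStep, PMF.mem_support_bind_iff, PMF.mem_support_map_iff] at ho
        obtain ⟨a, -, b, -, rfl⟩ := ho
        exact CoreParams.next_fst_ne_nil (Or.inl hw) _ _ _
  rw [hlate, hlate]
  congr 1
  funext s q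
  obtain ⟨⟨w, P⟩, sM⟩ := s
  by_cases h : CoreParams.isChal q = false ∨
    CoreParams.toEncrypt ⟨true, false, l⟩ w q = .nil
  · have he := CoreParams.toEncrypt_bit l w q b h
    have hfr : CoreParams.frozen ⟨true, b, l⟩ w = CoreParams.frozen ⟨true, false, l⟩ w := rfl
    have hd : CoreParams.toDecrypt ⟨true, b, l⟩ w q =
        CoreParams.toDecrypt ⟨true, false, l⟩ w q := rfl
    simp only [coreStep, CoreParams.pre, CoreParams.reply, CoreParams.next, CoreParams.ctxt, he, hd]
  · rw [not_or, Bool.not_eq_false] at h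
    have hne : CoreParams.toEncrypt ⟨true, b, l⟩ w q ≠ .nil := by
      intro h'
      cases b
      · exact h.2 h'
      · refine h.2 ?_
        revert h'
        have hfr : CoreParams.frozen ⟨true, true, l⟩ w = CoreParams.frozen ⟨true, false, l⟩ w := rfl
        unfold CoreParams.toEncrypt
        rw [hfr]
        cases CoreParams.frozen ⟨true, false, l⟩ w
        · cases h1 : decide (q.fst = .nil) && okMsg l q.snd
          · cases h2 : CoreParams.isChal q && decide (w.fst = .nil) && okMsg l q.snd.fst &&
              okMsg l q.snd.snd <;> simp
          · simp
        · simp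
    -- the step as a function of the padded message
    have pad : ∀ b : Bool, CoreParams.toEncrypt ⟨true, b, l⟩ w q ≠ .nil →
        ((randomBits l).bind fun y =>
          coreStep ⟨true, b, l⟩ (nonceQueue x (enc y)) stepM ((w, P), sM) q) =
        (randomBits l).bind fun y => (stepM sM (.cons .nil (appD x (enc y)))).map fun a =>
          (.cons .nil (.cons (.cons x (enc y)) a.1.snd),
            (.cons (.cons .nil (.cons (.cons x (enc y)) a.1.snd)) w.snd, P.snd), a.2) := by
      intro b hb
      rcases CoreParams.toEncrypt_cases ⟨true, b, l⟩ w q with he | ⟨m, hm, he, -⟩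
      · exact absurd he hb
      · change m.length = l at hm
        conv_rhs => rw [← hm, ← randomBits_map_xorBits m, PMF.bind_map, hm]
        simp [coreStep, nonceQueue, h.1, CoreParams.pre, CoreParams.reply, CoreParams.next,
          CoreParams.ctxt, he, Function.comp_def]
    rw [pad b hne, pad false h.2]

end Nonces

/-! ### The advantage in the CCA2 game -/

section Advantage

variable (F : WPRF) (M : WMAC) (n : ℕ) (skF skM : Data)

/-- A run of a player against the layer over the true function and the MAC oracles. -/
noncomputable def layerRun {α : Type} (ideal b : Bool) (c : OComp α) :
    PMF (α × (Data × Unit) × List (List Bool × Data)) :=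
  c.run (coreStep ⟨ideal, b, F.len n⟩ (nonceTrue (F.len n) (F.value n skF)) (M.oracle n skM))
    ((coreInit, ()), [])

/-- The guess of the hidden bit of the weak pseudorandomness game derived from a player in the CCA2
game, whose queries are answered by the layer in the ideal mode with a random bit, a simulator
`simM` of the MAC game and `t` values of the function obtained beforehand.  The value for the
challenge ciphertext is drawn from `μ`.  The guess is that `μ` yields true values, if the player finds
the bit without producing a forgery. -/
noncomputable def guessRun (l : ℕ) (fv : Data → Data) (simM : Data → Data → PMF (Data × Data))
    (t : ℕ) (μ : List Bool → PMF (List Bool)) (c : OComp Data) : PMF Bool :=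
  OComp.fairCoin.bind fun b => (queueDist l fv t).bind fun P =>
    (randomBits l).bind fun x => (μ x).bind fun y =>
      (c.run (coreStep ⟨true, b, l⟩ (nonceQueue (enc x) (enc y)) simM) ((coreInit, P), .nil)).map
        fun o => !(decide (o.2.1.1.snd.snd = .nil) && decide (o.1 = .bit b))

/-- The forgery recorded by the layer in the ideal mode with a random bit, using a simulator `simF` of
the weak pseudorandomness game. -/
noncomputable def forgeRun (l : ℕ) (simF : Data → Data → PMF (Data × Data)) (c : OComp Data) :
    PMF (Data × List (List Bool × Data)) :=
  OComp.fairCoin.bind fun b =>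
    (c.run (coreStep ⟨true, b, l⟩ (nonceVia l simF) (M.oracle n skM)) ((coreInit, .nil), [])).map
      fun o => (o.2.1.1.snd.snd, o.2.2)

/-- A forgery, with the list of the tags output by the signing oracle. -/
def WMAC.Forges (M : WMAC) (n : ℕ) (sk : Data) (o : Data × List (List Bool × Data)) : Prop :=
  (M.game n sk).win o.2 o.1

variable {F M n skF skM}

theorem winProb_encryptThenMAC (hlen : 1 ≤ F.len n)
    (hMsgs : ∀ m : List Bool, m.length = 2 * F.len n → m ∈ M.Msgs n)
    (R₁ R₂ : ℕ → (xk C : Data) → Data) (c : OComp Data) :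
    ((encryptThenMAC F M R₁ R₂).game n (.cons skF skM)).winProb c =
      (Pr (layerRun F M n skF skM false false c) (fun o => o.1 = .bit false) +
        Pr (layerRun F M n skF skM false true c) (fun o => o.1 = .bit true)) / 2 := by
  have h : ((encryptThenMAC F M R₁ R₂).game n (.cons skF skM)).winProb c =
      Pr (OComp.fairCoin.bind fun b => c.run ((encryptThenMAC F M R₁ R₂).oracle n (.cons skF skM))
        (b, none)) fun o => o.1 = .bit o.2.1 := by
    change Pr ((OComp.fairCoin.map fun b => ((b, none) : Bool × Option Data)).bind
      fun s => c.run ((encryptThenMAC F M R₁ R₂).oracle n (.cons skF skM)) s) _ = _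
    rw [PMF.bind_map]
    rfl
  rw [h, Pr_coin]
  simp only [← run_coreStep_real F M n skF skM R₁ R₂ hlen hMsgs, Pr_map]
  rfl

/-- In the real mode the player does at most as well as in the ideal mode, up to the probability of a
forgery. -/
theorem Pr_layerRun_real_le {α : Type} (hlen : 1 ≤ F.len n)
    (hMsgs : ∀ m : List Bool, m.length = 2 * F.len n → m ∈ M.Msgs n) (b : Bool) (c : OComp α)
    (E : α → Prop) :
    Pr (layerRun F M n skF skM false b c) (fun o => E o.1) ≤
      Pr (layerRun F M n skF skM true b c) (fun o => E o.1 ∧ ¬ HasForgery o.2.1.1) +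
      Pr (layerRun F M n skF skM true b c) (fun o => HasForgery o.2.1.1) := by
  have hval : ∀ r : List Bool, r.length = F.len n →
      F.value n skF (enc r) = enc (F.eval n skF r) := fun r hr => F.value_enc n skF hr
  have swap : ∀ (i j : Bool) (E' : α × (Data × Unit) × List (List Bool × Data) → Prop),
      Pr (layerRun F M n skF skM i b c) (fun o => E' o ∧ ¬ HasForgery o.2.1.1) ≤
        Pr (layerRun F M n skF skM j b c) E' := by
    intro i j E'
    refine OComp.Pr_run_until_flag (I := fun _ => True) (flag := fun s => HasForgery s.1.1)
      ?_ (fun _ _ _ _ _ => trivial) ?_ c trivial E'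
    · intro s q hs o ho
      exact hs.coreStep ho
    · intro s q _ hs
      have := coreStep_real_eq_ideal (n := n) (M := M) (skM := skM) (k := ⟨i, b, F.len n⟩) hlen hMsgs
        hval (fun r hr => F.length_eval n skF r hr) hs q i j
      exact this
  have h1 := swap false true fun o => E o.1 ∧ ¬ HasForgery o.2.1.1
  have h2 := swap true false fun o => ¬ HasForgery o.2.1.1
  have h3 : Pr (layerRun F M n skF skM false b c) (fun o => E o.1) ≤
      Pr (layerRun F M n skF skM false b c)
        (fun o => (E o.1 ∧ ¬ HasForgery o.2.1.1) ∧ ¬ HasForgery o.2.1.1) +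
      Pr (layerRun F M n skF skM false b c) (fun o => HasForgery o.2.1.1) :=
    (Pr_mono fun o _ h => by tauto).trans (Pr_or_le _ _)
  have h4 := Pr_not (μ := layerRun F M n skF skM false b c) fun o => HasForgery o.2.1.1
  have h5 := Pr_not (μ := layerRun F M n skF skM true b c) fun o => HasForgery o.2.1.1
  have h6 : Pr (layerRun F M n skF skM true b c) (fun o => ¬ HasForgery o.2.1.1) ≤
      Pr (layerRun F M n skF skM true b c)
        (fun o => ¬ HasForgery o.2.1.1 ∧ ¬ HasForgery o.2.1.1) := Pr_mono fun o _ h => ⟨h, h⟩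
  linarith

/-- True values: the guess is right whenever the player finds the bit without a forgery. -/
theorem Pr_guessRun_false {simM : Data → Data → PMF (Data × Data)}
    (hsim : ∀ c : OComp Data, (c.run simM .nil).map Prod.fst = (M.game n skM).view c)
    {t : ℕ} {c : OComp Data} (hc : c.QueryBound t) :
    Pr (guessRun (F.len n) (F.value n skF) simM t (fun x => PMF.pure (F.eval n skF x)) c)
      (fun g => g = false) =
    (Pr (layerRun F M n skF skM true false c)
        (fun o => o.1 = .bit false ∧ ¬ HasForgery o.2.1.1) +
      Pr (layerRun F M n skF skM true true c)
        (fun o => o.1 = .bit true ∧ ¬ HasForgery o.2.1.1)) / 2 := by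
  rw [guessRun, Pr_coin]
  have key : ∀ b : Bool, Pr ((queueDist (F.len n) (F.value n skF) t).bind fun P =>
      (randomBits (F.len n)).bind fun x => (PMF.pure (F.eval n skF x)).bind fun y =>
        (c.run (coreStep ⟨true, b, F.len n⟩ (nonceQueue (enc x) (enc y)) simM)
          ((coreInit, P), .nil)).map
            fun o => !(decide (o.2.1.1.snd.snd = .nil) && decide (o.1 = .bit b)))
        (fun g => g = false) =
      Pr (layerRun F M n skF skM true b c) (fun o => o.1 = .bit b ∧ ¬ HasForgery o.2.1.1) := by
    intro b
    set k : CoreParams := ⟨true, b, F.len n⟩ with hk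
    let E : Data × Data → Bool := fun o =>
      !(decide (o.2.snd.snd = .nil) && decide (o.1 = .bit b))
    have hN : ∀ (u : Unit) (q : Data),
        Sampleable (nonceTrue k.len (F.value n skF) u q) := fun u q =>
      (sampleable_nonceDist _ _).map _
    have e1 : ((queueDist (F.len n) (F.value n skF) t).bind fun P =>
        (randomBits (F.len n)).bind fun x => (PMF.pure (F.eval n skF x)).bind fun y =>
        (c.run (coreStep k (nonceQueue (enc x) (enc y)) simM) ((coreInit, P), .nil)).map
            fun o => !(decide (o.2.1.1.snd.snd = .nil) && decide (o.1 = .bit b))) =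
        (layerRun F M n skF skM true b c).map fun o => E (o.1, o.2.1.1) := by
      simp only [PMF.pure_bind]
      rw [PMF.bind_comm]
      have h1 : ∀ x y : Data, ((queueDist (F.len n) (F.value n skF) t).bind fun P =>
          (c.run (coreStep k (nonceQueue x y) simM) ((coreInit, P), .nil)).map
            fun o => !(decide (o.2.1.1.snd.snd = .nil) && decide (o.1 = .bit b))) =
          (c.run (coreStep k (nonceFresh (F.len n) (F.value n skF) x y) simM)
            ((coreInit, ()), .nil)).map fun o => E (o.1, o.2.1.1) := by
        intro x y
        have := congrArg (PMF.map fun o : Data × Data × Data => E (o.1, o.2.1))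
          (run_nonceQueue k (F.len n) (F.value n skF) x y simM c hc coreInit .nil)
        simp only [PMF.map_bind, PMF.map_comp] at this
        exact this
      rw [PMF.bind_congr_support (g := fun x => (c.run (coreStep k (nonceFresh (F.len n)
        (F.value n skF) (enc x) (F.value n skF (enc x))) simM) ((coreInit, ()), .nil)).map
          fun o => E (o.1, o.2.1.1)) fun x hx => by
            rw [h1, F.value_enc n skF (length_of_mem_randomBits hx)]]
      rw [← PMF.map_bind, run_nonceFresh (k := k) rfl]
      have h2 := congrArg (PMF.map fun o : Data × Data × Unit => E (o.1, o.2.1))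
        (map_run_coreStep_simM k hN hsim c coreInit ())
      simp only [PMF.map_comp] at h2
      refine h2.trans ?_
      change PMF.map _ ((PMF.pure ([] : List (List Bool × Data))).bind fun t => c.run (coreStep k
        (nonceTrue k.len (F.value n skF)) (M.oracle n skM)) ((coreInit, ()), t)) = _
      rw [PMF.pure_bind]
      rfl
    rw [e1, Pr_map]
    refine Pr_congr fun o _ => ?_
    simp [E, HasForgery, and_comm]
  rw [key, key]

/-- Random values: the guess is right at least half of the time. -/
theorem half_le_Pr_guessRun_true (l : ℕ) (fv : Data → Data)
    (simM : Data → Data → PMF (Data × Data)) (t : ℕ) (c : OComp Data) :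
    1 / 2 ≤ Pr (guessRun l fv simM t (fun _ => randomBits l) c) fun g => g = true := by
  rw [guessRun, Pr_coin]
  let D : PMF Data := (queueDist l fv t).bind fun P => (randomBits l).bind fun x =>
    (randomBits l).bind fun y => (c.run (coreStep ⟨true, false, l⟩ (nonceQueue (enc x) (enc y)) simM)
      ((coreInit, P), .nil)).map Prod.fst
  have key : ∀ b : Bool, Pr D (fun o => ¬ o = .bit b) ≤
      Pr ((queueDist l fv t).bind fun P => (randomBits l).bind fun x => (randomBits l).bind fun y =>
        (c.run (coreStep ⟨true, b, l⟩ (nonceQueue (enc x) (enc y)) simM) ((coreInit, P), .nil)).map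
          fun o => !(decide (o.2.1.1.snd.snd = .nil) && decide (o.1 = .bit b)))
        (fun g => g = true) := by
    intro b
    refine Pr_bind_mono fun P _ => Pr_bind_mono fun x _ => ?_
    rw [← PMF.map_bind, ← run_challenge_pad l (enc x) simM c ((coreInit, P), .nil) b, PMF.map_bind]
    refine Pr_bind_mono fun y _ => ?_
    rw [Pr_map, Pr_map]
    refine Pr_mono fun o _ h => ?_
    simp [h]
  have h0 := key false
  have h1 := key true
  have h2 := Pr_not (μ := D) fun o => o = .bit false
  have h3 := Pr_not (μ := D) fun o => o = .bit true
  have h4 : Pr D (fun o => o = .bit false) ≤ Pr D fun o => ¬ o = .bit true :=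
    Pr_mono fun o _ h => by rw [h]; simp [Data.bit]
  linarith

theorem WMAC.sampleable_oracle (M : WMAC) {n : ℕ} {sk : Data}
    (hsign : ∀ m, Sampleable (M.sign n sk m)) (s : List (List Bool × Data)) (q : Data) :
    Sampleable (M.oracle n sk s q) := by
  simp only [WMAC.oracle, WMAC.game]
  split
  · split
    · split_ifs
      · exact (hsign _).map _
      · exact Sampleable.pure _
    · exact Sampleable.pure _
  · exact Sampleable.pure _
  · exact Sampleable.pure _

/-- A recorded forgery wins the MAC game. -/
theorem Pr_forgeRun {simF : Data → Data → PMF (Data × Data)} (hlen : 1 ≤ F.len n)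
    (hMsgs : ∀ m : List Bool, m.length = 2 * F.len n → m ∈ M.Msgs n)
    (hsim : ∀ c : OComp Data, (c.run simF .nil).map Prod.fst = (F.game n skF).view c)
    (hsign : ∀ m, Sampleable (M.sign n skM m)) (c : OComp Data) :
    (Pr (layerRun F M n skF skM true false c) (fun o => HasForgery o.2.1.1) +
      Pr (layerRun F M n skF skM true true c) (fun o => HasForgery o.2.1.1)) / 2 ≤
    Pr (forgeRun M n skM (F.len n) simF c) (M.Forges n skM) := by
  have hM := M.sampleable_oracle hsign
  have hval : ∀ r : List Bool, r.length = F.len n →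
      F.value n skF (enc r) = enc (F.eval n skF r) := fun r hr => F.value_enc n skF hr
  rw [forgeRun, Pr_coin]
  have key : ∀ b : Bool, Pr (layerRun F M n skF skM true b c) (fun o => HasForgery o.2.1.1) ≤
      Pr ((c.run (coreStep ⟨true, b, F.len n⟩ (nonceVia (F.len n) simF) (M.oracle n skM))
        ((coreInit, .nil), [])).map fun o => (o.2.1.1.snd.snd, o.2.2))
        (M.Forges n skM) := by
    intro b
    have e : (c.run (coreStep ⟨true, b, F.len n⟩ (nonceVia (F.len n) simF) (M.oracle n skM))
          ((coreInit, .nil), [])).map (fun o => (o.2.1.1.snd.snd, o.2.2)) =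
        (c.run (coreStep ⟨true, b, F.len n⟩ (nonceTrue (F.len n) (F.value n skF)) (M.oracle n skM))
          ((coreInit, ()), [])).map fun o => (o.2.1.1.snd.snd, o.2.2) := by
      have e := congrArg (PMF.map fun o : Data × Data × List (List Bool × Data) =>
        (o.2.1.snd.snd, o.2.2))
          (map_run_coreStep_value F n skF ⟨true, b, F.len n⟩ (F.len n) hM hsim c coreInit [])
      rw [PMF.map_comp, PMF.map_comp] at e
      exact e
    rw [e, Pr_map, layerRun]
    refine Pr_mono fun o ho h => ?_
    have hstep : ∀ (s : (Data × Unit) × List (List Bool × Data)) (q : Data),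
        ForgerySound M n skM (F.len n) s.1.1 s.2 →
        ∀ o ∈ (coreStep ⟨true, b, F.len n⟩ (nonceTrue (F.len n) (F.value n skF))
          (M.oracle n skM) s q).support, ForgerySound M n skM (F.len n) o.2.1.1 o.2.2 :=
      fun s q hs o ho => hs.step (k := ⟨true, b, F.len n⟩) hlen hMsgs hval
        (fun r hr => F.length_eval n skF r hr) rfl ho
    have hinit : ForgerySound M n skM (F.len n) coreInit [] := ⟨by simp, Or.inl rfl⟩
    have hs : ForgerySound M n skM (F.len n) o.2.1.1 o.2.2 :=
      OComp.run_invariant (I := fun s : (Data × Unit) × List (List Bool × Data) =>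
        ForgerySound M n skM (F.len n) s.1.1 s.2) hstep c (s := ((coreInit, ()), [])) hinit o ho
    rcases hs.2 with hs | ⟨m, hm, σ, h1, h2, h3⟩
    · exact absurd hs h
    · exact ⟨m, hm, σ, h1, h2, h3⟩
  have h0 := key false
  have h1 := key true
  linarith

/-- The advantage in the CCA2 game is bounded by those of the two reductions. -/
theorem winProb_encryptThenMAC_le {simF simM : Data → Data → PMF (Data × Data)}
    (hlen : 1 ≤ F.len n)
    (hMsgs : ∀ m : List Bool, m.length = 2 * F.len n → m ∈ M.Msgs n)
    (hF : ∀ c : OComp Data, (c.run simF .nil).map Prod.fst = (F.game n skF).view c)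
    (hM : ∀ c : OComp Data, (c.run simM .nil).map Prod.fst = (M.game n skM).view c)
    (hsign : ∀ m, Sampleable (M.sign n skM m)) (R₁ R₂ : ℕ → (xk C : Data) → Data)
    {t : ℕ} {c : OComp Data} (hc : c.QueryBound t) :
    ((encryptThenMAC F M R₁ R₂).game n (.cons skF skM)).winProb c ≤
      Pr (guessRun (F.len n) (F.value n skF) simM t (fun x => PMF.pure (F.eval n skF x)) c)
        (fun g => g = false) +
      (Pr (guessRun (F.len n) (F.value n skF) simM t (fun _ => randomBits (F.len n)) c)
        (fun g => g = true) - 1 / 2) +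
      Pr (forgeRun M n skM (F.len n) simF c) (M.Forges n skM) := by
  rw [winProb_encryptThenMAC hlen hMsgs]
  have h1 := Pr_layerRun_real_le (skF := skF) (skM := skM) hlen hMsgs false c
    fun o => o = .bit false
  have h2 := Pr_layerRun_real_le (skF := skF) (skM := skM) hlen hMsgs true c
    fun o => o = .bit true
  have h3 := Pr_guessRun_false (F := F) (skF := skF) hM hc
  have h4 := half_le_Pr_guessRun_true (F.len n) (F.value n skF) simM t c
  have h5 := Pr_forgeRun (skF := skF) hlen hMsgs hF hsign c
  linarith

end Advantage

/-! ### Programs that run a given program against a handler -/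

namespace Prog

variable {σ : Type} {step : σ → Data → PMF (Data × σ)}

/-- The environment of a computation whose queries are answered by `h`; the state holds the fuel and
the state of the handler, unless the fuel is exhausted. -/
noncomputable def answerStep (h : ℕ → Data → OComp Res) (step : σ → Data → PMF (Data × σ)) :
    Option (ℕ × Data) × σ → Data → PMF (Data × Option (ℕ × Data) × σ)
  | (none, e), _ => PMF.pure (.nil, none, e)
  | (some (f, s), e), q => ((h f (.cons q s)).run step e).map fun o =>
      (o.1.elim .nil fun z => z.1.fst, o.1.map fun z => (z.2, z.1.snd), o.2)

/-- The result of `answerBy` for an output and a final state of `answerStep`. -/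
def answerRes : Data × Option (ℕ × Data) × σ → Res × σ
  | (_, none, e) => (none, e)
  | (y, some (f, s), e) =>
    (if (Data.cons y s).size ≤ f then some (.cons y s, f - (Data.cons y s).size) else none, e)

theorem run_answerBy (h : ℕ → Data → OComp Res) (c : OComp Res) (f : ℕ) (s : Data) (e : σ) :
    (answerBy h c f s).run step e =
      ((c.bind fun o => .pure (outOf o)).run (answerStep h step) (some (f, s), e)).map
        answerRes := by
  have dead : ∀ (c : OComp Data) (e : σ),
      (c.run (answerStep h step) (none, e)).map answerRes = PMF.pure (none, e) := by
    intro c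
    induction c with
    | pure a => intro e; simp [OComp.run, PMF.pure_map, answerRes]
    | coin k ih => intro e; simp [OComp.run, PMF.map_bind, ih]
    | query q k ih => intro e; simp [OComp.run, ih, answerStep]
  induction c generalizing f s e with
  | pure o =>
    rcases o with _ | ⟨y, r⟩ <;>
      simp only [answerBy, OComp.bind, OComp.run, PMF.pure_map, outOf, answerRes, Option.elim,
        Prog.ret]
  | coin k ih =>
    simp only [answerBy, OComp.bind, OComp.run, PMF.map_bind]
    exact congrArg _ (funext fun b => ih b f s e)
  | query q k ih =>
    simp only [answerBy, OComp.bind, OComp.run, PMF.map_bind, run_andThen, answerStep,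
      PMF.bind_map]
    congr 1
    funext o
    rcases o with ⟨_ | ⟨y, r⟩, e'⟩
    · exact (dead _ _).symm
    · exact ih _ _ _ _

/-- Answering queries depends only on the input-output behaviour. -/
theorem answerBy_equiv (h : ℕ → Data → OComp Res) {c c' : OComp Res}
    (hc : (c.bind fun o => .pure (outOf o)).Equiv (c'.bind fun o => .pure (outOf o))) (f : ℕ)
    (s : Data) : (answerBy h c f s).Equiv (answerBy h c' f s) := fun σ step e => by
  rw [run_answerBy, run_answerBy, hc]

theorem andThen_equiv {c c' : OComp Res} (h : c.Equiv c') {f g : Data → ℕ → OComp Res}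
    (hf : ∀ y r, (f y r).Equiv (g y r)) : (Prog.andThen c f).Equiv (Prog.andThen c' g) := by
  refine h.bind fun o => ?_
  rcases o with _ | ⟨y, r⟩
  · exact OComp.Equiv.refl _
  · exact hf y r

/-- The program that runs the program `C` without input, answering its queries by `H`, and applies
`Post` to the output and the last state of `H`.  The first state of `H` is computed by `Setup`, which
outputs the code of `H` and the state, from `params`. -/
def wrap (Setup Post : Prog) (params C : Data) : Prog :=
  .comp (.pair (.const C) (.pair (.const .nil) (.comp (.const params) Setup))) (.comp .handle Post)

theorem handle_equiv {C C' : Data} (hs : C.size = C'.size) (h : C.program.Equiv C'.program)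
    (f : ℕ) (z : Data) :
    (eval f .handle (.cons C (.cons .nil z))).Equiv (eval f .handle (.cons C' (.cons .nil z))) := by
  cases f with
  | zero => rw [eval, eval]; exact OComp.Equiv.refl _
  | succ n =>
    rw [eval, eval]
    by_cases hC : C.size ≤ n
    · have hC' : C'.size ≤ n := hs ▸ hC
      rw [dif_pos (show (Data.cons C (.cons .nil z)).fst.size ≤ n from hC),
        dif_pos (show (Data.cons C' (.cons .nil z)).fst.size ≤ n from hC')]
      simp only [Data.fst_cons, Data.snd_cons, hs]
      exact answerBy_equiv _ h _ _
    · have hC' : ¬ C'.size ≤ n := hs ▸ hC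
      rw [dif_neg (show ¬ (Data.cons C (.cons .nil z)).fst.size ≤ n from hC),
        dif_neg (show ¬ (Data.cons C' (.cons .nil z)).fst.size ≤ n from hC')]
      exact OComp.Equiv.refl _

/-- Programs of equal length and behaviour are wrapped to programs of equal behaviour. -/
theorem wrap_equiv {C C' : Data} (hs : C.size = C'.size) (h : C.program.Equiv C'.program)
    (Setup Post : Prog) (params x : Data) (T : ℕ) :
    (clocked T (wrap Setup Post params C) x).Equiv (clocked T (wrap Setup Post params C') x) := by
  refine OComp.Equiv.bind ?_ fun o => OComp.Equiv.refl _
  have hconst : ∀ (m : ℕ) (D x : Data), (eval m (.const D) x) =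
      .pure (if D.size + 1 ≤ m then some (D, m - (D.size + 1)) else none) := by
    intro m D x
    cases m with
    | zero => rw [eval]; simp
    | succ m =>
      rw [eval, Prog.ret]
      by_cases hD : D.size ≤ m
      · rw [if_pos hD, if_pos (by omega)]; congr 3; omega
      · rw [if_neg hD, if_neg (by omega)]
  have hnil : ∀ (m : ℕ) (q : Prog) (x : Data), ∃ c : OComp Res,
      eval m (.pair (.const .nil) q) x =
        Prog.andThen c fun z r => .pure (some (.cons .nil z, r)) := by
    intro m q x
    cases m with
    | zero => exact ⟨.pure none, by rw [eval]; rfl⟩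
    | succ m =>
      rw [eval, hconst]
      by_cases hm : Data.nil.size + 1 ≤ m
      · rw [if_pos hm]
        exact ⟨_, rfl⟩
      · rw [if_neg hm]
        exact ⟨.pure none, rfl⟩
  have hassoc : ∀ (c : OComp Res) (f g : Data → ℕ → OComp Res),
      Prog.andThen (Prog.andThen c f) g = Prog.andThen c fun y r => Prog.andThen (f y r) g := by
    intro c f g
    rw [Prog.andThen, Prog.andThen, OComp.bind_assoc]
    unfold Prog.andThen
    congr 1
    funext o
    rcases o with _ | ⟨y, r⟩ <;> rfl
  have hpure : ∀ (y : Data) (r : ℕ) (f : Data → ℕ → OComp Res),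
      Prog.andThen (.pure (some (y, r))) f = f y r := fun _ _ _ => rfl
  unfold wrap
  cases T with
  | zero => rw [eval, eval]; exact OComp.Equiv.refl _
  | succ n =>
    rw [eval, eval]
    cases n with
    | zero => rw [eval, eval]; exact OComp.Equiv.refl _
    | succ n =>
      rw [eval, eval, hconst, hconst, hs]
      by_cases hC : C'.size + 1 ≤ n
      · rw [if_pos hC]
        obtain ⟨c, hc⟩ := hnil (min (n - (C'.size + 1)) n) (.comp (.const params) Setup) x
        simp only [if_pos hC, hpure, hc, hassoc]
        refine andThen_equiv (OComp.Equiv.refl _) fun z r => ?_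
        cases hm : min r (n + 1) with
        | zero => rw [eval, eval]; exact OComp.Equiv.refl _
        | succ m =>
          rw [eval, eval]
          exact andThen_equiv (handle_equiv hs h m z) fun y r => OComp.Equiv.refl _
      · rw [if_neg hC, if_neg hC]
        exact OComp.Equiv.refl _

/-- What holds at the end of a run whose queries have bounded total size. -/
theorem Within.run_invariant {τ : Type} {c : OComp Res} {m : ℕ} (hc : Within m c)
    {κ : τ → Data → PMF (Data × τ)} {I : ℕ → τ → Prop}
    (hI : ∀ m t q, q.size + 1 ≤ m → I m t → ∀ o ∈ (κ t q).support, I (m - (q.size + 1)) o.2)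
    {t : τ} (ht : I m t) :
    ∀ o ∈ ((c.bind fun o => .pure (outOf o)).run κ t).support, o.1.size ≤ m ∧ ∃ j, I j o.2 := by
  induction c generalizing m t with
  | pure o =>
    intro o' ho
    simp only [OComp.bind, OComp.run, PMF.support_pure, Set.mem_singleton_iff] at ho
    subst ho
    refine ⟨?_, m, ht⟩
    rcases o with _ | ⟨y, r⟩
    · simp [outOf]
    · have := hc y r rfl
      simp only [outOf, Option.elim]
      omega
  | coin k ih =>
    intro o ho
    simp only [OComp.bind, OComp.run, PMF.mem_support_bind_iff] at ho
    obtain ⟨b, -, ho⟩ := ho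
    exact ih b (hc b) ht o ho
  | query q k ih =>
    intro o ho
    simp only [OComp.bind, OComp.run, PMF.mem_support_bind_iff] at ho
    obtain ⟨r, hr, ho⟩ := ho
    have := ih r.1 (hc.2 _) (hI m t q hc.1 ht r hr) o ho
    exact ⟨by omega, this.2⟩

theorem runs_wrap {τ : Type} {Setup H Post : Prog} {params C x : Data} {ν : PMF τ}
    {ψ : τ → Data × σ} {I : ℕ → τ → Prop} {B₀ B S B₁ : ℕ} {κ : τ → Data → PMF (Data × τ)}
    {post : Data × τ → Data} {e : σ}
    (hsetup : Runs step (on Setup params) e B₀ (ν.map fun t => (.cons H.encode (ψ t).1, (ψ t).2)))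
    (hinit : ∀ t ∈ ν.support, I C.snd.size t)
    (hh : ∀ m t q, q.size + 1 ≤ m → I m t →
      Runs step (on H (.cons q (ψ t).1)) (ψ t).2 B
        ((κ t q).map fun o => (.cons o.1 (ψ o.2).1, (ψ o.2).2)) ∧
      ∀ o ∈ (κ t q).support, I (m - (q.size + 1)) o.2)
    (hS : ∀ m t, I m t → (ψ t).1.size ≤ S)
    (hpost : ∀ y t, y.size ≤ C.snd.size → (∃ j, I j t) →
      Runs step (on Post (.cons y (ψ t).1)) (ψ t).2 B₁ (PMF.pure (post (y, t), (ψ t).2))) :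
    Runs step (on (wrap Setup Post params C) x) e
      (C.size + params.size + B₀ + (C.size + (C.snd.size * B + C.snd.size + S + 1) + 1) + B₁ + 10)
      (ν.bind fun t => (C.program.run κ t).map fun o => (post o, (ψ o.2).2)) := by
  have e1 := runs_comp_pure (runs_const (step := step) e x params) hsetup
  have e2 := runs_pair_pure (runs_const (step := step) e x .nil) e1
  have e3 := runs_pair_pure (runs_const (step := step) e x C) e2
  rw [PMF.map_comp, PMF.map_comp] at e3
  have e4 := runs_comp_index e3 (q := .comp .handle Post)
    (B' := (C.size + (C.snd.size * B + C.snd.size + S + 1) + 1) + B₁ + 1)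
    (κ := fun t => (C.program.run κ t).map fun o => (post o, (ψ o.2).2)) fun t ht => by
      have h1 := runs_handle (C := C) (arg := .nil) hh hS (hinit t ht)
      refine (runs_comp_index (κ := fun o => PMF.pure (post o, (ψ o.2).2)) h1 (B' := B₁)
        fun o ho => ?_).congr rfl
      obtain ⟨h2, h3⟩ := (within_eval C.snd.size (decode C.fst) .nil).run_invariant
        (fun m t q hq ht => (hh m t q hq ht).2) (hinit t ht) o ho
      exact hpost o.1 o.2 h2 h3
  exact e4.mono (by simp only [Data.size_nil]; omega)

end Prog

/-- The tree representing the wrapped program is computed in polynomial time. -/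
@[fun_prop] theorem PolyTime.encodeWrap {γ : Type} [Enc γ] (Setup Post : Prog) {f g : γ → Data}
    (hf : PolyTime f) (hg : PolyTime g) :
    PolyTime fun x => (Prog.wrap Setup Post (f x) (g x)).encode := by
  simp only [Prog.wrap, Prog.encode]
  fun_prop

/-! ### The reduction to the weak pseudorandom function -/

theorem Data.size_bits_le {l : ℕ} {r : List Bool} (h : r.length = l) : (enc r : Data).size ≤ 2 * l :=
  h ▸ size_enc_bits_le r

theorem WPRF.size_value_le (F : WPRF) (n : ℕ) (sk d : Data) :
    (F.value n sk d).size ≤ 2 * F.len n := by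
  by_cases h : okMsg (F.len n) d = true
  · obtain ⟨x, rfl, hx⟩ := okMsg_iff.1 h
    rw [F.value_enc n sk hx]
    exact Data.size_bits_le (F.length_eval n sk x hx)
  · rw [Bool.not_eq_true] at h
    simp [value, h]

/-- The value of the challenge in the weak pseudorandomness game. -/
noncomputable def WPRF.challenge (F : WPRF) (n : ℕ) (sk : Data) (b : Bool) (x : List Bool) :
    PMF (List Bool) :=
  bif b then randomBits (F.len n) else PMF.pure (F.eval n sk x)

theorem WPRF.length_challenge (F : WPRF) (n : ℕ) (sk : Data) (b : Bool) {x y : List Bool}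
    (hx : x.length = F.len n) (hy : y ∈ (F.challenge n sk b x).support) : y.length = F.len n := by
  cases b
  · simp only [challenge, cond_false, PMF.support_pure, Set.mem_singleton_iff] at hy
    rw [hy]; exact F.length_eval n sk x hx
  · exact length_of_mem_randomBits hy

theorem WPRF.oracle_challenge (F : WPRF) (n : ℕ) (sk : Data) (b : Bool) :
    F.oracle n sk (b, none) (.cons (.cons .nil .nil) .nil) =
      (randomBits (F.len n)).bind fun x => (F.challenge n sk b x).map fun y =>
        (enc (x, y), (b, some x)) := rfl

/-- The security parameter, the extraction key and the hidden bit. -/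
abbrev SimStatic : Type := (ℕ × Data) × Bool

/-- The state of the handler of the reduction to the pseudorandom function: the parameters, the
challenge, the state of the layer, the remaining values and the state of the MAC simulator. -/
abbrev GuessState : Type := (SimStatic × Data × Data) × (Data × Data) × Data

/-- The handler of the reduction to the pseudorandom function. -/
noncomputable def guessHandler (len : ℕ → ℕ) (simM : ℕ → Data → Data → Data → PMF (Data × Data))
    (t : GuessState) (q : Data) : PMF (Data × GuessState) :=
  (coreStep ⟨true, t.1.1.2, len t.1.1.1.1⟩ (nonceQueue t.1.2.1 t.1.2.2)
    (simM t.1.1.1.1 t.1.1.1.2) t.2 q).map fun o => (o.1, t.1, o.2)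

section Guess

variable {len : ℕ → ℕ} {simM : ℕ → Data → Data → Data → PMF (Data × Data)}

theorem ppt_guessHandler (hlen : PolyTime len)
    (hsim : PPT fun i : ℕ × Data × Data × Data => simM i.1 i.2.1 i.2.2.1 i.2.2.2) :
    PPT fun i : Data × GuessState => guessHandler len simM i.2 i.1 := by
  let K : Data × GuessState → CoreParams := fun i => ⟨true, i.2.1.1.2, len i.2.1.1.1.1⟩
  let r : Data × GuessState → Data := fun i =>
    bif CoreParams.isChal i.1 then i.2.1.2.1 else i.2.2.1.2.fst.fst
  let v : Data × GuessState → Data := fun i =>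
    bif CoreParams.isChal i.1 then i.2.1.2.2 else i.2.2.1.2.fst.snd
  have hK : PolyTime K := by fun_prop
  have hr : PolyTime r := by fun_prop
  have hv : PolyTime v := by fun_prop
  have h1 : PPT fun i : Data × GuessState => simM i.2.1.1.1.1 i.2.1.1.1.2 i.2.2.2
      ((K i).pre i.2.2.1.1 i.1 (r i) (v i)) :=
    hsim.precomp (f := fun i : Data × GuessState => (i.2.1.1.1.1, i.2.1.1.1.2, i.2.2.2,
      (K i).pre i.2.2.1.1 i.1 (r i) (v i))) (by fun_prop)
  have h2 := PPT.map h1 (g := fun i a => ((K i).reply i.2.2.1.1 i.1 (r i) (v i) a.1, (i.2.1,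
    (((K i).next i.2.2.1.1 i.1 (r i) (v i) a.1, i.2.2.1.2.snd), a.2)))) (by fun_prop)
  refine h2.of_map_enc fun i => ?_
  obtain ⟨q, t⟩ := i
  congr 1
  simp only [guessHandler, coreStep, nonceQueue, PMF.pure_bind, PMF.map_comp, K, r, v]
  cases CoreParams.isChal q <;> rfl

/-- Sizes occurring in the reduction, in terms of a common bound `N` of the sizes of its parameters:
`R` bounds the values obtained beforehand, `J` the total size of the queries to the simulator and `A`
its replies. -/
structure GuessBounds (len : ℕ → ℕ) (simM : ℕ → Data → Data → Data → PMF (Data × Data)) (k : ℕ)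
    where
  R : ℕ → ℕ
  J : ℕ → ℕ
  A : ℕ → ℕ
  polyR : PolyBounded R
  polyJ : PolyBounded J
  polyA : PolyBounded A
  len_le : ∀ n N, n ≤ N → (N + 1) * (4 * len n + 4) ≤ R N
  J_eq : ∀ N, J N = (2 * R N + 16) * N
  reply_le : ∀ n xk s q N, n + xk.size ≤ N → s.size ≤ (N + J N + 2) ^ k →
    q.size ≤ 5 * N + 2 * R N + 10 → ∀ o ∈ (simM n xk s q).support, o.1.size ≤ A N

theorem nonempty_guessBounds (hlen : PolyTime len)
    (hsim : PPT fun i : ℕ × Data × Data × Data => simM i.1 i.2.1 i.2.2.1 i.2.2.2) (k : ℕ) :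
    Nonempty (GuessBounds len simM k) := by
  obtain ⟨kl, hkl⟩ := hlen.size_le
  obtain ⟨ks, hks⟩ := hsim.size_le
  simp only [sz_nat] at hkl
  let R : ℕ → ℕ := fun N => (N + 1) * (4 * (N + 2) ^ kl + 4)
  have hR : PolyBounded R := by fun_prop
  let J : ℕ → ℕ := fun N => (2 * R N + 16) * N
  have hJ : PolyBounded J := by fun_prop
  let A : ℕ → ℕ := fun N => (N + ((N + J N + 2) ^ k + (5 * N + 2 * R N + 10)) + 10) ^ ks
  have hA : PolyBounded A := by fun_prop
  refine ⟨⟨R, J, A, hR, hJ, hA, fun n N hn => ?_, fun _ => rfl, fun n xk s q N h1 h2 h3 o ho => ?_⟩⟩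
  · have := (hkl n).trans (Nat.pow_le_pow_left (show n + 2 ≤ N + 2 by omega) kl)
    dsimp only [R]
    gcongr
  · have h4 := hks (n, xk, s, q) o ho
    have h5 : o.1.size ≤ sz o := by
      obtain ⟨o1, o2⟩ := o
      simp only [sz_pair, sz_data]
      omega
    refine h5.trans (h4.trans ?_)
    refine Nat.pow_le_pow_left ?_ ks
    simp only [sz_pair, sz_nat, sz_data]
    omega

/-- The invariant of the handler, with `m` the remaining total size of queries: each query of size `s`
adds at most a multiple of `s + 1` to the state of the layer and to the total size of the queries to
the simulator. -/
structure GuessInv {k : ℕ} (b : GuessBounds len simM k) (n : ℕ) (xk : Data) (N m : ℕ)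
    (t : GuessState) : Prop where
  params : t.1.1.1 = (n, xk)
  le : m ≤ N
  x_le : t.1.2.1.size ≤ b.R N
  y_le : t.1.2.2.size ≤ b.R N
  P_le : t.2.1.2.size ≤ b.R N
  w_le : t.2.1.1.size + (b.R N + b.A N + 30) * m ≤ (b.R N + b.A N + 30) * (N + 1)
  reaches : ∃ j, WMScheme.Reaches (simM n xk) j t.2.2 ∧ j + (2 * b.R N + 16) * m ≤ b.J N

variable {k : ℕ} {b : GuessBounds len simM k} {n : ℕ} {xk : Data} {N m : ℕ} {t : GuessState}

/-- The size of states allowed by the invariant. -/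
def GuessBounds.S (b : GuessBounds len simM k) (N : ℕ) : ℕ :=
  N + (b.R N + b.R N + b.R N) + (b.R N + b.A N + 30) * (N + 1) + (N + b.J N + 2) ^ k + 20

theorem GuessBounds.polyS (b : GuessBounds len simM k) : PolyBounded b.S := by
  have := b.polyR
  have := b.polyJ
  have := b.polyA
  unfold GuessBounds.S
  fun_prop

theorem GuessInv.sM_le (h : GuessInv b n xk N m t) (hn : n + xk.size ≤ N)
    (hreach : ∀ m s, WMScheme.Reaches (simM n xk) m s → s.size ≤ (n + m + 2) ^ k) :
    t.2.2.size ≤ (N + b.J N + 2) ^ k := by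
  obtain ⟨j, hj, hle⟩ := h.reaches
  refine (hreach j _ hj).trans (Nat.pow_le_pow_left ?_ k)
  have := Nat.zero_le ((2 * b.R N + 16) * m)
  omega

theorem GuessInv.size_le (h : GuessInv b n xk N m t) (hn : n + xk.size ≤ N)
    (hreach : ∀ m s, WMScheme.Reaches (simM n xk) m s → s.size ≤ (n + m + 2) ^ k) :
    (enc t : Data).size ≤ b.S N := by
  have h1 := h.sM_le hn hreach
  have h2 := h.w_le
  have h3 := h.x_le
  have h4 := h.y_le
  have h5 := h.P_le
  have h6 := h.params
  obtain ⟨⟨⟨⟨n', xk'⟩, β⟩, x, y⟩, ⟨w, P⟩, sM⟩ := t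
  simp only [Prod.mk.injEq] at h6
  obtain ⟨rfl, rfl⟩ := h6
  have h7 := sz_bool_le β
  simp only [size_enc, sz_pair, sz_nat, sz_data, GuessBounds.S]
  simp only at h1 h2 h3 h4 h5
  have := Nat.zero_le ((b.R N + b.A N + 30) * m)
  omega

theorem GuessInv.step (h : GuessInv b n xk N m t) (hn : n + xk.size ≤ N)
    (hreach : ∀ m s, WMScheme.Reaches (simM n xk) m s → s.size ≤ (n + m + 2) ^ k) {q : Data}
    (hq : q.size + 1 ≤ m) {o : Data × GuessState} (ho : o ∈ (guessHandler len simM t q).support) :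
    GuessInv b n xk N (m - (q.size + 1)) o.2 := by
  have hs := h.sM_le hn hreach
  obtain ⟨h6, hm, h3, h4, h5, h2, j, hj, hle⟩ := h
  obtain ⟨⟨⟨⟨n', xk'⟩, β⟩, x, y⟩, ⟨w, P⟩, sM⟩ := t
  simp only [Prod.mk.injEq] at h6
  obtain ⟨rfl, rfl⟩ := h6
  simp only at h2 h3 h4 h5 hj hs
  simp only [guessHandler, coreStep, nonceQueue, PMF.pure_bind, PMF.map_comp,
    PMF.mem_support_map_iff, Function.comp] at ho
  obtain ⟨a, ha, rfl⟩ := ho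
  set rv : Data × Data := bif CoreParams.isChal q then (x, y) else (P.fst.fst, P.fst.snd) with hrv
  have hr : rv.1.size ≤ b.R N := by
    have e1 := P.size_fst_le
    have e2 := P.fst.size_fst_le
    rw [hrv]
    cases CoreParams.isChal q
    · simp only [cond_false]; omega
    · simpa using h3
  have hpre := CoreParams.size_pre_le ⟨true, β, len n'⟩ w q rv.1 rv.2
  have hnext := CoreParams.size_next_le ⟨true, β, len n'⟩ w q rv.1 rv.2 a.1
  have hA := b.reply_le n' xk' sM _ N hn hs (by omega) a ha
  obtain ⟨i, rfl⟩ : ∃ i, m = i + (q.size + 1) := ⟨m - (q.size + 1), by omega⟩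
  rw [Nat.add_sub_cancel]
  have e := P.size_snd_le
  refine ⟨rfl, by omega, h3, h4, (P.size_snd_le).trans h5, ?_, ⟨_, hj.next ha, ?_⟩⟩
  · rw [Nat.mul_add] at h2
    have e3 : (b.R N + b.A N + 30) * (q.size + 1) =
      (b.R N + b.A N + 30) * q.size + (b.R N + b.A N + 30) := by ring
    have e4 : 30 * q.size ≤ (b.R N + b.A N + 30) * q.size := Nat.mul_le_mul_right _ (by omega)
    simp only
    omega
  · rw [Nat.mul_add] at hle
    have e3 : (2 * b.R N + 16) * (q.size + 1) =
      (2 * b.R N + 16) * q.size + (2 * b.R N + 16) := by ring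
    have e4 : 16 * q.size ≤ (2 * b.R N + 16) * q.size := Nat.mul_le_mul_right _ (by omega)
    omega

end Guess

section GuessSetup

variable (F : WPRF) (n : ℕ) (sk xk : Data)

/-- The initial states of the handler, together with the final states of the weak pseudorandomness
game with hidden bit `b`. -/
noncomputable def guessInit (t : ℕ) (b : Bool) : PMF (GuessState × Bool × Option (List Bool)) :=
  OComp.fairCoin.bind fun β => (queueDist (F.len n) (F.value n sk) t).bind fun P =>
    (randomBits (F.len n)).bind fun x => (F.challenge n sk b x).map fun y =>
      (((((n, xk), β), enc x, enc y), (coreInit, P), .nil), b, some x)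

theorem foldPMF_queue {τ : Type} (l : ℕ) (fv : Data → Data) (c : τ) (t : ℕ) :
    foldPMF (fun (s : τ × Data) (_ : Data) => (randomBits l).map fun r =>
      (s.1, Data.cons (.cons (enc r) (fv (enc r))) s.2)) (List.replicate t .nil) (c, .nil) =
      (queueDist l fv t).map fun P => (c, P) := by
  induction t with
  | zero => simp [foldPMF, queueDist, PMF.pure_map]
  | succ t ih =>
    rw [List.replicate_succ', foldPMF_concat, ih, queueDist, PMF.map_bind, PMF.bind_map]
    simp only [Function.comp_def, PMF.map_comp]

theorem size_queueDist_le {F : WPRF} {n : ℕ} {sk : Data} {t : ℕ} {P : Data}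
    (hP : P ∈ (queueDist (F.len n) (F.value n sk) t).support) : P.size ≤ t * (4 * F.len n + 3) := by
  induction t generalizing P with
  | zero => simp [queueDist] at hP; simp [hP]
  | succ t ih =>
    simp only [queueDist, PMF.mem_support_bind_iff, PMF.mem_support_map_iff] at hP
    obtain ⟨P', hP', r, hr, rfl⟩ := hP
    have h8 := Data.size_bits_le (length_of_mem_randomBits hr)
    have h9 := F.size_value_le n sk (enc r)
    have := ih hP'
    rw [Nat.add_mul]
    simp only [Data.size_cons]
    omega

/-- The initial state of the handler is obtained by asking for `t` values at random points and then for
the challenge. -/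
theorem exists_guessSetup (hlen : PolyTime F.len) (H : Data) : ∃ (Setup : Prog) (B : ℕ → ℕ),
    PolyBounded B ∧ ∀ n sk xk t b,
      Prog.Runs (F.oracle n sk) (Prog.on Setup (enc (n, xk, t))) (b, none) (B (n + xk.size + t))
        ((guessInit F n sk xk t b).map fun s => (.cons H (enc s.1), s.2)) := by
  have h1 : PPT fun i : ℕ × Data × ℕ => (OComp.fairCoin).map fun β =>
      (List.replicate i.2.2 Data.nil, (((i.1, i.2.1), β), Data.nil)) :=
    PPT.map (f := fun _ : ℕ × Data × ℕ => OComp.fairCoin) (g := fun i β =>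
      (List.replicate i.2.2 Data.nil, (((i.1, i.2.1), β), Data.nil))) ppt_fairCoin (by
        have := PolyTime.replicateNil.comp (g := fun i : (ℕ × Data × ℕ) × Bool => i.1.2.2)
          (by fun_prop)
        fun_prop)
  have h2 : PPT fun i : Data × SimStatic × Data => (randomBits (F.len i.2.1.1.1)).map fun r =>
      (Data.cons .nil (enc r), ((enc r : Data), i.2)) :=
    PPT.map (f := fun i : Data × SimStatic × Data => randomBits (F.len i.2.1.1.1))
      (g := fun i r => (Data.cons .nil (enc r), ((enc r : Data), i.2)))
      (PPT.randomBits.precomp (by fun_prop)) (by fun_prop)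
  have h2' : PPT fun i : Data × Data × SimStatic × Data =>
      PMF.pure (i.2.2.1, Data.cons (.cons i.2.1 i.1) i.2.2.2) := by
    have : PolyTime fun i : Data × Data × SimStatic × Data =>
      (i.2.2.1, Data.cons (.cons i.2.1 i.1) i.2.2.2) := by fun_prop
    exact this
  have h3 : PPT fun i : SimStatic × Data =>
      PMF.pure (Data.cons (.cons .nil .nil) .nil, i) := by
    have : PolyTime fun i : SimStatic × Data => (Data.cons (.cons .nil .nil) .nil, i) := by fun_prop
    exact this
  have h3' : PPT fun i : Data × SimStatic × Data => PMF.pure (Data.cons H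
      (enc (((i.2.1, i.1.fst, i.1.snd), (coreInit, i.2.2), Data.nil) : GuessState))) := by
    have : PolyTime fun i : Data × SimStatic × Data => Data.cons H
      (enc (((i.2.1, i.1.fst, i.1.snd), (coreInit, i.2.2), Data.nil) : GuessState)) := by fun_prop
    exact this
  obtain ⟨p1, k1, hp1⟩ := h1.computes
  obtain ⟨p2, k2, hp2⟩ := exists_ask_prog h2 h2'
  obtain ⟨p3, k3, hp3⟩ := exists_ask_prog h3 h3'
  obtain ⟨kl, hkl⟩ := hlen.size_le
  simp only [sz_nat] at hkl
  let L : ℕ → ℕ := fun N => (N + 2) ^ kl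
  have hL : PolyBounded L := by fun_prop
  let S : ℕ → ℕ := fun N => N + N + (N * (4 * L N + 3)) + 10
  have hS : PolyBounded S := by fun_prop
  let B2 : ℕ → ℕ := fun N => N * ((S N + 2 * L N + 10 + 2) ^ k2 + 4 * S N + 20) + S N + 1
  have hB2 : PolyBounded B2 := by fun_prop
  refine ⟨.comp p1 (.comp p2.fold p3), fun N => (N + 10 + 2) ^ k1 +
    (B2 N + (S N + (4 * L N + 1) + 2) ^ k3 + 1) + 1, by fun_prop, fun n sk xk t b => ?_⟩
  generalize hN : n + xk.size + t = N
  have hl : F.len n ≤ L N := (hkl n).trans (Nat.pow_le_pow_left (by omega) kl)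
  -- the presampling of the values
  have e2 : ∀ β : Bool, Prog.Runs (F.oracle n sk) (Prog.on p2.fold
      (enc (List.replicate t Data.nil, ((((n, xk), β) : SimStatic), Data.nil)))) (b, none) (B2 N)
      (((queueDist (F.len n) (F.value n sk) t).map fun P => ((((n, xk), β) : SimStatic), P)).map
        fun s => (enc s, (b, none))) := by
    intro β
    have h := runs_fold (p := p2) (step := F.oracle n sk) (S := S N)
      (B := (S N + 2 * L N + 10 + 2) ^ k2)
      (g := fun (s : SimStatic × Data) (_ : Data) => (randomBits (F.len n)).map fun r =>
        (s.1, Data.cons (.cons (enc r) (F.value n sk (enc r))) s.2))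
      (ψ := fun s => (enc s, (b, none)))
      (I := fun l s => s.1 = ((n, xk), β) ∧ (∀ d ∈ l, d = Data.nil) ∧ l.length ≤ t ∧
        s.2.size + l.length * (4 * L N + 3) ≤ t * (4 * L N + 3)) ?_ ?_
      (List.replicate t Data.nil) (((n, xk), β), Data.nil) ⟨rfl, fun d hd =>
        List.eq_of_mem_replicate hd, by simp, by simp⟩
    · rw [foldPMF_queue] at h
      refine h.mono ?_
      have hsz : ∀ t, sz (List.replicate t Data.nil) = t := fun t => by
        induction t with
        | zero => rfl
        | succ t ih => rw [List.replicate_succ, sz_cons, ih]; simp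
      rw [hsz]
      have : t ≤ N := by omega
      dsimp only [B2]
      gcongr
    · rintro l s ⟨h1, h2, h3, h4⟩
      have hsz : sz l = l.length := by
        clear h3 h4
        induction l with
        | nil => rfl
        | cons a l ih =>
          rw [sz_cons, ih fun d hd => h2 d (List.mem_cons_of_mem _ hd), h2 a List.mem_cons_self]
          simp
      obtain ⟨s1, P⟩ := s
      simp only at h1
      subst h1
      have h5 := sz_bool_le β
      have h6 : t * (4 * L N + 3) ≤ N * (4 * L N + 3) := Nat.mul_le_mul_right _ (by omega)
      simp only [size_enc, sz_pair, sz_nat, sz_data, hsz, S]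
      simp only at h4
      have := Nat.zero_le (l.length * (4 * L N + 3))
      omega
    · rintro a l ⟨s1, P⟩ ⟨h1, h2, h3, h4⟩
      simp only at h1 h4
      subst h1
      obtain rfl := h2 a List.mem_cons_self
      rw [List.length_cons] at h3 h4
      have h6 : t * (4 * L N + 3) ≤ N * (4 * L N + 3) := Nat.mul_le_mul_right _ (by omega)
      have h7 := Nat.zero_le (l.length * (4 * L N + 3))
      have h5 := sz_bool_le β
      rw [Nat.add_mul, one_mul] at h4
      constructor
      · have h := hp2 (Data.nil, ((n, xk), β), P) _ (F.oracle n sk) (b, none) (2 * L N) ?_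
        · refine (h.mono (Nat.pow_le_pow_left ?_ k2)).congr ?_
          · simp only [sz_pair, sz_nat, sz_data, Data.size_nil, S]
            omega
          · simp only [PMF.bind_map, Function.comp_def, F.oracle_eval, PMF.pure_bind, PMF.pure_map,
              PMF.map_comp]
            rfl
        · intro i hi o ho
          obtain ⟨r, hr, rfl⟩ := (PMF.mem_support_map_iff _ _ _).1 hi
          simp only [F.oracle_eval, PMF.support_pure, Set.mem_singleton_iff] at ho
          rw [ho]
          exact (F.size_value_le n sk _).trans (by omega)
      · intro o ho
        obtain ⟨r, hr, rfl⟩ := (PMF.mem_support_map_iff _ _ _).1 ho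
        refine ⟨rfl, fun d hd => h2 d (List.mem_cons_of_mem _ hd), by omega, ?_⟩
        have h8 := Data.size_bits_le (length_of_mem_randomBits hr)
        have h9 := F.size_value_le n sk (enc r)
        simp only [Data.size_cons]
        omega
  have e3 : ∀ β, ∀ P ∈ (queueDist (F.len n) (F.value n sk) t).support,
      Prog.Runs (F.oracle n sk) (Prog.on p3 (enc ((((n, xk), β) : SimStatic), P))) (b, none)
        ((S N + (4 * L N + 1) + 2) ^ k3) (((randomBits (F.len n)).bind fun x =>
          (F.challenge n sk b x).map fun y => ((((((n, xk), β), enc x, enc y), (coreInit, P), .nil) :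
            GuessState), b, some x)).map fun s => (.cons H (enc s.1), s.2)) := by
    intro β P hP
    have h8 := size_queueDist_le hP
    have h5 := sz_bool_le β
    have h6 : t * (4 * F.len n + 3) ≤ N * (4 * L N + 3) := by gcongr; omega
    refine ((hp3 (((n, xk), β), P) _ (F.oracle n sk) (b, none) (4 * L N + 1) ?_).mono
      (Nat.pow_le_pow_left ?_ k3)).congr ?_
    · intro i hi o ho
      simp only [PMF.support_pure, Set.mem_singleton_iff] at hi
      subst hi
      simp only [F.oracle_challenge, PMF.mem_support_bind_iff, PMF.mem_support_map_iff] at ho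
      obtain ⟨x, hx, y, hy, rfl⟩ := ho
      have hx' := length_of_mem_randomBits hx
      have h9 := Data.size_bits_le hx'
      have h10 := Data.size_bits_le (F.length_challenge n sk b hx' hy)
      simp only [enc_pair, Data.size_cons]
      omega
    · simp only [sz_pair, sz_nat, sz_data, S]
      omega
    · simp only [PMF.pure_bind, F.oracle_challenge, PMF.bind_bind, PMF.bind_map, PMF.map_bind,
        PMF.pure_map, PMF.map_comp, Function.comp_def]
      rfl
  have h := Prog.runs_comp_index (hp1 (n, xk, t) _ (F.oracle n sk) (b, none)) (q := .comp p2.fold p3)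
    (B' := B2 N + (S N + (4 * L N + 1) + 2) ^ k3 + 1)
    (κ := fun i => ((queueDist (F.len n) (F.value n sk) t).bind fun P =>
      (randomBits (F.len n)).bind fun x =>
          (F.challenge n sk b x).map fun y => ((((((n, xk), i.2.1.2), enc x, enc y), (coreInit, P),
            .nil) : GuessState), b, some x)).map fun s => (.cons H (enc s.1), s.2)) fun i hi => by
      obtain ⟨β, -, rfl⟩ := (PMF.mem_support_map_iff _ _ _).1 hi
      have e2' := e2 β
      rw [PMF.map_comp] at e2'
      exact (Prog.runs_comp_index e2' (e3 β)).congr (PMF.map_bind _ _ _).symm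
  refine (h.mono ?_).congr ?_
  · have : (sz (n, xk, t) + 2) ^ k1 ≤ (N + 10 + 2) ^ k1 := Nat.pow_le_pow_left (by
      simp only [sz_pair, sz_nat, sz_data]; omega) k1
    dsimp only
    omega
  · rw [PMF.bind_map, guessInit, PMF.map_bind]
    rfl

end GuessSetup

@[fun_prop] theorem PolyTime.bit {α : Type} [Enc α] {f : α → Bool} (hf : PolyTime f) :
    PolyTime fun x => Data.bit (f x) :=
  PolyTime.of_enc_eq hf fun _ => rfl

/-- The guess, from the output of the player and the last state of the handler. -/
def guessPost (o : Data × GuessState) : Bool :=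
  !(decide (o.2.2.1.1.snd.snd = .nil) && decide (o.1 = .bit o.2.1.1.2))

/-- The initial state of the handler satisfies the invariant. -/
theorem guessInv_init {F : WPRF} {simM : ℕ → Data → Data → Data → PMF (Data × Data)} {k : ℕ}
    (b : GuessBounds F.len simM k) {n : ℕ} {xk sk : Data} {N t : ℕ} {c : Bool} (hn : n ≤ N)
    (ht : t ≤ N) {s : GuessState × Bool × Option (List Bool)}
    (hs : s ∈ (guessInit F n sk xk t c).support) {m : ℕ} (hm : m ≤ N) :
    GuessInv b n xk N m s.1 := by
  simp only [guessInit, PMF.mem_support_bind_iff, PMF.mem_support_map_iff] at hs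
  obtain ⟨β, -, P, hP, x, hx, y, hy, rfl⟩ := hs
  have hx' := length_of_mem_randomBits hx
  have h1 := Data.size_bits_le hx'
  have h2 := Data.size_bits_le (F.length_challenge n sk c hx' hy)
  have h3 := b.len_le n N hn
  have h4 : 4 * F.len n + 4 ≤ (N + 1) * (4 * F.len n + 4) := Nat.le_mul_of_pos_left _ (by omega)
  refine ⟨rfl, hm, by dsimp only; omega, by dsimp only; omega, ?_, ?_, 0, .start, ?_⟩
  · have h5 := size_queueDist_le hP
    have h6 : t * (4 * F.len n + 3) ≤ (N + 1) * (4 * F.len n + 4) := by gcongr <;> omega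
    dsimp only; omega
  · have h7 : (b.R N + b.A N + 30) * m ≤ (b.R N + b.A N + 30) * N := Nat.mul_le_mul_left _ hm
    simp only [coreInit, Data.size_cons, Data.size_nil]
    rw [Nat.mul_succ]
    omega
  · rw [b.J_eq, zero_add]
    exact Nat.mul_le_mul_left _ hm

/-- The reduction to the pseudorandom function: a transformation of programs, which depends on the
length of the given program and otherwise uses it as a black box. -/
theorem exists_guess_reduction (F : WPRF) (hlen : PolyTime F.len)
    {simM : ℕ → Data → Data → Data → PMF (Data × Data)}
    (hsim : PPT fun i : ℕ × Data × Data × Data => simM i.1 i.2.1 i.2.2.1 i.2.2.2) (k : ℕ) :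
    ∃ R : ℕ → Data → Data → Data, PolyTime (fun i : ℕ × Data × Data => R i.1 i.2.1 i.2.2) ∧
      (∀ n xk C C', C.size = C'.size → C.program.Equiv C'.program →
        (R n xk C).size = (R n xk C').size ∧ (R n xk C).program.Equiv (R n xk C').program) ∧
      ∀ n sk xk, (∀ m s, WMScheme.Reaches (simM n xk) m s → s.size ≤ (n + m + 2) ^ k) →
        ∀ (C : Data) (b : Bool),
          ((R n xk C).program.run (F.oracle n sk) (b, none)).map (fun o => (o.1, o.2.1)) =
            (guessRun (F.len n) (F.value n sk) (simM n xk) C.size (F.challenge n sk b)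
              C.program).map fun g => (.bit g, b) := by
  obtain ⟨gb⟩ := nonempty_guessBounds hlen hsim k
  obtain ⟨H, kH, hH⟩ := (ppt_guessHandler hlen hsim).computes
  obtain ⟨Setup, B0, hB0, hSetup⟩ := exists_guessSetup F hlen H.encode
  have hpost : PolyTime guessPost := by unfold guessPost; fun_prop
  obtain ⟨Post, kP, hPost⟩ := hpost.runs
  have hpS := gb.polyS
  obtain ⟨kT, hkT⟩ : PolyBounded fun N => N + (N + 10) + B0 N +
      (N + (N * (N + gb.S N + 1 + 2) ^ kH + N + gb.S N + 1) + 1) + (N + gb.S N + 1 + 2) ^ kP + 10 := by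
    fun_prop
  refine ⟨fun n xk C => .cons (Prog.wrap Setup Post (enc (n, xk, C.size)) C).encode
    (.unary ((n + xk.size + C.size + 2) ^ kT)), ?_, ?_, ?_⟩
  · have : PolyTime fun i : ℕ × Data × Data =>
        (enc ((i.1 + i.2.1.size + i.2.2.size + 2) ^ kT) : Data) := by fun_prop
    exact PolyTime.dataCons (by fun_prop) this
  · intro n xk C C' hs he
    refine ⟨?_, ?_⟩
    · simp [Prog.wrap, Prog.encode, hs]
    · simp only [Data.program, Data.fst_cons, Data.snd_cons, Prog.decode_encode, hs]
      exact Prog.wrap_equiv hs he _ _ _ _ _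
  · intro n sk xk hreach C b
    generalize hN : n + xk.size + C.size = N
    have hn : n + xk.size ≤ N := by omega
    have hC : C.snd.size ≤ C.size := C.size_snd_le
    let κ : GuessState × Bool × Option (List Bool) → Data →
        PMF (Data × GuessState × Bool × Option (List Bool)) := fun t q =>
      (guessHandler F.len simM t.1 q).map fun o => (o.1, o.2, t.2)
    have hrun := Prog.runs_wrap (step := F.oracle n sk) (x := .nil) (C := C)
      (params := enc (n, xk, C.size)) (e := (b, none)) (H := H) (Post := Post) (Setup := Setup)
      (ψ := fun t : GuessState × Bool × Option (List Bool) => (enc t.1, t.2))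
      (I := fun m t => GuessInv gb n xk N m t.1) (κ := κ) (post := fun o => enc (guessPost (o.1, o.2.1)))
      (B := (N + gb.S N + 1 + 2) ^ kH) (S := gb.S N) (B₁ := (N + gb.S N + 1 + 2) ^ kP)
      (hSetup n sk xk C.size b)
      (fun t ht => guessInv_init gb (by omega) (by omega) ht (by omega)) ?_
      (fun m t ht => ht.size_le hn hreach) ?_
    · have hle := hkT N
      have hclock : (Prog.clocked ((N + 2) ^ kT) (Prog.wrap Setup Post (enc (n, xk, C.size)) C)
          .nil).run (F.oracle n sk) (b, none) = _ := hrun.clocked (by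
        refine le_trans ?_ hle
        simp only [size_enc, sz_pair, sz_nat, sz_data]
        have hh : C.snd.size * (N + gb.S N + 1 + 2) ^ kH ≤ N * (N + gb.S N + 1 + 2) ^ kH :=
          Nat.mul_le_mul_right _ (by omega)
        rw [show n + (xk.size + C.size + 1) + 1 = N + 2 by omega,
          show n + xk.size + C.size = N from hN]
        omega)
      have hprog : (Data.cons (Prog.wrap Setup Post (enc (n, xk, C.size)) C).encode
          (.unary ((N + 2) ^ kT))).program = Prog.clocked ((N + 2) ^ kT)
            (Prog.wrap Setup Post (enc (n, xk, C.size)) C) .nil := by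
        simp only [Data.program, Data.fst_cons, Data.snd_cons, Prog.decode_encode, Data.size_unary]
      beta_reduce
      rw [hN, hprog, hclock, guessInit, guessRun]
      simp only [PMF.map_bind, PMF.bind_bind, PMF.bind_map, PMF.map_comp, Function.comp_def]
      congr 1; funext β
      congr 1; funext P
      congr 1; funext x
      congr 1; funext y
      -- the parameters and the state of the game do not change
      have hinv := OComp.run_invariant (step := κ)
        (I := fun t => t.1.1 = (((n, xk), β), enc x, enc y) ∧ t.2 = (b, some x))
        (fun t q ht o ho => by
          obtain ⟨o', ho', rfl⟩ := (PMF.mem_support_map_iff _ _ _).1 ho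
          obtain ⟨o'', -, rfl⟩ := (PMF.mem_support_map_iff _ _ _).1 ho'
          exact ht) C.program
        (s := (((((n, xk), β), enc x, enc y), (coreInit, P), .nil), b, some x)) ⟨rfl, rfl⟩
      have hproj := OComp.run_project (step := κ)
        (step' := coreStep ⟨true, β, F.len n⟩ (nonceQueue (enc x) (enc y)) (simM n xk))
        (I := fun t => t.1.1 = (((n, xk), β), enc x, enc y) ∧ t.2 = (b, some x))
        (fun t => t.1.2)
        (fun t q ht o ho => by
          obtain ⟨o', ho', rfl⟩ := (PMF.mem_support_map_iff _ _ _).1 ho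
          obtain ⟨o'', -, rfl⟩ := (PMF.mem_support_map_iff _ _ _).1 ho'
          exact ht)
        (fun t q ht => by
          obtain ⟨⟨t1, t2⟩, t3⟩ := t
          obtain ⟨rfl, rfl⟩ := ht
          simp only [κ, guessHandler, PMF.map_comp]
          exact PMF.map_id _) C.program
        (s := (((((n, xk), β), enc x, enc y), (coreInit, P), .nil), b, some x)) ⟨rfl, rfl⟩
      simp only at hproj
      rw [← hproj, PMF.map_comp]
      refine PMF.map_congr_support fun o ho => ?_
      obtain ⟨h1, h2⟩ := hinv o ho
      simp only [Function.comp, guessPost, h1, h2]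
      rfl
    · rintro m t q hq ht
      constructor
      · refine ((hH (q, t.1) _ (F.oracle n sk) t.2).mono (Nat.pow_le_pow_left ?_ kH)).congr ?_
        · have h1 := ht.size_le hn hreach
          have h2 := ht.le
          simp only [sz_pair, sz_data]
          rw [size_enc] at h1
          omega
        · simp only [κ, PMF.map_comp]
          rfl
      · intro o ho
        obtain ⟨o', ho', rfl⟩ := (PMF.mem_support_map_iff _ _ _).1 ho
        exact ht.step hn hreach hq ho'
    · rintro y t hy ⟨m, ht⟩
      refine (hPost (y, t.1) _ (F.oracle n sk) t.2).mono (Nat.pow_le_pow_left ?_ kP)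
      have h1 := ht.size_le hn hreach
      simp only [sz_pair, sz_data]
      rw [size_enc] at h1
      omega

/-! ### The reduction to the message authentication code -/

/-- The state of the handler of the reduction to the message authentication code: the parameters, the
state of the layer and the state of the simulator of the pseudorandom function. -/
abbrev ForgeState : Type := SimStatic × Data × Data

/-- The handler of the reduction to the message authentication code, with the MAC oracles `stepM`. -/
noncomputable def forgeHandler {σ : Type} (len : ℕ → ℕ)
    (simF : ℕ → Data → Data → Data → PMF (Data × Data)) (stepM : σ → Data → PMF (Data × σ))
    (t : ForgeState × σ) (q : Data) : PMF (Data × ForgeState × σ) :=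
  (coreStep ⟨true, t.1.1.2, len t.1.1.1.1⟩ (nonceVia (len t.1.1.1.1) (simF t.1.1.1.1 t.1.1.1.2)) stepM
    (t.1.2, t.2) q).map fun o => (o.1, (t.1.1, o.2.1), o.2.2)

theorem PPT.nonceDist {γ : Type} [Enc γ] {l : γ → ℕ} {q : γ → Data} (hl : PolyTime l)
    (hq : PolyTime q) : PPT fun x => _root_.nonceDist (l x) (q x) := by
  have h1 : PolyTime fun x => (q x).snd.fst.fst := by fun_prop
  have h2 : PPT fun x => (_root_.randomBits (l x)).map (enc : List Bool → Data) :=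
    PPT.map (f := fun x => _root_.randomBits (l x)) (g := fun _ r => enc r)
      (PPT.randomBits.precomp hl) (by fun_prop)
  have h3 : PolyTime fun x => CoreParams.isDec (q x) := by fun_prop
  exact PPT.cond h3 h1 h2

theorem size_nonceDist_le {l : ℕ} {q r : Data} (hr : r ∈ (nonceDist l q).support) :
    r.size ≤ q.size + 2 * l := by
  unfold nonceDist at hr
  cases h : CoreParams.isDec q
  · rw [h, cond_false, PMF.mem_support_map_iff] at hr
    obtain ⟨x, hx, rfl⟩ := hr
    have := Data.size_bits_le (length_of_mem_randomBits hx)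
    omega
  · rw [h, cond_true, PMF.mem_support_pure_iff] at hr
    have h2 := q.size_snd_le
    have h3 := q.snd.size_fst_le
    have h4 := q.snd.fst.size_fst_le
    rw [hr]
    omega

section Forge

variable {len : ℕ → ℕ} {simF : ℕ → Data → Data → Data → PMF (Data × Data)}

/-- The parameters of the layer. -/
def forgeParams (len : ℕ → ℕ) (i : Data × ForgeState) : CoreParams :=
  ⟨true, i.2.1.2, len i.2.1.1.1⟩

/-- The query of the handler to the MAC oracles, with the data for computing the reply: the nonce, the
value of the pseudorandom function and the next state of its simulator. -/
noncomputable def forgeAsk (len : ℕ → ℕ) (simF : ℕ → Data → Data → Data → PMF (Data × Data))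
    (i : Data × ForgeState) : PMF (Data × (Data × ForgeState) × Data × Data × Data) :=
  (nonceDist (len i.2.1.1.1) i.1).bind fun r =>
    (simF i.2.1.1.1 i.2.1.1.2 i.2.2.2 (.cons .nil r)).map fun v =>
      ((forgeParams len i).pre i.2.2.1 i.1 r v.1, (i, r, v))

/-- The reply of the handler and its next state, given the answer of the MAC oracles. -/
def forgeReply (len : ℕ → ℕ) (j : Data × (Data × ForgeState) × Data × Data × Data) :
    Data × ForgeState :=
  ((forgeParams len j.2.1).reply j.2.1.2.2.1 j.2.1.1 j.2.2.1 j.2.2.2.1 j.1, (j.2.1.2.1,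
    ((forgeParams len j.2.1).next j.2.1.2.2.1 j.2.1.1 j.2.2.1 j.2.2.2.1 j.1, j.2.2.2.2)))

@[fun_prop] theorem polyTime_forgeParams (hlen : PolyTime len) : PolyTime (forgeParams len) := by
  unfold forgeParams
  fun_prop

theorem ppt_forgeAsk (hlen : PolyTime len)
    (hsim : PPT fun i : ℕ × Data × Data × Data => simF i.1 i.2.1 i.2.2.1 i.2.2.2) :
    PPT (forgeAsk len simF) := by
  have h0 : PPT fun i : Data × ForgeState => nonceDist (len i.2.1.1.1) i.1 :=
    PPT.nonceDist (by fun_prop) (by fun_prop)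
  have h1 : PPT fun i : (Data × ForgeState) × Data =>
      simF i.1.2.1.1.1 i.1.2.1.1.2 i.1.2.2.2 (.cons .nil i.2) :=
    hsim.precomp (f := fun i : (Data × ForgeState) × Data =>
      (i.1.2.1.1.1, i.1.2.1.1.2, i.1.2.2.2, Data.cons .nil i.2)) (by fun_prop)
  have h2 : PolyTime fun i : ((Data × ForgeState) × Data) × Data × Data =>
      ((forgeParams len i.1.1).pre i.1.1.2.2.1 i.1.1.1 i.1.2 i.2.1, (i.1.1, i.1.2, i.2)) := by
    have := polyTime_forgeParams hlen
    fun_prop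
  have h3 : PPT fun i : (Data × ForgeState) × Data =>
      (simF i.1.2.1.1.1 i.1.2.1.1.2 i.1.2.2.2 (.cons .nil i.2)).map fun v =>
        ((forgeParams len i.1).pre i.1.2.2.1 i.1.1 i.2 v.1, (i.1, i.2, v)) := PPT.map h1 h2
  have h4 : PPT fun i : Data × ForgeState => (nonceDist (len i.2.1.1.1) i.1).bind fun r =>
    (simF i.2.1.1.1 i.2.1.1.2 i.2.2.2 (.cons .nil r)).map fun v =>
      ((forgeParams len i).pre i.2.2.1 i.1 r v.1, (i, r, v)) := PPT.bind h0 h3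
  exact h4

theorem polyTime_forgeReply (hlen : PolyTime len) : PolyTime (forgeReply len) := by
  have := polyTime_forgeParams hlen
  unfold forgeReply
  fun_prop

theorem forgeHandler_eq {σ : Type} (stepM : σ → Data → PMF (Data × σ)) (t : ForgeState) (e : σ)
    (q : Data) : forgeHandler len simF stepM (t, e) q =
      (forgeAsk len simF (q, t)).bind fun i => (stepM e i.1).map fun o =>
        ((forgeReply len (o.1, i.2)).1, (forgeReply len (o.1, i.2)).2, o.2) := by
  simp only [forgeHandler, coreStep, nonceVia, forgeAsk, forgeReply, forgeParams, PMF.bind_bind,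
    PMF.bind_map, PMF.map_bind, PMF.map_comp, Function.comp_def]

theorem exists_forgeHandler (hlen : PolyTime len)
    (hsim : PPT fun i : ℕ × Data × Data × Data => simF i.1 i.2.1 i.2.2.1 i.2.2.2) :
    ∃ (H : Prog) (k : ℕ), ∀ (q : Data) (t : ForgeState) (σ : Type) (stepM : σ → Data → PMF (Data × σ))
      (e : σ) (b : ℕ),
      (∀ r ∈ (nonceDist (len t.1.1.1) q).support, ∀ v, ∀ o ∈ (stepM e
        (CoreParams.pre ⟨true, t.1.2, len t.1.1.1⟩ t.2.1 q r v)).support, o.1.size ≤ b) →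
      Prog.Runs stepM (Prog.on H (enc (q, t))) e ((sz (q, t) + b + 2) ^ k)
        ((forgeHandler len simF stepM (t, e) q).map fun o => (enc (o.1, o.2.1), o.2.2)) := by
  obtain ⟨H, k, hH⟩ := exists_ask_prog (ppt_forgeAsk hlen hsim) (polyTime_forgeReply hlen).ppt
  refine ⟨H, k, fun q t σ stepM e b hb => (hH (q, t) σ stepM e b ?_).congr ?_⟩
  · intro i hi o ho
    simp only [forgeAsk, PMF.mem_support_bind_iff, PMF.mem_support_map_iff] at hi
    obtain ⟨r, hr, v, -, rfl⟩ := hi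
    exact hb r hr v.1 o ho
  · simp only [forgeHandler_eq, PMF.map_bind, PMF.map_comp, PMF.pure_map]
    rfl

/-- Sizes occurring in the reduction, in terms of a common bound `N` of the sizes of its parameters:
`R` bounds the represented bit strings. -/
structure ForgeBounds (len : ℕ → ℕ) (k kM : ℕ) where
  R : ℕ → ℕ
  polyR : PolyBounded R
  len_le : ∀ n N, n ≤ N → 2 * len n + 2 ≤ R N

variable {k kM : ℕ}

namespace ForgeBounds

variable (b : ForgeBounds len k kM) (N : ℕ)

/-- Total size of the queries to the simulator. -/
def J : ℕ := b.R N * N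

/-- Size of the answers of the MAC oracles. -/
def A : ℕ := (N + (7 * N + 2 * b.R N + 10) + 2) ^ kM

/-- Size of the states of the handler. -/
def S : ℕ := N + (b.R N + b.A N + 30) * (N + 1) + (N + b.J N + 2) ^ k + 20

theorem polyS : PolyBounded b.S := by
  have := b.polyR
  unfold S A J
  fun_prop

theorem polyA : PolyBounded b.A := by
  have := b.polyR
  unfold A
  fun_prop

end ForgeBounds

theorem nonempty_forgeBounds (hlen : PolyTime len) (k kM : ℕ) :
    Nonempty (ForgeBounds len k kM) := by
  obtain ⟨kl, hkl⟩ := hlen.size_le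
  simp only [sz_nat] at hkl
  refine ⟨⟨fun N => 2 * (N + 2) ^ kl + 2, by fun_prop, fun n N hn => ?_⟩⟩
  have := (hkl n).trans (Nat.pow_le_pow_left (show n + 2 ≤ N + 2 by omega) kl)
  omega

/-- The invariant of the handler, with `m` the remaining total size of queries. -/
structure ForgeInv (simF : ℕ → Data → Data → Data → PMF (Data × Data)) (b : ForgeBounds len k kM)
    (n : ℕ) (xk : Data) (N m : ℕ) (t : ForgeState) : Prop where
  params : t.1.1 = (n, xk)
  le : m ≤ N
  w_le : t.2.1.size + (b.R N + b.A N + 30) * m ≤ (b.R N + b.A N + 30) * (N + 1)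
  reaches : ∃ j, WMScheme.Reaches (simF n xk) j t.2.2 ∧ j + b.R N * m ≤ b.J N

variable {b : ForgeBounds len k kM} {n : ℕ} {xk : Data} {N m : ℕ} {t : ForgeState}

theorem ForgeInv.size_le (h : ForgeInv simF b n xk N m t) (hn : n + xk.size ≤ N)
    (hreach : ∀ m s, WMScheme.Reaches (simF n xk) m s → s.size ≤ (n + m + 2) ^ k) :
    (enc t : Data).size ≤ b.S N := by
  obtain ⟨h6, hm, h2, j, hj, hle⟩ := h
  have h1 : t.2.2.size ≤ (N + b.J N + 2) ^ k := by
    refine (hreach j _ hj).trans (Nat.pow_le_pow_left ?_ k)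
    have := Nat.zero_le (b.R N * m)
    omega
  obtain ⟨⟨⟨n', xk'⟩, β⟩, w, sF⟩ := t
  simp only [Prod.mk.injEq] at h6
  obtain ⟨rfl, rfl⟩ := h6
  have h7 := sz_bool_le β
  simp only [size_enc, sz_pair, sz_nat, sz_data, ForgeBounds.S]
  simp only at h1 h2
  have := Nat.zero_le ((b.R N + b.A N + 30) * m)
  omega

theorem size_forge_answer_le {M : WMAC} {sk : Data} (hn : n ≤ N)
    (hM : ∀ s q, ∀ o ∈ (M.oracle n sk s q).support, o.1.size ≤ (n + q.size + 2) ^ kM)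
    (b : ForgeBounds len k kM) {s : List (List Bool × Data)} {β : Bool} {w q r v : Data}
    (hq : q.size ≤ N) (hr : r ∈ (nonceDist (len n) q).support) {o : Data × List (List Bool × Data)}
    (ho : o ∈ (M.oracle n sk s (CoreParams.pre ⟨true, β, len n⟩ w q r v)).support) :
    o.1.size ≤ b.A N := by
  refine (hM _ _ o ho).trans (Nat.pow_le_pow_left ?_ kM)
  have h1 := CoreParams.size_pre_le ⟨true, β, len n⟩ w q r v
  have h2 := size_nonceDist_le hr
  have h3 := b.len_le n N hn
  omega

theorem ForgeInv.step {M : WMAC} {sk : Data} {s : List (List Bool × Data)}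
    (h : ForgeInv simF b n xk N m t) (hn : n + xk.size ≤ N)
    (hM : ∀ s q, ∀ o ∈ (M.oracle n sk s q).support, o.1.size ≤ (n + q.size + 2) ^ kM) {q : Data}
    (hq : q.size + 1 ≤ m) {o : Data × ForgeState × List (List Bool × Data)}
    (ho : o ∈ (forgeHandler len simF (M.oracle n sk) (t, s) q).support) :
    ForgeInv simF b n xk N (m - (q.size + 1)) o.2.1 := by
  obtain ⟨h6, hm, h2, j, hj, hle⟩ := h
  obtain ⟨⟨⟨n', xk'⟩, β⟩, w, sF⟩ := t
  simp only [Prod.mk.injEq] at h6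
  obtain ⟨rfl, rfl⟩ := h6
  simp only at h2 hj
  simp only [forgeHandler, coreStep, nonceVia, PMF.map_bind, PMF.map_comp, PMF.bind_bind,
    PMF.bind_map, PMF.mem_support_bind_iff, PMF.mem_support_map_iff, Function.comp] at ho
  obtain ⟨r, hr, v, hv, a, ha, rfl⟩ := ho
  have hr' := size_nonceDist_le hr
  have hl := b.len_le n' N (by omega)
  have hA := size_forge_answer_le (N := N) (by omega) hM b (by omega) hr ha
  have hnext := CoreParams.size_next_le ⟨true, β, len n'⟩ w q r v.1 a.1
  obtain ⟨i, rfl⟩ : ∃ i, m = i + (q.size + 1) := ⟨m - (q.size + 1), by omega⟩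
  rw [Nat.add_sub_cancel]
  refine ⟨rfl, by omega, ?_, ⟨_, hj.next hv, ?_⟩⟩
  · rw [Nat.mul_add] at h2
    have e3 : (b.R N + b.A N + 30) * (q.size + 1) =
      (b.R N + b.A N + 30) * q.size + (b.R N + b.A N + 30) := by ring
    have e4 : 30 * q.size ≤ (b.R N + b.A N + 30) * q.size := Nat.mul_le_mul_right _ (by omega)
    simp only
    omega
  · rw [Nat.mul_add] at hle
    have e3 : b.R N * (q.size + 1) = b.R N * q.size + b.R N := by ring
    have e4 : 2 * q.size ≤ b.R N * q.size := Nat.mul_le_mul_right _ (by omega)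
    simp only [Data.size_cons, Data.size_nil]
    omega

end Forge

/-- The initial states of the handler. -/
noncomputable def forgeInit (n : ℕ) (xk : Data) : PMF ForgeState :=
  OComp.fairCoin.map fun β => (((n, xk), β), coreInit, .nil)

/-- The reduction to the message authentication code: a transformation of programs, which depends on
the length of the given program and otherwise uses it as a black box. -/
theorem exists_forge_reduction (M : WMAC) {len : ℕ → ℕ} (hlen : PolyTime len)
    {simF : ℕ → Data → Data → Data → PMF (Data × Data)}
    (hsim : PPT fun i : ℕ × Data × Data × Data => simF i.1 i.2.1 i.2.2.1 i.2.2.2) (k kM : ℕ) :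
    ∃ R : ℕ → Data → Data → Data, PolyTime (fun i : ℕ × Data × Data => R i.1 i.2.1 i.2.2) ∧
      (∀ n xk C C', C.size = C'.size → C.program.Equiv C'.program →
        (R n xk C).size = (R n xk C').size ∧ (R n xk C).program.Equiv (R n xk C').program) ∧
      ∀ n sk xk, (∀ m s, WMScheme.Reaches (simF n xk) m s → s.size ≤ (n + m + 2) ^ k) →
        (∀ s q, ∀ o ∈ (M.oracle n sk s q).support, o.1.size ≤ (n + q.size + 2) ^ kM) →
        ∀ C : Data, (R n xk C).program.run (M.oracle n sk) [] =
            forgeRun M n sk (len n) (simF n xk) C.program := by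
  obtain ⟨fb⟩ := nonempty_forgeBounds hlen k kM
  obtain ⟨H, kH, hH⟩ := exists_forgeHandler hlen hsim
  have hsetup : PPT fun i : ℕ × Data => (forgeInit i.1 i.2).map fun s => Data.cons H.encode (enc s) := by
    have := PPT.map (f := fun _ : ℕ × Data => OComp.fairCoin) (g := fun i β =>
      Data.cons H.encode (enc ((((i.1, i.2), β), coreInit, Data.nil) : ForgeState)))
      ppt_fairCoin (by fun_prop)
    refine this.of_map_enc fun i => ?_
    simp only [forgeInit, PMF.map_comp, Function.comp_def]
  have hpost : PolyTime fun o : Data × ForgeState => o.2.2.1.snd.snd := by fun_prop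
  obtain ⟨Setup, kS, hSetup⟩ := hsetup.computes
  obtain ⟨Post, kP, hPost⟩ := hpost.runs
  have hpS := fb.polyS
  have hpA := fb.polyA
  obtain ⟨kT, hkT⟩ : PolyBounded fun N => N + (N + 10) + (N + 1 + 2) ^ kS +
      (N + (N * (N + fb.S N + 1 + fb.A N + 2) ^ kH + N + fb.S N + 1) + 1) +
        (N + fb.S N + 1 + 2) ^ kP + 10 := by
    fun_prop
  refine ⟨fun n xk C => .cons (Prog.wrap Setup Post (enc (n, xk)) C).encode
    (.unary ((n + xk.size + C.size + 2) ^ kT)), ?_, ?_, ?_⟩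
  · have : PolyTime fun i : ℕ × Data × Data =>
        (enc ((i.1 + i.2.1.size + i.2.2.size + 2) ^ kT) : Data) := by fun_prop
    exact PolyTime.dataCons (by fun_prop) this
  · intro n xk C C' hs he
    refine ⟨?_, ?_⟩
    · simp [Prog.wrap, Prog.encode, hs]
    · simp only [Data.program, Data.fst_cons, Data.snd_cons, Prog.decode_encode, hs]
      exact Prog.wrap_equiv hs he _ _ _ _ _
  · intro n sk xk hreach hM C
    generalize hN : n + xk.size + C.size = N
    have hn : n + xk.size ≤ N := by omega
    have hC : C.snd.size ≤ C.size := C.size_snd_le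
    have hrun := Prog.runs_wrap (step := M.oracle n sk) (x := .nil) (C := C)
      (params := enc (n, xk)) (e := []) (H := H) (Post := Post) (Setup := Setup)
      (ν := (forgeInit n xk).map fun s => (s, []))
      (ψ := fun t : ForgeState × List (List Bool × Data) => (enc t.1, t.2))
      (I := fun m t => ForgeInv simF fb n xk N m t.1) (κ := forgeHandler len simF (M.oracle n sk))
      (post := fun o => o.2.1.2.1.snd.snd)
      (B := (N + fb.S N + 1 + fb.A N + 2) ^ kH) (S := fb.S N) (B₁ := (N + fb.S N + 1 + 2) ^ kP)
      (((hSetup (n, xk) _ (M.oracle n sk) []).congr (by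
        rw [PMF.map_comp, PMF.map_comp]; rfl)))
      ?_ ?_ (fun m t ht => ht.size_le hn hreach) ?_
    · have hle := hkT N
      have hclock : (Prog.clocked ((N + 2) ^ kT) (Prog.wrap Setup Post (enc (n, xk)) C)
          .nil).run (M.oracle n sk) [] = _ := hrun.clocked (by
        refine le_trans ?_ hle
        simp only [size_enc, sz_pair, sz_nat, sz_data]
        have hh : C.snd.size * (N + fb.S N + 1 + fb.A N + 2) ^ kH ≤
            N * (N + fb.S N + 1 + fb.A N + 2) ^ kH := Nat.mul_le_mul_right _ (by omega)
        have hh2 : (n + xk.size + 1 + 2) ^ kS ≤ (N + 1 + 2) ^ kS :=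
          Nat.pow_le_pow_left (by omega) _
        omega)
      have hprog : (Data.cons (Prog.wrap Setup Post (enc (n, xk)) C).encode
          (.unary ((N + 2) ^ kT))).program = Prog.clocked ((N + 2) ^ kT)
            (Prog.wrap Setup Post (enc (n, xk)) C) .nil := by
        simp only [Data.program, Data.fst_cons, Data.snd_cons, Prog.decode_encode, Data.size_unary]
      beta_reduce
      rw [hN, hprog, hclock, forgeInit, forgeRun]
      simp only [PMF.map_comp, PMF.bind_map, Function.comp_def]
      congr 1; funext β
      have hproj := OComp.run_project (step := forgeHandler len simF (M.oracle n sk))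
        (step' := coreStep ⟨true, β, len n⟩ (nonceVia (len n) (simF n xk)) (M.oracle n sk))
        (I := fun t => t.1.1 = ((n, xk), β))
        (fun t => (t.1.2, t.2))
        (fun t q ht o ho => by
          obtain ⟨o', ho', rfl⟩ := (PMF.mem_support_map_iff _ _ _).1 ho
          exact ht)
        (fun t q ht => by
          obtain ⟨⟨t1, t2⟩, t3⟩ := t
          obtain rfl := ht
          simp only [forgeHandler, PMF.map_comp]
          exact PMF.map_id _) C.program
        (s := ((((n, xk), β), (coreInit, .nil)), [])) rfl
      simp only at hproj
      rw [← hproj, PMF.map_comp]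
      rfl
    · intro t ht
      simp only [forgeInit, PMF.mem_support_map_iff] at ht
      obtain ⟨_, ⟨β, -, rfl⟩, rfl⟩ := ht
      refine ⟨rfl, by omega, ?_, 0, .start, ?_⟩
      · have h7 : (fb.R N + fb.A N + 30) * C.snd.size ≤ (fb.R N + fb.A N + 30) * N :=
          Nat.mul_le_mul_left _ (by omega)
        simp only [coreInit, Data.size_cons, Data.size_nil]
        rw [Nat.mul_succ]
        omega
      · rw [zero_add]
        exact Nat.mul_le_mul_left _ (by omega)
    · rintro m ⟨t, s⟩ q hq ht
      have h2 := ht.le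
      constructor
      · refine ((hH q t _ (M.oracle n sk) s (fb.A N) ?_).mono (Nat.pow_le_pow_left ?_ kH)).congr ?_
        · obtain ⟨⟨⟨n', xk'⟩, β⟩, w, sF⟩ := t
          obtain ⟨h6, -⟩ := ht
          simp only [Prod.mk.injEq] at h6
          obtain ⟨rfl, rfl⟩ := h6
          intro r hr v o ho
          exact size_forge_answer_le (by omega) hM fb (by omega) hr ho
        · have h1 := ht.size_le hn hreach
          simp only [sz_pair, sz_data]
          rw [size_enc] at h1
          dsimp only at h1
          omega
        · rfl
      · intro o ho
        exact ht.step hn hM hq ho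
    · rintro y t hy ⟨m, ht⟩
      refine (hPost (y, t.1) _ (M.oracle n sk) t.2).mono (Nat.pow_le_pow_left ?_ kP)
      have h1 := ht.size_le hn hreach
      simp only [sz_pair, sz_data]
      rw [size_enc] at h1
      omega

/-! ### The two reductions and the advantage in the CCA2 game -/

theorem Data.size_enc_of_toBits {d : Data} {m : List Bool} (h : d.toBits = some m) :
    sz m = d.size := by
  rw [Data.toBits_eq_some.1 h, size_enc]

theorem Keys.sz_eq (K : Keys) : sz K = K.sk.size + (K.mk.size + K.xk.size + 1) + 1 := rfl

theorem PPT.sampleable_data {α : Type} [Enc α] {f : α → PMF Data} (h : PPT f) (a : α) :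
    Sampleable (f a) := by
  have := h.sampleable a
  change Sampleable ((f a).map _root_.id) at this
  rwa [PMF.map_id] at this

/-- The replies of the MAC oracles have polynomial size. -/
theorem exists_size_oracle_le (M : WMAC) (hsetup : PPT M.setup)
    (hsign : PPT fun i : ℕ × Data × List Bool => M.sign i.1 i.2.1 i.2.2) :
    ∃ k, ∀ n, ∀ L ∈ (M.setup n).support, ∀ s q, ∀ o ∈ (M.oracle n L.sk s q).support,
      o.1.size ≤ (n + q.size + 2) ^ k := by
  obtain ⟨k₁, h₁⟩ := hsetup.size_le
  obtain ⟨k₂, h₂⟩ := hsign.size_le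
  obtain ⟨k, hk⟩ : PolyBounded fun N => (N + ((N + 2) ^ k₁ + N) + 10) ^ k₂ + 3 := by fun_prop
  refine ⟨k, fun n L hL s q o ho => ?_⟩
  have h3 := h₁ n L hL
  rw [Keys.sz_eq, sz_nat] at h3
  have hsk : L.sk.size ≤ (n + q.size + 2) ^ k₁ :=
    le_trans (by omega) (h3.trans (Nat.pow_le_pow_left (by omega) _))
  have hdef := hk (n + q.size)
  refine le_trans ?_ hdef
  have hsz : ∀ (d : Data) m, q.size = d.size + 1 → d.toBits = some m → ∀ σ ∈ (M.sign n L.sk m).support,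
      (enc (some σ) : Data).size ≤
        ((n + q.size) + ((n + q.size + 2) ^ k₁ + (n + q.size)) + 10) ^ k₂ + 3 := by
    intro d m hd hm σ hσ
    have h4 := h₂ (n, L.sk, m) σ hσ
    have h5 := Data.size_enc_of_toBits hm
    simp only [sz_pair, sz_data, sz_nat, h5] at h4
    have h6 := h4.trans (Nat.pow_le_pow_left
      (show _ ≤ (n + q.size) + ((n + q.size + 2) ^ k₁ + (n + q.size)) + 10 by omega) k₂)
    simp only [enc_some, Data.size_cons, Data.size_nil, enc_data]
    omega
  simp only [WMAC.oracle, WMAC.game] at ho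
  split at ho
  · rename_i d
    split at ho
    · rename_i m hm
      split_ifs at ho
      · obtain ⟨σ, hσ, rfl⟩ := (PMF.mem_support_map_iff _ _ _).1 ho
        exact hsz d m (by simp) hm σ hσ
      · rw [PMF.mem_support_pure_iff] at ho
        simp [ho]
    · rw [PMF.mem_support_pure_iff] at ho
      simp [ho]
  · rename_i d σ
    rw [PMF.mem_support_pure_iff] at ho
    rw [ho]
    cases hd : d.toBits with
    | none => simp
    | some m =>
      have := Data.size_bit_le (M.verify n L.sk m σ)
      dsimp only
      omega
  · rw [PMF.mem_support_pure_iff] at ho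
    simp [ho]

/-- A player of the weak pseudorandomness game whose guess does not depend on the hidden bit `b`
except through the distribution `μ b`. -/
theorem WPRF.winProb_eq (F : WPRF) (n : ℕ) (sk : Data) {c : OComp Data} {μ : Bool → PMF Bool}
    (h : ∀ b, (c.run (F.oracle n sk) (b, none)).map (fun o => (o.1, o.2.1)) =
      (μ b).map fun g => (.bit g, b)) :
    (F.game n sk).winProb c =
      (Pr (μ false) (fun g => g = false) + Pr (μ true) (fun g => g = true)) / 2 := by
  have h1 : (F.game n sk).winProb c = Pr (OComp.fairCoin.bind fun b =>
      c.run (F.oracle n sk) (b, none)) fun o => o.1 = .bit o.2.1 := by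
    rw [show (OComp.fairCoin.bind fun b => c.run (F.oracle n sk) (b, none)) =
      (OComp.fairCoin.map fun b => ((b, none) : Bool × Option (List Bool))).bind
        fun s => c.run (F.oracle n sk) s by rw [PMF.bind_map]; rfl]
    rfl
  have h2 : ∀ b, Pr (c.run (F.oracle n sk) (b, none)) (fun o => o.1 = .bit o.2.1) =
      Pr (μ b) fun g => g = b := fun b => by
    have := congrArg (fun ν => Pr ν fun o : Data × Bool => o.1 = .bit o.2) (h b)
    simp only [Pr_map] at this
    rw [this]
    refine Pr_congr fun g _ => ?_
    cases g <;> cases b <;> simp [Data.bit]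
  rw [h1, Pr_coin, h2, h2]

/-- `R₁` and `R₂` are black-box transformations of programs, and together the transformed programs
have the advantage of the given one in the CCA2 game. -/
structure Reductions (F : WPRF) (M : WMAC) (R₁ R₂ : ℕ → (xk C : Data) → Data) : Prop where
  poly₁ : PolyTime fun i : ℕ × Data × Data => R₁ i.1 i.2.1 i.2.2
  poly₂ : PolyTime fun i : ℕ × Data × Data => R₂ i.1 i.2.1 i.2.2
  equiv₁ : ∀ n xk C C', C.size = C'.size → C.program.Equiv C'.program →
    (R₁ n xk C).size = (R₁ n xk C').size ∧ (R₁ n xk C).program.Equiv (R₁ n xk C').program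
  equiv₂ : ∀ n xk C C', C.size = C'.size → C.program.Equiv C'.program →
    (R₂ n xk C).size = (R₂ n xk C').size ∧ (R₂ n xk C).program.Equiv (R₂ n xk C').program
  advantage : ∀ n, ∀ K ∈ (F.setup n).support, ∀ L ∈ (M.setup n).support, ∀ C : Data,
    ((encryptThenMAC F M R₁ R₂).game n (.cons K.sk L.sk)).winProb C.program - 1 / 2 ≤
      2 * ((F.game n K.sk).winProb (R₁ n L.xk C).program - 1 / 2) +
        (M.game n L.sk).winProb (R₂ n K.xk C).program

/-- Both simulators from the extraction keys are perfect, so that the bound of the advantage holds for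
each pair of keys.  The number of queries of a program is bounded by its size. -/
theorem exists_reductions {𝔐 : AdvModel} {q : Collusion} {F : WPRF} {M : WMAC}
    (hF : F.IsSecure 𝔐 q) (hM : M.IsSecure 𝔐 q)
    (hMsgs : ∀ (n : ℕ) (m : List Bool), m.length = 2 * F.len n → m ∈ M.Msgs n) :
    ∃ R₁ R₂, Reductions F M R₁ R₂ := by
  obtain ⟨simF, kF, hsimF, hF'⟩ := hF.watermarkable.key_simulates
  obtain ⟨simM, k', hsimM, hM'⟩ := hM.watermarkable.key_simulates
  obtain ⟨kM, hkM⟩ := exists_size_oracle_le M hM.watermarkable.setup_ppt hM.sign_ppt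
  obtain ⟨R₁, hp₁, he₁, h₁⟩ := exists_guess_reduction F hF.len_polyTime hsimM k'
  obtain ⟨R₂, hp₂, he₂, h₂⟩ := exists_forge_reduction M hF.len_polyTime hsimF kF kM
  refine ⟨R₁, R₂, hp₁, hp₂, he₁, he₂, fun n K hK L hL C => ?_⟩
  have hw₁ := F.winProb_eq n K.sk (h₁ n K.sk L.xk (hM' n L hL).1 C)
  have hw₂ : (M.game n L.sk).winProb (R₂ n K.xk C).program =
      Pr (forgeRun M n L.sk (F.len n) (simF n K.xk) C.program) (M.Forges n L.sk) := by
    rw [← h₂ n L.sk K.xk (hF' n K hK).1 (hkM n L hL) C,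
      ← PMF.pure_bind [] ((R₂ n K.xk C).program.run (M.oracle n L.sk))]
    rfl
  have hsign := fun m => hM.sign_ppt.sampleable_data (n, L.sk, m)
  have h := winProb_encryptThenMAC_le (hF.len_pos n) (hMsgs n) (hF' n K hK).2 (hM' n L hL).2 hsign
    R₁ R₂ ((Data.queryBound_program C).mono C.size_snd_le)
  rw [hw₁, hw₂]
  have e0 : F.challenge n K.sk false = fun x => PMF.pure (F.eval n K.sk x) := rfl
  have e1 : F.challenge n K.sk true = fun _ => randomBits (F.len n) := rfl
  rw [e0, e1]
  linarith

/-- If both transformed programs had an advantage below `1/(8a)`, that of the given program would be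
below `3/(8a)`. -/
theorem Reductions.areReductions {F : WPRF} {M : WMAC} {R₁ R₂ : ℕ → (xk C : Data) → Data}
    (h : Reductions F M R₁ R₂) : AreReductions F M R₁ R₂ := by
  intro n K hK L hL C a ha hgood
  by_contra! hcon
  have ha' : (0 : ℝ) < a := by exact_mod_cast ha
  have h1 := h.advantage n K hK L hL C
  simp only [Game.Good, not_le] at hgood hcon
  have h2 : (1 : ℝ) / (8 * a) = 1 / a / 8 := by rw [div_div, mul_comm]
  have h3 : (0 : ℝ) < 1 / a := by positivity
  rw [h2] at hcon
  linarith [hcon.1, hcon.2]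

/-! ### The algorithms of the encrypt-then-MAC scheme -/

namespace Negligible

variable {f g : ℕ → ℝ}

theorem add (hf : Negligible f) (hg : Negligible g) : Negligible fun n => f n + g n :=
  Asymptotics.SuperpolynomialDecay.add hf hg

theorem const_mul (hf : Negligible f) (c : ℝ) : Negligible fun n => c * f n :=
  Asymptotics.SuperpolynomialDecay.const_mul hf c

theorem of_le (hf : Negligible f) (h0 : ∀ n, 0 ≤ g n) (h : ∀ n, g n ≤ f n) : Negligible g :=
  Asymptotics.SuperpolynomialDecay.trans_abs_le hf fun n => by
    rw [abs_of_nonneg (h0 n)]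
    exact (h n).trans (le_abs_self _)

theorem abs (hf : Negligible f) : Negligible fun n => |f n| :=
  Asymptotics.SuperpolynomialDecay.trans_abs_le hf fun n => (abs_abs (f n)).le

end Negligible

theorem Pr_and_ge {α : Type} {μ : PMF α} {E E' : α → Prop} {x y : ℝ} (h : 1 - x ≤ Pr μ E)
    (h' : 1 - y ≤ Pr μ E') : 1 - (x + y) ≤ Pr μ fun a => E a ∧ E' a := by
  have h1 := Pr_not (μ := μ) E
  have h2 := Pr_not (μ := μ) E'
  have h3 := Pr_not (μ := μ) fun a => E a ∧ E' a
  have h4 : Pr μ (fun a => ¬ (E a ∧ E' a)) ≤ Pr μ fun a => ¬ E a ∨ ¬ E' a :=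
    Pr_mono fun a _ h => not_and_or.1 h
  have h5 := Pr_or_le (μ := μ) (fun a => ¬ E a) fun a => ¬ E' a
  linarith

section Keys

variable {γ : Type} [Enc γ]

@[fun_prop] theorem PolyTime.keysSk {f : γ → Keys} (hf : PolyTime f) : PolyTime fun x => (f x).sk :=
  PolyTime.comp (f := fun i : Data × Data × Data => i.1) (by fun_prop)
    (PolyTime.of_enc_eq (g := fun x => ((f x).sk, (f x).mk, (f x).xk)) hf fun _ => rfl)

@[fun_prop] theorem PolyTime.keysMk {f : γ → Keys} (hf : PolyTime f) : PolyTime fun x => (f x).mk :=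
  PolyTime.comp (f := fun i : Data × Data × Data => i.2.1) (by fun_prop)
    (PolyTime.of_enc_eq (g := fun x => ((f x).sk, (f x).mk, (f x).xk)) hf fun _ => rfl)

@[fun_prop] theorem PolyTime.keysXk {f : γ → Keys} (hf : PolyTime f) : PolyTime fun x => (f x).xk :=
  PolyTime.comp (f := fun i : Data × Data × Data => i.2.2) (by fun_prop)
    (PolyTime.of_enc_eq (g := fun x => ((f x).sk, (f x).mk, (f x).xk)) hf fun _ => rfl)

@[fun_prop] theorem PolyTime.keysOfParts {f g h : γ → Data} (hf : PolyTime f) (hg : PolyTime g)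
    (hh : PolyTime h) : PolyTime fun x => Keys.ofParts (f x) (g x) (h x) :=
  PolyTime.of_enc_eq (f := fun x => (f x, g x, h x)) (by fun_prop) fun _ => rfl

end Keys

section Scheme

variable {𝔐 : AdvModel} {q : Collusion} {F : WPRF} {M : WMAC}
  {R₁ R₂ : ℕ → (xk C : Data) → Data}

theorem ppt_encryptThenMAC_setup (hF : PPT F.setup) (hM : PPT M.setup) :
    PPT (encryptThenMAC F M R₁ R₂).setup := by
  have h1 : PPT fun i : ℕ × Keys => M.setup i.1 := hM.precomp (by fun_prop)
  have h2 : PolyTime fun i : (ℕ × Keys) × Keys => Keys.ofParts (.cons i.1.2.sk i.2.sk)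
    (.cons i.1.2.mk i.2.mk) (.cons i.1.2.xk i.2.xk) := by fun_prop
  have h3 : PPT fun i : ℕ × Keys => (M.setup i.1).map fun L => Keys.ofParts (.cons i.2.sk L.sk)
    (.cons i.2.mk L.mk) (.cons i.2.xk L.xk) := PPT.map h1 h2
  have h4 : PPT fun n : ℕ => (F.setup n).bind fun K => (M.setup n).map fun L =>
    Keys.ofParts (.cons K.sk L.sk) (.cons K.mk L.mk) (.cons K.xk L.xk) := PPT.bind hF h3
  exact h4

theorem ppt_encryptThenMAC_mark
    (hF : PPT fun i : ℕ × Data × Data × Data => F.mark i.1 i.2.1 i.2.2.1 i.2.2.2)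
    (hM : PPT fun i : ℕ × Data × Data × Data => M.mark i.1 i.2.1 i.2.2.1 i.2.2.2) :
    PPT fun i : ℕ × Data × Data × Data =>
      (encryptThenMAC F M R₁ R₂).mark i.1 i.2.1 i.2.2.1 i.2.2.2 := by
  have h0 : PPT fun i : ℕ × Data × Data × Data => F.mark i.1 i.2.1.fst i.2.2.1.fst i.2.2.2 :=
    hF.precomp (f := fun i : ℕ × Data × Data × Data => (i.1, i.2.1.fst, i.2.2.1.fst, i.2.2.2))
      (by fun_prop)
  have h1 : PPT fun i : (ℕ × Data × Data × Data) × Data =>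
      M.mark i.1.1 i.1.2.1.snd i.1.2.2.1.snd i.1.2.2.2 :=
    hM.precomp (f := fun i : (ℕ × Data × Data × Data) × Data =>
      (i.1.1, i.1.2.1.snd, i.1.2.2.1.snd, i.1.2.2.2)) (by fun_prop)
  have h2 : PolyTime fun i : ((ℕ × Data × Data × Data) × Data) × Data => Data.cons i.1.2 i.2 := by
    fun_prop
  have h3 : PPT fun i : (ℕ × Data × Data × Data) × Data =>
    (M.mark i.1.1 i.1.2.1.snd i.1.2.2.1.snd i.1.2.2.2).map fun t => Data.cons i.2 t :=
    PPT.map h1 h2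
  have h4 : PPT fun i : ℕ × Data × Data × Data =>
    (F.mark i.1 i.2.1.fst i.2.2.1.fst i.2.2.2).bind fun s =>
      (M.mark i.1 i.2.1.snd i.2.2.1.snd i.2.2.2).map fun t => Data.cons s t := PPT.bind h0 h3
  exact h4

theorem ppt_encryptThenMAC_extract
    (hF : PPT fun i : ℕ × Data × ℕ × Data => F.extract i.1 i.2.1 i.2.2.1 i.2.2.2)
    (hM : PPT fun i : ℕ × Data × ℕ × Data => M.extract i.1 i.2.1 i.2.2.1 i.2.2.2)
    (hR₁ : PolyTime fun i : ℕ × Data × Data => R₁ i.1 i.2.1 i.2.2)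
    (hR₂ : PolyTime fun i : ℕ × Data × Data => R₂ i.1 i.2.1 i.2.2) :
    PPT fun i : ℕ × Data × ℕ × Data =>
      (encryptThenMAC F M R₁ R₂).extract i.1 i.2.1 i.2.2.1 i.2.2.2 := by
  have e1 : PolyTime fun i : ℕ × Data × ℕ × Data => R₁ i.1 i.2.1.snd i.2.2.2 :=
    PolyTime.comp (f := fun i : ℕ × Data × Data => R₁ i.1 i.2.1 i.2.2)
      (g := fun i : ℕ × Data × ℕ × Data => (i.1, i.2.1.snd, i.2.2.2)) hR₁ (by fun_prop)
  have e2 : PolyTime fun i : (ℕ × Data × ℕ × Data) × List Data => R₂ i.1.1 i.1.2.1.fst i.1.2.2.2 :=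
    PolyTime.comp (f := fun i : ℕ × Data × Data => R₂ i.1 i.2.1 i.2.2)
      (g := fun i : (ℕ × Data × ℕ × Data) × List Data => (i.1.1, i.1.2.1.fst, i.1.2.2.2)) hR₂
      (by fun_prop)
  have h0 : PPT fun i : ℕ × Data × ℕ × Data =>
      F.extract i.1 i.2.1.fst (8 * i.2.2.1) (R₁ i.1 i.2.1.snd i.2.2.2) :=
    hF.precomp (f := fun i : ℕ × Data × ℕ × Data =>
      (i.1, i.2.1.fst, 8 * i.2.2.1, R₁ i.1 i.2.1.snd i.2.2.2)) (by fun_prop)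
  have h1 : PPT fun i : (ℕ × Data × ℕ × Data) × List Data =>
      M.extract i.1.1 i.1.2.1.snd (8 * i.1.2.2.1) (R₂ i.1.1 i.1.2.1.fst i.1.2.2.2) :=
    hM.precomp (f := fun i : (ℕ × Data × ℕ × Data) × List Data =>
      (i.1.1, i.1.2.1.snd, 8 * i.1.2.2.1, R₂ i.1.1 i.1.2.1.fst i.1.2.2.2)) (by fun_prop)
  have h2 : PolyTime fun i : ((ℕ × Data × ℕ × Data) × List Data) × List Data => i.1.2 ++ i.2 := by
    fun_prop
  have h3 : PPT fun i : (ℕ × Data × ℕ × Data) × List Data =>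
      (M.extract i.1.1 i.1.2.1.snd (8 * i.1.2.2.1) (R₂ i.1.1 i.1.2.1.fst i.1.2.2.2)).map
        fun l => i.2 ++ l := PPT.map h1 h2
  have h4 : PPT fun i : ℕ × Data × ℕ × Data =>
      (F.extract i.1 i.2.1.fst (8 * i.2.2.1) (R₁ i.1 i.2.1.snd i.2.2.2)).bind fun l₁ =>
        (M.extract i.1 i.2.1.snd (8 * i.2.2.1) (R₂ i.1 i.2.1.fst i.2.2.2)).map
          fun l₂ => l₁ ++ l₂ := PPT.bind h0 h3
  exact h4

theorem ppt_encryptThenMAC_encrypt (hF : F.IsSecure 𝔐 q) (hM : M.IsSecure 𝔐 q) :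
    PPT fun i : ℕ × Data × List Bool => (encryptThenMAC F M R₁ R₂).encrypt i.1 i.2.1 i.2.2 := by
  have hlen := hF.len_polyTime
  have e1 : PolyTime fun i : (ℕ × Data × List Bool) × List Bool => F.eval i.1.1 i.1.2.1.fst i.2 :=
    PolyTime.comp (f := fun i : ℕ × Data × List Bool => F.eval i.1 i.2.1 i.2.2)
      (g := fun i : (ℕ × Data × List Bool) × List Bool => (i.1.1, i.1.2.1.fst, i.2))
      hF.eval_polyTime (by fun_prop)
  have h0 : PPT fun i : ℕ × Data × List Bool => randomBits (F.len i.1) :=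
    PPT.randomBits.precomp (by fun_prop)
  have h1 : PPT fun i : (ℕ × Data × List Bool) × List Bool => M.sign i.1.1 i.1.2.1.snd
      (i.2 ++ xorBits (F.eval i.1.1 i.1.2.1.fst i.2) i.1.2.2) :=
    hM.sign_ppt.precomp (f := fun i : (ℕ × Data × List Bool) × List Bool => (i.1.1, i.1.2.1.snd,
      i.2 ++ xorBits (F.eval i.1.1 i.1.2.1.fst i.2) i.1.2.2)) (by fun_prop)
  have h2 : PolyTime fun i : ((ℕ × Data × List Bool) × List Bool) × Data =>
      (enc ((i.1.2, xorBits (F.eval i.1.1.1 i.1.1.2.1.fst i.1.2) i.1.1.2.2), i.2) : Data) := by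
    have : PolyTime fun i : ((ℕ × Data × List Bool) × List Bool) × Data =>
      F.eval i.1.1.1 i.1.1.2.1.fst i.1.2 := e1.comp (g := fun i : ((ℕ × Data × List Bool) ×
        List Bool) × Data => i.1) (by fun_prop)
    fun_prop
  have h3 : PPT fun i : (ℕ × Data × List Bool) × List Bool => (M.sign i.1.1 i.1.2.1.snd
      (i.2 ++ xorBits (F.eval i.1.1 i.1.2.1.fst i.2) i.1.2.2)).map fun σ =>
        (enc ((i.2, xorBits (F.eval i.1.1 i.1.2.1.fst i.2) i.1.2.2), σ) : Data) := PPT.map h1 h2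
  have h4 : PPT fun i : ℕ × Data × List Bool => (randomBits (F.len i.1)).bind fun r =>
      (M.sign i.1 i.2.1.snd (r ++ xorBits (F.eval i.1 i.2.1.fst r) i.2.2)).map fun σ =>
        (enc ((r, xorBits (F.eval i.1 i.2.1.fst r) i.2.2), σ) : Data) := PPT.bind h0 h3
  exact h4

theorem polyTime_encryptThenMAC_decrypt (hF : F.IsSecure 𝔐 q) (hM : M.IsSecure 𝔐 q) :
    PolyTime fun i : ℕ × Data × Data => (encryptThenMAC F M R₁ R₂).decrypt i.1 i.2.1 i.2.2 := by
  have hlen := hF.len_polyTime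
  have e1 : PolyTime fun i : ℕ × Data × Data => F.eval i.1 i.2.1.fst i.2.2.fst.fst.bits :=
    PolyTime.comp (f := fun i : ℕ × Data × List Bool => F.eval i.1 i.2.1 i.2.2)
      (g := fun i : ℕ × Data × Data => (i.1, i.2.1.fst, i.2.2.fst.fst.bits))
      hF.eval_polyTime (by fun_prop)
  have e2 : PolyTime fun i : ℕ × Data × Data =>
      M.verify i.1 i.2.1.snd (i.2.2.fst.fst.bits ++ i.2.2.fst.snd.bits) i.2.2.snd :=
    PolyTime.comp (f := fun i : ℕ × Data × List Bool × Data => M.verify i.1 i.2.1 i.2.2.1 i.2.2.2)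
      (g := fun i : ℕ × Data × Data =>
        (i.1, i.2.1.snd, i.2.2.fst.fst.bits ++ i.2.2.fst.snd.bits, i.2.2.snd))
      hM.verify_polyTime (by fun_prop)
  have e3 : PolyTime fun i : ℕ × Data × Data =>
      bif (okMsg (F.len i.1) i.2.2.fst.fst && okMsg (F.len i.1) i.2.2.fst.snd) &&
        M.verify i.1 i.2.1.snd (i.2.2.fst.fst.bits ++ i.2.2.fst.snd.bits) i.2.2.snd then
        some (xorBits (F.eval i.1 i.2.1.fst i.2.2.fst.fst.bits) i.2.2.fst.snd.bits) else none := by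
    fun_prop
  refine PolyTime.of_enc_eq e3 fun i => ?_
  obtain ⟨n, sk, d⟩ := i
  dsimp only
  by_cases h : (okMsg (F.len n) d.fst.fst && okMsg (F.len n) d.fst.snd) = true
  · obtain ⟨h1, h2⟩ := Bool.and_eq_true_iff.1 h
    obtain ⟨r, hr, hr'⟩ := okMsg_iff.1 h1
    obtain ⟨c, hc, hc'⟩ := okMsg_iff.1 h2
    rcases d with _ | ⟨_ | ⟨dr, dc⟩, σ⟩
    · simp [okMsg_nil (hF.len_pos n)] at h1
    · simp [okMsg_nil (hF.len_pos n)] at h1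
    simp only [Data.fst_cons, Data.snd_cons] at hr hc h ⊢
    subst hr hc
    have hd := encryptThenMAC_decrypt F M n sk.fst sk.snd R₁ R₂ hr' hc' σ
    have hd' : (encryptThenMAC F M R₁ R₂).decrypt n sk (.cons (.cons (enc r) (enc c)) σ) =
      (encryptThenMAC F M R₁ R₂).decrypt n (.cons sk.fst sk.snd)
        (.cons (.cons (enc r) (enc c)) σ) := rfl
    rw [hd', hd, h]
    simp only [Data.bits_enc, Bool.true_and]
    cases M.verify n sk.snd (r ++ c) σ <;> rfl
  · rw [Bool.not_eq_true] at h
    have hd : (encryptThenMAC F M R₁ R₂).decrypt n sk d =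
      (encryptThenMAC F M R₁ R₂).decrypt n (.cons sk.fst sk.snd) d := rfl
    rw [hd, encryptThenMAC_decrypt_eq_none F M n _ _ R₁ R₂ h, h]
    rfl

/-- An honest ciphertext decrypts correctly under keys whose tags and values agree with those used for
encryption. -/
theorem decrypt_encrypted {n : ℕ} {s sk : Data} {m r : List Bool} {σ : Data}
    (hm : m.length = F.len n) (hr : r.length = F.len n) (he : F.eval n sk.fst r = F.eval n s r)
    (hv : M.verify n sk.snd (r ++ xorBits (F.eval n s r) m) σ = true) :
    (encryptThenMAC F M R₁ R₂).decrypt n sk (enc ((r, xorBits (F.eval n s r) m), σ)) = some m := by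
  have hx := F.length_eval n s r hr
  have hc : (xorBits (F.eval n s r) m).length = F.len n := by
    rw [length_xorBits (hx.trans hm.symm), hm]
  have h := encryptThenMAC_decrypt F M n sk.fst sk.snd R₁ R₂ hr hc σ
  rw [if_pos hv, he, xorBits_xorBits_cancel (hx.trans hm.symm)] at h
  exact h

theorem encryptThenMAC_correct (hM : M.IsSecure 𝔐 q)
    (hMsgs : ∀ (n : ℕ) (m : List Bool), m.length = 2 * F.len n → m ∈ M.Msgs n) :
    ∃ ν, Negligible ν ∧ ∀ n, ∀ m : List Bool, m.length = F.len n →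
      1 - ν n ≤ Pr (((encryptThenMAC F M R₁ R₂).setup n).bind fun K =>
        ((encryptThenMAC F M R₁ R₂).encrypt n K.sk m).map fun ct => (K, ct))
        fun o => (encryptThenMAC F M R₁ R₂).decrypt n o.1.sk o.2 = some m := by
  obtain ⟨ν, hν, h⟩ := hM.correct
  refine ⟨ν, hν, fun n m hm => ?_⟩
  simp only [encryptThenMAC, PMF.bind_bind, PMF.bind_map, PMF.map_bind, PMF.map_comp,
    Function.comp_def, Data.fst_cons, Data.snd_cons]
  refine le_Pr_bind fun K _ => ?_
  rw [PMF.bind_comm]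
  refine le_Pr_bind fun r hr => ?_
  have hr' := length_of_mem_randomBits hr
  have hc : (r ++ xorBits (F.eval n K.sk r) m).length = 2 * F.len n := by
    rw [List.length_append, length_xorBits ((F.length_eval n K.sk r hr').trans hm.symm)]
    omega
  refine (h n _ (hMsgs n _ hc)).trans ?_
  refine Pr_bind_mono fun L _ => ?_
  rw [Pr_map, Pr_map]
  exact Pr_mono fun σ _ hv => decrypt_encrypted (R₁ := R₁) (R₂ := R₂)
    (sk := .cons K.sk L.sk) hm hr' rfl hv

/-- A marked function agrees with the unmarked one at the nonce, since functionality is preserved at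
every fixed input and the nonce is independent of the keys. -/
theorem encryptThenMAC_functionality (hF : F.IsSecure 𝔐 q) (hM : M.IsSecure 𝔐 q)
    (hMarks : F.Marks = M.Marks)
    (hMsgs : ∀ (n : ℕ) (m : List Bool), m.length = 2 * F.len n → m ∈ M.Msgs n) :
    ∃ ν, Negligible ν ∧ ∀ n, ∀ τ ∈ (encryptThenMAC F M R₁ R₂).Marks n, ∀ m : List Bool,
      m.length = F.len n →
      1 - ν n ≤ Pr (((encryptThenMAC F M R₁ R₂).markedKeys n τ).bind fun o =>
        ((encryptThenMAC F M R₁ R₂).encrypt n o.2 m).map fun ct => (o, ct))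
        fun o => (encryptThenMAC F M R₁ R₂).decrypt n o.1.2 o.2 = some m ∧
          (encryptThenMAC F M R₁ R₂).decrypt n o.1.1.sk o.2 = some m := by
  obtain ⟨ν₁, hν₁, h₁⟩ := hF.functionality_preserving
  obtain ⟨ν₂, hν₂, h₂⟩ := hM.functionality_preserving
  refine ⟨fun n => ν₁ n + ν₂ n, hν₁.add hν₂, fun n τ hτ m hm => ?_⟩
  have hτ' : τ ∈ M.Marks n := hMarks ▸ hτ
  let μ : PMF ((Keys × Data) × (Keys × Data) × List Bool × Data) :=
    (randomBits (F.len n)).bind fun r => (F.markedKeys n τ).bind fun o =>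
      (M.markedKeys n τ).bind fun p =>
        (M.sign n p.2 (r ++ xorBits (F.eval n o.2 r) m)).map fun σ => (o, p, r, σ)
  have e : (((encryptThenMAC F M R₁ R₂).markedKeys n τ).bind fun o =>
        ((encryptThenMAC F M R₁ R₂).encrypt n o.2 m).map fun ct => (o, ct)) =
      μ.map fun x => ((⟨.cons x.1.1.sk x.2.1.1.sk, .cons x.1.1.mk x.2.1.1.mk,
        .cons x.1.1.xk x.2.1.1.xk⟩, .cons x.1.2 x.2.1.2),
          enc ((x.2.2.1, xorBits (F.eval n x.1.2 x.2.2.1) m), x.2.2.2)) := by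
    simp only [μ, encryptThenMAC, WMScheme.markedKeys, PMF.bind_bind, PMF.bind_map, PMF.map_bind,
      PMF.map_comp, Function.comp_def, Data.fst_cons, Data.snd_cons]
    rw [PMF.bind_comm (randomBits (F.len n))]
    congr 1; funext K
    rw [PMF.bind_comm (randomBits (F.len n)), PMF.bind_comm (M.setup n)]
    congr 1; funext s
    rw [PMF.bind_comm (randomBits (F.len n))]
    congr 1; funext L
    rw [PMF.bind_comm (randomBits (F.len n))]
  have hE₁ : 1 - ν₁ n ≤ Pr μ fun x => F.eval n x.1.2 x.2.2.1 = F.eval n x.1.1.sk x.2.2.1 := by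
    refine le_Pr_bind fun r hr => ?_
    have := h₁ n τ hτ r (length_of_mem_randomBits hr)
    refine this.trans (le_of_eq ?_)
    rw [Pr_bind, Pr_eq_ex]
    refine ex_congr _ fun o _ => ?_
    by_cases ho : F.eval n o.2 r = F.eval n o.1.sk r
    · rw [if_pos ho, Pr_eq_one]
      intro x hx
      simp only [PMF.mem_support_bind_iff, PMF.mem_support_map_iff] at hx
      obtain ⟨p, -, σ, -, rfl⟩ := hx
      exact ho
    · rw [if_neg ho, Pr_eq_zero]
      intro x hx
      simp only [PMF.mem_support_bind_iff, PMF.mem_support_map_iff] at hx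
      obtain ⟨p, -, σ, -, rfl⟩ := hx
      exact ho
  have hE₂ : 1 - ν₂ n ≤ Pr μ fun x => M.verify n x.2.1.2
      (x.2.2.1 ++ xorBits (F.eval n x.1.2 x.2.2.1) m) x.2.2.2 = true ∧
      M.verify n x.2.1.1.sk (x.2.2.1 ++ xorBits (F.eval n x.1.2 x.2.2.1) m) x.2.2.2 = true := by
    refine le_Pr_bind fun r hr => le_Pr_bind fun o _ => ?_
    have hr' := length_of_mem_randomBits hr
    have hc : (r ++ xorBits (F.eval n o.2 r) m).length = 2 * F.len n := by
      rw [List.length_append, length_xorBits ((F.length_eval n o.2 r hr').trans hm.symm)]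
      omega
    refine (h₂ n τ hτ' _ (hMsgs n _ hc)).trans ?_
    refine Pr_bind_mono fun p _ => ?_
    rw [Pr_map, Pr_map]
  refine (Pr_and_ge hE₁ hE₂).trans ?_
  rw [e, Pr_map]
  refine Pr_mono fun x hx hE => ?_
  simp only [μ, PMF.mem_support_bind_iff, PMF.mem_support_map_iff] at hx
  obtain ⟨r, hr, o, -, p, -, σ, -, rfl⟩ := hx
  have hr' := length_of_mem_randomBits hr
  exact ⟨decrypt_encrypted (sk := .cons o.2 p.2) hm hr' rfl hE.2.1,
    decrypt_encrypted (sk := .cons o.1.sk p.1.sk) hm hr' hE.1.symm hE.2.2⟩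

/-- The keys of the scheme are pairs of keys of the components. -/
theorem mem_support_encryptThenMAC_setup {n : ℕ} {K : Keys}
    (hK : K ∈ ((encryptThenMAC F M R₁ R₂).setup n).support) :
    ∃ K₁ ∈ (F.setup n).support, ∃ K₂ ∈ (M.setup n).support,
      K = ⟨.cons K₁.sk K₂.sk, .cons K₁.mk K₂.mk, .cons K₁.xk K₂.xk⟩ := by
  simp only [encryptThenMAC, PMF.mem_support_bind_iff, PMF.mem_support_map_iff] at hK
  obtain ⟨K₁, h₁, K₂, h₂, rfl⟩ := hK
  exact ⟨K₁, h₁, K₂, h₂, rfl⟩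

/-- Extraction uses the transformed programs as black boxes, whose length and behaviour depend only on
the length and behaviour of the given program. -/
theorem Reductions.blackBox (h : Reductions F M R₁ R₂) (hF : F.BlackBox) (hM : M.BlackBox) :
    (encryptThenMAC F M R₁ R₂).BlackBox := by
  intro n K hK a C C' hs he
  obtain ⟨K₁, h₁, K₂, h₂, rfl⟩ := mem_support_encryptThenMAC_setup hK
  obtain ⟨hs₁, he₁⟩ := h.equiv₁ n K₂.xk C C' hs he
  obtain ⟨hs₂, he₂⟩ := h.equiv₂ n K₁.xk C C' hs he
  have e₁ := hF n K₁ h₁ (8 * a) _ _ hs₁ he₁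
  have e₂ := hM n K₂ h₂ (8 * a) _ _ hs₂ he₂
  change (F.extract n K₁.xk (8 * a) (R₁ n K₂.xk C)).bind (fun l₁ =>
    (M.extract n K₂.xk (8 * a) (R₂ n K₁.xk C)).map fun l₂ => l₁ ++ l₂) =
      (F.extract n K₁.xk (8 * a) (R₁ n K₂.xk C')).bind fun l₁ =>
        (M.extract n K₂.xk (8 * a) (R₂ n K₁.xk C')).map fun l₂ => l₁ ++ l₂
  rw [e₁, e₂]

end Scheme

/-! ### Simulation of the CCA2 game with the extraction key -/

/-- The state of the simulator of the CCA2 game: the hidden bit, the state of the layer and the states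
of the simulators of the components. -/
abbrev SimState : Type := Bool × (Data × Data) × Data

/-- The hidden bit of the simulated game; it is chosen in the initial state `nil`. -/
noncomputable def simBit (s : Data) : PMF Bool :=
  bif decide (s = .nil) then OComp.fairCoin else PMF.pure (!decide (s.fst = .nil))

/-- The states of the layer and of the simulators of the components. -/
def simParts (s : Data) : (Data × Data) × Data :=
  (bif decide (s = .nil) then (coreInit, .nil) else (s.snd.fst.fst, s.snd.fst.snd), s.snd.snd)

/-- The simulator of the CCA2 game. -/
noncomputable def etmSim (len : ℕ → ℕ) (simF simM : ℕ → Data → Data → Data → PMF (Data × Data))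
    (n : ℕ) (xk s q : Data) : PMF (Data × Data) :=
  (simBit s).bind fun β => (coreStep ⟨false, β, len n⟩ (nonceVia (len n) (simF n xk.fst))
    (simM n xk.snd) (simParts s) q).map fun o => (o.1, enc ((β, o.2) : SimState))

section Sim

variable {len : ℕ → ℕ} {simF simM : ℕ → Data → Data → Data → PMF (Data × Data)}

theorem etmSim_enc (n : ℕ) (xk q : Data) (β : Bool) (t : (Data × Data) × Data) :
    etmSim len simF simM n xk (enc ((β, t) : SimState)) q =
      (coreStep ⟨false, β, len n⟩ (nonceVia (len n) (simF n xk.fst)) (simM n xk.snd) t q).map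
        fun o => (o.1, enc ((β, o.2) : SimState)) := by
  obtain ⟨⟨w, sF⟩, sM⟩ := t
  cases β <;> simp [etmSim, simBit, simParts, Data.bit]

/-- The simulator as an environment, with the hidden bit chosen at the beginning. -/
theorem map_run_etmSim {α : Type} (n : ℕ) (xk : Data) (c : OComp α) :
    (c.run (etmSim len simF simM n xk) .nil).map Prod.fst = OComp.fairCoin.bind fun β =>
      (c.run (coreStep ⟨false, β, len n⟩ (nonceVia (len n) (simF n xk.fst)) (simM n xk.snd))
        ((coreInit, .nil), .nil)).map Prod.fst := by
  induction c with
  | pure a => simp only [OComp.run, PMF.pure_map, PMF.bind_const]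
  | coin k ih =>
    simp only [OComp.run, PMF.map_bind, ih]
    exact PMF.bind_comm _ _ _
  | query q k ih =>
    have h0 : etmSim len simF simM n xk .nil q = OComp.fairCoin.bind fun β =>
        (coreStep ⟨false, β, len n⟩ (nonceVia (len n) (simF n xk.fst)) (simM n xk.snd)
          ((coreInit, .nil), .nil) q).map fun o => (o.1, enc ((β, o.2) : SimState)) := by
      simp [etmSim, simBit, simParts]
    simp only [OComp.run, PMF.map_bind, h0, PMF.bind_bind, PMF.bind_map, Function.comp_def]
    congr 1; funext β
    congr 1; funext o
    have := OComp.run_project (step := coreStep ⟨false, β, len n⟩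
        (nonceVia (len n) (simF n xk.fst)) (simM n xk.snd))
      (step' := etmSim len simF simM n xk) (I := fun _ => True)
      (fun t => enc ((β, t) : SimState)) (fun _ _ _ _ _ => trivial)
      (fun t q _ => (etmSim_enc n xk q β t).symm) (k o.1) (s := o.2) trivial
    rw [← this, PMF.map_comp]
    rfl

/-- The parameters of the layer, for an input of the simulator and the hidden bit. -/
def simParams (len : ℕ → ℕ) (i : (ℕ × Data × Data × Data) × Bool) : CoreParams :=
  ⟨false, i.2, len i.1.1⟩

/-- The query to the MAC simulator. -/
def simPre (len : ℕ → ℕ) (i : (ℕ × Data × Data × Data) × Bool) (r v : Data) : Data :=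
  (simParams len i).pre (simParts i.1.2.2.1).1.1 i.1.2.2.2 r v

/-- The reply of the simulator and its next state. -/
def simOut (len : ℕ → ℕ) (i : (ℕ × Data × Data × Data) × Bool) (r : Data) (v a : Data × Data) :
    Data × Data :=
  ((simParams len i).reply (simParts i.1.2.2.1).1.1 i.1.2.2.2 r v.1 a.1,
    enc (i.2, (((simParams len i).next (simParts i.1.2.2.1).1.1 i.1.2.2.2 r v.1 a.1, v.2), a.2)))

section

variable {γ : Type} [Enc γ] {f : γ → (ℕ × Data × Data × Data) × Bool} {r : γ → Data}

@[fun_prop] theorem PolyTime.simParams (hlen : PolyTime len) (hf : PolyTime f) :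
    PolyTime fun x => _root_.simParams len (f x) := by
  unfold _root_.simParams
  fun_prop

theorem PolyTime.simPre {v : γ → Data} (hlen : PolyTime len) (hf : PolyTime f) (hr : PolyTime r)
    (hv : PolyTime v) : PolyTime fun x => _root_.simPre len (f x) (r x) (v x) := by
  unfold _root_.simPre
  fun_prop

theorem PolyTime.simOut {v a : γ → Data × Data} (hlen : PolyTime len) (hf : PolyTime f)
    (hr : PolyTime r) (hv : PolyTime v) (ha : PolyTime a) :
    PolyTime fun x => _root_.simOut len (f x) (r x) (v x) (a x) := by
  unfold _root_.simOut
  fun_prop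

end

theorem ppt_etmSim (hlen : PolyTime len)
    (hF : PPT fun i : ℕ × Data × Data × Data => simF i.1 i.2.1 i.2.2.1 i.2.2.2)
    (hM : PPT fun i : ℕ × Data × Data × Data => simM i.1 i.2.1 i.2.2.1 i.2.2.2) :
    PPT fun i : ℕ × Data × Data × Data => etmSim len simF simM i.1 i.2.1 i.2.2.1 i.2.2.2 := by
  have h0 : PPT fun i : ℕ × Data × Data × Data => simBit i.2.2.1 := by
    have h1 : PolyTime fun i : ℕ × Data × Data × Data => decide (i.2.2.1 = .nil) := by fun_prop
    have h2 : PolyTime fun i : ℕ × Data × Data × Data => !decide (i.2.2.1.fst = .nil) := by fun_prop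
    exact PPT.cond h1 ppt_fairCoin h2
  have h1 : PPT fun i : (ℕ × Data × Data × Data) × Bool => nonceDist (len i.1.1) i.1.2.2.2 :=
    PPT.nonceDist (by fun_prop) (by fun_prop)
  have h2 : PPT fun i : ((ℕ × Data × Data × Data) × Bool) × Data =>
      simF i.1.1.1 i.1.1.2.1.fst (simParts i.1.1.2.2.1).1.2 (.cons .nil i.2) :=
    hF.precomp (f := fun i : ((ℕ × Data × Data × Data) × Bool) × Data =>
      (i.1.1.1, i.1.1.2.1.fst, (simParts i.1.1.2.2.1).1.2, Data.cons .nil i.2)) (by fun_prop)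
  have e3 : PolyTime fun i : (((ℕ × Data × Data × Data) × Bool) × Data) × (Data × Data) =>
      simPre len i.1.1 i.1.2 i.2.1 :=
    PolyTime.simPre hlen (by fun_prop) (by fun_prop) (by fun_prop)
  have h3 : PPT fun i : (((ℕ × Data × Data × Data) × Bool) × Data) × (Data × Data) =>
      simM i.1.1.1.1 i.1.1.1.2.1.snd (simParts i.1.1.1.2.2.1).2 (simPre len i.1.1 i.1.2 i.2.1) :=
    hM.precomp (f := fun i : (((ℕ × Data × Data × Data) × Bool) × Data) × (Data × Data) =>
      (i.1.1.1.1, i.1.1.1.2.1.snd, (simParts i.1.1.1.2.2.1).2, simPre len i.1.1 i.1.2 i.2.1))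
      (by fun_prop)
  have e4 : PolyTime fun i : ((((ℕ × Data × Data × Data) × Bool) × Data) × (Data × Data)) ×
      (Data × Data) => simOut len i.1.1.1 i.1.1.2 i.1.2 i.2 :=
    PolyTime.simOut hlen (by fun_prop) (by fun_prop) (by fun_prop) (by fun_prop)
  have h4 : PPT fun i : (((ℕ × Data × Data × Data) × Bool) × Data) × (Data × Data) =>
      (simM i.1.1.1.1 i.1.1.1.2.1.snd (simParts i.1.1.1.2.2.1).2 (simPre len i.1.1 i.1.2 i.2.1)).map
        fun a => simOut len i.1.1 i.1.2 i.2 a := PPT.map h3 e4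
  have h5 : PPT fun i : ((ℕ × Data × Data × Data) × Bool) × Data =>
      (simF i.1.1.1 i.1.1.2.1.fst (simParts i.1.1.2.2.1).1.2 (.cons .nil i.2)).bind fun v =>
        (simM i.1.1.1 i.1.1.2.1.snd (simParts i.1.1.2.2.1).2 (simPre len i.1 i.2 v.1)).map
          fun a => simOut len i.1 i.2 v a := PPT.bind h2 h4
  have h6 : PPT fun i : (ℕ × Data × Data × Data) × Bool =>
      (nonceDist (len i.1.1) i.1.2.2.2).bind fun r =>
        (simF i.1.1 i.1.2.1.fst (simParts i.1.2.2.1).1.2 (.cons .nil r)).bind fun v =>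
          (simM i.1.1 i.1.2.1.snd (simParts i.1.2.2.1).2 (simPre len i r v.1)).map
            fun a => simOut len i r v a := PPT.bind h1 h5
  have h7 : PPT fun i : ℕ × Data × Data × Data => (simBit i.2.2.1).bind fun β =>
      (nonceDist (len i.1) i.2.2.2).bind fun r =>
        (simF i.1 i.2.1.fst (simParts i.2.2.1).1.2 (.cons .nil r)).bind fun v =>
          (simM i.1 i.2.1.snd (simParts i.2.2.1).2 (simPre len (i, β) r v.1)).map
            fun a => simOut len (i, β) r v a := PPT.bind h0 h6
  refine h7.of_map_enc fun i => ?_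
  congr 1
  simp only [etmSim, coreStep, nonceVia, PMF.bind_bind, PMF.bind_map, PMF.map_bind, PMF.map_comp,
    Function.comp_def, simPre, simOut, simParams]

/-- Sizes of the reachable states of the simulator: bounds for the state of the layer and for the total
size of the queries to the simulators of the components, after queries of total size `m`. -/
theorem reaches_etmSim {n : ℕ} {xk : Data} {N A R : ℕ} (hR : 2 * len n ≤ R)
    (hA : ∀ j s, WMScheme.Reaches (simM n xk.snd) j s → j ≤ (2 * R + 11) * N →
      ∀ q : Data, q.size ≤ (2 * R + 11) * N → ∀ o ∈ (simM n xk.snd s q).support, o.1.size ≤ A)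
    {m : ℕ} {s : Data} (h : WMScheme.Reaches (etmSim len simF simM n xk) m s) (hm : m ≤ N) :
    s = .nil ∨ ∃ (β : Bool) (w sF sM : Data) (jF jM : ℕ),
      s = enc ((β, (w, sF), sM) : SimState) ∧ w.size ≤ 10 + (R + A + 20) * m ∧
      WMScheme.Reaches (simF n xk.fst) jF sF ∧ jF ≤ (R + 3) * m ∧
      WMScheme.Reaches (simM n xk.snd) jM sM ∧ jM ≤ (2 * R + 11) * m := by
  induction h with
  | start => exact .inl rfl
  | @next m s q a s' hs ha ih =>
    refine .inr ?_
    obtain ⟨β, w, sF, sM, jF, jM, hstep, hw, hF, hjF, hM, hjM⟩ : ∃ (β : Bool) (w sF sM : Data)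
        (jF jM : ℕ), (a, s') ∈ ((coreStep ⟨false, β, len n⟩ (nonceVia (len n) (simF n xk.fst))
          (simM n xk.snd) ((w, sF), sM) q).map fun o => (o.1, enc ((β, o.2) : SimState))).support ∧
        w.size ≤ 10 + (R + A + 20) * m ∧
        WMScheme.Reaches (simF n xk.fst) jF sF ∧ jF ≤ (R + 3) * m ∧
        WMScheme.Reaches (simM n xk.snd) jM sM ∧ jM ≤ (2 * R + 11) * m := by
      rcases ih (by omega) with rfl | ⟨β, w, sF, sM, jF, jM, rfl, h1, h2⟩
      · simp only [etmSim, PMF.mem_support_bind_iff] at ha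
        obtain ⟨β, -, ha⟩ := ha
        exact ⟨β, coreInit, .nil, .nil, 0, 0, ha, by simp [coreInit]; omega, .start, by omega, .start,
          by omega⟩
      · rw [etmSim_enc] at ha
        exact ⟨β, w, sF, sM, jF, jM, ha, h1, h2⟩
    simp only [coreStep, nonceVia, PMF.map_bind, PMF.bind_bind, PMF.bind_map, PMF.map_comp,
      PMF.mem_support_bind_iff, PMF.mem_support_map_iff, Function.comp, Prod.mk.injEq] at hstep
    obtain ⟨r, hr, v, hv, b, hb, -, rfl⟩ := hstep
    have hr' := size_nonceDist_le hr
    have hpre := CoreParams.size_pre_le ⟨false, β, len n⟩ w q r v.1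
    have hnext := CoreParams.size_next_le ⟨false, β, len n⟩ w q r v.1 b.1
    have e1 : (2 * R + 11) * (m + q.size + 1) =
      (2 * R + 11) * m + (2 * (R * q.size) + 11 * q.size) + (2 * R + 11) := by ring
    have e2 : (2 * R + 11) * (m + q.size + 1) ≤ (2 * R + 11) * N := Nat.mul_le_mul_left _ hm
    have e3 : (R + 3) * (m + q.size + 1) = (R + 3) * m + (R * q.size + 3 * q.size) + (R + 3) := by
      ring
    have e4 : (R + A + 20) * (m + q.size + 1) =
      (R + A + 20) * m + (R * q.size + A * q.size + 20 * q.size) + (R + A + 20) := by ring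
    have hb' := hA jM sM hM (by omega) _ (by omega) b hb
    exact ⟨β, _, _, _, _, _, rfl, by omega, hF.next hv,
      by simp only [Data.size_cons, Data.size_nil]; omega, hM.next hb, by omega⟩

end Sim

theorem encryptThenMAC_keySimulates {𝔐 : AdvModel} {q : Collusion} {F : WPRF} {M : WMAC}
    {R₁ R₂ : ℕ → (xk C : Data) → Data} (hF : F.IsSecure 𝔐 q) (hM : M.IsSecure 𝔐 q)
    (hMsgs : ∀ (n : ℕ) (m : List Bool), m.length = 2 * F.len n → m ∈ M.Msgs n) :
    (encryptThenMAC F M R₁ R₂).KeySimulates (encryptThenMAC F M R₁ R₂).game := by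
  obtain ⟨simF, kF, hsimF, hF'⟩ := hF.watermarkable.key_simulates
  obtain ⟨simM, kM, hsimM, hM'⟩ := hM.watermarkable.key_simulates
  obtain ⟨kl, hkl⟩ := hF.len_polyTime.size_le
  obtain ⟨k₁, hk₁⟩ := hM.watermarkable.setup_ppt.size_le
  obtain ⟨k₂, hk₂⟩ := hsimM.size_le
  simp only [sz_nat] at hkl hk₁
  let R : ℕ → ℕ := fun N => 2 * (N + 2) ^ kl
  have hR : PolyBounded R := by fun_prop
  let J : ℕ → ℕ := fun N => (2 * R N + 11) * N
  have hJ : PolyBounded J := by fun_prop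
  let A : ℕ → ℕ := fun N => (N + ((N + 2) ^ k₁ + ((N + J N + 2) ^ kM + J N)) + 10) ^ k₂
  have hA : PolyBounded A := by fun_prop
  obtain ⟨k, hk⟩ : PolyBounded fun N => (10 + (R N + A N + 20) * N) +
      (N + (R N + 3) * N + 2) ^ kF + (N + J N + 2) ^ kM + 10 := by fun_prop
  refine ⟨etmSim F.len simF simM, k, ppt_etmSim hF.len_polyTime hsimF hsimM, fun n K hK => ?_⟩
  obtain ⟨K₁, h₁, K₂, h₂, rfl⟩ := mem_support_encryptThenMAC_setup hK
  constructor
  · intro m s hs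
    generalize hN : n + m = N
    have hlenR : 2 * F.len n ≤ R N :=
      Nat.mul_le_mul_left 2 ((hkl n).trans (Nat.pow_le_pow_left (by omega) _))
    have hreach := reaches_etmSim (N := N) (A := A N) (R := R N) hlenR ?_ hs (by omega)
    · rcases hreach with rfl | ⟨β, w, sF, sM, jF, jM, rfl, hw, hF₁, hF₂, hM₁, hM₂⟩
      · simp
      · have e1 := ((hF' n K₁ h₁).1 jF sF hF₁).trans (Nat.pow_le_pow_left
          (show _ ≤ N + (R N + 3) * N + 2 by
            have : (R N + 3) * m ≤ (R N + 3) * N := Nat.mul_le_mul_left _ (by omega)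
            omega) kF)
        have e2 := ((hM' n K₂ h₂).1 jM sM hM₁).trans (Nat.pow_le_pow_left
          (show _ ≤ N + J N + 2 by
            have : (2 * R N + 11) * m ≤ J N := Nat.mul_le_mul_left _ (by omega)
            omega) kM)
        have e3 : (R N + A N + 20) * m ≤ (R N + A N + 20) * N := Nat.mul_le_mul_left _ (by omega)
        have e4 := sz_bool_le β
        refine le_trans ?_ (hk N)
        simp only [size_enc, sz_pair, sz_data]
        omega
    · intro j s hj hjN q hq o ho
      have e1 := ((hM' n K₂ h₂).1 j s hj).trans (Nat.pow_le_pow_left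
        (show _ ≤ N + J N + 2 by dsimp only [J]; omega) kM)
      have e2 := hk₂ (n, K₂.xk, s, q) o ho
      have e3 := (hk₁ n K₂ h₂).trans (Nat.pow_le_pow_left (show n + 2 ≤ N + 2 by omega) k₁)
      rw [Keys.sz_eq] at e3
      simp only [sz_pair, sz_nat, sz_data] at e2
      refine le_trans (by obtain ⟨o₁, o₂⟩ := o; simp only [sz_pair, sz_data]; omega)
        (e2.trans (Nat.pow_le_pow_left ?_ k₂))
      dsimp only [J] at *
      omega
  · intro c
    rw [map_run_etmSim]
    have hsign := fun m => hM.sign_ppt.sampleable_data (n, K₂.sk, m)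
    have hN : ∀ s q, Sampleable (nonceVia (F.len n) (simF n K₁.xk) s q) := fun s q => by
      have h : ∀ q, Sampleable (simF n K₁.xk s q) := fun q => by
        have h := (hsimF.sampleable (n, K₁.xk, s, q)).map fun d => (d.fst, d.snd)
        rwa [PMF.map_comp, show ((fun d : Data => (d.fst, d.snd)) ∘ enc) =
          (id : Data × Data → Data × Data) from rfl, PMF.map_id] at h
      exact (sampleable_nonceDist _ _).bind fun r => (h _).map _
    rw [Game.view]
    change _ = ((OComp.fairCoin.map fun b => ((b, none) : Bool × Option Data)).bind fun s =>
      c.run ((encryptThenMAC F M R₁ R₂).oracle n (.cons K₁.sk K₂.sk)) s).map Prod.fst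
    rw [PMF.bind_map, PMF.map_bind]
    congr 1; funext β
    simp only [Data.fst_cons, Data.snd_cons, Function.comp]
    rw [← run_coreStep_real F M n K₁.sk K₂.sk R₁ R₂ (hF.len_pos n) (hMsgs n) β c, PMF.map_comp]
    have e1 := map_run_coreStep_simM ⟨false, β, F.len n⟩ hN (hM' n K₂ h₂).2 c coreInit .nil
    have e1' := congrArg (PMF.map fun o => o.1) e1
    have e2 := map_run_coreStep_value F n K₁.sk ⟨false, β, F.len n⟩ (F.len n)
      (M.sampleable_oracle hsign) (hF' n K₁ h₁).2 c coreInit []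
    have e2' := congrArg (PMF.map fun o => o.1) e2
    simp only [PMF.map_comp] at e1' e2'
    refine e1'.trans (Eq.trans ?_ e2')
    change (PMF.bind (PMF.pure []) fun t => c.run (coreStep ⟨false, β, F.len n⟩
      (nonceVia (F.len n) (simF n K₁.xk)) (M.oracle n K₂.sk)) ((coreInit, .nil), t)).map _ = _
    rw [PMF.pure_bind]
    rfl

/-! ### Adversaries that run a given program -/

/-- The adversary that computes from its input a program with an argument and the state of a handler,
runs the program with its queries answered by the handler program `H`, and continues with `Post`. -/
theorem exists_adversary {𝔐 : AdvModel} (A : Adversary 𝔐) {γ : Type} [Enc γ] {f : γ → PMF Data}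
    (hf : PPT f) (H Post : Prog) {b : ℕ → ℕ} (hb : PolyBounded b) :
    ∃ A' : Adversary 𝔐, A'.advice = A.advice ∧ ∀ (n : ℕ) (z : γ) (ι σ : Type) (ν : PMF ι)
      (C arg s : ι → Data) (step : σ → Data → PMF (Data × σ))
      (κ : ι → σ → Data → PMF (Data × σ)) (post : ι → Data → σ → PMF (Data × σ)),
      sz z ≤ b n →
      (f z = ν.map fun i => .cons (C i) (.cons (arg i) (.cons H.encode (s i)))) →
      (∀ i ∈ ν.support, ∀ e q, q.size ≤ (C i).snd.size →
        Prog.Runs step (Prog.on H (.cons q (s i))) e (b n)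
          ((κ i e q).map fun o => (.cons o.1 (s i), o.2))) →
      (∀ i ∈ ν.support, ∀ y e, y.size ≤ (C i).snd.size →
        Prog.Runs step (Prog.on Post (.cons y (s i))) e (b n) (post i y e)) →
      ∀ e, (A'.prog.clocked ((n + 2) ^ A'.exponent) (enc z)).run step e = ν.bind fun i =>
        (((Prog.decode (C i).fst).clocked (C i).snd.size (arg i)).run (κ i) e).bind
          fun o => post i o.1 o.2 := by
  obtain ⟨Prep, k, hPrep⟩ := hf.computes
  obtain ⟨k₁, hk₁⟩ := hf.size_le
  obtain ⟨j, hj⟩ : PolyBounded fun n => (b n + 2) ^ k + (((b n + 2) ^ k₁ +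
      ((b n + 2) ^ k₁ * b n + (b n + 2) ^ k₁ + (b n + 2) ^ k₁ + 1) + 1) + b n + 1) + 1 := by
    fun_prop
  refine ⟨⟨.comp Prep (.comp .handle Post), max j A.exponent, A.advice,
    fun n => (A.advice_size n).trans (Nat.pow_le_pow_right (by omega) (le_max_right _ _)),
    A.advice_uniform⟩, rfl, fun n z ι σ ν C arg s step κ post hz hfz hH hPost e => ?_⟩
  have hsize : ∀ i ∈ ν.support, (C i).size + (s i).size ≤ (b n + 2) ^ k₁ := fun i hi => by
    have h1 : Data.cons (C i) (.cons (arg i) (.cons H.encode (s i))) ∈ (f z).support := by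
      rw [hfz]
      exact (PMF.mem_support_map_iff _ _ _).2 ⟨i, hi, rfl⟩
    have h2 := (hk₁ z _ h1).trans (Nat.pow_le_pow_left (show sz z + 2 ≤ b n + 2 by omega) k₁)
    simp only [sz_data, Data.size_cons] at h2
    omega
  have h1 := (hPrep z σ step e).mono (Nat.pow_le_pow_left (show sz z + 2 ≤ b n + 2 by omega) k)
  rw [hfz, PMF.map_comp] at h1
  refine ((Prog.runs_comp_index h1 (q := .comp .handle Post) (κ := fun i =>
    (((Prog.decode (C i).fst).clocked (C i).snd.size (arg i)).run (κ i) e).bind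
      fun o => post i o.1 o.2) fun i hi => ?_).mono (hj n)).clocked
        (Nat.pow_le_pow_right (by omega) (le_max_left _ _))
  have h2 := Prog.runs_handle (step := step) (H := H) (C := C i) (arg := arg i)
    (ψ := fun e : σ => (s i, e)) (I := fun m _ => m ≤ (C i).snd.size) (B := b n) (S := (s i).size)
    (κ := κ i) (fun m t q hq hm => ⟨hH i hi t q (by omega), fun _ _ => by omega⟩)
    (fun _ _ _ => le_rfl) (t := e) le_rfl
  have h3 := Prog.runs_comp_index (κ := fun o => post i o.1 o.2) h2 (q := Post) (B' := b n)
    fun o ho => by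
      obtain ⟨h4, -⟩ := (Prog.within_eval (C i).snd.size (Prog.decode (C i).fst)
        (arg i)).run_invariant (I := fun m (_ : σ) => m ≤ (C i).snd.size)
          (fun _ _ _ _ _ _ _ => by omega) le_rfl o ho
      exact hPost i hi o.1 o.2 h4
  refine h3.mono ?_
  have h5 := hsize i hi
  have h6 := (C i).size_snd_le
  have h7 : (C i).snd.size * b n ≤ (b n + 2) ^ k₁ * b n := Nat.mul_le_mul_right _ (by omega)
  omega

/-- The program of an adversary as data, including its input.  Two units of time are added for
`comp` and `const`, besides the size of the input. -/
def progData (p : Prog) (t : ℕ) (x : Data) : Data :=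
  .cons (Prog.comp (.const x) p).encode (.unary (t + x.size + 2))

theorem program_progData (p : Prog) (t : ℕ) (x : Data) :
    (progData p t x).program = p.clocked t x := by
  rw [Data.program, progData, Data.fst_cons, Data.snd_cons, Prog.decode_encode, Data.size_unary,
    Prog.clocked, Prog.clocked]
  congr 1
  rw [show t + x.size + 2 = (t + x.size) + 1 + 1 from rfl, Prog.eval, Prog.eval, Prog.ret,
    if_pos (by omega)]
  change Prog.eval (min _ _) p x = _
  congr 1
  omega

@[fun_prop] theorem PolyTime.progData {γ : Type} [Enc γ] (p : Prog) {t : γ → ℕ} {x : γ → Data}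
    (ht : PolyTime t) (hx : PolyTime x) : PolyTime fun i => _root_.progData p (t i) (x i) := by
  have : PolyTime fun i => (enc (t i + (x i).size + 2) : Data) := by fun_prop
  exact PolyTime.dataCons (by simp only [Prog.encode]; fun_prop) this

/-- The adversary that generates keys of `V` and runs the transform of the program of `A`. -/
theorem exists_transform_adversary {𝔐 : AdvModel} (A : Adversary 𝔐) {V : WMScheme}
    (hV : PPT V.setup) {R : ℕ → Data → Data → Data}
    (hR : PolyTime fun i : ℕ × Data × Data => R i.1 i.2.1 i.2.2) (k : ℕ) :
    ∃ B : Adversary 𝔐, ∀ (n : ℕ) (σ : Type) (step : σ → Data → PMF (Data × σ)),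
      (∀ e q, ∀ o ∈ (step e q).support, o.1.size ≤ (n + q.size + 2) ^ k) → ∀ e,
      (B.comp n).run step e = (V.setup n).bind fun L =>
        (R n L.xk (progData A.prog ((n + 2) ^ A.exponent)
          (enc (n, A.advice n)))).program.run step e := by
  have hfwd : PPT fun i : Data × Data => PMF.pure i := PolyTime.id'
  obtain ⟨H, kH, hH⟩ := exists_ask_prog hfwd hfwd
  let P : ℕ × Data → Data := fun z => progData A.prog ((z.1 + 2) ^ A.exponent) (enc z)
  have hP : PolyTime P := by fun_prop
  have h1 : PPT fun z : ℕ × Data => V.setup z.1 := hV.precomp (by fun_prop)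
  have hRP : PolyTime fun i : (ℕ × Data) × Keys => R i.1.1 i.2.xk (P i.1) :=
    PolyTime.comp (f := fun i : ℕ × Data × Data => R i.1 i.2.1 i.2.2)
      (g := fun i : (ℕ × Data) × Keys => (i.1.1, i.2.xk, P i.1)) hR (by fun_prop)
  have h2 : PolyTime fun i : (ℕ × Data) × Keys => Data.cons (R i.1.1 i.2.xk (P i.1))
      (.cons .nil (.cons H.encode .nil)) := by fun_prop
  have hf : PPT fun z : ℕ × Data => (V.setup z.1).map fun L =>
      Data.cons (R z.1 L.xk (P z)) (.cons .nil (.cons H.encode .nil)) := PPT.map h1 h2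
  obtain ⟨kR, hkR⟩ := hRP.size_le
  obtain ⟨kV, hkV⟩ := hV.size_le
  -- sizes of the input, of the transformed program and of the replies
  let X : ℕ → ℕ := fun n => n + (n + 2) ^ A.exponent + 1
  have hX : PolyBounded X := by fun_prop
  let Y : ℕ → ℕ := fun n => (X n + (n + 2) ^ kV + 1 + 2) ^ kR
  have hY : PolyBounded Y := by fun_prop
  let b : ℕ → ℕ := fun n => X n + (Y n + 1 + (n + Y n + 2) ^ k + 2) ^ kH + (2 * Y n + 2)
  have hb : PolyBounded b := by fun_prop
  obtain ⟨B, hadv, hB⟩ := exists_adversary A hf H .fst hb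
  refine ⟨B, fun n σ step hstep e => ?_⟩
  have hx : sz (n, A.advice n) ≤ X n := by
    have := A.advice_size n
    simp only [sz_pair, sz_nat, sz_data, X]
    omega
  have hC : ∀ L ∈ (V.setup n).support, (R n L.xk (P (n, A.advice n))).size ≤ Y n := fun L hL => by
    refine (hkR ((n, A.advice n), L)).trans (Nat.pow_le_pow_left ?_ kR)
    have := hkV n L hL
    rw [sz_nat] at this
    rw [sz_pair]
    omega
  have h := hB n (n, A.advice n) Keys σ (V.setup n) (fun L => R n L.xk (P (n, A.advice n)))
    (fun _ => .nil) (fun _ => .nil) step (fun _ => step) (fun _ y e => PMF.pure (y, e))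
    (by dsimp only [b]; omega) rfl ?_ ?_ e
  · rw [Adversary.comp, hadv, h]
    congr 1; funext L
    exact PMF.bind_pure _
  · intro L hL e q hq
    have hq' : q.size ≤ Y n := hq.trans ((Data.size_snd_le _).trans (hC L hL))
    refine ((hH (q, .nil) σ step e ((n + Y n + 2) ^ k) fun i hi o ho => ?_).mono ?_).congr ?_
    · rw [PMF.mem_support_pure_iff] at hi
      subst hi
      exact (hstep e q o ho).trans (Nat.pow_le_pow_left (by omega) k)
    · have : (sz (q, Data.nil) + (n + Y n + 2) ^ k + 2) ^ kH ≤
          (Y n + 1 + (n + Y n + 2) ^ k + 2) ^ kH := Nat.pow_le_pow_left (by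
        simp only [sz_pair, sz_data, Data.size_nil]; omega) kH
      dsimp only [b]
      omega
    · simp only [PMF.pure_bind, PMF.pure_map]
      rfl
  · intro L hL y e hy
    have hy' : y.size ≤ Y n := hy.trans ((Data.size_snd_le _).trans (hC L hL))
    refine (Prog.runs_fst e _).mono ?_
    dsimp only [b, Data.fst]
    omega

/-- The replies of marking oracles have polynomial size. -/
theorem exists_size_markStep_le {W : WMScheme} (hsetup : PPT W.setup)
    (hmark : PPT fun i : ℕ × Data × Data × Data => W.mark i.1 i.2.1 i.2.2.1 i.2.2.2) :
    ∃ k, ∀ n, ∀ K ∈ (W.setup n).support, ∀ q Q τ, ∀ o ∈ (W.markStep q n K Q τ).support,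
      o.1.size ≤ (n + τ.size + 2) ^ k := by
  obtain ⟨k₁, h₁⟩ := hsetup.size_le
  obtain ⟨k₂, h₂⟩ := hmark.size_le
  obtain ⟨k, hk⟩ : PolyBounded fun N => (N + (N + 2) ^ k₁ + 10) ^ k₂ + 3 := by fun_prop
  refine ⟨k, fun n K hK q Q τ o ho => (?_ : _ ≤ _).trans (hk (n + τ.size))⟩
  unfold WMScheme.markStep at ho
  split_ifs at ho
  · obtain ⟨s, hs, rfl⟩ := (PMF.mem_support_map_iff _ _ _).1 ho
    have e1 := (h₁ n K hK).trans (Nat.pow_le_pow_left (show sz n + 2 ≤ n + τ.size + 2 by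
      rw [sz_nat]; omega) k₁)
    rw [Keys.sz_eq] at e1
    have e2 := h₂ (n, K.mk, K.sk, τ) s hs
    simp only [sz_pair, sz_nat, sz_data] at e2
    have e3 := e2.trans (Nat.pow_le_pow_left (show _ ≤
      n + τ.size + (n + τ.size + 2) ^ k₁ + 10 by omega) k₂)
    simp only [Data.size_cons, Data.size_nil]
    omega
  · rw [PMF.mem_support_pure_iff] at ho
    simp [ho]

open Classical in
/-- The oracle that marks a key of `W` and a key of `V` with the same mark. -/
noncomputable def pairMarkStep (W V : WMScheme) (c : Data → Data → Data) (q : Collusion) (n : ℕ)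
    (K L : Keys) (Q : List Data) (τ : Data) : PMF (Data × List Data) :=
  if τ ∈ W.Marks n ∧ q.Allows Q.length then
    (W.mark n K.mk K.sk τ).bind fun s => (V.mark n L.mk L.sk τ).map fun t =>
      (.cons .nil (c s t), τ :: Q)
  else PMF.pure (.nil, Q)

/-- The adversary that generates keys of `V`, runs `A` with its marking queries answered by the marking
oracle of `W` together with the generated keys, and transforms the program output by `A`. -/
theorem exists_mark_adversary {𝔐 : AdvModel} (A : Adversary 𝔐) {W V : WMScheme}
    (hW : PPT W.setup)
    (hW' : PPT fun i : ℕ × Data × Data × Data => W.mark i.1 i.2.1 i.2.2.1 i.2.2.2)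
    (hV : PPT V.setup)
    (hV' : PPT fun i : ℕ × Data × Data × Data => V.mark i.1 i.2.1 i.2.2.1 i.2.2.2)
    {c : Data → Data → Data} (hc : PolyTime fun i : Data × Data => c i.1 i.2)
    {R : ℕ → Data → Data → Data} (hR : PolyTime fun i : ℕ × Data × Data => R i.1 i.2.1 i.2.2)
    (q : Collusion) :
    ∃ B : Adversary 𝔐, ∀ n, ∀ K ∈ (W.setup n).support,
      (B.comp n).run (W.markStep q n K) [] = (V.setup n).bind fun L =>
        ((A.comp n).run (pairMarkStep W V c q n K L) []).map fun o => (R n L.xk o.1, o.2) := by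
  -- the handler
  have hpre : PPT fun i : Data × ℕ × Keys => PMF.pure (i.1, i) := by
    have : PolyTime fun i : Data × ℕ × Keys => (i.1, i) := by fun_prop
    exact this
  have hpost : PPT fun i : Data × Data × ℕ × Keys =>
      bif decide (i.1 = .nil) then PMF.pure (Data.nil, i.2.2) else
        (V.mark i.2.2.1 i.2.2.2.mk i.2.2.2.sk i.2.1).map fun t =>
          (Data.cons .nil (c i.1.snd t), i.2.2) := by
    have e1 : PolyTime fun i : Data × Data × ℕ × Keys => decide (i.1 = .nil) := by fun_prop
    have e2 : PPT fun i : Data × Data × ℕ × Keys => PMF.pure (Data.nil, i.2.2) := by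
      have : PolyTime fun i : Data × Data × ℕ × Keys => (Data.nil, i.2.2) := by fun_prop
      exact this
    have e3 : PPT fun i : Data × Data × ℕ × Keys =>
        V.mark i.2.2.1 i.2.2.2.mk i.2.2.2.sk i.2.1 :=
      hV'.precomp (f := fun i : Data × Data × ℕ × Keys => (i.2.2.1, i.2.2.2.mk, i.2.2.2.sk, i.2.1))
        (by fun_prop)
    have e4 : PolyTime fun i : (Data × Data × ℕ × Keys) × Data =>
        (Data.cons .nil (c i.1.1.snd i.2), i.1.2.2) := by
      have : PolyTime fun i : (Data × Data × ℕ × Keys) × Data => c i.1.1.snd i.2 :=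
        PolyTime.comp (f := fun i : Data × Data => c i.1 i.2)
          (g := fun i : (Data × Data × ℕ × Keys) × Data => (i.1.1.snd, i.2)) hc (by fun_prop)
      fun_prop
    exact PPT.cond e1 e2 (PPT.map e3 e4)
  obtain ⟨H, kH, hH⟩ := exists_ask_prog hpre hpost
  have hout : PolyTime fun i : Data × ℕ × Keys => R i.2.1 i.2.2.xk i.1 :=
    PolyTime.comp (f := fun i : ℕ × Data × Data => R i.1 i.2.1 i.2.2)
      (g := fun i : Data × ℕ × Keys => (i.2.1, i.2.2.xk, i.1)) hR (by fun_prop)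
  obtain ⟨Post, kP, hPost⟩ := hout.runs
  have h1 : PPT fun z : ℕ × Data => V.setup z.1 := hV.precomp (by fun_prop)
  have h2 : PolyTime fun i : (ℕ × Data) × Keys => Data.cons (.cons A.prog.encode
      (enc ((i.1.1 + 2) ^ A.exponent))) (.cons (enc i.1) (.cons H.encode (enc (i.1.1, i.2)))) := by
    fun_prop
  have hf : PPT fun z : ℕ × Data => (V.setup z.1).map fun L => Data.cons (.cons A.prog.encode
      (enc ((z.1 + 2) ^ A.exponent))) (.cons (enc z) (.cons H.encode (enc (z.1, L)))) :=
    PPT.map h1 h2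
  obtain ⟨kV, hkV⟩ := hV.size_le
  obtain ⟨kM, hkM⟩ := exists_size_markStep_le hW hW'
  let T : ℕ → ℕ := fun n => (n + 2) ^ A.exponent
  have hT : PolyBounded T := by fun_prop
  let Y : ℕ → ℕ := fun n => T n + n + (n + 2) ^ kV + 2
  have hY : PolyBounded Y := by fun_prop
  let b : ℕ → ℕ := fun n => n + T n + 1 + (Y n + (n + T n + 2) ^ kM + 2) ^ kH + (Y n + 2) ^ kP
  have hb : PolyBounded b := by fun_prop
  obtain ⟨B, hadv, hB⟩ := exists_adversary A hf H Post hb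
  refine ⟨B, fun n K hK => ?_⟩
  have hs : ∀ L ∈ (V.setup n).support, sz (n, L) ≤ n + (n + 2) ^ kV + 1 := fun L hL => by
    have := hkV n L hL
    rw [sz_nat] at this
    rw [sz_pair, sz_nat]
    omega
  have h := hB n (n, A.advice n) Keys (List Data) (V.setup n)
    (fun _ => .cons A.prog.encode (enc ((n + 2) ^ A.exponent))) (fun _ => enc (n, A.advice n))
    (fun L => enc (n, L)) (W.markStep q n K) (fun L => pairMarkStep W V c q n K L)
    (fun L y e => PMF.pure (R n L.xk y, e)) ?_ rfl ?_ ?_ []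
  · rw [Adversary.comp, hadv, h]
    congr 1; funext L
    simp only [Data.fst_cons, Data.snd_cons, enc_nat, Data.size_unary, Prog.decode_encode]
    rfl
  · have := A.advice_size n
    simp only [sz_pair, sz_nat, sz_data, b, T]
    omega
  · intro L hL Q τ hτ
    simp only [Data.snd_cons, enc_nat, Data.size_unary] at hτ
    have hτ' : τ.size ≤ T n := hτ
    refine ((hH (τ, n, L) _ (W.markStep q n K) Q ((n + T n + 2) ^ kM)
      fun i hi o ho => ?_).mono ?_).congr ?_
    · rw [PMF.mem_support_pure_iff] at hi
      subst hi
      exact (hkM n K hK q Q τ o ho).trans (Nat.pow_le_pow_left (by omega) kM)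
    · have h3 := hs L hL
      have : (sz (τ, n, L) + (n + T n + 2) ^ kM + 2) ^ kH ≤ (Y n + (n + T n + 2) ^ kM + 2) ^ kH :=
        Nat.pow_le_pow_left (by rw [sz_pair, sz_data]; dsimp only [Y]; omega) kH
      dsimp only [b]
      omega
    · simp only [PMF.pure_bind, WMScheme.markStep, pairMarkStep]
      split_ifs
      · simp only [PMF.bind_map, PMF.map_bind, PMF.map_comp, Function.comp_def]
        congr 1; funext s
        rw [decide_eq_false (by simp : ¬ Data.cons .nil s = .nil), cond_false, PMF.map_comp]
        rfl
      · simp only [PMF.pure_bind, PMF.pure_map, decide_true, cond_true]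
        rfl
  · intro L hL y e hy
    simp only [Data.snd_cons, enc_nat, Data.size_unary] at hy
    have hy' : y.size ≤ T n := hy
    refine (hPost (y, n, L) _ (W.markStep q n K) e).mono ?_
    have h3 := hs L hL
    have : (sz (y, n, L) + 2) ^ kP ≤ (Y n + 2) ^ kP :=
      Nat.pow_le_pow_left (by rw [sz_pair, sz_data]; dsimp only [Y]; omega) kP
    dsimp only [b]
    omega

/-- The adversary that is given a key of `W`, generates keys of `V`, runs `A` on both keys and
transforms the program output by `A`. -/
theorem exists_unmarked_adversary {𝔐 : AdvModel} (A : Adversary 𝔐) {W V : WMScheme}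
    (hW : PPT W.setup) (hV : PPT V.setup)
    {c : Data → Data → Data} (hc : PolyTime fun i : Data × Data => c i.1 i.2)
    {R : ℕ → Data → Data → Data} (hR : PolyTime fun i : ℕ × Data × Data => R i.1 i.2.1 i.2.2) :
    ∃ B : Adversary 𝔐, ∀ n, ∀ K ∈ (W.setup n).support,
      (B.prog.clocked ((n + 2) ^ B.exponent) (enc (n, B.advice n, K.sk))).dist =
        (V.setup n).bind fun L => ((A.prog.clocked ((n + 2) ^ A.exponent)
          (enc (n, A.advice n, c K.sk L.sk))).dist).map fun C => R n L.xk C := by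
  have hfwd : PPT fun i : Data × Data => PMF.pure i := PolyTime.id'
  have hnil : PolyTime fun i : Data × Data => (Data.nil, i.2) := by fun_prop
  obtain ⟨H, kH, hH⟩ := hnil.runs
  have hout : PolyTime fun i : Data × ℕ × Keys => R i.2.1 i.2.2.xk i.1 :=
    PolyTime.comp (f := fun i : ℕ × Data × Data => R i.1 i.2.1 i.2.2)
      (g := fun i : Data × ℕ × Keys => (i.2.1, i.2.2.xk, i.1)) hR (by fun_prop)
  obtain ⟨Post, kP, hPost⟩ := hout.runs
  have h1 : PPT fun z : ℕ × Data × Data => V.setup z.1 := hV.precomp (by fun_prop)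
  have h2 : PolyTime fun i : (ℕ × Data × Data) × Keys => Data.cons (.cons A.prog.encode
      (enc ((i.1.1 + 2) ^ A.exponent))) (.cons (enc (i.1.1, i.1.2.1, c i.1.2.2 i.2.sk))
        (.cons H.encode (enc (i.1.1, i.2)))) := by
    have : PolyTime fun i : (ℕ × Data × Data) × Keys => c i.1.2.2 i.2.sk :=
      PolyTime.comp (f := fun i : Data × Data => c i.1 i.2)
        (g := fun i : (ℕ × Data × Data) × Keys => (i.1.2.2, i.2.sk)) hc (by fun_prop)
    fun_prop
  have hf : PPT fun z : ℕ × Data × Data => (V.setup z.1).map fun L => Data.cons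
      (.cons A.prog.encode (enc ((z.1 + 2) ^ A.exponent))) (.cons (enc (z.1, z.2.1, c z.2.2 L.sk))
        (.cons H.encode (enc (z.1, L)))) := PPT.map h1 h2
  obtain ⟨kV, hkV⟩ := hV.size_le
  obtain ⟨kW, hkW⟩ := hW.size_le
  let T : ℕ → ℕ := fun n => (n + 2) ^ A.exponent
  have hT : PolyBounded T := by fun_prop
  let Y : ℕ → ℕ := fun n => T n + n + (n + 2) ^ kV + 2
  have hY : PolyBounded Y := by fun_prop
  let b : ℕ → ℕ := fun n => n + T n + (n + 2) ^ kW + 2 + (Y n + 2) ^ kH + (Y n + 2) ^ kP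
  have hb : PolyBounded b := by fun_prop
  obtain ⟨B, hadv, hB⟩ := exists_adversary A hf H Post hb
  refine ⟨B, fun n K hK => ?_⟩
  have hs : ∀ L ∈ (V.setup n).support, sz (n, L) ≤ n + (n + 2) ^ kV + 1 := fun L hL => by
    have := hkV n L hL
    rw [sz_nat] at this
    rw [sz_pair, sz_nat]
    omega
  have h := hB n (n, A.advice n, K.sk) Keys Unit (V.setup n)
    (fun _ => .cons A.prog.encode (enc ((n + 2) ^ A.exponent)))
    (fun L => enc (n, A.advice n, c K.sk L.sk))
    (fun L => enc (n, L)) (fun s _ => PMF.pure (.nil, s)) (fun _ s _ => PMF.pure (.nil, s))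
    (fun L y e => PMF.pure (R n L.xk y, e)) ?_ rfl ?_ ?_ ()
  · rw [hadv, OComp.dist, h, PMF.map_bind]
    congr 1; funext L
    simp only [Data.fst_cons, Data.snd_cons, enc_nat, Data.size_unary, Prog.decode_encode,
      OComp.dist, PMF.map_bind, PMF.pure_map, PMF.map_comp]
    rfl
  · have h3 := A.advice_size n
    have h4 := hkW n K hK
    rw [Keys.sz_eq, sz_nat] at h4
    simp only [sz_pair, sz_nat, sz_data, b, T]
    omega
  · intro L hL e τ hτ
    simp only [Data.snd_cons, enc_nat, Data.size_unary] at hτ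
    have hτ' : τ.size ≤ T n := hτ
    refine ((hH (τ, enc (n, L)) _ _ e).mono ?_).congr ?_
    · have h3 := hs L hL
      have : (sz (τ, (enc (n, L) : Data)) + 2) ^ kH ≤ (Y n + 2) ^ kH :=
        Nat.pow_le_pow_left (by rw [sz_pair, sz_data, sz_data, size_enc]; dsimp only [Y]; omega) kH
      dsimp only [b]
      omega
    · rw [PMF.pure_map]
      rfl
  · intro L hL y e hy
    simp only [Data.snd_cons, enc_nat, Data.size_unary] at hy
    have hy' : y.size ≤ T n := hy
    refine (hPost (y, n, L) _ _ e).mono ?_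
    have h3 := hs L hL
    have : (sz (y, n, L) + 2) ^ kP ≤ (Y n + 2) ^ kP :=
      Nat.pow_le_pow_left (by rw [sz_pair, sz_data]; dsimp only [Y]; omega) kP
    dsimp only [b]
    omega

/-! ### Security, unremovability and meaningfulness of the encrypt-then-MAC scheme -/

section Product

variable {α β : Type} {μ : PMF α} {ν : PMF β}

theorem ex_map {f : α → β} {g : β → ℝ} {b : ℝ} (hg : ∀ y, |g y| ≤ b) :
    ex (μ.map f) g = ex μ fun a => g (f a) := by
  rw [PMF.map_eq_bind, ex_bind _ _ hg]
  exact ex_congr _ fun a _ => ex_pure _ _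

theorem ex_prod {f : α × β → ℝ} {b : ℝ} (hf : ∀ y, |f y| ≤ b) :
    ex (μ.bind fun x => ν.map fun y => (x, y)) f = ex μ fun x => ex ν fun y => f (x, y) := by
  rw [ex_bind _ _ hf]
  exact ex_congr _ fun x _ => ex_map hf

theorem ex_prod_swap {f : α × β → ℝ} {b : ℝ} (hf : ∀ y, |f y| ≤ b) :
    ex (μ.bind fun x => ν.map fun y => (x, y)) f = ex ν fun y => ex μ fun x => f (x, y) := by
  have e : (μ.bind fun x => ν.map fun y => (x, y)) = ν.bind fun y => μ.map fun x => (x, y) :=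
    PMF.bind_comm _ _ _
  rw [e, ex_bind _ _ hf]
  exact ex_congr _ fun x _ => ex_map hf

end Product

theorem Game.abs_winProb_le (G : Game) (c : OComp Data) : |G.winProb c| ≤ 1 := abs_Pr_le _

/-- The winning probability of a player that picks a program at random. -/
theorem Game.winProb_of_run {ι : Type} (G : Game) {ν : PMF ι} {c : OComp Data}
    {d : ι → OComp Data} (h : ∀ s, c.run G.step s = ν.bind fun i => (d i).run G.step s) :
    G.winProb c = ex ν fun i => G.winProb (d i) := by
  rw [Game.winProb, funext h, PMF.bind_comm, Pr_bind]
  rfl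

/-- The replies of the oracles of the weak pseudorandomness game have polynomial size. -/
theorem WPRF.exists_size_oracle_le (F : WPRF) (hlen : PolyTime F.len) :
    ∃ k, ∀ n sk s q, ∀ o ∈ (F.oracle n sk s q).support, o.1.size ≤ (n + q.size + 2) ^ k := by
  obtain ⟨kl, hkl⟩ := hlen.size_le
  simp only [sz_nat] at hkl
  obtain ⟨k, hk⟩ : PolyBounded fun N => 4 * (N + 2) ^ kl + 1 := by fun_prop
  refine ⟨k, fun n sk s q o ho => ?_⟩
  have h1 : 4 * F.len n + 1 ≤ (n + q.size + 2) ^ k :=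
    le_trans (by have := hkl n; change _ ≤ 4 * (n + 2) ^ kl + 1; omega)
      ((hk n).trans (Nat.pow_le_pow_left (by omega) k))
  refine le_trans ?_ h1
  simp only [WPRF.oracle, WPRF.game] at ho
  split at ho
  · rename_i d
    rw [PMF.mem_support_pure_iff] at ho
    rw [ho]
    cases hd : d.toBits with
    | none => simp
    | some x =>
      dsimp only
      split_ifs with h
      · have := Data.size_bits_le (F.length_eval n sk x h.1)
        omega
      · simp
  · split at ho
    · simp only [PMF.mem_support_bind_iff, PMF.mem_support_map_iff] at ho
      obtain ⟨x, hx, y, hy, rfl⟩ := ho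
      have hx' := length_of_mem_randomBits hx
      have h2 := Data.size_bits_le hx'
      have h3 := Data.size_bits_le (F.length_challenge n sk s.1 hx' hy)
      simp only [enc_pair, Data.size_cons]
      omega
    · rw [PMF.mem_support_pure_iff] at ho
      simp [ho]
  · rw [PMF.mem_support_pure_iff] at ho
    simp [ho]

section Security

variable {𝔐 : AdvModel} {q : Collusion} {F : WPRF} {M : WMAC}
  {R₁ R₂ : ℕ → (xk C : Data) → Data}

/-- The bound of the advantage, averaged over the keys. -/
theorem Reductions.secureFor (h : Reductions F M R₁ R₂) (hF : F.IsSecure 𝔐 q)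
    (hM : M.IsSecure 𝔐 q) :
    (encryptThenMAC F M R₁ R₂).SecureFor (encryptThenMAC F M R₁ R₂).game (1 / 2) 𝔐 := by
  intro A
  obtain ⟨k₁, hk₁⟩ := F.exists_size_oracle_le hF.len_polyTime
  obtain ⟨k₂, hk₂⟩ := exists_size_oracle_le M hM.watermarkable.setup_ppt hM.sign_ppt
  obtain ⟨B₁, hB₁⟩ := exists_transform_adversary A hM.watermarkable.setup_ppt h.poly₁ k₁
  obtain ⟨B₂, hB₂⟩ := exists_transform_adversary A hF.watermarkable.setup_ppt h.poly₂ k₂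
  obtain ⟨ν₁, hν₁, h₁⟩ := hF.watermarkable.secure B₁
  obtain ⟨ν₂, hν₂, h₂⟩ := hM.watermarkable.secure B₂
  refine ⟨fun n => 2 * ν₁ n + ν₂ n, (hν₁.const_mul 2).add hν₂, fun n => ?_⟩
  set C := progData A.prog ((n + 2) ^ A.exponent) (enc (n, A.advice n)) with hC
  have hAC : A.comp n = C.program := (program_progData _ _ _).symm
  let ρ := (F.setup n).bind fun K => (M.setup n).map fun L => (K, L)
  let w₁ : Keys × Keys → ℝ := fun p => (F.game n p.1.sk).winProb (R₁ n p.2.xk C).program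
  let w₂ : Keys × Keys → ℝ := fun p => (M.game n p.2.sk).winProb (R₂ n p.1.xk C).program
  have a₁ : ∀ p, |w₁ p| ≤ 1 := fun p => Game.abs_winProb_le _ _
  have a₂ : ∀ p, |w₂ p| ≤ 1 := fun p => Game.abs_winProb_le _ _
  have e₁ : ex ρ w₁ ≤ 1 / 2 + ν₁ n := by
    refine le_of_eq_of_le ?_ (h₁ n)
    rw [ex_prod a₁]
    refine ex_congr _ fun K _ => ?_
    exact ((F.game n K.sk).winProb_of_run fun s =>
      hB₁ n _ (F.oracle n K.sk) (hk₁ n K.sk) s).symm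
  have e₂ : ex ρ w₂ ≤ 0 + ν₂ n := by
    refine le_of_eq_of_le ?_ (h₂ n)
    rw [ex_prod_swap a₂]
    refine ex_congr _ fun L hL => ?_
    exact ((M.game n L.sk).winProb_of_run fun s =>
      hB₂ n _ (M.oracle n L.sk) (hk₂ n L hL) s).symm
  have hsetup : (encryptThenMAC F M R₁ R₂).setup n = ρ.map fun p =>
      ⟨.cons p.1.sk p.2.sk, .cons p.1.mk p.2.mk, .cons p.1.xk p.2.xk⟩ := by
    simp only [encryptThenMAC, ρ, PMF.map_bind, PMF.map_comp]
    rfl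
  change ex ((encryptThenMAC F M R₁ R₂).setup n) (fun K =>
    ((encryptThenMAC F M R₁ R₂).game n K.sk).winProb (A.comp n)) ≤ _
  rw [hsetup, ex_map fun _ => Game.abs_winProb_le _ _]
  calc ex ρ (fun p => ((encryptThenMAC F M R₁ R₂).game n (.cons p.1.sk p.2.sk)).winProb (A.comp n))
      ≤ ex ρ fun p => (-(1 / 2) + 2 * w₁ p) + w₂ p := by
        refine ex_mono ρ (b' := 4) (fun _ => Game.abs_winProb_le _ _) (fun p => ?_) fun p hp => ?_
        · have := abs_le.1 (a₁ p)
          have := abs_le.1 (a₂ p)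
          rw [abs_le]
          constructor <;> linarith
        · simp only [ρ, PMF.mem_support_bind_iff, PMF.mem_support_map_iff] at hp
          obtain ⟨K, hK, L, hL, rfl⟩ := hp
          have := h.advantage n K hK L hL C
          rw [hAC]
          dsimp only [w₁, w₂]
          linarith
    _ = -(1 / 2) + 2 * ex ρ w₁ + ex ρ w₂ := by
        rw [ex_add ρ (f := fun p => -(1 / 2) + 2 * w₁ p) (g := w₂) (b := 3) (b' := 1),
          ex_add ρ (f := fun _ => -(1 / 2)) (g := fun p => 2 * w₁ p) (b := 1) (b' := 2), ex_mul,
          ex_const]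
        · intro p; rw [abs_le]; constructor <;> norm_num
        · intro p
          have := abs_le.1 (a₁ p)
          rw [abs_le]; constructor <;> linarith
        · intro p
          have := abs_le.1 (a₁ p)
          rw [abs_le]; constructor <;> linarith
        · exact a₂
    _ ≤ _ := by linarith

/-- If no queried mark is extracted from a good program, then none is extracted from either transformed
program, one of which is good. -/
theorem Reductions.unremovable (h : Reductions F M R₁ R₂) (hF : F.IsSecure 𝔐 q)
    (hM : M.IsSecure 𝔐 q) (hMarks : F.Marks = M.Marks) :
    (encryptThenMAC F M R₁ R₂).Unremovable (encryptThenMAC F M R₁ R₂).game (1 / 2) 𝔐 q := by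
  intro a ha ha1 A
  have hF' := hF.watermarkable
  have hM' := hM.watermarkable
  obtain ⟨B₁, hB₁⟩ := exists_mark_adversary A hF'.setup_ppt hF'.mark_ppt hM'.setup_ppt hM'.mark_ppt
    (c := Data.cons) (by fun_prop) h.poly₁ q
  obtain ⟨B₂, hB₂⟩ := exists_mark_adversary A hM'.setup_ppt hM'.mark_ppt hF'.setup_ppt hF'.mark_ppt
    (c := fun s t => Data.cons t s) (by fun_prop) h.poly₂ q
  have ha8 : PolyBounded fun n => 8 * a n := by fun_prop
  have ha81 : ∀ n, 1 ≤ 8 * a n := fun n => by have := ha1 n; omega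
  have h₁ := hF'.unremovable _ ha8 ha81 B₁
  have h₂ := hM'.unremovable _ ha8 ha81 B₂
  refine (h₁.add h₂).of_le (fun n => Pr_nonneg _) fun n => ?_
  -- all three experiments are functions of the following joint experiment `ρ`
  let κ := fun K L => pairMarkStep F.toWMScheme M.toWMScheme Data.cons q n K L
  let ρ : PMF ((Keys × Keys) × (Data × List Data) × List Data × List Data) :=
    (F.setup n).bind fun K => (M.setup n).bind fun L => ((A.comp n).run (κ K L) []).bind fun o =>
      (F.extract n K.xk (8 * a n) (R₁ n L.xk o.1)).bind fun l₁ =>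
        (M.extract n L.xk (8 * a n) (R₂ n K.xk o.1)).map fun l₂ => ((K, L), o, l₁, l₂)
  have e₀ : (encryptThenMAC F M R₁ R₂).markGame q A (a n) n = ρ.map fun x =>
      (⟨.cons x.1.1.sk x.1.2.sk, .cons x.1.1.mk x.1.2.mk, .cons x.1.1.xk x.1.2.xk⟩, x.2.1.1, x.2.1.2,
        x.2.2.1 ++ x.2.2.2) := by
    have hκ : ∀ K L : Keys, (encryptThenMAC F M R₁ R₂).markStep q n
        ⟨.cons K.sk L.sk, .cons K.mk L.mk, .cons K.xk L.xk⟩ = κ K L := fun K L => by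
      funext Q τ
      simp only [WMScheme.markStep, κ, pairMarkStep, encryptThenMAC, Data.fst_cons, Data.snd_cons,
        PMF.map_bind, PMF.map_comp, Function.comp_def]
      split_ifs with hτ
      · exact if_pos hτ
      · exact if_neg hτ
    simp only [WMScheme.markGame]
    rw [show (encryptThenMAC F M R₁ R₂).setup n = (F.setup n).bind fun K => (M.setup n).map fun L =>
      Keys.ofParts (.cons K.sk L.sk) (.cons K.mk L.mk) (.cons K.xk L.xk) from rfl]
    simp only [PMF.bind_bind, PMF.bind_map, Function.comp_def, hκ, ρ, PMF.map_bind, PMF.map_comp]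
    simp only [encryptThenMAC, Data.fst_cons, Data.snd_cons, PMF.map_bind, PMF.map_comp,
      Function.comp_def]
  have e₁ : F.markGame q B₁ (8 * a n) n = ρ.map fun x =>
      (x.1.1, R₁ n x.1.2.xk x.2.1.1, x.2.1.2, x.2.2.1) := by
    simp only [WMScheme.markGame, ρ, PMF.map_bind, PMF.map_comp, Function.comp_def]
    refine PMF.bind_congr_support fun K hK => ?_
    rw [hB₁ n K hK, PMF.bind_bind]
    congr 1; funext L
    rw [PMF.bind_map]
    congr 1; funext o
    simp only [PMF.map_eq_bind, PMF.bind_const, Function.comp]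
  have e₂ : M.markGame q B₂ (8 * a n) n = ρ.map fun x =>
      (x.1.2, R₂ n x.1.1.xk x.2.1.1, x.2.1.2, x.2.2.2) := by
    have hκ : ∀ K L : Keys, pairMarkStep M.toWMScheme F.toWMScheme (fun s t => Data.cons t s) q n L K
        = κ K L := fun K L => by
      funext Q τ
      simp only [κ, pairMarkStep]
      have hiff : τ ∈ M.Marks n ∧ q.Allows Q.length ↔ τ ∈ F.Marks n ∧ q.Allows Q.length := by
        rw [hMarks]
      by_cases hτ : τ ∈ F.Marks n ∧ q.Allows Q.length
      · rw [if_pos hτ, if_pos (hiff.2 hτ)]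
        exact PMF.bind_comm _ _ _
      · rw [if_neg hτ, if_neg fun h => hτ (hiff.1 h)]
    simp only [ρ, PMF.map_bind, PMF.map_comp, Function.comp_def]
    rw [PMF.bind_comm, WMScheme.markGame]
    refine PMF.bind_congr_support fun L hL => ?_
    rw [hB₂ n L hL, PMF.bind_bind]
    congr 1; funext K
    rw [PMF.bind_map, hκ]
    congr 1; funext o
    simp only [PMF.bind_const, Function.comp]
  rw [e₀, e₁, e₂, Pr_map, Pr_map, Pr_map]
  refine (Pr_mono fun x hx hE => ?_).trans (Pr_or_le _ _)
  simp only [ρ, PMF.mem_support_bind_iff, PMF.mem_support_map_iff] at hx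
  obtain ⟨K, hK, L, hL, o, -, l₁, -, l₂, -, rfl⟩ := hx
  obtain ⟨hE₁, hE₂⟩ := hE
  have hcast : (1 : ℝ) / ((8 * a n : ℕ) : ℝ) = 1 / (8 * (a n : ℝ)) := by push_cast; rfl
  simp only [hcast]
  rcases h.areReductions n K hK L hL o.1 (a n) (ha1 n) hE₂ with hg | hg
  · exact .inl ⟨fun τ hτ => hE₁ τ (List.mem_append_left _ hτ), hg⟩
  · exact .inr ⟨fun τ hτ => hE₁ τ (List.mem_append_right _ hτ), hg⟩

/-- A mark is found only if one of the component extractors finds it. -/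
theorem Reductions.meaningful (h : Reductions F M R₁ R₂) (hF : F.IsSecure 𝔐 q)
    (hM : M.IsSecure 𝔐 q) (hF' : F.Meaningful 𝔐) (hM' : M.Meaningful 𝔐) :
    (encryptThenMAC F M R₁ R₂).Meaningful 𝔐 := by
  intro a ha ha1 A
  have pF := hF.watermarkable.setup_ppt
  have pM := hM.watermarkable.setup_ppt
  obtain ⟨B₁, hB₁⟩ := exists_unmarked_adversary A pF pM (c := Data.cons) (by fun_prop) h.poly₁
  obtain ⟨B₂, hB₂⟩ := exists_unmarked_adversary A pM pF (c := fun s t => Data.cons t s)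
    (by fun_prop) h.poly₂
  have ha8 : PolyBounded fun n => 8 * a n := by fun_prop
  have ha81 : ∀ n, 1 ≤ 8 * a n := fun n => by have := ha1 n; omega
  refine ((hF' _ ha8 ha81 B₁).add (hM' _ ha8 ha81 B₂)).of_le (fun n => Pr_nonneg _) fun n => ?_
  let δ := fun K L : Keys =>
    (A.prog.clocked ((n + 2) ^ A.exponent) (enc (n, A.advice n, Data.cons K.sk L.sk))).dist
  let ρ : PMF (List Data × List Data) :=
    (F.setup n).bind fun K => (M.setup n).bind fun L => (δ K L).bind fun C =>
      (F.extract n K.xk (8 * a n) (R₁ n L.xk C)).bind fun l₁ =>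
        (M.extract n L.xk (8 * a n) (R₂ n K.xk C)).map fun l₂ => (l₁, l₂)
  have e₀ : (((encryptThenMAC F M R₁ R₂).setup n).bind fun K =>
      (A.prog.clocked ((n + 2) ^ A.exponent) (enc (n, A.advice n, K.sk))).dist.bind fun C =>
        (encryptThenMAC F M R₁ R₂).extract n K.xk (a n) C) = ρ.map fun x => x.1 ++ x.2 := by
    simp only [encryptThenMAC, PMF.bind_bind, PMF.bind_map, Function.comp_def, ρ, δ, PMF.map_bind,
      PMF.map_comp, Data.fst_cons, Data.snd_cons]
  have e₁ : ((F.setup n).bind fun K => (B₁.prog.clocked ((n + 2) ^ B₁.exponent)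
      (enc (n, B₁.advice n, K.sk))).dist.bind fun C => F.extract n K.xk (8 * a n) C) =
        ρ.map Prod.fst := by
    simp only [ρ, PMF.map_bind, PMF.map_comp, Function.comp_def]
    refine PMF.bind_congr_support fun K hK => ?_
    rw [hB₁ n K hK, PMF.bind_bind]
    congr 1; funext L
    rw [PMF.bind_map]
    congr 1; funext C
    simp only [PMF.map_eq_bind, PMF.bind_const, Function.comp, PMF.bind_pure]
  have e₂ : ((M.setup n).bind fun K => (B₂.prog.clocked ((n + 2) ^ B₂.exponent)
      (enc (n, B₂.advice n, K.sk))).dist.bind fun C => M.extract n K.xk (8 * a n) C) =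
        ρ.map Prod.snd := by
    simp only [ρ, PMF.map_bind, PMF.map_comp, Function.comp_def]
    rw [PMF.bind_comm]
    refine PMF.bind_congr_support fun L hL => ?_
    rw [hB₂ n L hL, PMF.bind_bind]
    congr 1; funext K
    rw [PMF.bind_map]
    congr 1; funext C
    simp only [PMF.map_eq_bind, PMF.bind_const, Function.comp, PMF.bind_pure]
  rw [e₀, e₁, e₂, Pr_map, Pr_map, Pr_map]
  refine (Pr_mono fun x _ hx => ?_).trans (Pr_or_le _ _)
  by_contra! hcon
  exact hx (by rw [hcon.1, hcon.2]; rfl)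

end Security

/-! ### Correctness of extraction -/

section Markov

variable {α β : Type} {μ : PMF α}

theorem Pr_le_Pr_bind {g : α → PMF β} {E : α → Prop} {E' : β → Prop}
    (h : ∀ a ∈ μ.support, E a → ∀ y ∈ (g a).support, E' y) : Pr μ E ≤ Pr (μ.bind g) E' := by
  classical
  rw [Pr_bind, Pr_eq_ex]
  refine ex_mono μ (fun _ => abs_ite_le_one _) (fun _ => abs_Pr_le _) fun a ha => ?_
  split_ifs with hE
  · exact (Pr_eq_one (h a ha hE)).ge
  · exact Pr_nonneg _

/-- Markov's inequality. -/
theorem mul_Pr_lt_le {f : α → ℝ} {b c : ℝ} (hf : ∀ a, |f a| ≤ b) (h0 : ∀ a, 0 ≤ f a) :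
    c * Pr μ (fun a => c < f a) ≤ ex μ f := by
  classical
  rw [Pr_eq_ex, ← ex_mul]
  refine ex_mono μ (b := |c|) (fun a => ?_) hf fun a _ => ?_
  · split_ifs <;> simp
  · split_ifs with h
    · rw [mul_one]; exact h.le
    · rw [mul_zero]; exact h0 a

end Markov

theorem OComp.run_nil {α σ : Type} (c : OComp α) (s : σ) :
    c.run (fun (s : σ) _ => PMF.pure (Data.nil, s)) s = c.dist.map fun y => (y, s) := by
  induction c with
  | pure a => simp [OComp.run, OComp.dist, PMF.pure_map]
  | coin k ih =>
    simp only [OComp.dist, OComp.run, PMF.map_bind, ih]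
  | query q k ih =>
    simp only [OComp.dist, OComp.run, PMF.pure_bind, ih]

/-- The adversary that queries the marking oracle for the mark that `A` generates and outputs the
program made by `T` from the marked key. -/
theorem exists_query_adversary {𝔐 : AdvModel} (A : Adversary 𝔐) {W : WMScheme}
    (hW : PPT W.setup)
    (hW' : PPT fun i : ℕ × Data × Data × Data => W.mark i.1 i.2.1 i.2.2.1 i.2.2.2)
    {T : ℕ → Data → Data} (hT : PolyTime fun i : ℕ × Data => T i.1 i.2) (q : Collusion) :
    ∃ B : Adversary 𝔐, ∀ n, ∀ K ∈ (W.setup n).support,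
      (B.comp n).run (W.markStep q n K) [] = (A.comp n).dist.bind fun τ =>
        (W.markStep q n K [] τ).map fun o => (T n o.1.snd, o.2) := by
  have hnil : PolyTime fun i : Data × Data => (Data.nil, i.2) := by fun_prop
  obtain ⟨H, kH, hH⟩ := hnil.runs
  have hask : PPT fun i : Data × ℕ => PMF.pure i := PolyTime.id'
  have hout : PolyTime fun i : Data × ℕ => T i.2 i.1.snd :=
    PolyTime.comp (f := fun i : ℕ × Data => T i.1 i.2)
      (g := fun i : Data × ℕ => (i.2, i.1.snd)) hT (by fun_prop)
  obtain ⟨Post, kP, hPost⟩ := exists_ask_prog hask hout.ppt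
  have hf : PolyTime fun z : ℕ × Data => Data.cons (.cons A.prog.encode
      (enc ((z.1 + 2) ^ A.exponent))) (.cons (enc z) (.cons H.encode (enc z.1))) := by fun_prop
  obtain ⟨kM, hkM⟩ := exists_size_markStep_le hW hW'
  let t : ℕ → ℕ := fun n => (n + 2) ^ A.exponent
  have ht : PolyBounded t := by fun_prop
  let b : ℕ → ℕ := fun n => n + t n + 1 + (t n + n + 1 + 2) ^ kH +
    (t n + n + 1 + (n + t n + 2) ^ kM + 2) ^ kP
  have hb : PolyBounded b := by fun_prop
  obtain ⟨B, hadv, hB⟩ := exists_adversary A hf.ppt H Post hb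
  refine ⟨B, fun n K hK => ?_⟩
  have h := hB n (n, A.advice n) Unit (List Data) (PMF.pure ())
    (fun _ => .cons A.prog.encode (enc ((n + 2) ^ A.exponent))) (fun _ => enc (n, A.advice n))
    (fun _ => enc n) (W.markStep q n K) (fun _ s _ => PMF.pure (.nil, s))
    (fun _ τ Q => (W.markStep q n K Q τ).map fun o => (T n o.1.snd, o.2)) ?_ ?_ ?_ ?_ []
  · rw [Adversary.comp, hadv, h, PMF.pure_bind, OComp.run_nil, PMF.bind_map]
    simp only [Data.fst_cons, Data.snd_cons, enc_nat, Data.size_unary, Prog.decode_encode]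
    rfl
  · have := A.advice_size n
    simp only [sz_pair, sz_nat, sz_data, b, t]
    omega
  · rw [PMF.pure_map]
  · intro _ _ e τ hτ
    simp only [Data.snd_cons, enc_nat, Data.size_unary] at hτ
    have hτ' : τ.size ≤ t n := hτ
    refine ((hH (τ, enc n) _ _ e).mono ?_).congr ?_
    · have : (sz (τ, (enc n : Data)) + 2) ^ kH ≤ (t n + n + 1 + 2) ^ kH :=
        Nat.pow_le_pow_left (by
          rw [sz_pair, sz_data, sz_data, size_enc, sz_nat]; omega) kH
      dsimp only [b]
      omega
    · rw [PMF.pure_map]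
      rfl
  · intro _ _ τ e hτ
    simp only [Data.snd_cons, enc_nat, Data.size_unary] at hτ
    have hτ' : τ.size ≤ t n := hτ
    refine ((hPost (τ, n) _ (W.markStep q n K) e ((n + t n + 2) ^ kM) fun i hi o ho => ?_).mono
      ?_).congr ?_
    · rw [PMF.mem_support_pure_iff] at hi
      subst hi
      exact (hkM n K hK q e τ o ho).trans (Nat.pow_le_pow_left (by omega) kM)
    · have : (sz (τ, n) + (n + t n + 2) ^ kM + 2) ^ kP ≤
          (t n + n + 1 + (n + t n + 2) ^ kM + 2) ^ kP := Nat.pow_le_pow_left (by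
        rw [sz_pair, sz_data, sz_nat]; omega) kP
      dsimp only [b]
      omega
    · simp only [PMF.pure_bind, PMF.pure_map]
      rfl

section Extraction

variable {𝔐 : AdvModel} {q : Collusion} {F : WPRF} {M : WMAC}
  {R₁ R₂ : ℕ → (xk C : Data) → Data}

/-- From any key one can make in polynomial time a player of the CCA2 game that asks for a challenge on
two messages with different first bits and decrypts it with that key.  It wins whenever the
pseudorandom functions of this key and of the secret key agree at the nonce of the challenge. -/
theorem exists_decrypting_player (hF : F.IsSecure 𝔐 q) (hM : M.IsSecure 𝔐 q) :
    ∃ T : ℕ → Data → Data, PolyTime (fun i : ℕ × Data => T i.1 i.2) ∧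
      ∀ n, ∀ K ∈ ((encryptThenMAC F M R₁ R₂).setup n).support, ∀ sk,
        1 - Pr (randomBits (F.len n)) (fun r => F.eval n sk.fst r ≠ F.eval n K.sk.fst r) ≤
          ((encryptThenMAC F M R₁ R₂).game n K.sk).winProb (T n sk).program := by
  have hlen := hF.len_polyTime
  -- the challenge messages are `0 ⋯ 0` and `1 0 ⋯ 0`
  let m₀ : ℕ → Data := fun n => enc (List.replicate (F.len n) false)
  have hm₀ : PolyTime m₀ := by fun_prop
  have hpre : PolyTime fun i : ℕ × Data =>
      (Data.cons (.cons .nil (.cons .nil .nil))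
        (.cons (m₀ i.1) (.cons (.bit true) (m₀ i.1).snd)), i) := by
    fun_prop
  have hev : PolyTime fun i : Data × ℕ × Data => F.eval i.2.1 i.2.2.fst i.1.snd.fst.fst.bits :=
    PolyTime.comp (f := fun i : ℕ × Data × List Bool => F.eval i.1 i.2.1 i.2.2)
      (g := fun i : Data × ℕ × Data => (i.2.1, i.2.2.fst, i.1.snd.fst.fst.bits))
      hF.eval_polyTime (by fun_prop)
  have hpost : PolyTime fun i : Data × ℕ × Data => Data.bit (!decide ((enc (xorBits
      (F.eval i.2.1 i.2.2.fst i.1.snd.fst.fst.bits) i.1.snd.fst.snd.bits) : Data).fst = .nil)) := by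
    fun_prop
  obtain ⟨P, k, hP⟩ := exists_ask_prog hpre.ppt hpost.ppt
  have hS := ppt_encryptThenMAC_setup (R₁ := R₁) (R₂ := R₂) hF.watermarkable.setup_ppt
    hM.watermarkable.setup_ppt
  obtain ⟨kS, hkS⟩ := hS.size_le
  obtain ⟨kE, hkE⟩ := (ppt_encryptThenMAC_encrypt (R₁ := R₁) (R₂ := R₂) hF hM).size_le
  obtain ⟨kl, hkl⟩ := hlen.size_le
  simp only [sz_nat] at hkl
  let b : ℕ → ℕ := fun N => (N + (N + 2) ^ kS + 2 * (N + 2) ^ kl + 2 + 2) ^ kE + 1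
  have hb : PolyBounded b := by fun_prop
  obtain ⟨kT, hkT⟩ : PolyBounded fun N => (N + 1 + b N + 2) ^ k := by fun_prop
  refine ⟨fun n sk => progData P ((n + sk.size + 2) ^ kT) (enc (n, sk)), by fun_prop,
    fun n K hK sk => ?_⟩
  set S := encryptThenMAC F M R₁ R₂ with hSdef
  have hl := hF.len_pos n
  let m : Bool → List Bool := fun β => β :: List.replicate (F.len n - 1) false
  have hm : ∀ β, (m β).length = F.len n := fun β => by simp [m]; omega
  have hm0 : m₀ n = enc (m false) := by
    simp only [m₀, m]
    rw [← List.replicate_succ, Nat.sub_add_cancel hl]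
  have hm1 : Data.cons (.bit true) (m₀ n).snd = enc (m true) := by
    rw [hm0]
    rfl
  have hchal : ∀ β, S.oracle n K.sk (β, none)
      (.cons (.cons .nil (.cons .nil .nil)) (.cons (m₀ n) (.cons (.bit true) (m₀ n).snd))) =
        (S.encrypt n K.sk (m β)).map fun ct => (enc (some ct), (β, some ct)) := fun β => by
    rw [hm0, show Data.cons (.bit true) (enc (m false) : Data).snd = enc (m true) from rfl]
    have h : (m false).length = S.len n ∧ (m true).length = S.len n := ⟨hm _, hm _⟩
    simp only [WSKE.oracle, WSKE.game, Data.toBits_enc]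
    rw [if_pos h]
    cases β <;> rfl
  have hreply : ∀ β, ∀ ct ∈ (S.encrypt n K.sk (m β)).support, (enc (some ct) : Data).size ≤ b n := by
    intro β ct hct
    have h1 := hkE (n, K.sk, m β) ct hct
    have h2 := hkS n K hK
    rw [Keys.sz_eq, sz_nat] at h2
    have h3 := Data.size_bits_le (hm β)
    have h4 := hkl n
    rw [size_enc] at h3
    simp only [sz_pair, sz_nat, sz_data] at h1
    refine le_trans ?_ (Nat.add_le_add_right (h1.trans (Nat.pow_le_pow_left
      (show _ ≤ n + (n + 2) ^ kS + 2 * (n + 2) ^ kl + 2 + 2 by omega) kE)) 1)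
    change ((Data.nil.cons ct).size ≤ _)
    simp
  have hrun : ∀ β, (progData P ((n + sk.size + 2) ^ kT) (enc (n, sk))).program.run
      (S.oracle n K.sk) (β, none) = (S.encrypt n K.sk (m β)).map fun ct =>
        (Data.bit (!decide ((enc (xorBits (F.eval n sk.fst ct.fst.fst.bits)
          ct.fst.snd.bits) : Data).fst = .nil)), (β, some ct)) := fun β => by
    rw [program_progData]
    have h := (hP (n, sk) _ (S.oracle n K.sk) (β, none) (b n) fun i hi o ho => ?_).clocked
      (T := (n + sk.size + 2) ^ kT) ?_
    · rw [h, PMF.pure_bind]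
      dsimp only
      rw [hchal β, PMF.bind_map]
      simp only [Function.comp_def, PMF.pure_map]
      rfl
    · rw [PMF.mem_support_pure_iff] at hi
      subst hi
      rw [hchal β] at ho
      obtain ⟨ct, hct, rfl⟩ := (PMF.mem_support_map_iff _ _ _).1 ho
      exact hreply β ct hct
    · refine le_trans (Nat.pow_le_pow_left ?_ k) (hkT (n + sk.size))
      have : b n ≤ b (n + sk.size) := by
        dsimp only [b]
        gcongr <;> omega
      rw [sz_pair, sz_nat, sz_data]
      omega
  rw [← Pr_not]
  change _ ≤ Pr ((OComp.fairCoin.map fun β => (β, none)).bind fun s =>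
    (progData P ((n + sk.size + 2) ^ kT) (enc (n, sk))).program.run (S.oracle n K.sk) s) fun ys =>
      ys.1 = .bit ys.2.1
  rw [PMF.bind_map]
  refine le_Pr_bind fun β _ => ?_
  simp only [Function.comp_def]
  rw [hrun β, Pr_map]
  dsimp only
  rw [hSdef]
  simp only [encryptThenMAC]
  refine Pr_le_Pr_bind fun r hr hE ct hct => ?_
  obtain ⟨σ, -, rfl⟩ := (PMF.mem_support_map_iff _ _ _).1 hct
  rw [not_not] at hE
  have hr' := length_of_mem_randomBits hr
  simp only [enc_pair, Data.fst_cons, Data.snd_cons, Data.bits_enc]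
  rw [hE, xorBits_xorBits_cancel ((F.length_eval n K.sk.fst r hr').trans (hm β).symm)]
  cases β <;> rfl

/-- Functionality preservation of the pseudorandom function, for marked keys of the scheme. -/
theorem Pr_markedKeys_eval_ne_le {ν : ℕ → ℝ}
    (hν : ∀ n, ∀ τ ∈ F.Marks n, ∀ x : List Bool, x.length = F.len n →
      1 - ν n ≤ Pr (F.markedKeys n τ) fun o => F.eval n o.2 x = F.eval n o.1.sk x)
    {n : ℕ} {τ : Data} (hτ : τ ∈ F.Marks n) {x : List Bool} (hx : x.length = F.len n) :
    Pr ((encryptThenMAC F M R₁ R₂).markedKeys n τ)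
      (fun o => F.eval n o.2.fst x ≠ F.eval n o.1.sk.fst x) ≤ ν n := by
  have e : ((encryptThenMAC F M R₁ R₂).markedKeys n τ).map (fun o => (o.1.sk.fst, o.2.fst)) =
      (F.markedKeys n τ).map fun o => (o.1.sk, o.2) := by
    simp only [encryptThenMAC, WMScheme.markedKeys, PMF.bind_bind, PMF.bind_map, PMF.map_bind,
      PMF.map_comp, Function.comp_def, Data.fst_cons, Data.snd_cons]
    simp only [PMF.map_eq_bind, PMF.bind_const]
  have h1 := hν n τ hτ x hx
  have h2 := Pr_map (μ := (encryptThenMAC F M R₁ R₂).markedKeys n τ)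
    (fun o => (o.1.sk.fst, o.2.fst)) fun p => F.eval n p.2 x = F.eval n p.1 x
  have h3 := Pr_map (μ := F.markedKeys n τ)
    (fun o => (o.1.sk, o.2)) fun p => F.eval n p.2 x = F.eval n p.1 x
  rw [e, h3] at h2
  have h4 := Pr_not (μ := (encryptThenMAC F M R₁ R₂).markedKeys n τ)
    fun o => F.eval n o.2.fst x = F.eval n o.1.sk.fst x
  linarith

/-- An adversary that queries one mark and outputs the decrypting player made from the marked key
contradicts unremovability, unless the mark is extracted or the marked key decrypts badly. -/
theorem encryptThenMAC_extractionCorrect (hF : F.IsSecure 𝔐 q) (hM : M.IsSecure 𝔐 q)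
    (hS : (encryptThenMAC F M R₁ R₂).Unremovable (encryptThenMAC F M R₁ R₂).game (1 / 2) 𝔐 q) :
    (encryptThenMAC F M R₁ R₂).ExtractionCorrect 𝔐 := by
  have hF' := hF.watermarkable
  have hM' := hM.watermarkable
  obtain ⟨T, hT, hwin⟩ := exists_decrypting_player (R₁ := R₁) (R₂ := R₂) hF hM
  obtain ⟨ν, hν, hν0, hev⟩ : ∃ ν, Negligible ν ∧ (∀ n, 0 ≤ ν n) ∧ ∀ n, ∀ τ ∈ F.Marks n,
      ∀ x : List Bool, x.length = F.len n →
        1 - ν n ≤ Pr (F.markedKeys n τ) fun o => F.eval n o.2 x = F.eval n o.1.sk x := by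
    obtain ⟨ν, hν, h⟩ := hF.functionality_preserving
    exact ⟨_, hν.abs, fun n => abs_nonneg _, fun n τ hτ x hx =>
      (sub_le_sub_left (le_abs_self _) _).trans (h n τ hτ x hx)⟩
  refine ⟨T, 4, hT, fun a ha ha4 A => ?_⟩
  obtain ⟨B, hB⟩ := exists_query_adversary A
    (ppt_encryptThenMAC_setup (R₁ := R₁) (R₂ := R₂) hF'.setup_ppt hM'.setup_ppt)
    (ppt_encryptThenMAC_mark (R₁ := R₁) (R₂ := R₂) hF'.mark_ppt hM'.mark_ppt) hT q
  have hneg := hS a ha (fun n => by have := ha4 n; omega) B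
  refine (hneg.add (hν.const_mul 4)).of_le (fun n => Pr_nonneg _) fun n => ?_
  set S := encryptThenMAC F M R₁ R₂ with hSdef
  let Good : Keys × Data → Prop := fun o =>
    (S.game n o.1.sk).Good (1 / 2) (1 / (a n : ℝ)) (T n o.2).program
  let ρ : Data → PMF ((Keys × Data) × List Data) := fun τ => (S.markedKeys n τ).bind fun o =>
    (S.extract n o.1.xk (a n) (T n o.2)).map fun L => (o, L)
  -- by Markov's inequality the marked key rarely yields a bad player
  have hbad : ∀ τ ∈ F.Marks n, Pr (ρ τ) (fun x => ¬ Good x.1) ≤ 4 * ν n := fun τ hτ => by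
    let p : Keys × Data → ℝ := fun o =>
      Pr (randomBits (F.len n)) fun r => F.eval n o.2.fst r ≠ F.eval n o.1.sk.fst r
    have hp : ex (S.markedKeys n τ) p ≤ ν n := by
      have h1 := Pr_bind (μ := S.markedKeys n τ)
        (fun o => (randomBits (F.len n)).map fun r => (o, r))
        fun y => F.eval n y.1.2.fst y.2 ≠ F.eval n y.1.1.sk.fst y.2
      simp only [Pr_map] at h1
      have h2 : ((S.markedKeys n τ).bind fun o => (randomBits (F.len n)).map fun r => (o, r)) =
        (randomBits (F.len n)).bind fun r => (S.markedKeys n τ).map fun o => (o, r) :=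
          PMF.bind_comm _ _ _
      rw [h2] at h1
      refine h1.symm.trans_le (Pr_bind_le fun r hr => ?_)
      rw [Pr_map]
      exact Pr_markedKeys_eval_ne_le hev hτ (length_of_mem_randomBits hr)
    have h3 := mul_Pr_lt_le (μ := S.markedKeys n τ) (f := p) (c := 1 / 4)
      (fun _ => abs_Pr_le _) fun _ => Pr_nonneg _
    have h4 : Pr (ρ τ) (fun x => ¬ Good x.1) ≤ Pr (S.markedKeys n τ) fun o => 1 / 4 < p o := by
      have e : (ρ τ).map Prod.fst = S.markedKeys n τ := by
        simp only [ρ, PMF.map_bind, PMF.map_comp, Function.comp_def]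
        simp only [PMF.map_eq_bind, PMF.bind_const, PMF.bind_pure]
      rw [← e, Pr_map]
      refine Pr_mono fun x hx hbad => ?_
      by_contra hle
      refine hbad ?_
      have hx' : x.1.1 ∈ (S.setup n).support := by
        simp only [ρ, WMScheme.markedKeys, PMF.mem_support_bind_iff, PMF.mem_support_map_iff] at hx
        obtain ⟨o, ⟨K, hK, s, -, rfl⟩, L, -, rfl⟩ := hx
        exact hK
      have h5 := hwin n x.1.1 hx' x.1.2
      have h6 : (1 : ℝ) / a n ≤ 1 / 4 :=
        one_div_le_one_div_of_le (by norm_num) (by exact_mod_cast ha4 n)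
      change (1 : ℝ) / 2 + 1 / a n ≤ _
      refine le_trans ?_ h5
      change _ ≤ 1 - p x.1
      linarith [not_lt.1 hle]
    linarith
  have e : S.markGame q B (a n) n = (A.comp n).dist.bind fun τ => (S.setup n).bind fun K =>
      (S.markStep q n K [] τ).bind fun o =>
        (S.extract n K.xk (a n) (T n o.1.snd)).map fun L => (K, T n o.1.snd, o.2, L) := by
    rw [PMF.bind_comm, WMScheme.markGame]
    refine PMF.bind_congr_support fun K hK => ?_
    rw [hB n K hK, PMF.bind_bind]
    congr 1; funext τ
    rw [PMF.bind_map]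
    rfl
  rw [e, Pr_bind, Pr_bind, ← ex_const (A.comp n).dist (4 * ν n),
    ← ex_add (b := 1) (b' := |4 * ν n|) _ (fun _ => abs_Pr_le _) fun _ => le_rfl]
  refine ex_mono _ (b := 1) (b' := 1 + |4 * ν n|) (fun _ => abs_Pr_le _) (fun τ => ?_)
    fun τ _ => ?_
  · exact (abs_add_le _ _).trans (add_le_add (abs_Pr_le _) le_rfl)
  by_cases hτ : τ ∈ F.Marks n
  · have e₁ : ((S.setup n).bind fun K => (S.mark n K.mk K.sk τ).bind fun s =>
        (S.extract n K.xk (a n) (T n s)).map fun L => (τ, L)) = (ρ τ).map fun x => (τ, x.2) := by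
      simp only [ρ, WMScheme.markedKeys, PMF.map_bind, PMF.bind_bind, PMF.bind_map, PMF.map_comp,
        Function.comp_def]
    have hτ' : τ ∈ S.Marks n ∧ q.Allows ([] : List Data).length := ⟨hτ, by cases q <;> trivial⟩
    have e₂ : ((S.setup n).bind fun K => (S.markStep q n K [] τ).bind fun o =>
        (S.extract n K.xk (a n) (T n o.1.snd)).map fun L => (K, T n o.1.snd, o.2, L)) =
          (ρ τ).map fun x => (x.1.1, T n x.1.2, [τ], x.2) := by
      simp only [ρ, WMScheme.markedKeys, WMScheme.markStep, if_pos hτ', PMF.map_bind, PMF.bind_bind,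
        PMF.bind_map, PMF.map_comp, Function.comp_def, Data.snd_cons]
    rw [e₁, e₂, Pr_map, Pr_map]
    refine le_trans ?_ (add_le_add_right (hbad τ hτ) _)
    refine (Pr_mono fun x _ hx => ?_).trans (Pr_or_le _ _)
    by_cases hg : Good x.1
    · refine .inl ⟨fun τ' h' => ?_, hg⟩
      exact fun h'' => hx.2 (List.mem_singleton.1 h'' ▸ h')
    · exact .inr hg
  · rw [Pr_eq_zero]
    · exact add_nonneg (Pr_nonneg _) (mul_nonneg (by norm_num) (hν0 n))
    · intro x hx hx'
      simp only [PMF.mem_support_bind_iff, PMF.mem_support_map_iff] at hx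
      obtain ⟨K, -, s, -, L, -, rfl⟩ := hx
      exact hτ hx'.1

end Extraction

theorem mainTheorem5 (𝔐 : AdvModel) (q : Collusion) (F : WPRF) (M : WMAC)
    (hF : F.IsSecure 𝔐 q) (hM : M.IsSecure 𝔐 q)
    (hMarks : F.Marks = M.Marks)
    (hMsgs : ∀ (n : ℕ) (m : List Bool), m.length = 2 * F.len n → m ∈ M.Msgs n) :
    ∃ R₁ R₂ : ℕ → Data → Data → Data,
      PolyTime (fun i : ℕ × Data × Data => R₁ i.1 i.2.1 i.2.2) ∧
      PolyTime (fun i : ℕ × Data × Data => R₂ i.1 i.2.1 i.2.2) ∧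
      AreReductions F M R₁ R₂ ∧
      (encryptThenMAC F M R₁ R₂).IsSecure 𝔐 q ∧
      (F.Meaningful 𝔐 → M.Meaningful 𝔐 → (encryptThenMAC F M R₁ R₂).Meaningful 𝔐) := by
  obtain ⟨R₁, R₂, h⟩ := exists_reductions hF hM hMsgs
  have hF' := hF.watermarkable
  have hM' := hM.watermarkable
  have hrem := h.unremovable hF hM hMarks
  refine ⟨R₁, R₂, h.poly₁, h.poly₂, h.areReductions, ⟨?_, hF.len_pos, hF.len_polyTime,
    ppt_encryptThenMAC_encrypt hF hM, polyTime_encryptThenMAC_decrypt hF hM,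
    encryptThenMAC_correct hM hMsgs, encryptThenMAC_functionality hF hM hMarks hMsgs⟩,
    h.meaningful hF hM⟩
  exact ⟨ppt_encryptThenMAC_setup hF'.setup_ppt hM'.setup_ppt,
    ppt_encryptThenMAC_mark hF'.mark_ppt hM'.mark_ppt,
    ppt_encryptThenMAC_extract hF'.extract_ppt hM'.extract_ppt h.poly₁ h.poly₂,
    h.secureFor hF hM, hrem, encryptThenMAC_keySimulates hF hM hMsgs,
    h.blackBox hF'.black_box hM'.black_box, encryptThenMAC_extractionCorrect hF hM hrem⟩
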